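/- **Setting.** Let $n\ge 2$ and let $\mathcal T\cong\mathbb Z^3$ be a translation group with an embedding $\eta:\mathcal T\to\mathbb R^3$ (injective, every set of three generators going to a basis). A *$p$-theory* with $\mathbb Z_n$-valued statistics consists of a finitely generated $\mathbb Z_n\mathcal T$-module $S$ of superselection sectors in which no non-zero sector has stabilizer isomorphic to $\mathbb Z^3$, a unit normal for each orientation of planons, and mutual statistics of planons. Here a *planon* is a sector with stabilizer isomorphic to $\mathbb Z^2$, its orientation is the plane spanned by the image of the stabilizer, $A$ is the set of orientations, and $S_a$ is the submodule generated by the $a$-oriented planons. The statistics are, for each $a\in A$, a $\mathbb Z$-bilinear, translation invariant map $\langle\cdot,\cdot\rangle_a:S_a\times S\to\mathbb Z_n$ that is symmetric on $S_a\times S_a$ and such that, if no non-zero multiple of $g\in\mathcal T$ fixes $p$, then $\langle g^ip,x\rangle_a=0$ for all large $|i|$. Put $K_a=\{x: \langle p,x\rangle_a=0\ \forall p\in S_a\}$, $Q_a=S/K_a$ (plane charges), $Q=\bigoplus_{a\in A}Q_a$, $\pi:S\to Q$ the natural map, and $C=Q/\pi(S)$ (the *constraint module*), with quotient map $\omega:Q\to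 C$. The theory is *$p$-modular* if $\pi$ is injective. The *weight* of $x\in S$ is the number of $a\in A$ with $x\notin K_a$; $S^{(i)}$ is the submodule generated by sectors of weight at most $i$; $\mathcal W_i=S/S^{(i)}$; and $\mathcal W=(\mathcal W_1,\dots,\mathcal W_{|A|})$ is the *weighted QSS* (as abelian groups). A $\mathbb Z_n$ *CSS Pauli code* with $q$ qudits and $t$ stabilizers per unit cell is given over $R=\mathbb Z_n\mathcal T$ by an excitation map $\epsilon=\begin{pmatrix}0&\epsilon^Z\\ \epsilon^X&0\end{pmatrix}:R^{2q}\to R^{t}$; its stabilizer map is $\sigma=\lambda\epsilon^\dagger$ with $\lambda=\begin{pmatrix}0&1\\-1&0\end{pmatrix}$ and $\dagger$ the transpose with the antipode $g\mapsto \bar g=g^{-1}$ of each entry. Its sectors are $S=R^t/\operatorname{im}\epsilon$. Its statistics are the braiding phases: $\langle p,x\rangle_a$ is the total eigenvalue on $x$ of the stabilizers whose product is the operator that moves $p$ around a large loop in the plane $a$, counterclockwise with respect to the normal. A *$p$-modular sequence* of the code is a sequence $0\to R^t\xrightarrow{\sigma}R^{2q}\xrightarrow{\epsilon}R^t\xrightarrow{\pi}Q\xrightarrow{\omega}C\to0$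 whose maps $\pi,\omega$ are the plane charge map and the constraint map. **Models.** $x,y,z$ are translations along the axes. Write $p_\mu:R\to R_\mu=\mathbb Z_n[t^{\pm}]$ for the projection to the group ring of $\mathcal T$ modulo the stabilizer of the $\mu$-plane, $t$ being the unit translation transverse to it, and $c_\mu:R_\mu\to\mathbb Z_n$ for the sum of coefficients. In the rows of $\pi^Z,\pi^X$ below the orientations are listed in order. 1. X-cube: $\epsilon^Z=\begin{pmatrix}0&-(1-y)&1-z\\-(1-x)&0&1-z\end{pmatrix}$, $\epsilon^X=-\big((1-\bar y)(1-\bar z),\,(1-\bar z)(1-\bar x),\,(1-\bar x)(1-\bar y)\big)$; $\pi^Z=\begin{pmatrix}-p_x&0\\0&p_y\\p_z&-p_z\end{pmatrix}$, $\pi^X=\begin{pmatrix}p_x\\p_y\\p_z\end{pmatrix}$, $\omega^Z=(c_x,c_y,c_z)$, $\omega^X=\begin{pmatrix}c_x&0&-c_z\\0&c_y&-c_z\end{pmatrix}$. 2. Toric code layers: $\epsilon^Z=(-(1-x),\,1-y)$, $\epsilon^X=(-(1-\bar y),\,-(1-\bar x))$; $\pi^Z=\pi^X=p_z$, $C=0$.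 3. Anisotropic model: $\epsilon^Z=(-(1-z),\,(1-x)(1-y))$, $\epsilon^X=(-(1-\bar x)(1-\bar y),\,-(1-\bar z))$; $\pi^Z=\begin{pmatrix}p_x\\-p_y\end{pmatrix}$, $\pi^X=\begin{pmatrix}p_x\\p_y\end{pmatrix}$, $\omega^Z=(c_x,c_y)$, $\omega^X=(c_x,-c_y)$. 4. Checkerboard: $\mathcal T=\langle yz,zx,xy\rangle$, $\tau=1+yz+zx+xy$, $\epsilon^Z=(\bar\tau,\tau)$, $\epsilon^X=(-\bar\tau,\tau)$; $\pi^Z=\pi^X=(\varepsilon_xp_x,\varepsilon_yp_y,\varepsilon_zp_z)^T$, where $p_\mu$ records the degree in $\mu$ and $\varepsilon_x,\varepsilon_y,\varepsilon_z:\mathcal T\to\{\pm1\}$ are the parities of the degree in $z,x,y$ respectively. With $e_\mu,o_\mu:R_\mu\to\mathbb Z_n$ the sums of the coefficients in even and in odd degrees, $\omega^Z=\omega^X=\begin{pmatrix}o_x&-e_y&e_z\\e_x&o_y&-e_z\\-e_x&e_y&o_z\end{pmatrix}$. 5. 4-planar X-cube: orientations $x,y,z$ and $w$, where $p_w$ records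 the total degree; $\epsilon^Z=\begin{pmatrix}0&1-y&-(1-z)&y-z&0&0\\-(1-x)&0&1-z&0&z-x&0\\1-x&-(1-y)&0&0&0&x-y\end{pmatrix}$, $\epsilon^X=\begin{pmatrix}-1&-1&-1&-1&-1&-1\\\bar y+\bar z&\bar z+\bar x&\bar x+\bar y&1+\bar x&1+\bar y&1+\bar z\\-\bar y\bar z&-\bar z\bar x&-\bar x\bar y&-\bar x&-\bar y&-\bar z\end{pmatrix}$; $\pi^Z=\begin{pmatrix}p_x&0&0\\0&p_y&0\\0&0&p_z\\-p_w&-p_w&-p_w\end{pmatrix}$, $\pi^X=\begin{pmatrix}p_x&p_x&p_x\\p_y&p_y&p_y\\p_z&p_z&p_z\\\bar t\,p_w&p_w&t\,p_w\end{pmatrix}$, $\omega^Z=(c_x,c_y,c_z,c_w)$, $\omega^X=\begin{pmatrix}c_x&0&0&-c_w\\0&c_y&0&-c_w\\0&0&c_z&-c_w\end{pmatrix}$. **Theorem.** Let $n\ge2$. For each of the five models, for every embedding $\eta$ of the translation lattice and every choice of unit normals: (a) The displayed sequence is exact and is the $p$-modular sequence of the code: the planes of the $p_\mu$ are distinct and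 are all the orientations of planons, and the components of $\pi$ are surjective with kernels the transparent sectors $K_a$. The braiding statistics are well defined and make the code a $p$-modular $p$-theory, and $n$ is the least positive integer with $nS=0$. (b) As abelian groups, the constraint module and the weighted QSS are | model | $C$ | $\mathcal W$ | |---|---|---| | toric code layers | $0$ | $(0)$ | | anisotropic | $\mathbb Z_n^2$ | $(\mathbb Z_n^2,0)$ | | X-cube | $\mathbb Z_n^3$ | $(\mathbb Z_n^3,\mathbb Z_n,0)$ | | checkerboard | $\mathbb Z_n^6$ | $(\mathbb Z_n^6,\mathbb Z_{(n,2)}^2,0)$ | | 4-planar X-cube | $\mathbb Z_n^4$ | $(\mathbb Z_n^4,\mathbb Z_n,\mathbb Z_n,0)$ | (c) Each model, in the case of the checkerboard model after coarsening the translations to $\langle x^2,y^2,z^2\rangle$, satisfies the following conditions with $r=1$ for all $a$ ($r=2$ for the checkerboard model). For each $a\in A$, the quotient of $\mathcal T$ by the stabilizer of $Q_a$ is isomorphic to $\mathbb Z$, so that its group ring is $R_a\cong\mathbb Z_n[t^\pm]$; and $Q_a$ has an $R_a$-basis $q_{e1},q_{m1},\dots,q_{er},q_{mr}$ for which there are $\Delta_i\in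 R_a$, with units as highest and lowest coefficients, such that $\ker\omega|_{Q_a}=\bigoplus_i(\Delta_iR_aq_{ei}\oplus\bar\Delta_iR_aq_{mi})$ and the $R_a$-valued statistics $p\mapsto\sum_{k}\langle t^{-k}p,\cdot\rangle_a t^k$ sends $\Delta_iq_{ei}$ and $\bar\Delta_iq_{mi}$ to the (antilinear) dual basis elements $q_{mi}^*$ and $q_{ei}^*$. Moreover $\mathcal T$ acts trivially on $C$. Consequently each of these theories $P$ admits a foliated RG with every scale factor $m\ge2$: after coarsening the translations to $\mathcal T^{(m)}=\{g^m\}$, $P$ is isomorphic to the stack of its own copy $P^{(m)}$ scaled up by $m$ and of $\mathbb Z_n$ toric code layers, with $r(m-1)$ layers of each orientation $a\in A$ per unit cell of $\mathcal T^{(m)}$. (d) For $n>2$ the checkerboard model is not equivalent to a stack of two X-cube models. That is, in the equivalence relation on $p$-theories generated by isomorphism, coarsening of the translation group to a subgroup isomorphic to $\mathbb Z^3$, and stacking with $p$-theories in which all sectors are sums of planons, the $p$-theory of the checkerboard model is not equivalent to any stack of two $p$-theories each of which is equivalent to that of an X-cube model. -/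

import Mathlib

open scoped LaurentPolynomial BigOperators

noncomputable section

namespace Fracton

/-! ### Fusion theories and `p`-theories -/

/-- Real three-dimensional space. -/
abbrev E3 : Type := EuclideanSpace ℝ (Fin 3)

/-- Linear subspaces of space; orientations of planons are two-dimensional ones. -/
abbrev Plane : Type := Submodule ℝ E3

/-- `η` is injective and sends every set of three generators of the lattice to a basis of space. -/
def IsLatticeEmbedding {T : Type} [AddCommGroup T] (η : T →+ E3) : Prop :=
  Function.Injective η ∧ ∀ b : Module.Basis (Fin 3) ℤ T, LinearIndependent ℝ (fun i => η (b i))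

/-- The data of a fusion theory: a translation group `T` (written additively), a module `S` of
superselection sectors over the group ring of `T` with coefficients in `ZMod n` (given as a
`ZMod n`-module with a linear action of `T`), and a map of `T` into space. -/
structure FusionData (n : ℕ) where
  T : Type
  [groupT : AddCommGroup T]
  S : Type
  [groupS : AddCommGroup S]
  [moduleS : Module (ZMod n) S]
  act : T → Module.End (ZMod n) S
  act_zero : act 0 = 1
  act_add : ∀ g h, act (g + h) = act g * act h
  η : T →+ E3

attribute [instance] FusionData.groupT FusionData.groupS FusionData.moduleS

namespace FusionData

variable {n : ℕ} (F : FusionData n)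

/-- The group of translations that fix the sector `x`. -/
def stab (x : F.S) : AddSubgroup F.T where
  carrier := {g | F.act g x = x}
  zero_mem' := by simp [F.act_zero]
  add_mem' := by
    intro g h hg hh
    simp only [Set.mem_ofPred_eq] at hg hh ⊢
    rw [F.act_add, Module.End.mul_apply, hh, hg]
  neg_mem' := by
    intro g hg
    simp only [Set.mem_ofPred_eq] at hg ⊢
    have h1 : F.act (-g) (F.act g x) = x := by
      rw [← Module.End.mul_apply, ← F.act_add, neg_add_cancel, F.act_zero]; rfl
    rw [hg] at h1
    exact h1

/-- The real span of the translations that fix `x`. -/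
def orientation (x : F.S) : Plane := Submodule.span ℝ (F.η '' (F.stab x : Set F.T))

/-- A planon is a sector whose stabilizer is free abelian of rank two. -/
def IsPlanon (x : F.S) : Prop := Nonempty (F.stab x ≃+ (Fin 2 → ℤ))

/-- The set of orientations of planons. -/
def A : Set Plane := {a | ∃ x, F.IsPlanon x ∧ F.orientation x = a}

/-- The submodule generated by the `a`-oriented planons. (The set of these planons is stable under
translations, so that the `ZMod n`-span is a submodule over the group ring.) -/
def Sa (a : Plane) : Submodule (ZMod n) F.S :=
  Submodule.span (ZMod n) {x | F.IsPlanon x ∧ F.orientation x = a}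

/-- A choice of a unit normal vector for each orientation of planons. -/
def IsUnitNormal (normal : Plane → E3) : Prop :=
  ∀ a ∈ F.A, ‖normal a‖ = 1 ∧ ∀ v ∈ a, inner ℝ (normal a) v = 0

end FusionData

/-- The data of a `p`-theory: a fusion theory, normal vectors of the orientations of planons, and
forms `form a p x` that give the mutual statistics of an `a`-oriented planon `p` and a sector `x`.
Only the values at `a ∈ A` and at `p ∈ Sa a` are meaningful. -/
structure PData (n : ℕ) extends FusionData n where
  normal : Plane → E3
  form : Plane → S → (S →ₗ[ZMod n] ZMod n)

namespace PData

variable {n : ℕ} (P : PData n)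

/-- The axioms of a `p`-theory with `ZMod n`-valued statistics. (That `n` is the least positive
integer that kills `S` is the separate statement `AddMonoid.exponent P.S = n`.) -/
structure IsPTheory : Prop where
  lattice : Nonempty (P.T ≃+ (Fin 3 → ℤ))
  fg : ∃ G : Finset P.S, Submodule.span (ZMod n) {y | ∃ g, ∃ x ∈ G, y = P.act g x} = ⊤
  no_mobile : ∀ x, Nonempty (P.stab x ≃+ (Fin 3 → ℤ)) → x = 0
  embedding : IsLatticeEmbedding P.η
  normal_unit : P.IsUnitNormal P.normal
  form_add : ∀ a ∈ P.A, ∀ p ∈ P.Sa a, ∀ q ∈ P.Sa a, P.form a (p + q) = P.form a p + P.form a q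
  form_symm : ∀ a ∈ P.A, ∀ p ∈ P.Sa a, ∀ q ∈ P.Sa a, P.form a p q = P.form a q p
  form_act : ∀ a ∈ P.A, ∀ p ∈ P.Sa a, ∀ x g, P.form a (P.act g p) (P.act g x) = P.form a p x
  form_local : ∀ a ∈ P.A, ∀ p ∈ P.Sa a, ∀ x g, (∀ i : ℤ, P.act (i • g) p = p → i = 0) →
    ∃ m : ℕ, ∀ i : ℤ, (m : ℤ) ≤ |i| → P.form a (P.act (i • g) p) x = 0

/-- `p`-modularity: every non-zero sector is detected by braiding with some planon. -/
def PModular : Prop := ∀ x : P.S, x ≠ 0 → ∃ a ∈ P.A, ∃ p ∈ P.Sa a, P.form a p x ≠ 0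

/-- The submodule of `a`-transparent sectors. -/
def K (a : Plane) : Submodule (ZMod n) P.S := ⨅ p ∈ P.Sa a, LinearMap.ker (P.form a p)

/-- The module of `a`-oriented plane charges. -/
abbrev Qa (a : Plane) : Type := P.S ⧸ P.K a

/-- The plane charge module, the sum of all `Qa` (a finite sum, since a fusion theory has finitely
many orientations of planons). -/
abbrev Q : Type := ∀ a : P.A, P.Qa a

/-- The plane charge map. -/
def pi : P.S →ₗ[ZMod n] P.Q := LinearMap.pi fun a => (P.K a).mkQ

/-- The constraint module. -/
abbrev C : Type := P.Q ⧸ LinearMap.range P.pi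

/-- The weight of a sector: the number of orientations in which it has a plane charge. -/
def weight (x : P.S) : ℕ := {a ∈ P.A | x ∉ P.K a}.ncard

/-- The submodule generated by sectors of weight at most `i`. -/
def Sle (i : ℕ) : Submodule (ZMod n) P.S := Submodule.span (ZMod n) {x | P.weight x ≤ i}

/-- The `i`-th weighted quotient superselection sectors. -/
abbrev W (i : ℕ) : Type := P.S ⧸ P.Sle i

/-- All sectors are sums of planons. -/
def EssentiallyOnePlanar : Prop := (⨆ a ∈ P.A, P.Sa a) = ⊤

/-- The submodule of plane charges in `Qa` that satisfy all constraints, i.e. the kernel in `Qa` of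
the quotient map `Q → C`. -/
def kerOmega (a : P.A) : Submodule (ZMod n) (P.Qa a) :=
  letI : DecidableEq P.A := Classical.decEq _
  (LinearMap.range P.pi).comap (LinearMap.single (ZMod n) (fun b : P.A => P.Qa b) a)

/-- Translations act trivially on the constraint module. -/
def TrivialOnC : Prop :=
  ∀ g, ∀ x : P.A → P.S, (fun a => (P.K a).mkQ (P.act g (x a) - x a) : P.Q) ∈ LinearMap.range P.pi

/-- Isomorphism of `p`-theories. -/
def Iso (P P' : PData n) : Prop :=
  ∃ (αT : P.T ≃+ P'.T) (αS : P.S ≃ₗ[ZMod n] P'.S),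
    (∀ g, P'.η (αT g) = P.η g) ∧
    (∀ g x, αS (P.act g x) = P'.act (αT g) (αS x)) ∧
    (∀ a ∈ P.A, P.normal a = P'.normal a) ∧
    ∀ a ∈ P.A, ∀ p ∈ P.Sa a, ∀ x, P.form a p x = P'.form a (αS p) (αS x)

open Classical in
/-- `P` is isomorphic to the stack of the (finitely many) theories `F i`: the translation groups and
their maps to space are identified, the sectors form the direct sum, the normal vectors agree, and
the statistics are the sums of the statistics of the components. -/
def IsStackOf {ι : Type} (P : PData n) (F : ι → PData n) : Prop :=
  ∃ (αT : ∀ i, P.T ≃+ (F i).T) (αS : P.S ≃ₗ[ZMod n] ∀ i, (F i).S),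
    (∀ i g, (F i).η (αT i g) = P.η g) ∧
    (∀ g x i, αS (P.act g x) i = (F i).act (αT i g) (αS x i)) ∧
    (∀ i, ∀ a ∈ (F i).A, P.normal a = (F i).normal a) ∧
    ∀ a ∈ P.A, ∀ p ∈ P.Sa a, ∀ x, P.form a p x =
      ∑ᶠ i, if a ∈ (F i).A then (F i).form a (αS p i) (αS x i) else 0

/-- Coarsening: only the translations in the subgroup `H` are kept. -/
def coarsen (H : AddSubgroup P.T) : PData n where
  T := H
  S := P.S
  act g := P.act g
  act_zero := P.act_zero
  act_add g h := P.act_add g h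
  η := P.η.comp H.subtype
  normal := P.normal
  form := P.form

/-- The subgroup of `m`-th multiples of translations. -/
def multiples (m : ℕ) : AddSubgroup P.T := (nsmulAddMonoidHom m : P.T →+ P.T).range

/-- The copy of `P` that is scaled up by `m`. Its translation group is the group of `m`-th multiples,
with `m • h` acting as `h` acts in `P`; it is identified with `T` by `h ↦ m • h`. -/
def scale (m : ℕ) : PData n := { P with η := m • P.η }

/-- Layers of the `ZMod n` toric code of orientation `a`, one layer for each value of the position
`θ`: the sectors are pairs `(u, v)` of Laurent polynomials, `u` counting electric and `v` magnetic
charges in each layer, and the statistics of `(u, v)` and `(f, g)` is the sum over all layers of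
`u * g + v * f`. Translation group, lattice and normal vectors are those of `P`. -/
def toricLayers (a : Plane) (θ : P.T →+ ℤ) : PData n where
  T := P.T
  S := (ZMod n)[T;T⁻¹] × (ZMod n)[T;T⁻¹]
  act g := Algebra.lsmul (ZMod n) (ZMod n) _ (LaurentPolynomial.T (R := ZMod n) (θ g))
  act_zero := by simp
  act_add g h := by rw [map_add, LaurentPolynomial.T_add, map_mul]
  η := P.η
  normal := P.normal
  form b p := by
    classical
    exact if b = a then
      { toFun := fun x => (p.1 * LaurentPolynomial.invert x.2 +
          p.2 * LaurentPolynomial.invert x.1).coeff 0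
        map_add' := by
          intro x y
          simp only [Prod.fst_add, Prod.snd_add, map_add, mul_add, AddMonoidAlgebra.coeff_add,
            Finsupp.add_apply]
          abel
        map_smul' := by
          intro c x
          simp [mul_add] }
      else 0

/-- The highest and the lowest coefficient are units. -/
def UnitEnds (Δ : (ZMod n)[T;T⁻¹]) : Prop :=
  ∃ lo hi : ℤ, lo ≤ hi ∧ IsUnit (Δ.coeff lo) ∧ IsUnit (Δ.coeff hi) ∧
    ∀ k, k < lo ∨ hi < k → Δ.coeff k = 0

/-- The hypotheses of the sufficient criterion for a foliated RG. For each orientation `a`: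
translations modulo the stabilizer of `Qa` form a group isomorphic to `ℤ` (by `θ`), so that the group
ring of that quotient is the ring of Laurent polynomials; `Qa` is free of rank `2 * r a` over it, by
an isomorphism `e` whose components come in pairs (electric, magnetic); the plane charges in `Qa` that
satisfy all constraints are those whose `i`-th components are multiples of `Δ i` and of its antipode;
and the map that sends such a plane charge `p` to its Laurent polynomial valued statistics, with
coefficient `⟨g⁻¹ p, ·⟩` at `t ^ θ g`, takes the basis elements `Δ i * e_i` and `invert (Δ i) * m_i` to
the antilinear dual basis elements of `m_i` and `e_i`. -/
def FoliationHypotheses (r : Plane → ℕ) : Prop :=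
  ∀ a : P.A, ∃ θ : P.T →+ ℤ, Function.Surjective θ ∧
    (∀ g, θ g = 0 ↔ ∀ x, P.act g x - x ∈ P.K a) ∧
    ∃ e : P.Qa a ≃ₗ[ZMod n] (Fin (r a) → (ZMod n)[T;T⁻¹] × (ZMod n)[T;T⁻¹]),
      (∀ g x, e ((P.K a).mkQ (P.act g x)) =
        (LaurentPolynomial.T (θ g) : (ZMod n)[T;T⁻¹]) • e ((P.K a).mkQ x)) ∧
      ∃ Δ : Fin (r a) → (ZMod n)[T;T⁻¹], (∀ i, UnitEnds (Δ i)) ∧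
        (∀ q, q ∈ P.kerOmega a ↔
          ∀ i, Δ i ∣ (e q i).1 ∧ LaurentPolynomial.invert (Δ i) ∣ (e q i).2) ∧
        ∀ p ∈ P.Sa a, ∀ u v : Fin (r a) → (ZMod n)[T;T⁻¹],
          (∀ i, e ((P.K a).mkQ p) i = (Δ i * u i, LaurentPolynomial.invert (Δ i) * v i)) →
          ∀ x g, P.form a (P.act (-g) p) x =
            (∑ i, (u i * LaurentPolynomial.invert (e ((P.K a).mkQ x) i).2 +
              v i * LaurentPolynomial.invert (e ((P.K a).mkQ x) i).1)).coeff (θ g)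

/-- Foliated RG with scale factor `m`: after coarsening to `m`-th multiples of translations, the
theory is the stack of its own scaled up copy and of a theory `L`, which is a stack of `ZMod n` toric
code layers with `r a * (m - 1)` layers of each orientation `a` per unit cell. -/
def AdmitsFoliatedRG (m : ℕ) (r : Plane → ℕ) : Prop :=
  ∃ L : PData n, L.IsPTheory ∧
    (P.coarsen (P.multiples m)).IsStackOf ![P.scale m, L] ∧
    ∃ θ : P.A → ((P.coarsen (P.multiples m)).T →+ ℤ),
      (∀ a, Function.Surjective (θ a) ∧
        ∀ g, θ a g = 0 ↔ (P.coarsen (P.multiples m)).η g ∈ (a : Plane)) ∧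
      L.IsStackOf fun i : (Σ a : P.A, Fin (r a * (m - 1))) =>
        (P.coarsen (P.multiples m)).toricLayers i.1 (θ i.1)

/-- Elementary moves between `p`-theories that preserve the phase in the coarse sense: isomorphism,
coarsening to a subgroup isomorphic to `ℤ ^ 3`, and stacking with an essentially one-planar
theory (for instance with decoupled two-dimensional layers). -/
inductive PhaseMove : PData n → PData n → Prop
  | iso {P P' : PData n} : P.IsPTheory → P.Iso P' → PhaseMove P P'
  | coarsen {P : PData n} (H : AddSubgroup P.T) : P.IsPTheory → Nonempty (H ≃+ (Fin 3 → ℤ)) →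
      PhaseMove P (P.coarsen H)
  | stack {P L P' : PData n} : P.IsPTheory → L.IsPTheory → L.EssentiallyOnePlanar →
      P'.IsStackOf ![P, L] → PhaseMove P P'

/-- The equivalence relation generated by the moves. -/
def PhaseEquiv : PData n → PData n → Prop := Relation.EqvGen PhaseMove

end PData

/-- The finite abelian group `ℤ/d₁ × ℤ/d₂ × ⋯` for a list `d₁, d₂, …`; trivial for the empty list. -/
abbrev AbGrp (l : List ℕ) : Type := ∀ j : Fin l.length, ZMod (l.get j)

/-- The weighted QSS is the given sequence of groups; its length is the number of orientations. -/
def PData.HasWeightedQSS {n : ℕ} (P : PData n) (w : List (List ℕ)) : Prop :=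
  P.A.ncard = w.length ∧ ∀ i : Fin w.length, Nonempty (P.W (i + 1) ≃+ AbGrp (w.get i))

/-! ### CSS Pauli codes and their `p`-theories -/

/-- The translation group of the models. -/
abbrev Z3 : Type := Fin 3 → ℤ

/-- The group ring of the translation group over `ZMod n`. -/
abbrev GroupRing (n : ℕ) : Type := AddMonoidAlgebra (ZMod n) Z3

/-- The monomial of a translation. -/
def mono (n : ℕ) (g : Z3) : GroupRing n := AddMonoidAlgebra.single g 1

/-- The antipode, which inverts translations. -/
def antipode (n : ℕ) : GroupRing n ≃ₐ[ZMod n] GroupRing n :=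
  AddMonoidAlgebra.domCongr (ZMod n) (ZMod n) (AddEquiv.neg Z3)

open Classical in
/-- The sum of the coefficients of `r` at the translations in `H`. -/
def coeffSum {n : ℕ} (H : AddSubgroup Z3) (r : GroupRing n) : ZMod n :=
  r.coeff.sum fun g c => if g ∈ H then c else 0

/-- A translation invariant `ZMod n` CSS code with `q` qudits, `tZ` stabilizers of `Z` type and `tX`
of `X` type per unit cell, given by the two blocks of its excitation map: `eZ` gives the excitations
of `Z` stabilizers created by `X` operators, and `eX` the excitations of `X` stabilizers created by
`Z` operators. -/
structure CSSCode (n : ℕ) where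
  q : ℕ
  tZ : ℕ
  tX : ℕ
  eZ : Matrix (Fin tZ) (Fin q) (GroupRing n)
  eX : Matrix (Fin tX) (Fin q) (GroupRing n)

namespace CSSCode

variable {n : ℕ} (X : CSSCode n)

/-- The Pauli module: `Z` operators (left) and `X` operators (right). -/
abbrev Pauli : Type := Fin X.q ⊕ Fin X.q → GroupRing n

/-- The module of excitations, which is also that of formal sums of stabilizers: `Z` stabilizers
(left) and `X` stabilizers (right). -/
abbrev Exc : Type := Fin X.tZ ⊕ Fin X.tX → GroupRing n

/-- The matrix of the excitation map. -/
def epsMat : Matrix (Fin X.tZ ⊕ Fin X.tX) (Fin X.q ⊕ Fin X.q) (GroupRing n) :=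
  Matrix.fromBlocks 0 X.eZ X.eX 0

/-- The excitation map `ε`. -/
def eps : X.Pauli →ₗ[GroupRing n] X.Exc := X.epsMat.mulVecLin

/-- The symplectic form on the Pauli module. -/
def lam : Matrix (Fin X.q ⊕ Fin X.q) (Fin X.q ⊕ Fin X.q) (GroupRing n) := Matrix.fromBlocks 0 1 (-1) 0

/-- The stabilizer map `σ = λ ε†`, where `†` is the transpose with the antipode of each entry; thus
`ε = σ† λ`. -/
def sigma : X.Exc →ₗ[GroupRing n] X.Pauli := (X.lam * (X.epsMat.map (antipode n)).transpose).mulVecLin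

/-- The superselection sectors: excitations modulo locally created ones. -/
abbrev Sec : Type := X.Exc ⧸ LinearMap.range X.eps

/-- The sector of an excitation. -/
def sec (e : X.Exc) : X.Sec := Submodule.Quotient.mk e

/-- The fusion theory of the code, for a given map of the lattice to space. -/
def fusion (η : Z3 →+ E3) : FusionData n where
  T := Z3
  S := X.Sec
  act g := Algebra.lsmul (ZMod n) (ZMod n) X.Sec (mono n g)
  act_zero := by
    have : mono n 0 = 1 := rfl
    rw [this, map_one]
  act_add g h := by
    have : mono n (g + h) = mono n g * mono n h := by
      simp [mono, AddMonoidAlgebra.single_mul_single]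
    rw [this, map_mul]
  η := η

/-- The data of a `p`-theory of the code, for given normal vectors and forms. -/
def theory (η : Z3 →+ E3) (normal : Plane → E3)
    (form : Plane → X.Sec → (X.Sec →ₗ[ZMod n] ZMod n)) : PData n :=
  { X.fusion η with normal := normal, form := form }

/-- The forms give the braiding statistics of the code. Let `e` be an excitation whose sector lies in
`Sa a`, let `g`, `h` be translations in the plane `a` such that `(normal a, g, h)` is positively
oriented, and let `sg`, `sh` be Pauli operators that move `e` by `g` and by `h`. Then moving `e`
counterclockwise around the parallelogram spanned by `g` and `h` is done by the operator
`(1 - h) sg - (1 - g) sh`, which creates no excitation and is therefore a product `w` of stabilizers.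
The loop operator of a large parallelogram is the product of the translates of `w`, and the phase
that it acquires around an excitation `x` is the sum of the eigenvalues of the stabilizers in it.
In the limit of large loops this is a sum over the translates of `w` by the group generated by `g`
and `h`. -/
def IsStatistics (η : Z3 →+ E3) (normal : Plane → E3)
    (form : Plane → X.Sec → (X.Sec →ₗ[ZMod n] ZMod n)) : Prop :=
  ∀ a ∈ (X.fusion η).A, ∀ e x : X.Exc, X.sec e ∈ (X.fusion η).Sa a →
    ∀ g h : Z3, η g ∈ a → η h ∈ a →
      0 < (Matrix.of ![(fun i => normal a i), (fun i => η g i), (fun i => η h i)]).det →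
    ∀ (sg sh : X.Pauli) (w : X.Exc),
      X.eps sg = (mono n g - 1) • e → X.eps sh = (mono n h - 1) • e →
      X.sigma w = (1 - mono n h) • sg - (1 - mono n g) • sh →
      form a (X.sec e) (X.sec x) =
        ∑ j, coeffSum (AddSubgroup.closure {g, h}) (antipode n (w j) * x j)

/-- `X.theory η normal form` is a `p`-theory of the code: `η` is an embedding of the lattice, `normal`
a choice of unit normal vectors, and the forms are the braiding statistics of the code. -/
structure IsTheory (η : Z3 →+ E3) (normal : Plane → E3)
    (form : Plane → X.Sec → (X.Sec →ₗ[ZMod n] ZMod n)) : Prop where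
  embedding : IsLatticeEmbedding η
  unitNormal : (X.fusion η).IsUnitNormal normal
  statistics : X.IsStatistics η normal form

/-- The braiding statistics of the code are well defined, for each embedding of the lattice and each
choice of normal vectors. -/
def HasTheory : Prop :=
  ∀ η normal, IsLatticeEmbedding η → (X.fusion η).IsUnitNormal normal →
    ∃ form, X.IsTheory η normal form

end CSSCode

/-- The homomorphism from the group ring to Laurent polynomials that sends a translation `g` to
`(-1) ^ χ g * t ^ θ g`. For `χ = 0` and `θ` surjective it is the projection to the group ring of the
quotient by `ker θ`, identified with the ring of Laurent polynomials by `θ`. -/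
def proj (n : ℕ) (θ χ : Z3 →+ ℤ) : GroupRing n →ₐ[ZMod n] (ZMod n)[T;T⁻¹] :=
  AddMonoidAlgebra.lift (ZMod n) ((ZMod n)[T;T⁻¹]) Z3
    { toFun := fun g => LaurentPolynomial.C (((-1 : (ZMod n)ˣ) ^ χ g.toAdd : (ZMod n)ˣ) : ZMod n) *
        LaurentPolynomial.T (θ g.toAdd)
      map_one' := by simp
      map_mul' := by
        intro g h
        simp only [toAdd_mul, map_add, zpow_add, Units.val_mul, map_mul, LaurentPolynomial.T_add]
        ring }

/-- The plane charge and constraint maps of a proposed `p`-modular sequence for a CSS code. There are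
`k` orientations, each with one module of `Z`-charges and one of `X`-charges, all of them Laurent
polynomials. The plane charge map has components `∑ j, pZ i j * proj (θ i) (χ i) (v j)`, similarly for
`X`; the constraint maps have components `∑ i, ∑ d, oZ l i d * (coefficient of t ^ d in q i)`. -/
structure SeqData {n : ℕ} (X : CSSCode n) where
  k : ℕ
  θ : Fin k → (Z3 →+ ℤ)
  χ : Fin k → (Z3 →+ ℤ)
  pZ : Matrix (Fin k) (Fin X.tZ) ((ZMod n)[T;T⁻¹])
  pX : Matrix (Fin k) (Fin X.tX) ((ZMod n)[T;T⁻¹])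
  cZ : ℕ
  cX : ℕ
  oZ : Fin cZ → Fin k → ℤ → ZMod n
  oX : Fin cX → Fin k → ℤ → ZMod n

namespace SeqData

variable {n : ℕ} {X : CSSCode n} (M : SeqData X)

/-- The plane charge map. -/
def pi (v : X.Exc) : Fin M.k ⊕ Fin M.k → (ZMod n)[T;T⁻¹] :=
  Sum.elim (fun i => ∑ j, M.pZ i j * proj n (M.θ i) (M.χ i) (v (Sum.inl j)))
    (fun i => ∑ j, M.pX i j * proj n (M.θ i) (M.χ i) (v (Sum.inr j)))

/-- The constraint map. -/
def omega (q : Fin M.k ⊕ Fin M.k → (ZMod n)[T;T⁻¹]) : Fin M.cZ ⊕ Fin M.cX → ZMod n :=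
  Sum.elim (fun l => ∑ i, (q (Sum.inl i)).coeff.sum fun d c => M.oZ l i d * c)
    (fun l => ∑ i, (q (Sum.inr i)).coeff.sum fun d c => M.oX l i d * c)

/-- The sequence `0 → G → P → E → Q → C → 0` with maps `σ`, `ε`, `π`, `ω` is exact. -/
def IsExact : Prop :=
  Function.Injective X.sigma ∧ Function.Exact X.sigma X.eps ∧ Function.Exact X.eps M.pi ∧
    Function.Exact M.pi M.omega ∧ Function.Surjective M.omega

/-- The plane in space that belongs to the `i`-th orientation. -/
def plane (η : Z3 →+ E3) (i : Fin M.k) : Plane :=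
  Submodule.span ℝ (η '' ((M.θ i).ker : Set Z3))

/-- The modules and maps of the sequence are the plane charges of the `p`-theory: the planes are
distinct and are exactly the orientations of planons, and the `i`-th part of the plane charge map is
surjective and has the `i`-th transparent sectors as its kernel. -/
def IsSequenceOf (η : Z3 →+ E3) (normal : Plane → E3)
    (form : Plane → X.Sec → (X.Sec →ₗ[ZMod n] ZMod n)) : Prop :=
  Function.Injective (M.plane η) ∧ (X.theory η normal form).A = Set.range (M.plane η) ∧
    ∀ i, (∀ v, X.sec v ∈ (X.theory η normal form).K (M.plane η i) ↔
        M.pi v (Sum.inl i) = 0 ∧ M.pi v (Sum.inr i) = 0) ∧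
      ∀ f g, ∃ v, M.pi v (Sum.inl i) = f ∧ M.pi v (Sum.inr i) = g

end SeqData

/-- The `p`-modular sequence of the code is exact, and the `p`-theory of the code exists, is
`p`-modular with least fusion order `n`, and has the given constraint module and weighted QSS. -/
def CSSCode.IsPModularWith {n : ℕ} (X : CSSCode n) (M : SeqData X) (c : List ℕ)
    (w : List (List ℕ)) : Prop :=
  M.IsExact ∧ X.HasTheory ∧ ∀ η normal form, X.IsTheory η normal form →
    (X.theory η normal form).IsPTheory ∧
    AddMonoid.exponent (X.theory η normal form).S = n ∧
    (X.theory η normal form).PModular ∧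
    M.IsSequenceOf η normal form ∧
    Nonempty ((X.theory η normal form).C ≃+ AbGrp c) ∧
    (X.theory η normal form).HasWeightedQSS w

/-- The hypotheses of the criterion for a foliated RG hold with `r` layers in each orientation,
translations act trivially on the constraint module, and there is a foliated RG with any scale
factor `m ≥ 2`. -/
def PData.IsFoliated {n : ℕ} (P : PData n) (r : ℕ) : Prop :=
  P.FoliationHypotheses (fun _ => r) ∧ P.TrivialOnC ∧
    ∀ m, 2 ≤ m → P.AdmitsFoliatedRG m (fun _ => r)

/-! ### The models -/

/-- The `i`-th coordinate of a translation. -/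
def deg (i : Fin 3) : Z3 →+ ℤ := Pi.evalAddMonoidHom (fun _ => ℤ) i

section Cubic

variable (n : ℕ)

/-- Monomials of the translations by one unit along the coordinate axes. -/
def tx : GroupRing n := mono n ![1, 0, 0]
def ty : GroupRing n := mono n ![0, 1, 0]
def tz : GroupRing n := mono n ![0, 0, 1]

/-- Their inverses. -/
def txi : GroupRing n := mono n ![-1, 0, 0]
def tyi : GroupRing n := mono n ![0, -1, 0]
def tzi : GroupRing n := mono n ![0, 0, -1]

/-- The X-cube model. -/
def xCube : CSSCode n where
  q := 3
  tZ := 2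
  tX := 1
  eZ := !![0, -(1 - ty n), 1 - tz n;
           -(1 - tx n), 0, 1 - tz n]
  eX := !![-((1 - tyi n) * (1 - tzi n)), -((1 - tzi n) * (1 - txi n)), -((1 - txi n) * (1 - tyi n))]

def xCubeSeq : SeqData (xCube n) where
  k := 3
  θ := deg
  χ := 0
  pZ := !![-1, 0;
           0, 1;
           1, -1]
  pX := !![1; 1; 1]
  cZ := 1
  cX := 2
  oZ := fun l i _ => !![1, 1, 1] l i
  oX := fun l i _ => !![1, 0, -1;
                        0, 1, -1] l i

/-- Toric code layers. -/
def toricCodeLayers : CSSCode n where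
  q := 2
  tZ := 1
  tX := 1
  eZ := !![-(1 - tx n), 1 - ty n]
  eX := !![-(1 - tyi n), -(1 - txi n)]

def toricCodeLayersSeq : SeqData (toricCodeLayers n) where
  k := 1
  θ := fun _ => deg 2
  χ := 0
  pZ := !![1]
  pX := !![1]
  cZ := 0
  cX := 0
  oZ := fun l => l.elim0
  oX := fun l => l.elim0

/-- The anisotropic model. -/
def anisotropic : CSSCode n where
  q := 2
  tZ := 1
  tX := 1
  eZ := !![-(1 - tz n), (1 - tx n) * (1 - ty n)]
  eX := !![-((1 - txi n) * (1 - tyi n)), -(1 - tzi n)]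

def anisotropicSeq : SeqData (anisotropic n) where
  k := 2
  θ := ![deg 0, deg 1]
  χ := 0
  pZ := !![1; -1]
  pX := !![1; 1]
  cZ := 1
  cX := 1
  oZ := fun l i _ => !![1, 1] l i
  oX := fun l i _ => !![1, -1] l i

/-- The 4-planar X-cube model. -/
def fourPlanar : CSSCode n where
  q := 6
  tZ := 3
  tX := 3
  eZ := !![0, 1 - ty n, -(1 - tz n), ty n - tz n, 0, 0;
           -(1 - tx n), 0, 1 - tz n, 0, tz n - tx n, 0;
           1 - tx n, -(1 - ty n), 0, 0, 0, tx n - ty n]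
  eX := !![-1, -1, -1, -1, -1, -1;
           tyi n + tzi n, tzi n + txi n, txi n + tyi n, 1 + txi n, 1 + tyi n, 1 + tzi n;
           -(tyi n * tzi n), -(tzi n * txi n), -(txi n * tyi n), -txi n, -tyi n, -tzi n]

def fourPlanarSeq : SeqData (fourPlanar n) where
  k := 4
  θ := ![deg 0, deg 1, deg 2, deg 0 + deg 1 + deg 2]
  χ := 0
  pZ := !![1, 0, 0;
           0, 1, 0;
           0, 0, 1;
           -1, -1, -1]
  pX := !![1, 1, 1;
           1, 1, 1;
           1, 1, 1;
           LaurentPolynomial.T (-1), 1, LaurentPolynomial.T 1]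
  cZ := 1
  cX := 3
  oZ := fun l i _ => !![1, 1, 1, 1] l i
  oX := fun l i _ => !![1, 0, 0, -1;
                        0, 1, 0, -1;
                        0, 0, 1, -1] l i

end Cubic

section Fcc

variable (n : ℕ)

/-- In the checkerboard model, translations are written in the basis `yz, zx, xy` of the face
centered cubic lattice. This is `1 + yz + zx + xy`. -/
def tau : GroupRing n := 1 + mono n ![1, 0, 0] + mono n ![0, 1, 0] + mono n ![0, 0, 1]

/-- The checkerboard model. -/
def checkerboard : CSSCode n where
  q := 2
  tZ := 1
  tX := 1
  eZ := !![antipode n (tau n), tau n]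
  eX := !![-antipode n (tau n), tau n]

/-- The weight `c` at even, `d` at odd degrees. -/
def alt (c d : ZMod n) (k : ℤ) : ZMod n := if Even k then c else d

/-- The degrees in `x, y, z` of the translation `(yz)^i (zx)^j (xy)^k` are `j + k, k + i, i + j`. The
sign that belongs to `x` is the parity of the degree in `z`, and so on cyclically. The three rows of
`oZ` and `oX` are the constraints of the sequence coarsened to even translations, for which the
modules of plane charges split into even and odd degrees. -/
def checkerboardSeq : SeqData (checkerboard n) where
  k := 3
  θ := ![deg 1 + deg 2, deg 2 + deg 0, deg 0 + deg 1]
  χ := ![deg 0 + deg 1, deg 1 + deg 2, deg 2 + deg 0]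
  pZ := !![1; 1; 1]
  pX := !![1; 1; 1]
  cZ := 3
  cX := 3
  oZ := ![![alt n 0 1, alt n (-1) 0, alt n 1 0],
          ![alt n 1 0, alt n 0 1, alt n (-1) 0],
          ![alt n (-1) 0, alt n 1 0, alt n 0 1]]
  oX := ![![alt n 0 1, alt n (-1) 0, alt n 1 0],
          ![alt n 1 0, alt n 0 1, alt n (-1) 0],
          ![alt n (-1) 0, alt n 1 0, alt n 0 1]]

/-- The subgroup of translations generated by `x^2, y^2, z^2`. -/
def evenLattice : AddSubgroup Z3 :=
  AddSubgroup.closure {![-1, 1, 1], ![1, -1, 1], ![1, 1, -1]}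

end Fcc

end Fracton

end

open Fracton

open scoped LaurentPolynomial BigOperators

noncomputable section

namespace Fracton

section Lattice

variable {T : Type} [AddCommGroup T]

theorem free_int_of_equiv {ι : Type} [Finite ι] (h : Nonempty (T ≃+ (ι → ℤ))) :
    Module.Free ℤ T ∧ Module.Finite ℤ T ∧ Module.finrank ℤ T = Nat.card ι := by
  obtain ⟨e⟩ := h
  have := Fintype.ofFinite ι
  refine ⟨Module.Free.of_equiv e.toIntLinearEquiv.symm,
    Module.Finite.equiv e.toIntLinearEquiv.symm, ?_⟩
  rw [e.toIntLinearEquiv.finrank_eq]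
  simp

theorem subgroup_free [Module.Free ℤ T] [Module.Finite ℤ T] (H : AddSubgroup T) :
    Module.Free ℤ H ∧ Module.Finite ℤ H :=
  ⟨inferInstanceAs (Module.Free ℤ (AddSubgroup.toIntSubmodule H)),
    inferInstanceAs (Module.Finite ℤ (AddSubgroup.toIntSubmodule H))⟩

theorem nonempty_equiv_iff_finrank [Module.Free ℤ T] [Module.Finite ℤ T] (H : AddSubgroup T)
    (d : ℕ) : Nonempty (H ≃+ (Fin d → ℤ)) ↔ Module.finrank ℤ H = d := by
  obtain ⟨_, _⟩ := subgroup_free H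
  constructor
  · intro h
    simpa using (free_int_of_equiv h).2.2
  · intro h
    exact ⟨(Module.finBasisOfFinrankEq ℤ H h).equivFun.toAddEquiv⟩

theorem finrank_subgroup_mono [Module.Free ℤ T] [Module.Finite ℤ T] {H K : AddSubgroup T}
    (h : H ≤ K) : Module.finrank ℤ H ≤ Module.finrank ℤ K := by
  obtain ⟨_, _⟩ := subgroup_free K
  exact LinearMap.finrank_le_finrank_of_injective (f := (AddSubgroup.inclusion h).toIntLinearMap)
    (AddSubgroup.inclusion_injective h)

theorem finrank_subgroup_le_of_smul [Module.Free ℤ T] [Module.Finite ℤ T] {H K : AddSubgroup T}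
    (m : ℕ) (hm : m ≠ 0) (h : ∀ g ∈ K, m • g ∈ H) :
    Module.finrank ℤ K ≤ Module.finrank ℤ H := by
  obtain ⟨_, _⟩ := subgroup_free H
  let f : K →+ H := AddMonoidHom.codRestrict ((nsmulAddMonoidHom m).comp K.subtype) H
    (fun g => h g g.2)
  refine LinearMap.finrank_le_finrank_of_injective (f := f.toIntLinearMap) ?_
  intro a b hab
  have h1 : m • (a : T) = m • (b : T) := congrArg Subtype.val hab
  refine Subtype.ext (smul_right_injective T (Int.natCast_ne_zero.2 hm) ?_)
  simpa only [natCast_zsmul] using h1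

theorem finrank_range_of_ne_zero {M : Type} [AddCommGroup M] (θ : M →+ ℤ) (h : ∃ g, θ g ≠ 0) :
    Module.finrank ℤ (LinearMap.range θ.toIntLinearMap) = 1 := by
  obtain ⟨g, hg⟩ := h
  refine le_antisymm ?_ ?_
  · exact (Submodule.finrank_le _).trans (by simp)
  · rw [Nat.one_le_iff_ne_zero]
    intro h0
    rw [Submodule.finrank_eq_zero] at h0
    have : θ g ∈ LinearMap.range θ.toIntLinearMap := ⟨g, rfl⟩
    rw [h0] at this
    exact hg (by simpa using this)

theorem finrank_ker_add_one {M : Type} [AddCommGroup M] [Module.Finite ℤ M]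
    (θ : M →+ ℤ) (h : ∃ g, θ g ≠ 0) :
    Module.finrank ℤ θ.ker + 1 = Module.finrank ℤ M := by
  have := Submodule.finrank_quotient_add_finrank (LinearMap.ker θ.toIntLinearMap)
  rw [θ.toIntLinearMap.quotKerEquivRange.finrank_eq, finrank_range_of_ne_zero θ h, add_comm] at this
  exact this

theorem finrank_ker_inf_ker [Module.Free ℤ T] [Module.Finite ℤ T] (θ θ' : T →+ ℤ)
    (h : ∃ g, θ g = 0 ∧ θ' g ≠ 0) :
    Module.finrank ℤ (θ.ker ⊓ θ'.ker : AddSubgroup T) + 1 ≤ Module.finrank ℤ θ.ker := by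
  obtain ⟨_, _⟩ := subgroup_free θ.ker
  obtain ⟨g, hg, hg'⟩ := h
  have h1 := finrank_ker_add_one (θ'.comp θ.ker.subtype) ⟨⟨g, hg⟩, hg'⟩
  obtain ⟨_, _⟩ := subgroup_free (θ'.comp θ.ker.subtype).ker
  rw [← h1]
  gcongr
  let f : (θ.ker ⊓ θ'.ker : AddSubgroup T) →+ (θ'.comp θ.ker.subtype).ker :=
    { toFun := fun x => ⟨⟨x.1, x.2.1⟩, x.2.2⟩
      map_zero' := rfl
      map_add' := fun _ _ => rfl }
  refine LinearMap.finrank_le_finrank_of_injective (f := f.toIntLinearMap) ?_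
  intro a b hab
  exact Subtype.ext (congrArg (fun z : (θ'.comp θ.ker.subtype).ker => ((z : θ.ker) : T)) hab)

theorem exists_smul_mem_of_finrank_eq [Module.Free ℤ T] [Module.Finite ℤ T] (H : AddSubgroup T)
    (h : Module.finrank ℤ H = Module.finrank ℤ T) : ∃ N : ℕ, N ≠ 0 ∧ ∀ g, N • g ∈ H := by
  have hf : Finite (T ⧸ AddSubgroup.toIntSubmodule H) :=
    Submodule.finiteQuotientOfFreeOfRankEq _ h
  have hf' : Finite (T ⧸ H) := hf
  refine ⟨H.index, H.index_ne_zero_of_finite, fun g => ?_⟩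
  exact AddSubgroup.nsmul_index_mem H g

theorem IsLatticeEmbedding.exists_extension {η : T →+ E3} (h : IsLatticeEmbedding η)
    (hT : Nonempty (T ≃+ (Fin 3 → ℤ))) (θ : T →+ ℤ) :
    ∃ φ : E3 →ₗ[ℝ] ℝ, ∀ g, φ (η g) = θ g := by
  obtain ⟨e⟩ := hT
  let b : Module.Basis (Fin 3) ℤ T := Module.Basis.ofEquivFun e.toIntLinearEquiv
  let B := basisOfLinearIndependentOfCardEqFinrank (h.2 b) (by simp)
  refine ⟨B.constr ℝ fun i => (θ (b i) : ℝ), fun g => ?_⟩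
  have h1 : ∀ i, B.constr ℝ (fun i => (θ (b i) : ℝ)) (η (b i)) = θ (b i) := by
    intro i
    have : η (b i) = B i := by simp [B]
    rw [this, Module.Basis.constr_basis]
  let f1 : T →+ ℝ := (B.constr ℝ fun i => (θ (b i) : ℝ)).toAddMonoidHom.comp η
  let f2 : T →+ ℝ := (Int.castAddHom ℝ).comp θ
  have : f1.toIntLinearMap = f2.toIntLinearMap := b.ext h1
  exact congrArg (fun f => f g) this

/-- The plane spanned by the kernel of `θ`. -/
def kerPlane (η : T →+ E3) (θ : T →+ ℤ) : Plane := Submodule.span ℝ (η '' (θ.ker : Set T))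

theorem mem_kerPlane_iff {η : T →+ E3} (h : IsLatticeEmbedding η)
    (hT : Nonempty (T ≃+ (Fin 3 → ℤ))) (θ : T →+ ℤ) (g : T) :
    η g ∈ kerPlane η θ ↔ θ g = 0 := by
  constructor
  · intro hg
    obtain ⟨φ, hφ⟩ := h.exists_extension hT θ
    have h1 : kerPlane η θ ≤ LinearMap.ker φ := by
      rw [kerPlane, Submodule.span_le]
      rintro _ ⟨k, hk, rfl⟩
      have : θ k = 0 := hk
      simp [hφ, this]
    have h2 : φ (η g) = 0 := h1 hg
    rw [hφ] at h2
    exact_mod_cast h2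
  · intro hg
    exact Submodule.subset_span ⟨g, hg, rfl⟩

theorem span_image_eq_of_smul (η : T →+ E3) {H K : AddSubgroup T} (hle : H ≤ K)
    (m : ℕ) (hm : m ≠ 0) (h : ∀ g ∈ K, m • g ∈ H) :
    Submodule.span ℝ (η '' (H : Set T)) = Submodule.span ℝ (η '' (K : Set T)) := by
  refine le_antisymm (Submodule.span_mono (Set.image_mono hle)) ?_
  rw [Submodule.span_le]
  rintro _ ⟨g, hg, rfl⟩
  have h1 : η (m • g) ∈ Submodule.span ℝ (η '' (H : Set T)) :=
    Submodule.subset_span ⟨_, h g hg, rfl⟩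
  have h2 : η g = (m : ℝ)⁻¹ • η (m • g) := by
    rw [map_nsmul, ← Nat.cast_smul_eq_nsmul ℝ, smul_smul, inv_mul_cancel₀ (by exact_mod_cast hm),
      one_smul]
  simp only [SetLike.mem_coe]
  rw [h2]
  exact Submodule.smul_mem _ _ h1

theorem IsLatticeEmbedding.of_smul {η : T →+ E3} {T' : Type} [AddCommGroup T'] {η' : T' →+ E3}
    (hη' : IsLatticeEmbedding η')
    (hT' : Nonempty (T' ≃+ (Fin 3 → ℤ)))
    (j : T →+ T') (hj : Function.Injective j) (hη : ∀ g, η g = η' (j g)) :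
    IsLatticeEmbedding η := by
  refine ⟨fun a b hab => hj (hη'.1 (by rw [← hη, ← hη, hab])), fun b => ?_⟩
  obtain ⟨e⟩ := hT'
  let b' : Module.Basis (Fin 3) ℤ T' := Module.Basis.ofEquivFun e.toIntLinearEquiv
  have h1 := hη'.2 b'
  have hZ : LinearIndependent ℤ (fun i => j (b i)) :=
    b.linearIndependent.map' j.toIntLinearMap (LinearMap.ker_eq_bot.2 hj)
  have hdet : (b'.toMatrix (fun i => j (b i))).det ≠ 0 := by
    intro h0
    rw [← Module.Basis.det_apply] at h0
    obtain ⟨v, hv0, hv⟩ := Matrix.exists_mulVec_eq_zero_iff.2 ((Module.Basis.det_apply b' _).symm.trans h0)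
    apply hv0
    have h2 : ∑ i, v i • j (b i) = 0 := by
      apply b'.ext_elem
      intro k
      have := congrFun hv k
      simp only [Matrix.mulVec, dotProduct, Module.Basis.toMatrix_apply] at this
      rw [map_sum]
      simp only [map_zsmul, Finsupp.coe_finsetSum, Finset.sum_apply, Finsupp.coe_smul, Pi.smul_apply, smul_eq_mul, map_zero, Finsupp.coe_zero, Pi.zero_apply]
      rw [Pi.zero_apply] at this
      rw [← this]
      exact Finset.sum_congr rfl fun i _ => mul_comm _ _
    exact funext (Fintype.linearIndependent_iff.1 hZ v h2)
  have h3 : (fun i => η (b i)) = fun i => ∑ k, ((b'.toMatrix (fun i => j (b i)) k i : ℤ) : ℝ) • η' (b' k) := by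
    funext i
    rw [hη]
    conv_lhs => rw [← b'.sum_toMatrix_smul_self (fun i => j (b i)) i]
    rw [map_sum]
    refine Finset.sum_congr rfl fun k _ => ?_
    rw [map_zsmul, Int.cast_smul_eq_zsmul]
  rw [h3, Fintype.linearIndependent_iff]
  intro c hc
  have h4 : ((b'.toMatrix (fun i => j (b i))).map (Int.cast : ℤ → ℝ)).mulVec c = 0 := by
    funext k
    have h5 : ∑ k, (∑ i, c i * ((b'.toMatrix (fun i => j (b i)) k i : ℤ) : ℝ)) • η' (b' k) = 0 := by
      rw [← hc]
      simp only [Finset.sum_smul, Finset.smul_sum, smul_smul]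
      rw [Finset.sum_comm]
    have h6 := Fintype.linearIndependent_iff.1 h1 _ h5 k
    simp only [Matrix.mulVec, dotProduct, Matrix.map_apply, Pi.zero_apply]
    rw [← h6]
    exact Finset.sum_congr rfl fun i _ => mul_comm _ _
  have h7 : ((b'.toMatrix (fun i => j (b i))).map (Int.cast : ℤ → ℝ)).det ≠ 0 := by
    have := (Int.castRingHom ℝ).map_det (b'.toMatrix (fun i => j (b i)))
    rw [RingHom.mapMatrix_apply] at this
    change Matrix.det ((b'.toMatrix (fun i => j (b i))).map (Int.castRingHom ℝ)) ≠ 0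
    rw [← this]
    simpa using hdet
  exact fun i => congrFun (Matrix.eq_zero_of_mulVec_eq_zero h7 h4) i

end Lattice

/-- Submodules `N i` of sectors without charge at the `i`-th of finitely many families of planes,
which are given by the kernels of the maps `θ i`. -/
structure Coordinates {n : ℕ} (F : FusionData n) {ι : Type} (θ : ι → F.T →+ ℤ)
    (N : ι → Submodule (ZMod n) F.S) : Prop where
  lattice : Nonempty (F.T ≃+ (Fin 3 → ℤ))
  embedding : IsLatticeEmbedding F.η
  surj : ∀ i, Function.Surjective (θ i)
  indep : ∀ i j, i ≠ j → ∃ g, θ i g = 0 ∧ θ j g ≠ 0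
  moves : ∀ i g x, θ i g ≠ 0 → F.act g x - x ∈ N i → x ∈ N i
  fixes : ∀ i g x, θ i g = 0 → F.act (2 • g) x - x ∈ N i
  act_mem : ∀ i g x, x ∈ N i → F.act g x ∈ N i
  separates : ∀ x, (∀ i, x ∈ N i) → x = 0
  exists_planon : ∀ i, ∃ x ∉ N i, ∀ j, j ≠ i → x ∈ N j

namespace Coordinates

variable {n : ℕ} {F : FusionData n} {ι : Type} {θ : ι → F.T →+ ℤ}
  {N : ι → Submodule (ZMod n) F.S} (h : Coordinates F θ N)

include h

theorem stab_le {i : ι} {x : F.S} (hx : x ∉ N i) : F.stab x ≤ (θ i).ker := by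
  intro g hg
  by_contra hne
  refine hx (h.moves i g x hne ?_)
  have : F.act g x = x := hg
  rw [this, sub_self]
  exact Submodule.zero_mem _

theorem two_smul_mem_stab {i : ι} {x : F.S} (hx : ∀ j, j ≠ i → x ∈ N j) {g : F.T}
    (hg : g ∈ (θ i).ker) : 2 • g ∈ F.stab x := by
  have : F.act (2 • g) x - x = 0 := by
    refine h.separates _ fun j => ?_
    by_cases hj : j = i
    · subst hj
      exact h.fixes _ _ _ hg
    · exact Submodule.sub_mem _ (h.act_mem j _ _ (hx j hj)) (hx j hj)
  exact sub_eq_zero.1 this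

theorem finrank_ker (i : ι) : Module.finrank ℤ (θ i).ker = 2 := by
  obtain ⟨_, _, h3⟩ := free_int_of_equiv h.lattice
  obtain ⟨g, hg⟩ := h.surj i 1
  have := finrank_ker_add_one (θ i) ⟨g, by simp [hg]⟩
  simp only [Nat.card_eq_fintype_card, Fintype.card_fin] at h3
  omega

theorem isPlanon_iff (x : F.S) : F.IsPlanon x ↔ ∃ i, x ∉ N i ∧ ∀ j, j ≠ i → x ∈ N j := by
  obtain ⟨_, _, h3⟩ := free_int_of_equiv h.lattice
  rw [FusionData.IsPlanon, nonempty_equiv_iff_finrank]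
  constructor
  · intro hr
    by_cases h0 : x = 0
    · subst h0
      have : F.stab 0 = ⊤ := by
        ext g
        simp [FusionData.stab]
      rw [this] at hr
      have e : (⊤ : AddSubgroup F.T) ≃+ F.T := AddSubgroup.topEquiv
      rw [e.toIntLinearEquiv.finrank_eq] at hr
      simp only [Nat.card_eq_fintype_card, Fintype.card_fin] at h3
      omega
    · have hne : ∃ i, x ∉ N i := by
        by_contra! hc
        exact h0 (h.separates x hc)
      obtain ⟨i, hi⟩ := hne
      refine ⟨i, hi, fun j hj => ?_⟩
      by_contra hjN
      have h4 := finrank_ker_inf_ker (θ i) (θ j) (h.indep i j hj.symm)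
      have h5 := finrank_subgroup_mono (le_inf (h.stab_le hi) (h.stab_le hjN))
      rw [h.finrank_ker] at h4
      omega
  · rintro ⟨i, hi, hj⟩
    have h1 := finrank_subgroup_mono (h.stab_le hi)
    have h2 := finrank_subgroup_le_of_smul 2 two_ne_zero
      (fun g hg => h.two_smul_mem_stab hj (g := g) hg)
    rw [h.finrank_ker] at h1 h2
    omega

theorem orientation_eq {i : ι} {x : F.S} (hi : x ∉ N i) (hj : ∀ j, j ≠ i → x ∈ N j) :
    F.orientation x = kerPlane F.η (θ i) :=
  span_image_eq_of_smul F.η (h.stab_le hi) 2 two_ne_zero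
    (fun _ hg => h.two_smul_mem_stab hj hg)

theorem kerPlane_injective : Function.Injective fun i => kerPlane F.η (θ i) := by
  intro i j hij
  by_contra hne
  obtain ⟨g, hg, hg'⟩ := h.indep i j hne
  have h1 := (mem_kerPlane_iff h.embedding h.lattice (θ i) g).2 hg
  have h2 : kerPlane F.η (θ i) = kerPlane F.η (θ j) := hij
  rw [h2] at h1
  exact hg' ((mem_kerPlane_iff h.embedding h.lattice (θ j) g).1 h1)

theorem planon_orientation_iff (i : ι) (x : F.S) :
    (F.IsPlanon x ∧ F.orientation x = kerPlane F.η (θ i)) ↔ x ∉ N i ∧ ∀ j, j ≠ i → x ∈ N j := by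
  constructor
  · rintro ⟨hp, ho⟩
    obtain ⟨k, hk, hj⟩ := (h.isPlanon_iff x).1 hp
    rw [h.orientation_eq hk hj] at ho
    obtain rfl := h.kerPlane_injective ho
    exact ⟨hk, hj⟩
  · rintro ⟨hi, hj⟩
    exact ⟨(h.isPlanon_iff x).2 ⟨i, hi, hj⟩, h.orientation_eq hi hj⟩

theorem A_eq : F.A = Set.range fun i => kerPlane F.η (θ i) := by
  ext a
  constructor
  · rintro ⟨x, hp, rfl⟩
    obtain ⟨k, hk, hj⟩ := (h.isPlanon_iff x).1 hp
    exact ⟨k, (h.orientation_eq hk hj).symm⟩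
  · rintro ⟨i, rfl⟩
    obtain ⟨x, hi, hj⟩ := h.exists_planon i
    exact ⟨x, (h.planon_orientation_iff i x).2 ⟨hi, hj⟩⟩

theorem kerPlane_mem_A (i : ι) : kerPlane F.η (θ i) ∈ F.A := by
  rw [h.A_eq]
  exact ⟨i, rfl⟩

theorem mem_Sa_iff (i : ι) (p : F.S) :
    p ∈ F.Sa (kerPlane F.η (θ i)) ↔ ∀ j, j ≠ i → p ∈ N j := by
  have hset : {x | F.IsPlanon x ∧ F.orientation x = kerPlane F.η (θ i)} =
      {x | x ∉ N i ∧ ∀ j, j ≠ i → x ∈ N j} := Set.ext fun x => h.planon_orientation_iff i x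
  rw [FusionData.Sa, hset]
  constructor
  · intro hp j hj
    have : Submodule.span (ZMod n) {x | x ∉ N i ∧ ∀ j, j ≠ i → x ∈ N j} ≤ N j := by
      rw [Submodule.span_le]
      exact fun x hx => hx.2 j hj
    exact this hp
  · intro hp
    by_cases hi : p ∈ N i
    · have : p = 0 := by
        refine h.separates p fun j => ?_
        by_cases hj : j = i
        · rwa [hj]
        · exact hp j hj
      rw [this]
      exact Submodule.zero_mem _
    · exact Submodule.subset_span ⟨hi, hp⟩

theorem no_mobile (x : F.S) (hx : Nonempty (F.stab x ≃+ (Fin 3 → ℤ))) : x = 0 := by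
  obtain ⟨_, _, h3⟩ := free_int_of_equiv h.lattice
  refine h.separates x fun i => ?_
  by_contra hi
  rw [nonempty_equiv_iff_finrank] at hx
  have := finrank_subgroup_mono (h.stab_le hi)
  rw [h.finrank_ker] at this
  omega

end Coordinates

section Coarsen

variable {n : ℕ} (P : PData n) (H : AddSubgroup P.T)

theorem coarsen_exists_smul (hT : Nonempty (P.T ≃+ (Fin 3 → ℤ)))
    (hH : Nonempty (H ≃+ (Fin 3 → ℤ))) : ∃ N : ℕ, N ≠ 0 ∧ ∀ g, N • g ∈ H := by
  obtain ⟨_, _, h3⟩ := free_int_of_equiv hT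
  obtain ⟨_, _, h3'⟩ := free_int_of_equiv hH
  exact exists_smul_mem_of_finrank_eq H (h3'.trans h3.symm)

variable {P H} in
theorem coarsen_isPlanon_iff (hT : Nonempty (P.T ≃+ (Fin 3 → ℤ)))
    (hH : Nonempty (H ≃+ (Fin 3 → ℤ))) (x : P.S) :
    (P.coarsen H).IsPlanon x ↔ P.IsPlanon x := by
  obtain ⟨N, hN, hm⟩ := coarsen_exists_smul P H hT hH
  obtain ⟨_, _, h3⟩ := free_int_of_equiv hT
  obtain ⟨_, _, h3'⟩ := free_int_of_equiv hH
  have e : (P.coarsen H).stab x ≃+ ((P.coarsen H).stab x).map H.subtype :=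
    AddSubgroup.equivMapOfInjective _ _ H.subtype_injective
  have hi : Module.finrank ℤ (((P.coarsen H).stab x).map H.subtype) =
      Module.finrank ℤ (P.stab x) := by
    refine le_antisymm (finrank_subgroup_mono ?_) (finrank_subgroup_le_of_smul N hN ?_)
    · rintro _ ⟨g, hg, rfl⟩
      exact hg
    · intro g hg
      exact ⟨⟨N • g, hm g⟩, AddSubgroup.nsmul_mem (P.stab x) hg N, rfl⟩
  have h1 : P.IsPlanon x ↔ Nonempty (((P.coarsen H).stab x).map H.subtype ≃+ (Fin 2 → ℤ)) := by
    rw [FusionData.IsPlanon, nonempty_equiv_iff_finrank, ← hi, ← nonempty_equiv_iff_finrank]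
  exact Iff.trans ⟨fun ⟨f⟩ => ⟨e.symm.trans f⟩, fun ⟨f⟩ => ⟨e.trans f⟩⟩ h1.symm

variable {P H} in
theorem coarsen_orientation (hT : Nonempty (P.T ≃+ (Fin 3 → ℤ)))
    (hH : Nonempty (H ≃+ (Fin 3 → ℤ))) (x : P.S) :
    (P.coarsen H).orientation x = P.orientation x := by
  obtain ⟨N, hN, hm⟩ := coarsen_exists_smul P H hT hH
  refine Eq.trans ?_ (span_image_eq_of_smul P.η
    (H := ((P.coarsen H).stab x).map H.subtype) (K := P.stab x) ?_ N hN ?_)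
  · refine congrArg (Submodule.span ℝ) (Set.ext fun v => ⟨?_, ?_⟩)
    · rintro ⟨g, hg, rfl⟩
      exact ⟨H.subtype g, ⟨g, hg, rfl⟩, rfl⟩
    · rintro ⟨_, ⟨g, hg, rfl⟩, rfl⟩
      exact ⟨g, hg, rfl⟩
  · rintro _ ⟨g, hg, rfl⟩
    exact hg
  · intro g hg
    exact ⟨⟨N • g, hm g⟩, AddSubgroup.nsmul_mem (P.stab x) hg N, rfl⟩

variable {P H} in
theorem coarsen_A (hT : Nonempty (P.T ≃+ (Fin 3 → ℤ)))
    (hH : Nonempty (H ≃+ (Fin 3 → ℤ))) : (P.coarsen H).A = P.A := by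
  ext a
  exact exists_congr fun x => and_congr (coarsen_isPlanon_iff hT hH x)
    (Eq.congr_left (coarsen_orientation hT hH x))

variable {P H} in
theorem coarsen_Sa (hT : Nonempty (P.T ≃+ (Fin 3 → ℤ)))
    (hH : Nonempty (H ≃+ (Fin 3 → ℤ))) (a : Plane) : (P.coarsen H).Sa a = P.Sa a := by
  change Submodule.span (ZMod n) _ = Submodule.span (ZMod n) _
  congr 1
  ext x
  exact and_congr (coarsen_isPlanon_iff hT hH x) (Eq.congr_left (coarsen_orientation hT hH x))

variable {P H} in
theorem coarsen_K (hT : Nonempty (P.T ≃+ (Fin 3 → ℤ)))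
    (hH : Nonempty (H ≃+ (Fin 3 → ℤ))) (a : Plane) : (P.coarsen H).K a = P.K a := by
  have := coarsen_Sa hT hH a
  change (⨅ p ∈ (P.coarsen H).Sa a, LinearMap.ker (P.form a p)) = _
  rw [this]
  rfl

variable {P H} in
theorem coarsen_Sle (hT : Nonempty (P.T ≃+ (Fin 3 → ℤ)))
    (hH : Nonempty (H ≃+ (Fin 3 → ℤ))) (i : ℕ) : (P.coarsen H).Sle i = P.Sle i := by
  have hw : ∀ x, (P.coarsen H).weight x = P.weight x := fun x => by
    refine congrArg Set.ncard (Set.ext fun a => and_congr ?_ (not_congr ?_))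
    · exact iff_of_eq (congrArg (fun s => a ∈ s) (coarsen_A hT hH))
    · exact iff_of_eq (congrArg (fun s : Submodule (ZMod n) P.S => x ∈ s) (coarsen_K hT hH a))
  refine congrArg (Submodule.span (ZMod n)) (Set.ext fun x => ?_)
  exact iff_of_eq (congrArg (fun w => w ≤ i) (hw x))

end Coarsen

section Rank

variable {T : Type} [AddCommGroup T]

theorem finrank_subgroup_le_of_torsion [Module.Free ℤ T] [Module.Finite ℤ T]
    {H M : AddSubgroup T} (h : ∀ g ∈ H, ∃ N : ℤ, N ≠ 0 ∧ N • g ∈ M) :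
    Module.finrank ℤ H ≤ Module.finrank ℤ M := by
  obtain ⟨_, _⟩ := subgroup_free H
  obtain ⟨_, _⟩ := subgroup_free M
  let b := Module.finBasis ℤ H
  choose N hN hM using fun i => h (b i) (b i).2
  have hli : LinearIndependent ℤ (fun i => (⟨N i • (b i : T), hM i⟩ : M)) := by
    rw [Fintype.linearIndependent_iff]
    intro c hc i
    have h1 : ∑ i, (c i * N i) • b i = 0 := by
      apply Subtype.ext
      have := congrArg Subtype.val hc
      simpa [mul_smul] using this
    have h2 := Fintype.linearIndependent_iff.1 b.linearIndependent _ h1 i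
    exact (mul_eq_zero.1 h2).resolve_right (hN i)
  simpa using hli.fintype_card_le_finrank

theorem exists_smul_mem_of_finrank_le [Module.Free ℤ T] [Module.Finite ℤ T]
    {M H : AddSubgroup T} (hle : M ≤ H) (h : Module.finrank ℤ H ≤ Module.finrank ℤ M) :
    ∃ N : ℕ, N ≠ 0 ∧ ∀ g ∈ H, N • g ∈ M := by
  obtain ⟨_, _⟩ := subgroup_free H
  have e : M.addSubgroupOf H ≃+ M := AddSubgroup.addSubgroupOfEquivOfLe hle
  obtain ⟨N, hN, hg⟩ := exists_smul_mem_of_finrank_eq (M.addSubgroupOf H)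
    (e.toIntLinearEquiv.finrank_eq.trans (le_antisymm (finrank_subgroup_mono hle) h))
  exact ⟨N, hN, fun g hgH => hg ⟨g, hgH⟩⟩

theorem IsLatticeEmbedding.linearIndependent {η : T →+ E3} (h : IsLatticeEmbedding η)
    (hT : Nonempty (T ≃+ (Fin 3 → ℤ))) {c : Fin 3 → T} (hc : LinearIndependent ℤ c) :
    LinearIndependent ℝ fun i => η (c i) := by
  let j : (Fin 3 → ℤ) →+ T := (Fintype.linearCombination ℤ c).toAddMonoidHom
  have hj : Function.Injective j := by
    rw [injective_iff_map_eq_zero]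
    intro v hv
    exact funext (Fintype.linearIndependent_iff.1 hc v hv)
  have h1 : IsLatticeEmbedding (η.comp j) := h.of_smul hT j hj fun _ => rfl
  have h2 := h1.2 (Pi.basisFun ℤ (Fin 3))
  convert h2 using 2 with i
  simp [j, Fintype.linearCombination_apply, Pi.single_apply]

theorem exists_smul_mem_of_span_eq {η : T →+ E3} (h : IsLatticeEmbedding η)
    (hT : Nonempty (T ≃+ (Fin 3 → ℤ))) {H K : AddSubgroup T} (hH : Module.finrank ℤ H = 2)
    (hK : ∀ g ∈ K, η g ∈ Submodule.span ℝ (η '' (H : Set T))) :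
    ∀ g ∈ K, ∃ N : ℤ, N ≠ 0 ∧ N • g ∈ H := by
  obtain ⟨_, _, -⟩ := free_int_of_equiv hT
  obtain ⟨_, _⟩ := subgroup_free H
  intro g hg
  by_contra! hc
  let b := Module.finBasisOfFinrankEq ℤ H hH
  have hli : LinearIndependent ℤ ![(b 0 : T), (b 1 : T), g] := by
    rw [Fintype.linearIndependent_iff]
    intro c hc0
    rw [Fin.sum_univ_three] at hc0
    simp only [Matrix.cons_val] at hc0
    have h2 : c 2 = 0 := by
      by_contra hne
      refine hc (c 2) hne ?_
      have : c 2 • g = ((-(c 0 • b 0 + c 1 • b 1) : H) : T) := by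
        push_cast
        rw [eq_neg_iff_add_eq_zero, ← hc0]
        abel
      rw [this]
      exact SetLike.coe_mem _
    rw [h2, zero_smul, add_zero] at hc0
    have h3 : ∑ i : Fin 2, (![c 0, c 1] i) • b i = 0 := by
      apply Subtype.ext
      rw [Fin.sum_univ_two]
      simpa using hc0
    have h4 := Fintype.linearIndependent_iff.1 b.linearIndependent _ h3
    intro i
    fin_cases i
    · exact h4 0
    · exact h4 1
    · exact h2
  have h5 := h.linearIndependent hT hli
  have h6 : η g ∈ Submodule.span ℝ (Set.range fun i : Fin 2 => η (b i : T)) := by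
    refine Submodule.span_le.2 ?_ (hK g hg)
    rintro _ ⟨k, hk, rfl⟩
    have h7 := b.sum_repr ⟨k, hk⟩
    have h8 : η k = ∑ i, ((b.repr ⟨k, hk⟩ i : ℤ) : ℝ) • η (b i : T) := by
      have := congrArg (fun z : H => η (z : T)) h7
      simp only [AddSubgroup.val_finsetSum, AddSubgroup.coe_zsmul, map_sum, map_zsmul] at this
      rw [← this]
      exact Finset.sum_congr rfl fun i _ => (Int.cast_smul_eq_zsmul ℝ _ _).symm
    rw [h8]
    exact Submodule.sum_mem _ fun i _ => Submodule.smul_mem _ _ (Submodule.subset_span ⟨i, rfl⟩)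
  refine h5.notMem_span_image (s := {0, 1}) (x := 2) (by decide) (Submodule.span_mono ?_ h6)
  rintro _ ⟨i, rfl⟩
  fin_cases i
  · exact ⟨0, by simp, rfl⟩
  · exact ⟨1, by simp, rfl⟩

end Rank

namespace PData.IsPTheory

variable {n : ℕ} {P : PData n} (h : P.IsPTheory)

include h

theorem stab_finrank {x : P.S} (hx : P.IsPlanon x) : Module.finrank ℤ (P.stab x) = 2 := by
  obtain ⟨_, _, -⟩ := free_int_of_equiv h.lattice
  exact (nonempty_equiv_iff_finrank _ _).1 hx

theorem not_isPlanon_zero : ¬ P.IsPlanon 0 := by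
  intro hx
  obtain ⟨_, _, h3⟩ := free_int_of_equiv h.lattice
  have h1 := h.stab_finrank hx
  have : P.stab 0 = ⊤ := by
    ext g
    simp [FusionData.stab]
  rw [this, (AddSubgroup.topEquiv (G := P.T)).toIntLinearEquiv.finrank_eq] at h1
  simp only [Nat.card_eq_fintype_card, Fintype.card_fin] at h3
  omega

theorem finrank_stab_le {x : P.S} (hx : x ≠ 0) : Module.finrank ℤ (P.stab x) ≤ 2 := by
  obtain ⟨_, _, h3⟩ := free_int_of_equiv h.lattice
  simp only [Nat.card_eq_fintype_card, Fintype.card_fin] at h3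
  have h1 := finrank_subgroup_mono (le_top : P.stab x ≤ ⊤)
  rw [(AddSubgroup.topEquiv (G := P.T)).toIntLinearEquiv.finrank_eq, h3] at h1
  have h2 : Module.finrank ℤ (P.stab x) ≠ 3 := fun h4 =>
    hx (h.no_mobile x ((nonempty_equiv_iff_finrank _ _).2 h4))
  omega

/-- A non-zero sector that is fixed by a planar group of translations is a planon of the orientation
of that group. -/
theorem isPlanon_of_le_stab {x : P.S} (hx : x ≠ 0) {H : AddSubgroup P.T}
    (hH : Module.finrank ℤ H = 2) (hle : H ≤ P.stab x) :
    P.IsPlanon x ∧ P.orientation x = Submodule.span ℝ (P.η '' (H : Set P.T)) := by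
  obtain ⟨_, _, -⟩ := free_int_of_equiv h.lattice
  have h1 := finrank_subgroup_mono hle
  have h2 := h.finrank_stab_le hx
  obtain ⟨N, hN, hg⟩ := exists_smul_mem_of_finrank_le hle (by omega)
  exact ⟨(nonempty_equiv_iff_finrank _ _).2 (by omega),
    (span_image_eq_of_smul P.η hle N hN hg).symm⟩

/-- Planons of different orientations: some translation fixes one of them, while none of its
multiples fixes the other. -/
theorem exists_stab_not_fixing {x y : P.S} (hx : P.IsPlanon x) (hy : P.IsPlanon y)
    (hxy : P.orientation x ≠ P.orientation y) :
    ∃ g ∈ P.stab x, ∀ i : ℤ, i • g ∈ P.stab y → i = 0 := by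
  obtain ⟨_, _, -⟩ := free_int_of_equiv h.lattice
  by_contra! hc
  apply hxy
  have h1 : ∀ g ∈ P.stab x, ∃ N : ℤ, N ≠ 0 ∧ N • g ∈ P.stab x ⊓ P.stab y := by
    intro g hg
    obtain ⟨i, hi, h0⟩ := hc g hg
    exact ⟨i, h0, AddSubgroup.zsmul_mem _ hg i, hi⟩
  have h2 := finrank_subgroup_le_of_torsion h1
  have hx2 := h.stab_finrank hx
  have hy2 := h.stab_finrank hy
  obtain ⟨N, hN, hg⟩ := exists_smul_mem_of_finrank_le (inf_le_left : P.stab x ⊓ P.stab y ≤ _) h2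
  obtain ⟨N', hN', hg'⟩ := exists_smul_mem_of_finrank_le
    (inf_le_right : P.stab x ⊓ P.stab y ≤ _) (by omega)
  exact (span_image_eq_of_smul P.η inf_le_left N hN hg).symm.trans
    (span_image_eq_of_smul P.η inf_le_right N' hN' hg')

theorem orientation_multiple {x y : P.S} (hy : P.IsPlanon y)
    (hxy : P.orientation x = P.orientation y) :
    ∃ N : ℕ, N ≠ 0 ∧ ∀ g ∈ P.stab x, N • g ∈ P.stab y := by
  obtain ⟨_, _, -⟩ := free_int_of_equiv h.lattice
  have h1 := exists_smul_mem_of_span_eq h.embedding h.lattice (H := P.stab y) (K := P.stab x)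
    (h.stab_finrank hy) (fun g hg => by
      change P.η g ∈ P.orientation y
      rw [← hxy]
      exact Submodule.subset_span ⟨g, hg, rfl⟩)
  have h2 : ∀ g ∈ P.stab x, ∃ N : ℤ, N ≠ 0 ∧ N • g ∈ P.stab x ⊓ P.stab y := by
    intro g hg
    obtain ⟨i, h0, hi⟩ := h1 g hg
    exact ⟨i, h0, AddSubgroup.zsmul_mem _ hg i, hi⟩
  obtain ⟨N, hN, hg⟩ := exists_smul_mem_of_finrank_le (inf_le_left : P.stab x ⊓ P.stab y ≤ _)
    (finrank_subgroup_le_of_torsion h2)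
  exact ⟨N, hN, fun g hgx => (hg g hgx).2⟩

theorem form_zero {a : Plane} (ha : a ∈ P.A) : P.form a 0 = 0 := by
  have := h.form_add a ha 0 (Submodule.zero_mem _) 0 (Submodule.zero_mem _)
  rw [add_zero] at this
  simpa using this

/-- Planons braid trivially with planons of other orientations. -/
theorem planon_mem_K {x : P.S} (hx : P.IsPlanon x) {a : Plane} (ha : a ∈ P.A)
    (hne : P.orientation x ≠ a) : x ∈ P.K a := by
  rw [PData.K, Submodule.mem_iInf]
  intro p
  rw [Submodule.mem_iInf]
  intro hp
  rw [LinearMap.mem_ker]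
  have key : p ∈ P.Sa a ∧ P.form a p x = 0 := by
    refine Submodule.span_induction (p := fun p _ => p ∈ P.Sa a ∧ P.form a p x = 0)
      ?_ ?_ ?_ ?_ hp
    · rintro q ⟨hq, rfl⟩
      have hqS : q ∈ P.Sa (P.orientation q) := Submodule.subset_span ⟨hq, rfl⟩
      refine ⟨hqS, ?_⟩
      obtain ⟨g, hg, hi⟩ := h.exists_stab_not_fixing hx hq hne
      obtain ⟨m, hm⟩ := h.form_local _ ha q hqS x g hi
      have h1 := hm m (by simp)
      have h2 : P.act ((m : ℤ) • g) x = x := AddSubgroup.zsmul_mem (P.stab x) hg m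
      rw [← h2, h.form_act _ ha q hqS] at h1
      exact h1
    · exact ⟨Submodule.zero_mem _, by rw [h.form_zero ha]; rfl⟩
    · rintro p q _ _ ⟨h1, h2⟩ ⟨h3, h4⟩
      refine ⟨Submodule.add_mem _ h1 h3, ?_⟩
      rw [h.form_add a ha p h1 q h3, LinearMap.add_apply, h2, h4, add_zero]
    · rintro c p _ ⟨h1, h2⟩
      have hcast : ∀ k : ℕ, P.form a (k • p) x = 0 := by
        intro k
        induction k with
        | zero => rw [zero_smul, h.form_zero ha]; rfl
        | succ k ih =>
          rw [succ_nsmul, h.form_add a ha _ (Submodule.smul_of_tower_mem _ k h1) _ h1,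
            LinearMap.add_apply, ih, h2, add_zero]
      refine ⟨Submodule.smul_mem _ _ h1, ?_⟩
      obtain ⟨k, rfl⟩ := ZMod.intCast_surjective c
      rw [Int.cast_smul_eq_zsmul]
      have hs := hcast k.natAbs
      have hS : k.natAbs • p ∈ P.Sa a := Submodule.smul_of_tower_mem _ _ h1
      rcases Int.natAbs_eq k with hk | hk
      · rw [hk, natCast_zsmul]
        exact hs
      · rw [hk, neg_smul, natCast_zsmul]
        have h5 := h.form_add a ha _ hS _ (Submodule.neg_mem _ hS)
        rw [add_neg_cancel, h.form_zero ha] at h5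
        have h6 := congrArg (fun f => f x) h5
        simp only [LinearMap.zero_apply, LinearMap.add_apply, hs, zero_add] at h6
        exact h6.symm
  exact key.2

theorem planon_weight_le {x : P.S} (hx : P.IsPlanon x) : P.weight x ≤ 1 := by
  have : {a ∈ P.A | x ∉ P.K a} ⊆ {P.orientation x} := by
    rintro a ⟨ha, hK⟩
    by_contra hne
    exact hK (h.planon_mem_K hx ha fun he => hne he.symm)
  exact (Set.ncard_le_ncard this).trans (Set.ncard_singleton _).le

theorem Sle_eq_top (hL : P.EssentiallyOnePlanar) {i : ℕ} (hi : 1 ≤ i) : P.Sle i = ⊤ := by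
  rw [eq_top_iff, ← hL]
  refine iSup₂_le fun a _ => Submodule.span_le.2 ?_
  rintro x ⟨hx, -⟩
  exact Submodule.subset_span ((h.planon_weight_le hx).trans hi)

omit h in
theorem le_stab_act (g : P.T) (x : P.S) : P.stab x ≤ P.stab (P.act g x) := by
  intro k hk
  have h1 : P.act k x = x := hk
  change P.act k (P.act g x) = P.act g x
  rw [← Module.End.mul_apply, ← P.act_add, add_comm, P.act_add, Module.End.mul_apply, h1]

theorem act_mem_Sa (a : Plane) (g : P.T) {x : P.S} (hx : x ∈ P.Sa a) : P.act g x ∈ P.Sa a := by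
  refine Submodule.span_induction (p := fun x _ => P.act g x ∈ P.Sa a) ?_ ?_ ?_ ?_ hx
  · rintro x ⟨hp, rfl⟩
    by_cases h0 : P.act g x = 0
    · rw [h0]
      exact Submodule.zero_mem _
    · exact Submodule.subset_span (h.isPlanon_of_le_stab h0 (h.stab_finrank hp)
        (le_stab_act g x))
  · rw [map_zero]
    exact Submodule.zero_mem _
  · intro x y _ _ hx hy
    rw [map_add]
    exact Submodule.add_mem _ hx hy
  · intro c x _ hx
    rw [map_smul]
    exact Submodule.smul_mem _ _ hx

/-- Sectors generated by planons of the orientation of `y` are fixed by multiples of the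
translations that fix `y`. -/
theorem exists_multiple_le_stab {y x : P.S}
    (hx : x ∈ P.Sa (P.orientation y)) :
    ∃ N : ℕ, N ≠ 0 ∧ ∀ g ∈ P.stab y, N • g ∈ P.stab x := by
  refine Submodule.span_induction
    (p := fun x _ => ∃ N : ℕ, N ≠ 0 ∧ ∀ g ∈ P.stab y, N • g ∈ P.stab x) ?_ ?_ ?_ ?_ hx
  · rintro x ⟨hp, ho⟩
    exact h.orientation_multiple hp ho.symm
  · exact ⟨1, one_ne_zero, fun g _ => map_zero _⟩
  · rintro x x' _ _ ⟨N, hN, h1⟩ ⟨N', hN', h2⟩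
    refine ⟨N * N', mul_ne_zero hN hN', fun g hg => ?_⟩
    have e1 : P.act ((N * N') • g) x = x := by
      rw [mul_comm, mul_smul]
      exact AddSubgroup.nsmul_mem (P.stab x) (h1 g hg) N'
    have e2 : P.act ((N * N') • g) x' = x' := by
      rw [mul_smul]
      exact AddSubgroup.nsmul_mem (P.stab x') (h2 g hg) N
    change P.act _ (x + x') = x + x'
    rw [map_add, e1, e2]
  · rintro c x _ ⟨N, hN, h1⟩
    refine ⟨N, hN, fun g hg => ?_⟩
    have e1 : P.act (N • g) x = x := h1 g hg
    change P.act _ (c • x) = c • x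
    rw [map_smul, e1]

/-- Planons are not sums of planons of other orientations. -/
theorem not_mem_iSup_Sa (B : Finset Plane) : ∀ x, P.IsPlanon x → P.orientation x ∉ B →
    x ∉ ⨆ b ∈ B, P.Sa b := by
  classical
  induction B using Finset.induction_on with
  | empty =>
    intro x hx _ hmem
    have : x = 0 := by simpa using hmem
    exact h.not_isPlanon_zero (this ▸ hx)
  | insert b B _ ih =>
    intro x hx hB hmem
    rw [Finset.mem_insert, not_or] at hB
    rw [Finset.iSup_insert, Submodule.mem_sup] at hmem
    obtain ⟨u, hu, v, hv, huv⟩ := hmem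
    by_cases hb : ∃ y, P.IsPlanon y ∧ P.orientation y = b
    · obtain ⟨y, hy, rfl⟩ := hb
      obtain ⟨k, hk, hik⟩ := h.exists_stab_not_fixing hy hx fun he => hB.1 he.symm
      obtain ⟨N, hN, hstab⟩ := h.exists_multiple_le_stab hu
      have hact : ∀ v ∈ ⨆ b ∈ B, P.Sa b, P.act (N • k) v - v ∈ ⨆ b ∈ B, P.Sa b := by
        intro v hv
        refine Submodule.sub_mem _ ?_ hv
        have : (⨆ b ∈ B, P.Sa b) ≤ (⨆ b ∈ B, P.Sa b).comap (P.act (N • k)) := by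
          refine iSup₂_le fun b hb z hz => ?_
          exact (le_iSup₂ (f := fun b (_ : b ∈ B) => P.Sa b) b hb) (h.act_mem_Sa b _ hz)
        exact this hv
      have hu' : P.act (N • k) u = u := hstab k hk
      have hxv : P.act (N • k) x - x = P.act (N • k) v - v := by
        rw [← huv, map_add, hu']
        abel
      have hne : P.act (N • k) x - x ≠ 0 := by
        intro h0
        have h1 : (N : ℤ) • k ∈ P.stab x := by
          rw [natCast_zsmul]
          exact sub_eq_zero.1 h0
        exact hN (by exact_mod_cast hik _ h1)
      have hle : P.stab x ≤ P.stab (P.act (N • k) x - x) := by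
        intro g hg
        have e1 := le_stab_act (N • k) x hg
        have e1' : P.act g (P.act (N • k) x) = P.act (N • k) x := e1
        have e2 : P.act g x = x := hg
        change P.act g (P.act (N • k) x - x) = P.act (N • k) x - x
        rw [map_sub, e1', e2]
      obtain ⟨hp, ho⟩ := h.isPlanon_of_le_stab hne (h.stab_finrank hx) hle
      refine ih _ hp ?_ ?_
      · rw [ho]
        exact hB.2
      · rw [hxv]
        exact hact v hv
    · have hbot : P.Sa b = ⊥ := by
        have : {x | P.IsPlanon x ∧ P.orientation x = b} = ∅ :=
          Set.eq_empty_of_forall_notMem fun y hy => hb ⟨y, hy⟩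
        rw [FusionData.Sa, this, Submodule.span_empty]
      rw [hbot, Submodule.mem_bot] at hu
      rw [hu, zero_add] at huv
      exact ih x hx hB.2 (huv ▸ hv)

/-- A finitely generated theory has finitely many orientations of planons. -/
theorem A_finite : P.A.Finite := by
  classical
  let Φ : AddMonoidAlgebra (ZMod n) P.T →ₐ[ZMod n] Module.End (ZMod n) P.S :=
    AddMonoidAlgebra.lift (ZMod n) (Module.End (ZMod n) P.S) P.T
      { toFun := fun g => P.act g.toAdd
        map_one' := P.act_zero
        map_mul' := fun g g' => P.act_add _ _ }
  have hΦ : ∀ g, Φ (AddMonoidAlgebra.single g 1) = P.act g := fun g => by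
    simp [Φ]
  let _ : Module (AddMonoidAlgebra (ZMod n) P.T) P.S := Module.compHom P.S Φ.toRingHom
  have hsmul : ∀ g (x : P.S), (AddMonoidAlgebra.single g (1 : ZMod n)) • x = P.act g x := fun g x => by
    rw [← hΦ]
    rfl
  have : IsScalarTower (ZMod n) (AddMonoidAlgebra (ZMod n) P.T) P.S := ⟨fun c r x => by
    change Φ (c • r) x = c • Φ r x
    rw [map_smul]
    rfl⟩
  obtain ⟨_, _, -⟩ := free_int_of_equiv h.lattice
  have : AddGroup.FG P.T := by
    have : Module.Finite ℤ P.T := inferInstance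
    exact Module.Finite.iff_addGroup_fg.1 this
  have : AddMonoid.FG P.T := AddGroup.fg_iff_addMonoid_fg.1 inferInstance
  have : IsNoetherianRing (ZMod n) := by
    exact isNoetherianRing_of_surjective ℤ (ZMod n) (Int.castRingHom _) ZMod.intCast_surjective
  have : IsNoetherianRing (AddMonoidAlgebra (ZMod n) P.T) :=
    Algebra.FiniteType.isNoetherianRing (ZMod n) _
  have : Module.Finite (AddMonoidAlgebra (ZMod n) P.T) P.S := by
    obtain ⟨G, hG⟩ := h.fg
    refine ⟨⟨G, ?_⟩⟩
    rw [eq_top_iff]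
    intro x _
    have hx : x ∈ (⊤ : Submodule (ZMod n) P.S) := trivial
    rw [← hG] at hx
    have hle : Submodule.span (ZMod n) {y | ∃ g, ∃ x ∈ G, y = P.act g x} ≤
        (Submodule.span (AddMonoidAlgebra (ZMod n) P.T) (G : Set P.S)).restrictScalars (ZMod n) := by
      rw [Submodule.span_le]
      rintro _ ⟨g, x, hx, rfl⟩
      rw [← hsmul]
      exact Submodule.smul_mem _ _ (Submodule.subset_span hx)
    exact hle hx
  let V : Plane → Submodule (AddMonoidAlgebra (ZMod n) P.T) P.S := fun a =>
    { (P.Sa a).toAddSubmonoid with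
      smul_mem' := by
        intro r x hx
        change r • x ∈ P.Sa a
        induction r using AddMonoidAlgebra.induction_linear with
        | zero => rw [zero_smul]; exact Submodule.zero_mem _
        | add f g hf hg => rw [add_smul]; exact Submodule.add_mem _ hf hg
        | single g c =>
          have : (AddMonoidAlgebra.single g c : AddMonoidAlgebra (ZMod n) P.T) =
            c • AddMonoidAlgebra.single g 1 := by simp
          rw [this, smul_assoc, hsmul]
          exact Submodule.smul_mem _ _ (h.act_mem_Sa a g hx) }
  obtain ⟨M, ⟨B, rfl⟩, hM⟩ := set_has_maximal_iff_noetherian.2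
    (inferInstance : IsNoetherian (AddMonoidAlgebra (ZMod n) P.T) P.S)
    (Set.range fun B : Finset Plane => ⨆ b ∈ B, V b) (Set.range_nonempty _)
  refine B.finite_toSet.subset ?_
  rintro a ⟨x, hx, rfl⟩
  by_contra hB
  refine h.not_mem_iSup_Sa B x hx hB ?_
  have h1 : ⨆ b ∈ insert (P.orientation x) B, V b = ⨆ b ∈ B, V b := by
    by_contra hne
    refine hM _ ⟨insert (P.orientation x) B, rfl⟩ (lt_of_le_of_ne ?_ (Ne.symm hne))
    exact biSup_mono fun b hb => Finset.mem_insert_of_mem hb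
  have h2 : x ∈ ⨆ b ∈ B, V b := by
    rw [← h1, Finset.iSup_insert]
    refine Submodule.mem_sup_left ?_
    have : x ∈ P.Sa (P.orientation x) := Submodule.subset_span ⟨hx, rfl⟩
    exact this
  have h3 : (⨆ b ∈ B, V b).restrictScalars (ZMod n) ≤ ⨆ b ∈ B, P.Sa b := by
    change Submodule.restrictScalarsLatticeHom (ZMod n) _ _ (⨆ b ∈ B, V b) ≤ _
    simp only [map_iSup]
    exact iSup₂_le fun b hb y hy => (le_iSup₂ (f := fun b (_ : b ∈ B) => P.Sa b) b hb) hy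
  exact h3 h2

end PData.IsPTheory

namespace PData

variable {n : ℕ}

open Classical in
/-- The stack of two theories, in terms of a product. -/
theorem isStackOf_pair_iff (P P₁ P₂ : PData n) : P.IsStackOf ![P₁, P₂] ↔
    ∃ (α₁ : P.T ≃+ P₁.T) (α₂ : P.T ≃+ P₂.T) (αS : P.S ≃ₗ[ZMod n] P₁.S × P₂.S),
      (∀ g, P₁.η (α₁ g) = P.η g) ∧ (∀ g, P₂.η (α₂ g) = P.η g) ∧
      (∀ g x, (αS (P.act g x)).1 = P₁.act (α₁ g) (αS x).1) ∧
      (∀ g x, (αS (P.act g x)).2 = P₂.act (α₂ g) (αS x).2) ∧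
      (∀ a ∈ P₁.A, P.normal a = P₁.normal a) ∧ (∀ a ∈ P₂.A, P.normal a = P₂.normal a) ∧
      ∀ a ∈ P.A, ∀ p ∈ P.Sa a, ∀ x, P.form a p x =
        (if a ∈ P₁.A then P₁.form a (αS p).1 (αS x).1 else 0) +
        if a ∈ P₂.A then P₂.form a (αS p).2 (αS x).2 else 0 := by
  let e : (∀ i : Fin 2, (![P₁, P₂] i).S) ≃ₗ[ZMod n] P₁.S × P₂.S :=
    LinearEquiv.piFinTwo (ZMod n) fun i => (![P₁, P₂] i).S
  constructor
  · rintro ⟨αT, αS, h1, h2, h3, h4⟩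
    refine ⟨αT 0, αT 1, αS.trans e, h1 0, h1 1, fun g x => h2 g x 0, fun g x => h2 g x 1,
      h3 0, h3 1, fun a ha p hp x => ?_⟩
    rw [h4 a ha p hp x, finsum_eq_sum_of_fintype, Fin.sum_univ_two]
    rfl
  · rintro ⟨α₁, α₂, αS, h1, h1', h2, h2', h3, h3', h4⟩
    have he : ∀ x, e (e.symm x) = x := e.apply_symm_apply
    have he0 : ∀ x, (e.symm x) 0 = x.1 := fun x => congrArg Prod.fst (he x)
    have he1 : ∀ x, (e.symm x) 1 = x.2 := fun x => congrArg Prod.snd (he x)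
    refine ⟨Fin.cons α₁ (Fin.cons α₂ fun i => i.elim0), αS.trans e.symm,
      Fin.forall_fin_two.2 ⟨h1, h1'⟩, fun g x => Fin.forall_fin_two.2 ⟨h2 g x, h2' g x⟩,
      Fin.forall_fin_two.2 ⟨h3, h3'⟩, fun a ha p hp x => ?_⟩
    rw [h4 a ha p hp x, finsum_eq_sum_of_fintype, Fin.sum_univ_two]
    rfl

section Stack

variable {P P₁ P₂ : PData n} (h₁ : P₁.IsPTheory) (h₂ : P₂.IsPTheory)
  {α₁ : P.T ≃+ P₁.T} {α₂ : P.T ≃+ P₂.T} {αS : P.S ≃ₗ[ZMod n] P₁.S × P₂.S}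
  (hη₁ : ∀ g, P₁.η (α₁ g) = P.η g) (hη₂ : ∀ g, P₂.η (α₂ g) = P.η g)
  (ha₁ : ∀ g x, (αS (P.act g x)).1 = P₁.act (α₁ g) (αS x).1)
  (ha₂ : ∀ g x, (αS (P.act g x)).2 = P₂.act (α₂ g) (αS x).2)

include ha₁ ha₂ in
theorem mem_stab_stack_iff (x : P.S) (g : P.T) : g ∈ P.stab x ↔
    α₁ g ∈ P₁.stab (αS x).1 ∧ α₂ g ∈ P₂.stab (αS x).2 := by
  change P.act g x = x ↔ P₁.act (α₁ g) (αS x).1 = (αS x).1 ∧ P₂.act (α₂ g) (αS x).2 = (αS x).2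
  rw [← ha₁, ← ha₂, ← αS.injective.eq_iff, Prod.ext_iff]

/-- Pulling back a subgroup along an isomorphism. -/
theorem finrank_comap {T T' : Type} [AddCommGroup T] [AddCommGroup T'] (α : T ≃+ T')
    (H : AddSubgroup T') :
    Module.finrank ℤ (H.comap α.toAddMonoidHom) = Module.finrank ℤ H := by
  let e : H.comap α.toAddMonoidHom ≃+ H :=
    { toFun := fun x => ⟨α x, x.2⟩
      invFun := fun y => ⟨α.symm y, by
        change α (α.symm y) ∈ H
        rw [α.apply_symm_apply]
        exact y.2⟩
      left_inv := fun x => Subtype.ext (α.symm_apply_apply _)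
      right_inv := fun x => Subtype.ext (α.apply_symm_apply _)
      map_add' := fun x y => Subtype.ext (map_add α _ _) }
  exact e.toIntLinearEquiv.finrank_eq

theorem span_comap {T T' : Type} [AddCommGroup T] [AddCommGroup T'] (α : T ≃+ T')
    (H : AddSubgroup T') {η : T →+ E3} {η' : T' →+ E3} (h : ∀ g, η' (α g) = η g) :
    Submodule.span ℝ (η '' (H.comap α.toAddMonoidHom : Set T)) =
      Submodule.span ℝ (η' '' (H : Set T')) := by
  refine congrArg (Submodule.span ℝ) (Set.ext fun v => ⟨?_, ?_⟩)
  · rintro ⟨g, hg, rfl⟩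
    exact ⟨α g, hg, h g⟩
  · rintro ⟨g, hg, rfl⟩
    refine ⟨α.symm g, ?_, by rw [← h, α.apply_symm_apply]⟩
    change α (α.symm g) ∈ H
    rwa [α.apply_symm_apply]

include h₁ hη₁ ha₁ ha₂ in
/-- The components of a planon of a stack are planons or zero. -/
theorem fst_of_isPlanon_stack {x : P.S} (hx : P.IsPlanon x) :
    (αS x).1 = 0 ∨ P₁.IsPlanon (αS x).1 ∧ P₁.orientation (αS x).1 = P.orientation x := by
  by_cases h0 : (αS x).1 = 0
  · exact Or.inl h0
  right
  have hT : Nonempty (P.T ≃+ (Fin 3 → ℤ)) := h₁.lattice.map α₁.trans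
  obtain ⟨_, _, -⟩ := free_int_of_equiv hT
  have hr : Module.finrank ℤ (P.stab x) = 2 := (nonempty_equiv_iff_finrank _ _).1 hx
  have e : ((P.stab x).comap α₁.symm.toAddMonoidHom) ≤ P₁.stab (αS x).1 := by
    intro g hg
    have := ((mem_stab_stack_iff ha₁ ha₂ x (α₁.symm g)).1 hg).1
    rwa [α₁.apply_symm_apply] at this
  have h3 := h₁.isPlanon_of_le_stab h0 ((finrank_comap _ _).trans hr) e
  refine ⟨h3.1, h3.2.trans (span_comap α₁.symm _ fun g => ?_)⟩
  rw [← hη₁, α₁.apply_symm_apply]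

include h₁ hη₁ ha₁ ha₂ in
theorem isPlanon_stack_inl {x : P₁.S} (hx : P₁.IsPlanon x) :
    P.IsPlanon (αS.symm (x, 0)) ∧ P.orientation (αS.symm (x, 0)) = P₁.orientation x := by
  have hT : Nonempty (P.T ≃+ (Fin 3 → ℤ)) := h₁.lattice.map α₁.trans
  obtain ⟨_, _, -⟩ := free_int_of_equiv hT
  have hs : P.stab (αS.symm (x, 0)) = (P₁.stab x).comap α₁.toAddMonoidHom := by
    ext g
    rw [mem_stab_stack_iff ha₁ ha₂, αS.apply_symm_apply]
    exact and_iff_left (map_zero _)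
  constructor
  · rw [FusionData.IsPlanon, nonempty_equiv_iff_finrank, hs, finrank_comap, h₁.stab_finrank hx]
  · rw [FusionData.orientation, hs]
    exact span_comap α₁ _ hη₁

end Stack

section Stack

variable {P P₁ P₂ : PData n} (h₁ : P₁.IsPTheory) (h₂ : P₂.IsPTheory)
  {α₁ : P.T ≃+ P₁.T} {α₂ : P.T ≃+ P₂.T} {αS : P.S ≃ₗ[ZMod n] P₁.S × P₂.S}
  (hη₁ : ∀ g, P₁.η (α₁ g) = P.η g) (hη₂ : ∀ g, P₂.η (α₂ g) = P.η g)
  (ha₁ : ∀ g x, (αS (P.act g x)).1 = P₁.act (α₁ g) (αS x).1)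
  (ha₂ : ∀ g x, (αS (P.act g x)).2 = P₂.act (α₂ g) (αS x).2)

include h₂ hη₂ ha₁ ha₂ in
theorem snd_of_isPlanon_stack {x : P.S} (hx : P.IsPlanon x) :
    (αS x).2 = 0 ∨ P₂.IsPlanon (αS x).2 ∧ P₂.orientation (αS x).2 = P.orientation x :=
  fst_of_isPlanon_stack (αS := αS.trans (LinearEquiv.prodComm _ _ _)) h₂ hη₂ ha₂ ha₁ hx

include h₂ hη₂ ha₁ ha₂ in
theorem isPlanon_stack_inr {x : P₂.S} (hx : P₂.IsPlanon x) :
    P.IsPlanon (αS.symm (0, x)) ∧ P.orientation (αS.symm (0, x)) = P₂.orientation x :=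
  isPlanon_stack_inl (αS := αS.trans (LinearEquiv.prodComm _ _ _)) h₂ hη₂ ha₂ ha₁ hx

include h₁ h₂ hη₁ hη₂ ha₁ ha₂ in
theorem A_stack : P.A = P₁.A ∪ P₂.A := by
  ext a
  constructor
  · rintro ⟨x, hx, rfl⟩
    have hne : αS x ≠ 0 := by
      intro h0
      have hT : Nonempty (P.T ≃+ (Fin 3 → ℤ)) := h₁.lattice.map α₁.trans
      obtain ⟨_, _, h3⟩ := free_int_of_equiv hT
      have hr : Module.finrank ℤ (P.stab x) = 2 := (nonempty_equiv_iff_finrank _ _).1 hx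
      have hx0 : x = 0 := αS.injective (by rw [h0, map_zero])
      have : P.stab x = ⊤ := by
        ext g
        simp [FusionData.stab, hx0]
      rw [this, (AddSubgroup.topEquiv (G := P.T)).toIntLinearEquiv.finrank_eq] at hr
      simp only [Nat.card_eq_fintype_card, Fintype.card_fin] at h3
      omega
    rcases fst_of_isPlanon_stack h₁ hη₁ ha₁ ha₂ hx with h01 | ⟨hp, ho⟩
    · rcases snd_of_isPlanon_stack h₂ hη₂ ha₁ ha₂ hx with h02 | ⟨hp, ho⟩
      · exact absurd (Prod.ext h01 h02) hne
      · exact Or.inr ⟨_, hp, ho⟩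
    · exact Or.inl ⟨_, hp, ho⟩
  · rintro (⟨x, hx, rfl⟩ | ⟨x, hx, rfl⟩)
    · exact ⟨_, isPlanon_stack_inl h₁ hη₁ ha₁ ha₂ hx⟩
    · exact ⟨_, isPlanon_stack_inr h₂ hη₂ ha₁ ha₂ hx⟩

include h₁ h₂ hη₁ hη₂ ha₁ ha₂ in
theorem mem_Sa_stack_iff (a : Plane) (x : P.S) :
    x ∈ P.Sa a ↔ (αS x).1 ∈ P₁.Sa a ∧ (αS x).2 ∈ P₂.Sa a := by
  constructor
  · intro hx
    have hle : P.Sa a ≤ ((P₁.Sa a).prod (P₂.Sa a)).comap αS.toLinearMap := by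
      rw [FusionData.Sa, Submodule.span_le]
      rintro y ⟨hy, rfl⟩
      constructor
      · rcases fst_of_isPlanon_stack h₁ hη₁ ha₁ ha₂ hy with h0 | h0
        · change (αS y).1 ∈ _
          rw [h0]
          exact Submodule.zero_mem _
        · exact Submodule.subset_span h0
      · rcases snd_of_isPlanon_stack h₂ hη₂ ha₁ ha₂ hy with h0 | h0
        · change (αS y).2 ∈ _
          rw [h0]
          exact Submodule.zero_mem _
        · exact Submodule.subset_span h0
    exact hle hx
  · rintro ⟨hx1, hx2⟩
    have hle1 : P₁.Sa a ≤ (P.Sa a).comap (αS.symm.toLinearMap ∘ₗ LinearMap.inl _ _ _) := by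
      rw [FusionData.Sa, Submodule.span_le]
      rintro y ⟨hy, rfl⟩
      exact Submodule.subset_span (isPlanon_stack_inl h₁ hη₁ ha₁ ha₂ hy)
    have hle2 : P₂.Sa a ≤ (P.Sa a).comap (αS.symm.toLinearMap ∘ₗ LinearMap.inr _ _ _) := by
      rw [FusionData.Sa, Submodule.span_le]
      rintro y ⟨hy, rfl⟩
      exact Submodule.subset_span (isPlanon_stack_inr h₂ hη₂ ha₁ ha₂ hy)
    have e1 : αS.symm ((αS x).1, 0) ∈ P.Sa a := hle1 hx1
    have e2 : αS.symm (0, (αS x).2) ∈ P.Sa a := hle2 hx2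
    have h3 := Submodule.add_mem _ e1 e2
    rwa [← map_add, Prod.mk_add_mk, add_zero, zero_add, Prod.mk.eta, αS.symm_apply_apply] at h3

variable (hf : ∀ a ∈ P.A, ∀ p ∈ P.Sa a, ∀ x, P.form a p x =
        (open Classical in if a ∈ P₁.A then P₁.form a (αS p).1 (αS x).1 else 0) +
        open Classical in if a ∈ P₂.A then P₂.form a (αS p).2 (αS x).2 else 0)

theorem mem_K_iff (P : PData n) (a : Plane) (x : P.S) :
    x ∈ P.K a ↔ ∀ p ∈ P.Sa a, P.form a p x = 0 := by
  simp [PData.K]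

include h₁ h₂ hη₁ hη₂ ha₁ ha₂ hf in
theorem mem_K_stack_iff {a : Plane} (ha : a ∈ P.A) (x : P.S) :
    x ∈ P.K a ↔ (a ∈ P₁.A → (αS x).1 ∈ P₁.K a) ∧ (a ∈ P₂.A → (αS x).2 ∈ P₂.K a) := by
  simp only [mem_K_iff]
  constructor
  · intro hx
    constructor
    · intro ha1 p hp
      have h3 := hx (αS.symm (p, 0)) ((mem_Sa_stack_iff h₁ h₂ hη₁ hη₂ ha₁ ha₂ a _).2 (by
        rw [αS.apply_symm_apply]
        exact ⟨hp, Submodule.zero_mem _⟩))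
      rw [hf a ha _ ((mem_Sa_stack_iff h₁ h₂ hη₁ hη₂ ha₁ ha₂ a _).2 (by
        rw [αS.apply_symm_apply]
        exact ⟨hp, Submodule.zero_mem _⟩)), αS.apply_symm_apply, if_pos ha1] at h3
      by_cases ha2 : a ∈ P₂.A
      · simpa [h₂.form_zero ha2] using h3
      · simpa [ha2] using h3
    · intro ha2 p hp
      have h3 := hx (αS.symm (0, p)) ((mem_Sa_stack_iff h₁ h₂ hη₁ hη₂ ha₁ ha₂ a _).2 (by
        rw [αS.apply_symm_apply]
        exact ⟨Submodule.zero_mem _, hp⟩))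
      rw [hf a ha _ ((mem_Sa_stack_iff h₁ h₂ hη₁ hη₂ ha₁ ha₂ a _).2 (by
        rw [αS.apply_symm_apply]
        exact ⟨Submodule.zero_mem _, hp⟩)), αS.apply_symm_apply, if_pos ha2] at h3
      by_cases ha1 : a ∈ P₁.A
      · simpa [h₁.form_zero ha1] using h3
      · simpa [ha1] using h3
  · rintro ⟨hx1, hx2⟩ p hp
    rw [hf a ha p hp]
    obtain ⟨hp1, hp2⟩ := (mem_Sa_stack_iff h₁ h₂ hη₁ hη₂ ha₁ ha₂ a p).1 hp
    split_ifs with ha1 ha2 ha2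
    · rw [hx1 ha1 _ hp1, hx2 ha2 _ hp2, add_zero]
    · rw [hx1 ha1 _ hp1, add_zero]
    · rw [hx2 ha2 _ hp2, add_zero]
    · rw [add_zero]

include h₁ h₂ hη₁ hη₂ ha₁ ha₂ hf in
theorem weight_stack_set (x : P.S) : {a ∈ P.A | x ∉ P.K a} =
    {a ∈ P₁.A | (αS x).1 ∉ P₁.K a} ∪ {a ∈ P₂.A | (αS x).2 ∉ P₂.K a} := by
  ext a
  have hA := A_stack h₁ h₂ hη₁ hη₂ ha₁ ha₂
  simp only [Set.mem_ofPred_eq, Set.mem_union]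
  constructor
  · rintro ⟨ha, hx⟩
    rw [mem_K_stack_iff h₁ h₂ hη₁ hη₂ ha₁ ha₂ hf ha] at hx
    tauto
  · intro hx
    have ha : a ∈ P.A := by
      rw [hA]
      exact hx.imp And.left And.left
    refine ⟨ha, ?_⟩
    rw [mem_K_stack_iff h₁ h₂ hη₁ hη₂ ha₁ ha₂ hf ha]
    tauto

include h₁ h₂ hη₁ hη₂ ha₁ ha₂ hf in
theorem mem_Sle_stack_iff (i : ℕ) (x : P.S) :
    x ∈ P.Sle i ↔ (αS x).1 ∈ P₁.Sle i ∧ (αS x).2 ∈ P₂.Sle i := by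
  have hw : ∀ x, P.weight x = ({a ∈ P₁.A | (αS x).1 ∉ P₁.K a} ∪
      {a ∈ P₂.A | (αS x).2 ∉ P₂.K a}).ncard := fun x =>
    congrArg Set.ncard (weight_stack_set h₁ h₂ hη₁ hη₂ ha₁ ha₂ hf x)
  have hfin : ∀ x, ({a ∈ P₁.A | (αS x).1 ∉ P₁.K a} ∪ {a ∈ P₂.A | (αS x).2 ∉ P₂.K a}).Finite :=
    fun x => (h₁.A_finite.subset fun _ ha => ha.1).union (h₂.A_finite.subset fun _ ha => ha.1)
  constructor
  · intro hx
    have hle : P.Sle i ≤ ((P₁.Sle i).prod (P₂.Sle i)).comap αS.toLinearMap := by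
      rw [PData.Sle, Submodule.span_le]
      intro x hx
      have hx' : P.weight x ≤ i := hx
      rw [hw] at hx'
      exact ⟨Submodule.subset_span ((Set.ncard_le_ncard Set.subset_union_left (hfin x)).trans hx'),
        Submodule.subset_span ((Set.ncard_le_ncard Set.subset_union_right (hfin x)).trans hx')⟩
    exact hle hx
  · rintro ⟨hx1, hx2⟩
    have hle1 : P₁.Sle i ≤ (P.Sle i).comap (αS.symm.toLinearMap ∘ₗ LinearMap.inl _ _ _) := by
      rw [PData.Sle, Submodule.span_le]
      intro x hx
      refine Submodule.subset_span ?_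
      change P.weight (αS.symm (x, 0)) ≤ i
      rw [hw, αS.apply_symm_apply]
      simpa [PData.weight] using hx
    have hle2 : P₂.Sle i ≤ (P.Sle i).comap (αS.symm.toLinearMap ∘ₗ LinearMap.inr _ _ _) := by
      rw [PData.Sle, Submodule.span_le]
      intro x hx
      refine Submodule.subset_span ?_
      change P.weight (αS.symm (0, x)) ≤ i
      rw [hw, αS.apply_symm_apply]
      simpa [PData.weight] using hx
    have e1 : αS.symm ((αS x).1, 0) ∈ P.Sle i := hle1 hx1
    have e2 : αS.symm (0, (αS x).2) ∈ P.Sle i := hle2 hx2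
    have h3 := Submodule.add_mem _ e1 e2
    rwa [← map_add, Prod.mk_add_mk, add_zero, zero_add, Prod.mk.eta, αS.symm_apply_apply] at h3

end Stack

/-- The weighted quotients of a stack of two theories. -/
theorem W_stack_equiv {P P₁ P₂ : PData n} (h₁ : P₁.IsPTheory) (h₂ : P₂.IsPTheory)
    (h : P.IsStackOf ![P₁, P₂]) (i : ℕ) : Nonempty (P.W i ≃+ P₁.W i × P₂.W i) := by
  obtain ⟨α₁, α₂, αS, hη₁, hη₂, ha₁, ha₂, -, -, hf⟩ := (isStackOf_pair_iff P P₁ P₂).1 h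
  let f : P.S →ₗ[ZMod n] P₁.W i × P₂.W i :=
    ((P₁.Sle i).mkQ.prodMap (P₂.Sle i).mkQ) ∘ₗ αS.toLinearMap
  have hsurj : Function.Surjective f :=
    (Function.Surjective.prodMap (Submodule.mkQ_surjective _) (Submodule.mkQ_surjective _)).comp
      αS.surjective
  have hker : LinearMap.ker f = P.Sle i := by
    ext x
    rw [mem_Sle_stack_iff h₁ h₂ hη₁ hη₂ ha₁ ha₂ hf i x]
    simp [f]
  exact ⟨((Submodule.quotEquivOfEq _ _ hker.symm).trans
    (f.quotKerEquivOfSurjective hsurj)).toAddEquiv⟩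

theorem W_iso_equiv {P P' : PData n} (h : P.Iso P') (hP : P.IsPTheory) (i : ℕ) :
    Nonempty (P.W i ≃+ P'.W i) := by
  obtain ⟨αT, αS, h1, h2, -, h4⟩ := h
  have hT' : Nonempty (P'.T ≃+ (Fin 3 → ℤ)) := hP.lattice.map αT.symm.trans
  have hstab : ∀ x, P.stab x = (P'.stab (αS x)).comap αT.toAddMonoidHom := by
    intro x
    ext g
    change P.act g x = x ↔ P'.act (αT g) (αS x) = αS x
    rw [← h2, αS.injective.eq_iff]
  obtain ⟨_, _, -⟩ := free_int_of_equiv hP.lattice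
  obtain ⟨_, _, -⟩ := free_int_of_equiv hT'
  have hpl : ∀ x, P.IsPlanon x ↔ P'.IsPlanon (αS x) := by
    intro x
    rw [FusionData.IsPlanon, FusionData.IsPlanon, nonempty_equiv_iff_finrank,
      nonempty_equiv_iff_finrank, hstab, finrank_comap]
  have hor : ∀ x, P.orientation x = P'.orientation (αS x) := by
    intro x
    rw [FusionData.orientation, FusionData.orientation, hstab]
    exact span_comap αT _ h1
  have hA : P.A = P'.A := by
    ext a
    constructor
    · rintro ⟨x, hx, rfl⟩
      exact ⟨αS x, (hpl x).1 hx, (hor x).symm⟩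
    · rintro ⟨x, hx, rfl⟩
      obtain ⟨x, rfl⟩ := αS.surjective x
      exact ⟨x, (hpl x).2 hx, hor x⟩
  have hSa : ∀ a x, x ∈ P.Sa a ↔ αS x ∈ P'.Sa a := by
    intro a x
    have : (P'.Sa a).comap αS.toLinearMap = P.Sa a := by
      rw [FusionData.Sa, FusionData.Sa, Submodule.comap_equiv_eq_map_symm,
        Submodule.map_span]
      congr 1
      ext x
      constructor
      · rintro ⟨y, ⟨hy, rfl⟩, rfl⟩
        obtain ⟨x, rfl⟩ := αS.surjective y
        simpa using ⟨(hpl x).2 hy, hor x⟩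
      · rintro ⟨hx, rfl⟩
        exact ⟨αS x, ⟨(hpl x).1 hx, (hor x).symm⟩, by simp⟩
    rw [← this]
    rfl
  have hK : ∀ a ∈ P.A, ∀ x, x ∈ P.K a ↔ αS x ∈ P'.K a := by
    intro a ha x
    simp only [mem_K_iff]
    constructor
    · intro hx p hp
      obtain ⟨p, rfl⟩ := αS.surjective p
      have hp' := (hSa a p).2 hp
      rw [← h4 a ha p hp']
      exact hx p hp'
    · intro hx p hp
      rw [h4 a ha p hp]
      exact hx _ ((hSa a p).1 hp)
  have hw : ∀ x, P.weight x = P'.weight (αS x) := by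
    intro x
    unfold PData.weight
    congr 1
    ext a
    simp only [Set.mem_ofPred_eq, ← hA]
    exact and_congr_right fun ha => not_congr (hK a ha x)
  have hS : (P.Sle i).map αS.toLinearMap = P'.Sle i := by
    rw [PData.Sle, PData.Sle, Submodule.map_span]
    congr 1
    ext y
    constructor
    · rintro ⟨x, hx, rfl⟩
      change P'.weight (αS x) ≤ i
      rw [← hw]
      exact hx
    · intro hy
      obtain ⟨x, rfl⟩ := αS.surjective y
      refine ⟨x, ?_, rfl⟩
      change P.weight x ≤ i
      rw [hw]
      exact hy
  exact ⟨(Submodule.Quotient.equiv _ _ αS hS).toAddEquiv⟩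

theorem PhaseMove.W_equiv {P P' : PData n} (h : PhaseMove P P') {i : ℕ} (hi : 1 ≤ i) :
    Nonempty (P.W i ≃+ P'.W i) := by
  cases h with
  | iso hP hI => exact W_iso_equiv hI hP i
  | coarsen H hP hH =>
    have hS : (P.coarsen H).Sle i = P.Sle i := coarsen_Sle hP.lattice hH i
    have e : Nonempty (P.S ⧸ P.Sle i ≃+ P.S ⧸ (P.Sle i)) := ⟨AddEquiv.refl _⟩
    change Nonempty (P.S ⧸ P.Sle i ≃+ P.S ⧸ (id ((P.coarsen H).Sle i) : Submodule (ZMod n) P.S))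
    rw [hS]
    exact e
  | @stack L _ hP hL hE hS =>
    obtain ⟨e⟩ := W_stack_equiv hP hL hS i
    have hsub : Subsingleton (L.W i) := Submodule.Quotient.subsingleton_iff.2 (hL.Sle_eq_top hE hi)
    let _ : Unique (L.W i) := Unique.mk' _
    exact ⟨(e.trans AddEquiv.prodUnique).symm⟩

/-- The weighted quotients are invariants of the phase. -/
theorem PhaseEquiv.W_equiv {P P' : PData n} (h : PhaseEquiv P P') {i : ℕ} (hi : 1 ≤ i) :
    Nonempty (P.W i ≃+ P'.W i) := by
  induction h with
  | rel _ _ h => exact h.W_equiv hi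
  | refl _ => exact ⟨AddEquiv.refl _⟩
  | symm _ _ _ ih => exact ih.map AddEquiv.symm
  | trans _ _ _ _ _ ih1 ih2 =>
    obtain ⟨e1⟩ := ih1
    obtain ⟨e2⟩ := ih2
    exact ⟨e1.trans e2⟩

end PData

section Regular

variable {k G : Type} [CommRing k] [AddCommGroup G]

/-- An element with a unique term of maximal degree, whose coefficient is a unit, is regular. -/
theorem eq_zero_of_mul_eq_zero_of_top (ℓ : G →+ ℤ) {g₀ : G} {u : k} (hu : IsUnit u)
    {r h : AddMonoidAlgebra k G} (hr : ∀ g, r.coeff g ≠ 0 → ℓ g < ℓ g₀)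
    (hh : (AddMonoidAlgebra.single g₀ u + r) * h = 0) : h = 0 := by
  classical
  by_contra hne
  have hs : h.coeff.support.Nonempty := by
    rw [Finsupp.support_nonempty_iff]
    simpa using hne
  obtain ⟨m, hm, hmax⟩ := Finset.exists_max_image _ ℓ hs
  have h1 := congrArg (fun f => f.coeff (g₀ + m)) hh
  simp only [add_mul, AddMonoidAlgebra.coeff_add, Finsupp.add_apply, AddMonoidAlgebra.coeff_zero,
    Finsupp.coe_zero, Pi.zero_apply] at h1
  have h2 : (AddMonoidAlgebra.single g₀ u * h).coeff (g₀ + m) = u * h.coeff m := by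
    rw [AddMonoidAlgebra.coeff_single_mul_apply, neg_add_cancel_left]
  have h3 : (r * h).coeff (g₀ + m) = 0 := by
    rw [AddMonoidAlgebra.coeff_mul]
    refine Finset.sum_eq_zero fun a ha => Finset.sum_eq_zero fun b hb => ?_
    refine if_neg fun hab => ?_
    have e1 := hr a (Finsupp.mem_support_iff.1 ha)
    have e2 := hmax b hb
    have e3 := congrArg ℓ hab
    rw [map_add, map_add] at e3
    omega
  rw [h2, h3, add_zero] at h1
  exact Finsupp.mem_support_iff.1 hm (hu.mul_right_eq_zero.1 h1)

theorem eq_zero_of_binomial_mul_eq_zero (ℓ : G →+ ℤ) {g g' : G} (hg : ℓ g ≠ ℓ g') {u v : k}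
    (hu : IsUnit u) (hv : IsUnit v) {h : AddMonoidAlgebra k G}
    (hh : (AddMonoidAlgebra.single g u + AddMonoidAlgebra.single g' v) * h = 0) : h = 0 := by
  classical
  rcases lt_or_gt_of_ne hg with hlt | hlt
  · rw [add_comm] at hh
    refine eq_zero_of_mul_eq_zero_of_top ℓ hv (fun a ha => ?_) hh
    rw [AddMonoidAlgebra.coeff_single, Finsupp.single_apply] at ha
    obtain rfl : g = a := by
      by_contra hne
      exact ha (if_neg hne)
    exact hlt
  · refine eq_zero_of_mul_eq_zero_of_top ℓ hu (fun a ha => ?_) hh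
    rw [AddMonoidAlgebra.coeff_single, Finsupp.single_apply] at ha
    obtain rfl : g' = a := by
      by_contra hne
      exact ha (if_neg hne)
    exact hlt

end Regular

/-- Laurent polynomials over `ZMod n`. -/
abbrev Lau (n : ℕ) : Type := (ZMod n)[T;T⁻¹]

section Laurent

open LaurentPolynomial

variable {n : ℕ}

theorem lau_eq_zero_of_mul {j k : ℤ} (hjk : j ≠ k) {u v : ZMod n} (hu : IsUnit u) (hv : IsUnit v)
    {h : Lau n} (hh : (C u * T j + C v * T k) * h = 0) : h = 0 := by
  rw [← single_eq_C_mul_T, ← single_eq_C_mul_T] at hh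
  exact eq_zero_of_binomial_mul_eq_zero (AddMonoidHom.id ℤ) hjk hu hv hh

theorem lau_eq_zero_of_T_sub_one_mul {k : ℤ} (hk : k ≠ 0) {c : ZMod n} (hc : IsUnit c) {h : Lau n}
    (hh : (C c * T k) * h = h) : h = 0 := by
  refine lau_eq_zero_of_mul hk hc (v := -1) isUnit_one.neg (h := h) ?_
  rw [add_mul, hh]
  simp

/-- The sum of the coefficients of a Laurent polynomial. -/
def aug (n : ℕ) : Lau n →ₐ[ZMod n] ZMod n := AddMonoidAlgebra.lift (ZMod n) (ZMod n) ℤ 1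

@[simp] theorem aug_T (k : ℤ) : aug n (T k) = 1 := by
  rw [aug, T, AddMonoidAlgebra.lift_single]
  simp

@[simp] theorem aug_C (c : ZMod n) : aug n (C c) = c := by
  rw [aug, ← single_eq_C, AddMonoidAlgebra.lift_single]
  simp

theorem aug_invert (f : Lau n) : aug n (invert f) = aug n f := by
  induction f using LaurentPolynomial.induction_on' with
  | add p q hp hq => rw [map_add, map_add, map_add, hp, hq]
  | C_mul_T k c => simp

theorem one_sub_T_dvd (j k : ℤ) : (1 - T j : Lau n) ∣ T (k * j) - 1 := by
  have hnat : ∀ m : ℕ, (1 - T j : Lau n) ∣ T ((m : ℤ) * j) - 1 := fun m => by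
    rw [← T_pow, ← neg_dvd, neg_sub]
    simpa only [one_pow] using sub_dvd_pow_sub_pow (T j : Lau n) 1 m
  obtain ⟨m, rfl | rfl⟩ := k.eq_nat_or_neg
  · exact hnat m
  · have h1 : (T (-(m : ℤ) * j) - 1 : Lau n) = -(T (-(m : ℤ) * j) * (T ((m : ℤ) * j) - 1)) := by
      rw [mul_sub, ← T_add]
      simp
    rw [h1]
    exact (dvd_mul_of_dvd_right (hnat m) _).neg_right

theorem one_sub_T_dvd_iff (f : Lau n) : (1 - T 1 : Lau n) ∣ f ↔ aug n f = 0 := by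
  constructor
  · rintro ⟨g, rfl⟩
    simp
  · intro h
    have key : ∀ f : Lau n, (1 - T 1 : Lau n) ∣ f - C (aug n f) := by
      intro f
      induction f using LaurentPolynomial.induction_on' with
      | add p q hp hq =>
        have := dvd_add hp hq
        rw [map_add, map_add]
        convert this using 1
        ring
      | C_mul_T k c =>
        have h1 := one_sub_T_dvd (n := n) 1 k
        rw [mul_one] at h1
        have := dvd_mul_of_dvd_right h1 (C c)
        simpa [mul_sub] using this
    simpa [h] using key f

end Laurent

section GroupRing

variable {n : ℕ}

theorem mono_mul (g h : Z3) : mono n g * mono n h = mono n (g + h) := by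
  simp [mono, AddMonoidAlgebra.single_mul_single]

theorem mono_zero : mono n 0 = 1 := rfl

/-- Monomials as units. -/
def monoU (n : ℕ) (g : Z3) : (GroupRing n)ˣ where
  val := mono n g
  inv := mono n (-g)
  val_inv := by rw [mono_mul, add_neg_cancel, mono_zero]
  inv_val := by rw [mono_mul, neg_add_cancel, mono_zero]

@[simp] theorem val_monoU (g : Z3) : (monoU n g : GroupRing n) = mono n g := rfl

@[simp] theorem antipode_mono (g : Z3) : antipode n (mono n g) = mono n (-g) := by
  simp [antipode, mono]

@[simp] theorem antipode_antipode (r : GroupRing n) : antipode n (antipode n r) = r := by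
  induction r using AddMonoidAlgebra.induction_linear with
  | zero => simp
  | add f g hf hg => rw [map_add, map_add, hf, hg]
  | single g c => simp [antipode]

theorem eq_zero_of_mono_mul {g h : Z3} (hgh : g ≠ h) {u v : ZMod n} (hu : IsUnit u)
    (hv : IsUnit v) {f : GroupRing n} (hf : (u • mono n g + v • mono n h) * f = 0) : f = 0 := by
  obtain ⟨i, hi⟩ := Function.ne_iff.1 hgh
  refine eq_zero_of_binomial_mul_eq_zero (deg i) (g := g) (g' := h) hi hu hv ?_
  simpa [mono] using hf

/-- Algebra homomorphisms of the group ring agree if they do so on the three generators. -/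
theorem groupRing_hom_ext {B : Type} [Semiring B] [Algebra (ZMod n) B]
    {φ ψ : GroupRing n →ₐ[ZMod n] B} (hx : φ (tx n) = ψ (tx n)) (hy : φ (ty n) = ψ (ty n))
    (hz : φ (tz n) = ψ (tz n)) : φ = ψ := by
  let Hs : AddSubgroup Z3 :=
    { carrier := {g | φ (mono n g) = ψ (mono n g)}
      zero_mem' := by simp [mono_zero]
      add_mem' := by
        intro a b ha hb
        simp only [Set.mem_ofPred_eq] at ha hb ⊢
        rw [← mono_mul, map_mul, map_mul, ha, hb]
      neg_mem' := by
        intro a ha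
        simp only [Set.mem_ofPred_eq] at ha ⊢
        have h1 : φ (mono n (-a)) * φ (mono n a) = 1 := by
          rw [← map_mul, mono_mul, neg_add_cancel, mono_zero, map_one]
        have h2 : ψ (mono n a) * ψ (mono n (-a)) = 1 := by
          rw [← map_mul, mono_mul, add_neg_cancel, mono_zero, map_one]
        rw [← ha] at h2
        exact left_inv_eq_right_inv h1 h2 }
  have hall : ∀ g : Z3, g ∈ Hs := by
    intro g
    have : g = g 0 • ![1, 0, 0] + g 1 • ![0, 1, 0] + g 2 • ![0, 0, 1] := by
      funext i
      fin_cases i <;> simp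
    rw [this]
    exact Hs.add_mem (Hs.add_mem (Hs.zsmul_mem hx _) (Hs.zsmul_mem hy _)) (Hs.zsmul_mem hz _)
  refine AddMonoidAlgebra.algHom_ext hall ?_
  ext

/-- A ring endomorphism that is trivial on generators modulo an ideal is trivial modulo it. -/
theorem sub_mem_of_generators (I : Ideal (GroupRing n)) (φ : GroupRing n →ₐ[ZMod n] GroupRing n)
    (hx : tx n - φ (tx n) ∈ I) (hy : ty n - φ (ty n) ∈ I) (hz : tz n - φ (tz n) ∈ I)
    (f : GroupRing n) : f - φ f ∈ I := by
  have : Ideal.Quotient.mkₐ (ZMod n) I = (Ideal.Quotient.mkₐ (ZMod n) I).comp φ :=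
    groupRing_hom_ext ((Ideal.Quotient.mk_eq_mk_iff_sub_mem _ _).2 hx)
      ((Ideal.Quotient.mk_eq_mk_iff_sub_mem _ _).2 hy)
      ((Ideal.Quotient.mk_eq_mk_iff_sub_mem _ _).2 hz)
  exact (Ideal.Quotient.mk_eq_mk_iff_sub_mem _ _).1 (DFunLike.congr_fun this f)

/-- The homomorphism from the group ring that sends the generators to given units. -/
def evalR {B : Type} [CommRing B] [Algebra (ZMod n) B] (u : Fin 3 → Bˣ) :
    GroupRing n →ₐ[ZMod n] B :=
  AddMonoidAlgebra.lift (ZMod n) B Z3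
    { toFun := fun g => ((∏ i, u i ^ g.toAdd i : Bˣ) : B)
      map_one' := by simp
      map_mul' := by
        intro g h
        simp [zpow_add, Finset.prod_mul_distrib] }

theorem evalR_mono {B : Type} [CommRing B] [Algebra (ZMod n) B] (u : Fin 3 → Bˣ) (g : Z3) :
    evalR (n := n) u (mono n g) = ((∏ i, u i ^ g i : Bˣ) : B) := by
  rw [evalR, mono, AddMonoidAlgebra.lift_single, one_smul]
  rfl

open LaurentPolynomial

/-- The homomorphism from Laurent polynomials that sends the variable to a given unit. -/
def evalL {B : Type} [CommRing B] [Algebra (ZMod n) B] (u : Bˣ) : Lau n →ₐ[ZMod n] B :=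
  AddMonoidAlgebra.lift (ZMod n) B ℤ ((Units.coeHom B).comp (zpowersHom Bˣ u))

theorem evalL_T {B : Type} [CommRing B] [Algebra (ZMod n) B] (u : Bˣ) (k : ℤ) :
    evalL (n := n) u (T k) = ((u ^ k : Bˣ) : B) := by
  rw [evalL, T, AddMonoidAlgebra.lift_single, one_smul]
  rfl

theorem lau_hom_ext {B : Type} [CommRing B] [Algebra (ZMod n) B] {φ ψ : Lau n →ₐ[ZMod n] B}
    (h : ∀ k, φ (T k) = ψ (T k)) : φ = ψ := by
  refine AddMonoidAlgebra.algHom_ext h ?_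
  ext

theorem proj_mono (θ χ : Z3 →+ ℤ) (g : Z3) :
    proj n θ χ (mono n g) = C (((-1 : (ZMod n)ˣ) ^ χ g : (ZMod n)ˣ) : ZMod n) * T (θ g) := by
  rw [proj, mono, AddMonoidAlgebra.lift_single, one_smul]
  rfl

theorem proj_mono_zero (θ : Z3 →+ ℤ) (g : Z3) : proj n θ 0 (mono n g) = T (θ g) := by
  simp [proj_mono]

theorem proj_antipode (θ χ : Z3 →+ ℤ) (f : GroupRing n) :
    proj n θ χ (antipode n f) = invert (proj n θ χ f) := by
  have : (proj n θ χ).comp (antipode n).toAlgHom = (invert (R := ZMod n)).toAlgHom.comp (proj n θ χ) := by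
    refine AddMonoidAlgebra.algHom_ext (fun g => ?_) (by ext)
    change proj n θ χ (antipode n (mono n g)) = invert (proj n θ χ (mono n g))
    rw [antipode_mono, proj_mono, proj_mono]
    have h1 : ((-1 : (ZMod n)ˣ) ^ χ g)⁻¹ = (-1 : (ZMod n)ˣ) ^ χ g := by
      rw [inv_eq_iff_mul_eq_one, ← mul_zpow]
      simp
    simp [h1]
  exact DFunLike.congr_fun this f

end GroupRing

open LaurentPolynomial

/-- A description of a theory by its plane charges: for each `i`, sectors have charges `c i` that are
vectors of pairs of Laurent polynomials; the charges of `i`-planons are the multiples of `Δ`, and the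
statistics is determined by the charges. -/
structure ChargeModel {n : ℕ} (P : PData n) (r : ℕ) (ι : Type) where
  θ : ι → P.T →+ ℤ
  sgn : ι → P.T → ZMod n
  c : ι → P.S →ₗ[ZMod n] (Fin r → Lau n × Lau n)
  Δ : ι → Fin r → Lau n
  one_lt : 1 < n
  pos : 0 < r
  lattice : Nonempty (P.T ≃+ (Fin 3 → ℤ))
  embedding : IsLatticeEmbedding P.η
  surj : ∀ i, Function.Surjective (θ i)
  indep : ∀ i j, i ≠ j → ∃ g, θ i g = 0 ∧ θ j g ≠ 0
  sgn_sq : ∀ i g, sgn i g * sgn i g = 1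
  c_act : ∀ i g x k, c i (P.act g x) k = (C (sgn i g) * T (θ i g) : Lau n) • c i x k
  inj : ∀ x, (∀ i, c i x = 0) → x = 0
  surj_c : ∀ i, Function.Surjective (c i)
  Δ_reg : ∀ i k f, Δ i k * f = 0 → f = 0
  planon : ∀ i p, (∀ j, j ≠ i → c j p = 0) →
    ∃ u v : Fin r → Lau n, ∀ k, c i p k = (Δ i k * u k, invert (Δ i k) * v k)
  exists_planon : ∀ i (u v : Fin r → Lau n), ∃ p, (∀ j, j ≠ i → c j p = 0) ∧
    ∀ k, c i p k = (Δ i k * u k, invert (Δ i k) * v k)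
  form_eq : ∀ i p x (u v : Fin r → Lau n), (∀ j, j ≠ i → c j p = 0) →
    (∀ k, c i p k = (Δ i k * u k, invert (Δ i k) * v k)) →
    P.form (kerPlane P.η (θ i)) p x =
      (∑ k, (u k * invert (c i x k).2 + v k * invert (c i x k).1)).coeff 0

theorem coeff_T_mul {n : ℕ} (k j : ℤ) (f : Lau n) : (T k * f).coeff j = f.coeff (j - k) := by
  rw [T, AddMonoidAlgebra.coeff_single_mul_apply, one_mul, neg_add_eq_sub]

theorem coeff_C_mul {n : ℕ} (c : ZMod n) (j : ℤ) (f : Lau n) : (C c * f).coeff j = c * f.coeff j := by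
  rw [← smul_eq_C_mul, AddMonoidAlgebra.coeff_smul_apply, smul_eq_mul]

theorem exists_coeff_bound {n : ℕ} (f : Lau n) : ∃ m : ℕ, ∀ k : ℤ, (m : ℤ) ≤ |k| → f.coeff k = 0 := by
  refine ⟨(f.coeff.support.sup fun k => k.natAbs) + 1, fun k hk => ?_⟩
  by_contra hne
  have h1 := Finset.le_sup (f := fun k : ℤ => k.natAbs) (Finsupp.mem_support_iff.2 hne)
  push_cast at hk
  have h2 : (k.natAbs : ℤ) = |k| := Int.natCast_natAbs k
  omega

theorem coeff_zero_invert_mul {n : ℕ} (f g : Lau n) :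
    (f * invert g).coeff 0 = (g * invert f).coeff 0 := by
  have : invert (f * invert g) = g * invert f := by
    rw [map_mul, involutive_invert, mul_comm]
  rw [← this, invert_apply, neg_zero]

namespace ChargeModel

variable {n r : ℕ} {P : PData n} {ι : Type} (M : ChargeModel P r ι)

theorem isUnit_sgn (i : ι) (g : P.T) : IsUnit (M.sgn i g) :=
  IsUnit.of_mul_eq_one _ (M.sgn_sq i g)

theorem coordinates : Coordinates P.toFusionData M.θ fun i => LinearMap.ker (M.c i) where
  lattice := M.lattice
  embedding := M.embedding
  surj := M.surj
  indep := M.indep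
  moves := by
    intro i g x hg hx
    rw [LinearMap.mem_ker, map_sub, sub_eq_zero] at hx
    rw [LinearMap.mem_ker]
    funext k
    have h1 := congrFun hx k
    rw [M.c_act] at h1
    exact Prod.ext (lau_eq_zero_of_T_sub_one_mul hg (M.isUnit_sgn i g) (congrArg Prod.fst h1))
      (lau_eq_zero_of_T_sub_one_mul hg (M.isUnit_sgn i g) (congrArg Prod.snd h1))
  fixes := by
    intro i g x hg
    rw [LinearMap.mem_ker, map_sub, sub_eq_zero]
    funext k
    rw [two_smul, P.act_add, Module.End.mul_apply, M.c_act, M.c_act, smul_smul, hg, T_zero, mul_one,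
      ← map_mul, M.sgn_sq, map_one, one_smul]
  act_mem := by
    intro i g x hx
    rw [LinearMap.mem_ker] at hx ⊢
    funext k
    rw [M.c_act, hx]
    simp
  separates := fun x hx => M.inj x hx
  exists_planon := by
    intro i
    obtain ⟨p, hp, hc⟩ := M.exists_planon i (fun _ => 1) 0
    refine ⟨p, fun h0 => ?_, hp⟩
    rw [LinearMap.mem_ker] at h0
    have h1 := hc ⟨0, M.pos⟩
    rw [h0] at h1
    have h2 := M.Δ_reg i ⟨0, M.pos⟩ 1 (congrArg Prod.fst h1).symm
    have : Fact (1 < n) := ⟨M.one_lt⟩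
    exact one_ne_zero h2

/-- The plane of the `i`-th orientation. -/
abbrev plane (i : ι) : Plane := kerPlane P.η (M.θ i)

theorem plane_injective : Function.Injective M.plane := M.coordinates.kerPlane_injective

theorem A_eq : P.A = Set.range M.plane := M.coordinates.A_eq

theorem plane_mem_A (i : ι) : M.plane i ∈ P.A := M.coordinates.kerPlane_mem_A i

theorem mem_Sa_iff (i : ι) (p : P.S) : p ∈ P.Sa (M.plane i) ↔ ∀ j, j ≠ i → M.c j p = 0 :=
  M.coordinates.mem_Sa_iff i p

theorem mem_K_iff (i : ι) (x : P.S) : x ∈ P.K (M.plane i) ↔ M.c i x = 0 := by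
  rw [PData.mem_K_iff]
  constructor
  · intro hx
    funext k
    have key : ∀ (u v : Fin r → Lau n),
        (∑ k, (u k * invert (M.c i x k).2 + v k * invert (M.c i x k).1)).coeff 0 = 0 := by
      intro u v
      obtain ⟨p, hp, hc⟩ := M.exists_planon i u v
      rw [← M.form_eq i p x u v hp hc]
      exact hx p ((M.mem_Sa_iff i p).2 hp)
    apply Prod.ext
    · ext j
      have := key 0 (Pi.single k (T j))
      rw [Finset.sum_eq_single k (fun l _ hl => by simp [Pi.single_eq_of_ne hl]) (by simp)] at this
      simp only [Pi.zero_apply, zero_mul, Pi.single_eq_same, zero_add, coeff_T_mul,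
        invert_apply] at this
      simpa using this
    · ext j
      have := key (Pi.single k (T j)) 0
      rw [Finset.sum_eq_single k (fun l _ hl => by simp [Pi.single_eq_of_ne hl]) (by simp)] at this
      simp only [Pi.zero_apply, zero_mul, Pi.single_eq_same, add_zero, coeff_T_mul,
        invert_apply] at this
      simpa using this
  · intro hx p hp
    obtain ⟨u, v, hc⟩ := M.planon i p ((M.mem_Sa_iff i p).1 hp)
    rw [M.form_eq i p x u v ((M.mem_Sa_iff i p).1 hp) hc, hx]
    simp

theorem K_eq (i : ι) : P.K (M.plane i) = LinearMap.ker (M.c i) :=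
  Submodule.ext fun x => M.mem_K_iff i x

include M in
theorem pModular : P.PModular := by
  intro x hx
  have : ∃ i, M.c i x ≠ 0 := by
    by_contra! hc
    exact hx (M.inj x hc)
  obtain ⟨i, hi⟩ := this
  rw [Ne, ← M.mem_K_iff, PData.mem_K_iff] at hi
  push Not at hi
  exact ⟨_, M.plane_mem_A i, hi⟩

theorem c_act_planon {i : ι} {p : P.S} {u v : Fin r → Lau n}
    (hc : ∀ k, M.c i p k = (M.Δ i k * u k, invert (M.Δ i k) * v k)) (g : P.T) (k : Fin r) :
    M.c i (P.act g p) k = (M.Δ i k * (C (M.sgn i g) * T (M.θ i g) * u k),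
      invert (M.Δ i k) * (C (M.sgn i g) * T (M.θ i g) * v k)) := by
  rw [M.c_act, hc]
  apply Prod.ext
  · simp only [Prod.smul_fst, smul_eq_mul]
    ring
  · simp only [Prod.smul_snd, smul_eq_mul]
    ring

theorem c_act_eq_zero {i : ι} {x : P.S} (h : M.c i x = 0) (g : P.T) : M.c i (P.act g x) = 0 := by
  funext k
  rw [M.c_act, h]
  simp

theorem form_act_left {i : ι} {p : P.S} (hp : p ∈ P.Sa (M.plane i)) {u v : Fin r → Lau n}
    (hc : ∀ k, M.c i p k = (M.Δ i k * u k, invert (M.Δ i k) * v k)) (g : P.T) (x : P.S) :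
    P.form (M.plane i) (P.act g p) x = M.sgn i g *
      (∑ k, (u k * invert (M.c i x k).2 + v k * invert (M.c i x k).1)).coeff (-M.θ i g) := by
  rw [M.form_eq i _ x _ _ (fun j hj => M.c_act_eq_zero ((M.mem_Sa_iff i p).1 hp j hj) g)
    (M.c_act_planon hc g)]
  have : (∑ k, (C (M.sgn i g) * T (M.θ i g) * u k * invert (M.c i x k).2 +
      C (M.sgn i g) * T (M.θ i g) * v k * invert (M.c i x k).1)) = C (M.sgn i g) * (T (M.θ i g) *
      ∑ k, (u k * invert (M.c i x k).2 + v k * invert (M.c i x k).1)) := by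
    rw [Finset.mul_sum, Finset.mul_sum]
    refine Finset.sum_congr rfl fun k _ => ?_
    ring
  rw [this, coeff_C_mul, coeff_T_mul, zero_sub]

include M in
theorem isPTheory (hN : P.IsUnitNormal P.normal)
    (fg : ∃ G : Finset P.S, Submodule.span (ZMod n) {y | ∃ g, ∃ x ∈ G, y = P.act g x} = ⊤) :
    P.IsPTheory where
  lattice := M.lattice
  fg := fg
  no_mobile := M.coordinates.no_mobile
  embedding := M.embedding
  normal_unit := hN
  form_add := by
    rw [M.A_eq]
    rintro _ ⟨i, rfl⟩ p hp q hq
    obtain ⟨u, v, hc⟩ := M.planon i p ((M.mem_Sa_iff i p).1 hp)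
    obtain ⟨u', v', hc'⟩ := M.planon i q ((M.mem_Sa_iff i q).1 hq)
    ext x
    rw [LinearMap.add_apply, M.form_eq i p x u v ((M.mem_Sa_iff i p).1 hp) hc,
      M.form_eq i q x u' v' ((M.mem_Sa_iff i q).1 hq) hc',
      M.form_eq i (p + q) x (u + u') (v + v')
        ((M.mem_Sa_iff i _).1 (Submodule.add_mem _ hp hq)) (fun k => by
          rw [map_add, Pi.add_apply, hc, hc', Prod.mk_add_mk, Pi.add_apply, Pi.add_apply, mul_add,
            mul_add]), ← Finsupp.add_apply, ← AddMonoidAlgebra.coeff_add, ← Finset.sum_add_distrib]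
    congr 2
    refine Finset.sum_congr rfl fun k _ => ?_
    simp only [Pi.add_apply]
    ring
  form_symm := by
    rw [M.A_eq]
    rintro _ ⟨i, rfl⟩ p hp q hq
    obtain ⟨u, v, hc⟩ := M.planon i p ((M.mem_Sa_iff i p).1 hp)
    obtain ⟨u', v', hc'⟩ := M.planon i q ((M.mem_Sa_iff i q).1 hq)
    rw [M.form_eq i p q u v ((M.mem_Sa_iff i p).1 hp) hc,
      M.form_eq i q p u' v' ((M.mem_Sa_iff i q).1 hq) hc', AddMonoidAlgebra.coeff_sum,
      AddMonoidAlgebra.coeff_sum, Finsupp.finsetSum_apply, Finsupp.finsetSum_apply]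
    refine Finset.sum_congr rfl fun k _ => ?_
    rw [hc, hc']
    simp only [map_mul, involutive_invert _, AddMonoidAlgebra.coeff_add, Finsupp.add_apply]
    rw [add_comm]
    congr 1
    · have h1 := coeff_zero_invert_mul (v k) (M.Δ i k * u' k)
      rw [map_mul] at h1
      rw [h1, mul_comm (M.Δ i k), mul_assoc]
    · have h1 := coeff_zero_invert_mul (v' k) (M.Δ i k * u k)
      rw [map_mul] at h1
      rw [h1, mul_left_comm, mul_assoc]
  form_act := by
    rw [M.A_eq]
    rintro _ ⟨i, rfl⟩ p hp x g
    obtain ⟨u, v, hc⟩ := M.planon i p ((M.mem_Sa_iff i p).1 hp)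
    rw [M.form_act_left hp hc, M.form_eq i p x u v ((M.mem_Sa_iff i p).1 hp) hc]
    have : (∑ k, (u k * invert (M.c i (P.act g x) k).2 + v k * invert (M.c i (P.act g x) k).1)) =
        C (M.sgn i g) * (T (-M.θ i g) *
          ∑ k, (u k * invert (M.c i x k).2 + v k * invert (M.c i x k).1)) := by
      rw [Finset.mul_sum, Finset.mul_sum]
      refine Finset.sum_congr rfl fun k _ => ?_
      rw [M.c_act]
      simp only [Prod.smul_fst, Prod.smul_snd, smul_eq_mul, map_mul, invert_T, invert_C]
      ring
    rw [this, coeff_C_mul, coeff_T_mul, ← mul_assoc, M.sgn_sq, one_mul, sub_self]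
  form_local := by
    rw [M.A_eq]
    rintro _ ⟨i, rfl⟩ p hp x g hg
    obtain ⟨u, v, hc⟩ := M.planon i p ((M.mem_Sa_iff i p).1 hp)
    have hθ : M.θ i g ≠ 0 := by
      intro h0
      have h1 : (2 : ℕ) • g ∈ P.stab p :=
        M.coordinates.two_smul_mem_stab (fun j hj => (M.mem_Sa_iff i p).1 hp j hj) h0
      have h2 := hg 2 (by
        have h3 : P.act ((2 : ℕ) • g) p = p := h1
        rwa [← natCast_zsmul] at h3)
      exact two_ne_zero h2
    obtain ⟨m, hm⟩ := exists_coeff_bound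
      (∑ k, (u k * invert (M.c i x k).2 + v k * invert (M.c i x k).1))
    refine ⟨m, fun k hk => ?_⟩
    rw [M.form_act_left hp hc, hm, mul_zero]
    rw [abs_neg, map_zsmul, smul_eq_mul, abs_mul]
    have := Int.one_le_abs hθ
    nlinarith [abs_nonneg k]

/-- The plane charges of orientation `i` are the vectors of pairs of Laurent polynomials. -/
def qaEquiv (i : ι) : P.Qa (M.plane i) ≃ₗ[ZMod n] (Fin r → Lau n × Lau n) :=
  (Submodule.quotEquivOfEq _ _ (M.K_eq i)).trans ((M.c i).quotKerEquivOfSurjective (M.surj_c i))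

@[simp] theorem qaEquiv_mk (i : ι) (x : P.S) : M.qaEquiv i ((P.K (M.plane i)).mkQ x) = M.c i x := rfl

theorem kerOmega_iff (a : P.A) (q : P.Qa a) :
    q ∈ P.kerOmega a ↔ ∃ x, (P.K a).mkQ x = q ∧ ∀ b : P.A, b ≠ a → x ∈ P.K b := by
  let _ : DecidableEq P.A := Classical.decEq _
  rw [PData.kerOmega, Submodule.mem_comap]
  constructor
  · rintro ⟨x, hx⟩
    refine ⟨x, ?_, fun b hb => ?_⟩
    · have h1 := congrFun hx a
      simp only [LinearMap.coe_single, Pi.single_eq_same] at h1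
      exact h1
    · have h1 := congrFun hx b
      simp only [LinearMap.coe_single] at h1
      rw [Pi.single_eq_of_ne hb] at h1
      exact (Submodule.Quotient.mk_eq_zero _).1 h1
  · rintro ⟨x, hx, hb⟩
    refine ⟨x, ?_⟩
    funext b
    simp only [LinearMap.coe_single]
    by_cases hab : b = a
    · subst hab
      rw [Pi.single_eq_same]
      exact hx
    · rw [Pi.single_eq_of_ne hab]
      exact (Submodule.Quotient.mk_eq_zero _).2 (hb b hab)

theorem foliationHypotheses (hs : ∀ i g, M.sgn i g = 1) (hΔ : ∀ i k, PData.UnitEnds (M.Δ i k)) :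
    P.FoliationHypotheses fun _ => r := by
  rintro ⟨a, ha⟩
  rw [M.A_eq] at ha
  obtain ⟨i, rfl⟩ := ha
  refine ⟨M.θ i, M.surj i, fun g => ?_, M.qaEquiv i, fun g x => ?_, M.Δ i, hΔ i, fun q => ?_,
    fun p hp u v hc x g => ?_⟩
  · constructor
    · intro hg x
      rw [M.mem_K_iff, map_sub, sub_eq_zero]
      funext k
      rw [M.c_act, hs, hg]
      simp
    · intro h
      by_contra hne
      obtain ⟨p, hp, -⟩ := M.coordinates.exists_planon i
      have h1 := h p
      rw [M.K_eq] at h1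
      exact hp (M.coordinates.moves i g p hne h1)
  · funext k
    rw [M.qaEquiv_mk, M.c_act, hs, map_one, one_mul]
    rfl
  · rw [kerOmega_iff]
    constructor
    · rintro ⟨x, rfl, hx⟩ k
      have hx' : ∀ j, j ≠ i → M.c j x = 0 := fun j hj =>
        (M.mem_K_iff j x).1 (hx ⟨_, M.plane_mem_A j⟩ fun he =>
          hj (M.plane_injective (congrArg Subtype.val he)))
      obtain ⟨u, v, hc⟩ := M.planon i x hx'
      rw [M.qaEquiv_mk, hc]
      exact ⟨dvd_mul_right _ _, dvd_mul_right _ _⟩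
    · intro h
      choose u hu using fun k => (h k).1
      choose v hv using fun k => (h k).2
      obtain ⟨p, hp, hc⟩ := M.exists_planon i u v
      refine ⟨p, (M.qaEquiv i).injective ?_, fun b hb => ?_⟩
      · funext k
        exact (hc k).trans (Prod.ext (hu k).symm (hv k).symm)
      · obtain ⟨b, hbA⟩ := b
        have hbA' := hbA
        rw [M.A_eq] at hbA'
        obtain ⟨j, rfl⟩ := hbA'
        refine (M.mem_K_iff j p).2 (hp j ?_)
        rintro rfl
        exact hb rfl
  · rw [M.form_act_left hp (fun k => by rw [← M.qaEquiv_mk]; exact hc k), hs, one_mul,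
      (M.θ i).map_neg, neg_neg]
    rfl

theorem mem_range_pi_iff (q : P.Q) : q ∈ LinearMap.range P.pi ↔
    ∃ x, ∀ i, M.c i x = M.qaEquiv i (q ⟨_, M.plane_mem_A i⟩) := by
  constructor
  · rintro ⟨x, rfl⟩
    exact ⟨x, fun i => rfl⟩
  · rintro ⟨x, hx⟩
    refine ⟨x, ?_⟩
    funext a
    obtain ⟨a, ha⟩ := a
    have ha' := ha
    rw [M.A_eq] at ha'
    obtain ⟨i, rfl⟩ := ha'
    exact (M.qaEquiv i).injective (hx i)

/-- Plane charges that are multiples of `Δ` in each orientation satisfy all constraints. -/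
theorem exists_of_dvd [Finite ι] (q : ι → Fin r → Lau n × Lau n)
    (h : ∀ i k, M.Δ i k ∣ (q i k).1 ∧ invert (M.Δ i k) ∣ (q i k).2) : ∃ x, ∀ i, M.c i x = q i := by
  classical
  have := Fintype.ofFinite ι
  choose u hu using fun i k => (h i k).1
  choose v hv using fun i k => (h i k).2
  choose p hp hc using fun i => M.exists_planon i (u i) (v i)
  refine ⟨∑ i, p i, fun i => ?_⟩
  rw [map_sum, Finset.sum_eq_single i (fun j _ hj => hp j i hj.symm) (by simp)]
  funext k
  rw [hc, ← hu, ← hv]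

theorem trivialOnC [Finite ι] (hs : ∀ i g, M.sgn i g = 1)
    (hΔ : ∀ i k j, M.Δ i k ∣ T j - 1) : P.TrivialOnC := by
  intro g x
  rw [M.mem_range_pi_iff]
  refine M.exists_of_dvd (fun i => M.qaEquiv i ((P.K _).mkQ _)) fun i k => ?_
  rw [M.qaEquiv_mk, map_sub]
  have h1 : M.c i (P.act g (x ⟨_, M.plane_mem_A i⟩)) k - M.c i (x ⟨_, M.plane_mem_A i⟩) k =
      (T (M.θ i g) - 1 : Lau n) • M.c i (x ⟨_, M.plane_mem_A i⟩) k := by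
    rw [M.c_act, hs, map_one, one_mul, sub_smul, one_smul]
  rw [Pi.sub_apply, h1]
  refine ⟨dvd_mul_of_dvd_left (hΔ _ _ _) _, dvd_mul_of_dvd_left ?_ _⟩
  have h2 := map_dvd (invert (R := ZMod n)) (hΔ i k (-M.θ i g))
  simpa using h2

end ChargeModel

open LaurentPolynomial

section Sections

variable {n : ℕ} (M : ℕ)

/-- The terms of degree `k` modulo `M + 1`, as a Laurent polynomial in the `(M + 1)`-st power of the
variable. -/
def secFun (k : Fin (M + 1)) : Lau n →ₗ[ZMod n] Lau n where
  toFun f := AddMonoidAlgebra.ofCoeff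
    (f.coeff.comapDomain (fun j : ℤ => ((M + 1 : ℕ) : ℤ) * j + ((k : ℕ) : ℤ)) (by
      intro a _ b _ hab
      have : ((M + 1 : ℕ) : ℤ) ≠ 0 := by positivity
      exact mul_left_cancel₀ this (add_right_cancel hab)))
  map_add' f g := by ext; simp
  map_smul' c f := by ext; simp

theorem coeff_secFun (k : Fin (M + 1)) (f : Lau n) (j : ℤ) :
    (secFun M k f).coeff j = f.coeff (((M + 1 : ℕ) : ℤ) * j + ((k : ℕ) : ℤ)) := rfl

theorem secFun_monomial (k : Fin (M + 1)) (c : ZMod n) (j : ℤ) (l : Fin (M + 1)) :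
    secFun M l (C c * T (((M + 1 : ℕ) : ℤ) * j + ((k : ℕ) : ℤ)) : Lau n) =
      if l = k then C c * T j else 0 := by
  ext i
  rw [coeff_secFun, coeff_C_mul, T_apply]
  have hl := l.2
  have hk := k.2
  by_cases h : l = k
  · subst h
    rw [if_pos rfl, coeff_C_mul, T_apply]
    congr 1
    have h0 : ((M + 1 : ℕ) : ℤ) ≠ 0 := by positivity
    by_cases hji : j = i
    · simp [hji]
    · rw [if_neg hji, if_neg]
      intro he
      exact hji (mul_left_cancel₀ h0 (add_right_cancel he))
  · rw [if_neg h, if_neg, mul_zero]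
    · rfl
    · intro he
      apply h
      have h1 := congrArg (fun z => z % ((M + 1 : ℕ) : ℤ)) he
      simp only [Int.mul_add_emod_self_left] at h1
      rw [Int.emod_eq_of_lt (by positivity) (by exact_mod_cast hk),
        Int.emod_eq_of_lt (by positivity) (by exact_mod_cast hl)] at h1
      exact Fin.ext (by exact_mod_cast h1.symm)

theorem exists_divMod (i : ℤ) :
    ∃ (j : ℤ) (k : Fin (M + 1)), i = ((M + 1 : ℕ) : ℤ) * j + ((k : ℕ) : ℤ) := by
  have h0 : (0 : ℤ) < ((M + 1 : ℕ) : ℤ) := by positivity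
  have h1 := Int.emod_nonneg i h0.ne'
  have h2 := Int.emod_lt_of_pos i h0
  refine ⟨i / ((M + 1 : ℕ) : ℤ), ⟨(i % ((M + 1 : ℕ) : ℤ)).toNat, by omega⟩, ?_⟩
  rw [Int.toNat_of_nonneg h1]
  exact (Int.mul_ediv_add_emod i _).symm

/-- Decomposition of Laurent polynomials by degree modulo `M + 1`. -/
def sec : Lau n ≃ₗ[ZMod n] (Fin (M + 1) → Lau n) :=
  LinearEquiv.ofBijective (LinearMap.pi fun k => secFun M k) (by
    constructor
    · rw [injective_iff_map_eq_zero]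
      intro f hf
      ext i
      obtain ⟨j, k, rfl⟩ := exists_divMod M i
      rw [← coeff_secFun]
      have := congrFun hf k
      simp only [LinearMap.pi_apply] at this
      rw [this]
      rfl
    · have key : ∀ (k : Fin (M + 1)) (f : Lau n), ∃ g, (LinearMap.pi fun k => secFun M k) g =
          (Pi.single k f : Fin (M + 1) → Lau n) := by
        intro k f
        induction f using LaurentPolynomial.induction_on' with
        | add p q hp hq =>
          obtain ⟨g, hg⟩ := hp
          obtain ⟨g', hg'⟩ := hq
          exact ⟨g + g', by rw [map_add, hg, hg', Pi.single_add]⟩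
        | C_mul_T j c =>
          refine ⟨C c * T (((M + 1 : ℕ) : ℤ) * j + ((k : ℕ) : ℤ)), ?_⟩
          funext l
          rw [LinearMap.pi_apply, secFun_monomial, Pi.single_apply]
      intro F
      choose g hg using key
      refine ⟨∑ k, g k (F k), ?_⟩
      rw [map_sum]
      simp only [hg]
      exact Finset.univ_sum_single F)

theorem coeff_sec (k : Fin (M + 1)) (f : Lau n) (j : ℤ) :
    (sec M f k).coeff j = f.coeff (((M + 1 : ℕ) : ℤ) * j + ((k : ℕ) : ℤ)) := rfl

theorem sec_monomial (k : Fin (M + 1)) (c : ZMod n) (j : ℤ) (l : Fin (M + 1)) :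
    sec M (C c * T (((M + 1 : ℕ) : ℤ) * j + ((k : ℕ) : ℤ)) : Lau n) l =
      if l = k then C c * T j else 0 := secFun_monomial M k c j l

theorem sec_T_mul (j : ℤ) (f : Lau n) (k : Fin (M + 1)) :
    sec M (T (((M + 1 : ℕ) : ℤ) * j) * f) k = T j * sec M f k := by
  ext i
  rw [coeff_sec, coeff_T_mul, coeff_T_mul, coeff_sec]
  congr 1
  ring

theorem sec_T_one_mul_zero (f : Lau n) : sec M (T 1 * f) 0 = T 1 * sec M f (Fin.last M) := by
  ext i
  rw [coeff_sec, coeff_T_mul, coeff_T_mul, coeff_sec]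
  congr 1
  simp only [Fin.val_zero, Fin.val_last]
  push_cast
  ring

theorem sec_T_one_mul_succ (f : Lau n) (j : Fin M) :
    sec M (T 1 * f) j.succ = sec M f j.castSucc := by
  ext i
  rw [coeff_sec, coeff_T_mul, coeff_sec]
  congr 1
  simp only [Fin.val_succ, Fin.val_castSucc]
  push_cast
  ring

theorem sec_T_neg_one_mul_last (f : Lau n) :
    sec M (T (-1) * f) (Fin.last M) = T (-1) * sec M f 0 := by
  ext i
  rw [coeff_sec, coeff_T_mul, coeff_T_mul, coeff_sec]
  congr 1
  simp only [Fin.val_zero, Fin.val_last]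
  push_cast
  ring

theorem sec_T_neg_one_mul_castSucc (f : Lau n) (j : Fin M) :
    sec M (T (-1) * f) j.castSucc = sec M f j.succ := by
  ext i
  rw [coeff_sec, coeff_T_mul, coeff_sec]
  congr 1
  simp only [Fin.val_succ, Fin.val_castSucc]
  push_cast
  ring

theorem aug_sec (f : Lau n) : ∑ k, aug n (sec M f k) = aug n f := by
  induction f using LaurentPolynomial.induction_on' with
  | add p q hp hq =>
    rw [map_add, map_add, ← hp, ← hq, ← Finset.sum_add_distrib]
    simp
  | C_mul_T i c =>
    obtain ⟨j, k, rfl⟩ := exists_divMod M i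
    simp only [sec_monomial, apply_ite (aug n), map_zero]
    simp

theorem coeff_zero_C_mul_T_mul_invert (c : ZMod n) (j : ℤ) (g : Lau n) :
    (C c * T j * invert g).coeff 0 = c * g.coeff j := by
  rw [mul_assoc, coeff_C_mul, coeff_T_mul, invert_apply, zero_sub, neg_neg]

theorem coeff_zero_sec (u g : Lau n) :
    (u * invert g).coeff 0 = ∑ k, (sec M u k * invert (sec M g k)).coeff 0 := by
  induction u using LaurentPolynomial.induction_on' with
  | add p q hp hq =>
    rw [map_add, add_mul, AddMonoidAlgebra.coeff_add, Finsupp.add_apply, hp, hq,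
      ← Finset.sum_add_distrib]
    refine Finset.sum_congr rfl fun k _ => ?_
    rw [Pi.add_apply, add_mul, AddMonoidAlgebra.coeff_add, Finsupp.add_apply]
  | C_mul_T i c =>
    obtain ⟨j, k, rfl⟩ := exists_divMod M i
    rw [Finset.sum_eq_single k, sec_monomial, if_pos rfl, coeff_zero_C_mul_T_mul_invert,
      coeff_zero_C_mul_T_mul_invert, coeff_sec]
    · intro l _ hl
      rw [sec_monomial, if_neg hl, zero_mul]
      rfl
    · simp

end Sections

/-- A decomposition of pairs of Laurent polynomials, with the statistics given by `Δ`, into a copy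
that is scaled up by `M + 1` and `M` layers of toric codes. -/
structure LayerSplit (n M : ℕ) (Δ : Lau n) where
  E : Lau n ≃ₗ[ZMod n] Lau n × (Fin M → Lau n)
  G : Lau n ≃ₗ[ZMod n] Lau n × (Fin M → Lau n)
  E_T : ∀ k f, E (T (((M + 1 : ℕ) : ℤ) * k) * f) = (T k : Lau n) • E f
  G_T : ∀ k f, G (T (((M + 1 : ℕ) : ℤ) * k) * f) = (T k : Lau n) • G f
  E_dvd : ∀ f, Δ ∣ f - (E f).1
  G_dvd : ∀ f, invert Δ ∣ f - (G f).1
  E_mul : ∀ u, ∃ u', (E (Δ * u)).1 = Δ * u' ∧ ∀ g, (u * invert g).coeff 0 =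
    (u' * invert (G g).1).coeff 0 + ∑ j, ((E (Δ * u)).2 j * invert ((G g).2 j)).coeff 0
  G_mul : ∀ v, ∃ v', (G (invert Δ * v)).1 = invert Δ * v' ∧ ∀ f, (v * invert f).coeff 0 =
    (v' * invert (E f).1).coeff 0 + ∑ j, ((G (invert Δ * v)).2 j * invert ((E f).2 j)).coeff 0

/-- Separating the first of finitely many components. -/
def finConsEquiv (n M : ℕ) : (Fin (M + 1) → Lau n) ≃ₗ[ZMod n] Lau n × (Fin M → Lau n) where
  toFun f := (f 0, fun j => f j.succ)
  invFun p := Fin.cons p.1 p.2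
  left_inv f := Fin.cons_self_tail f
  right_inv _ := rfl
  map_add' _ _ := rfl
  map_smul' _ _ := rfl

/-- The decomposition for decoupled layers. -/
def layerSplitOne (n M : ℕ) : LayerSplit n M 1 where
  E := (sec M).trans (finConsEquiv n M)
  G := (sec M).trans (finConsEquiv n M)
  E_T k f := Prod.ext (sec_T_mul M k f 0) (funext fun j => sec_T_mul M k f j.succ)
  G_T k f := Prod.ext (sec_T_mul M k f 0) (funext fun j => sec_T_mul M k f j.succ)
  E_dvd f := one_dvd _
  G_dvd f := by rw [map_one]; exact one_dvd _
  E_mul u := ⟨sec M u 0, by rw [one_mul, one_mul]; rfl, fun g => by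
    rw [coeff_zero_sec M, Fin.sum_univ_succ, one_mul]
    rfl⟩
  G_mul u := ⟨sec M u 0, by rw [map_one, one_mul, one_mul]; rfl, fun g => by
    rw [coeff_zero_sec M, Fin.sum_univ_succ, map_one, one_mul]
    rfl⟩

section Planar

variable (n M : ℕ)

/-- Adding the other components to the first one. -/
def sumEquiv : (Fin (M + 1) → Lau n) ≃ₗ[ZMod n] Lau n × (Fin M → Lau n) where
  toFun g := (∑ k, g k, fun j => g j.succ)
  invFun p := Fin.cons (p.1 - ∑ j, p.2 j) p.2
  left_inv g := by
    funext k
    refine Fin.cases ?_ (fun j => ?_) k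
    · simp [Fin.sum_univ_succ]
    · simp
  right_inv p := by
    apply Prod.ext
    · simp [Fin.sum_univ_succ]
    · funext j
      simp
  map_add' f g := by
    apply Prod.ext
    · simp [Finset.sum_add_distrib]
    · rfl
  map_smul' c f := by
    apply Prod.ext
    · simp [Finset.smul_sum]
    · rfl

variable {n M} in
theorem partialSum_sub (B : Fin (M + 1) → Lau n) (h : B 0 = 0) :
    Fin.partialSum (fun j : Fin M => B j.succ - B j.castSucc) = B := by
  funext k
  induction k using Fin.induction with
  | zero => rw [Fin.partialSum_zero, h]
  | succ j ih => rw [Fin.partialSum_succ, ih, add_sub_cancel]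

variable {n M} in
theorem partialSum_succ_sub (f : Fin M → Lau n) (j : Fin M) :
    Fin.partialSum f j.succ - Fin.partialSum f j.castSucc = f j := by
  rw [Fin.partialSum_succ, add_sub_cancel_left]

variable {n M} in
theorem partialSum_last (f : Fin M → Lau n) : Fin.partialSum f (Fin.last M) = ∑ j, f j := by
  have h1 : ∀ j, f j = Fin.partialSum f j.succ - Fin.partialSum f j.castSucc := fun j =>
    (partialSum_succ_sub f j).symm
  have h2 := Fin.sum_univ_succ (Fin.partialSum f)
  rw [Fin.sum_univ_castSucc, Fin.partialSum_zero, zero_add] at h2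
  rw [Finset.sum_congr rfl fun j _ => h1 j, Finset.sum_sub_distrib, ← h2]
  ring

variable {n M} in
theorem cons_partialSum (f : Fin M → Lau n) :
    (Fin.cons 0 fun j : Fin M => Fin.partialSum f j.succ : Fin (M + 1) → Lau n) =
      Fin.partialSum f := by
  funext k
  refine Fin.cases ?_ (fun j => ?_) k
  · rw [Fin.cons_zero, Fin.partialSum_zero]
  · rw [Fin.cons_succ]

/-- Partial sums of the components, the first one shifted. -/
def partialSumEquiv : (Fin (M + 1) → Lau n) ≃ₗ[ZMod n] Lau n × (Fin M → Lau n) :=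
  LinearEquiv.symm
  { toFun := fun p => Fin.cons (p.1 - T 1 * (Fin.cons 0 p.2 : Fin (M + 1) → Lau n) (Fin.last M))
      fun j => (Fin.cons 0 p.2 : Fin (M + 1) → Lau n) j.succ -
        (Fin.cons 0 p.2 : Fin (M + 1) → Lau n) j.castSucc
    invFun := fun f => (f 0 + T 1 * ∑ j : Fin M, f j.succ,
      fun j => Fin.partialSum (fun i : Fin M => f i.succ) j.succ)
    right_inv := by
      intro f
      dsimp only
      rw [cons_partialSum]
      funext k
      refine Fin.cases ?_ (fun j => ?_) k
      · rw [Fin.cons_zero, partialSum_last, add_sub_cancel_right]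
      · rw [Fin.cons_succ, partialSum_succ_sub]
    left_inv := by
      intro p
      dsimp only
      simp only [Fin.cons_succ (n := M), Fin.cons_zero (n := M)]
      have h1 := partialSum_sub (Fin.cons 0 p.2 : Fin (M + 1) → Lau n) (Fin.cons_zero _ _)
      have h2 := partialSum_last fun j : Fin M => (Fin.cons 0 p.2 : Fin (M + 1) → Lau n) j.succ -
        (Fin.cons 0 p.2 : Fin (M + 1) → Lau n) j.castSucc
      rw [h1] at h2
      simp only [Fin.cons_succ (n := M)] at h1 h2
      rw [← h2, h1, sub_add_cancel]
      rfl
    map_add' := by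
      intro p q
      have h1 : (Fin.cons 0 (p + q).2 : Fin (M + 1) → Lau n) =
          (Fin.cons 0 p.2 : Fin (M + 1) → Lau n) + (Fin.cons 0 q.2 : Fin (M + 1) → Lau n) := by
        funext k
        refine Fin.cases ?_ (fun j => ?_) k <;> simp
      rw [h1]
      funext k
      refine Fin.cases ?_ (fun j => ?_) k
      · simp only [Fin.cons_zero, Pi.add_apply, Prod.fst_add]
        ring
      · simp only [Fin.cons_succ, Pi.add_apply]
        ring
    map_smul' := by
      intro c p
      have h1 : (Fin.cons 0 (c • p).2 : Fin (M + 1) → Lau n) =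
          c • (Fin.cons 0 p.2 : Fin (M + 1) → Lau n) := by
        funext k
        refine Fin.cases ?_ (fun j => ?_) k <;> simp
      rw [h1]
      funext k
      refine Fin.cases ?_ (fun j => ?_) k
      · simp [smul_sub]
      · simp [smul_sub] }

variable {n M} in
theorem partialSumEquiv_apply (f : Fin (M + 1) → Lau n) : partialSumEquiv n M f =
    (f 0 + T 1 * ∑ j : Fin M, f j.succ,
      fun j => Fin.partialSum (fun i : Fin M => f i.succ) j.succ) := rfl

variable {n M} in
theorem mul_partialSum (c : Lau n) (f : Fin M → Lau n) (k : Fin (M + 1)) :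
    Fin.partialSum (fun j => c * f j) k = c * Fin.partialSum f k := by
  induction k using Fin.induction with
  | zero => rw [Fin.partialSum_zero, Fin.partialSum_zero, mul_zero]
  | succ j ih => rw [Fin.partialSum_succ, Fin.partialSum_succ, ih, mul_add]

/-- The decomposition for charges constrained by their sum. -/
def layerSplitPlanar : LayerSplit n M (1 - T 1) where
  E := (sec M).trans (partialSumEquiv n M)
  G := (sec M).trans (sumEquiv n M)
  E_T k f := by
    simp only [LinearEquiv.trans_apply, partialSumEquiv_apply, sec_T_mul]
    apply Prod.ext
    · simp only [Prod.smul_fst, smul_eq_mul, ← Finset.mul_sum]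
      ring
    · funext j
      exact mul_partialSum _ _ _
  G_T k f := by
    simp only [LinearEquiv.trans_apply]
    apply Prod.ext
    · change ∑ l, sec M _ l = T k * ∑ l, sec M f l
      simp only [sec_T_mul, Finset.mul_sum]
    · funext j
      exact sec_T_mul M k f _
  E_dvd f := by
    rw [one_sub_T_dvd_iff, LinearEquiv.trans_apply, partialSumEquiv_apply, map_sub,
      ← aug_sec M f, Fin.sum_univ_succ]
    simp
  G_dvd f := by
    have h1 : invert (1 - T 1 : Lau n) = -T (-1) * (1 - T 1) := by
      rw [map_sub, map_one, invert_T, mul_sub, neg_mul, neg_mul, ← T_add]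
      simp
      ring
    have h2 : (1 - T 1 : Lau n) ∣ f - ((sec M).trans (sumEquiv n M) f).1 := by
      rw [one_sub_T_dvd_iff, map_sub, ← aug_sec M f]
      change _ - aug n (∑ k, sec M f k) = 0
      simp
    rw [h1]
    exact ((isUnit_T (R := ZMod n) (-1)).neg.mul_left_dvd).2 h2
  E_mul u := by
    have h0 : sec M ((1 - T 1) * u) 0 = sec M u 0 - T 1 * sec M u (Fin.last M) := by
      rw [sub_mul, one_mul, map_sub, Pi.sub_apply, sec_T_one_mul_zero]
    have hs : ∀ j : Fin M, sec M ((1 - T 1) * u) j.succ =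
        (sec M u j.succ - sec M u 0) - (sec M u j.castSucc - sec M u 0) := fun j => by
      rw [sub_mul, one_mul, map_sub, Pi.sub_apply, sec_T_one_mul_succ]
      ring
    have hp := partialSum_sub (fun k => sec M u k - sec M u 0) (sub_self _)
    have hE : (sec M).trans (partialSumEquiv n M) ((1 - T 1) * u) =
        ((1 - T 1) * sec M u 0, fun j => sec M u j.succ - sec M u 0) := by
      rw [LinearEquiv.trans_apply, partialSumEquiv_apply]
      simp only [hs]
      rw [← partialSum_last, hp, h0]
      apply Prod.ext
      · simp only
        ring
      · rfl
    refine ⟨sec M u 0, by rw [hE], fun g => ?_⟩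
    rw [hE, coeff_zero_sec M]
    change _ = (sec M u 0 * invert (∑ k, sec M g k)).coeff 0 +
      ∑ j : Fin M, ((sec M u j.succ - sec M u 0) * invert (sec M g j.succ)).coeff 0
    rw [← Finsupp.finsetSum_apply, ← Finsupp.finsetSum_apply, ← AddMonoidAlgebra.coeff_sum,
      ← AddMonoidAlgebra.coeff_sum, ← Finsupp.add_apply, ← AddMonoidAlgebra.coeff_add]
    congr 2
    rw [Fin.sum_univ_succ, Fin.sum_univ_succ, map_add, map_sum, mul_add, Finset.mul_sum, add_assoc,
      ← Finset.sum_add_distrib]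
    congr 1
    refine Finset.sum_congr rfl fun j _ => ?_
    ring
  G_mul v := by
    have hi : invert (1 - T 1 : Lau n) = 1 - T (-1) := by simp
    rw [hi]
    have hl : sec M ((1 - T (-1)) * v) (Fin.last M) = sec M v (Fin.last M) - T (-1) * sec M v 0 := by
      rw [sub_mul, one_mul, map_sub, Pi.sub_apply, sec_T_neg_one_mul_last]
    have hc : ∀ j : Fin M, sec M ((1 - T (-1)) * v) j.castSucc =
        sec M v j.castSucc - sec M v j.succ := fun j => by
      rw [sub_mul, one_mul, map_sub, Pi.sub_apply, sec_T_neg_one_mul_castSucc]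
    have hsum : ∑ k, sec M ((1 - T (-1)) * v) k = (1 - T (-1)) * sec M v 0 := by
      have h1 := Fin.sum_univ_succ (sec M v)
      rw [Fin.sum_univ_castSucc] at h1
      rw [Fin.sum_univ_castSucc, hl]
      simp only [hc]
      rw [Finset.sum_sub_distrib]
      linear_combination h1
    refine ⟨sec M v 0, hsum, fun f => ?_⟩
    rw [coeff_zero_sec M]
    change _ = (sec M v 0 * invert (sec M f 0 + T 1 * ∑ j : Fin M, sec M f j.succ)).coeff 0 +
      ∑ j : Fin M, (sec M ((1 - T (-1)) * v) j.succ *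
        invert (Fin.partialSum (fun i : Fin M => sec M f i.succ) j.succ)).coeff 0
    rw [← Finsupp.finsetSum_apply, ← Finsupp.finsetSum_apply, ← AddMonoidAlgebra.coeff_sum,
      ← AddMonoidAlgebra.coeff_sum, ← Finsupp.add_apply, ← AddMonoidAlgebra.coeff_add]
    congr 2
    rw [← partialSum_last fun i : Fin M => sec M f i.succ]
    set F := Fin.partialSum (fun i : Fin M => sec M f i.succ) with hF
    have hF0 : F 0 = 0 := Fin.partialSum_zero _
    have hFs : ∀ j : Fin M, sec M f j.succ = F j.succ - F j.castSucc := fun j =>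
      (partialSum_succ_sub (fun i : Fin M => sec M f i.succ) j).symm
    rw [Fin.sum_univ_succ]
    simp only [hFs]
    have h1 := Fin.sum_univ_succ fun k => sec M ((1 - T (-1)) * v) k * invert (F k)
    rw [Fin.sum_univ_castSucc, hF0, map_zero, mul_zero, zero_add] at h1
    rw [← h1, hl]
    simp only [hc]
    have h2 := Fin.sum_univ_succ fun k => sec M v k * invert (F k)
    rw [Fin.sum_univ_castSucc, hF0, map_zero, mul_zero, zero_add] at h2
    simp only [map_sub, mul_sub, sub_mul, Finset.sum_sub_distrib, map_add, map_mul, invert_T]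
    linear_combination -h2

end Planar

open LaurentPolynomial

/-- The statistics of pairs of Laurent polynomials that count electric and magnetic charges. -/
def layerForm {n : ℕ} (p : Lau n × Lau n) : Lau n × Lau n →ₗ[ZMod n] ZMod n where
  toFun x := (p.1 * invert x.2 + p.2 * invert x.1).coeff 0
  map_add' x y := by
    simp only [Prod.fst_add, Prod.snd_add, map_add, mul_add, AddMonoidAlgebra.coeff_add,
      Finsupp.add_apply]
    abel
  map_smul' c x := by simp [mul_add]

theorem layerForm_apply {n : ℕ} (p x : Lau n × Lau n) :
    layerForm p x = (p.1 * invert x.2 + p.2 * invert x.1).coeff 0 := rfl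

open Classical in
theorem PData.toricLayers_form {n : ℕ} (Q : PData n) (a b : Plane) (θ : Q.T →+ ℤ)
    (p x : Lau n × Lau n) :
    (Q.toricLayers a θ).form b p x = if b = a then layerForm p x else 0 := by
  by_cases h : b = a
  · rw [if_pos h]
    simp only [PData.toricLayers, if_pos h]
    rfl
  · rw [if_neg h]
    simp only [PData.toricLayers, if_neg h]
    rfl

theorem T_smul_eq_iff {n : ℕ} (hn : 1 < n) (k : ℤ) :
    (T k : Lau n) • ((1, 0) : Lau n × Lau n) = (1, 0) ↔ k = 0 := by
  have : Fact (1 < n) := ⟨hn⟩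
  constructor
  · intro h
    by_contra hk
    have h1 : (C 1 * T k : Lau n) * 1 = 1 := by
      rw [map_one, one_mul]
      exact congrArg Prod.fst h
    exact one_ne_zero (lau_eq_zero_of_T_sub_one_mul hk isUnit_one h1)
  · rintro rfl
    rw [T_zero, one_smul]

theorem PData.kerPlane_mem_toricLayers_A {n : ℕ} (hn : 1 < n) (Q : PData n)
    (hT : Nonempty (Q.T ≃+ (Fin 3 → ℤ))) (a : Plane) (θ : Q.T →+ ℤ) (hθ : ∃ g, θ g ≠ 0) :
    kerPlane Q.η θ ∈ (Q.toricLayers a θ).A := by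
  obtain ⟨_, _, h3⟩ := free_int_of_equiv hT
  have hs : (Q.toricLayers a θ).stab ((1, 0) : Lau n × Lau n) = θ.ker := by
    ext g
    exact T_smul_eq_iff hn (θ g)
  refine ⟨((1, 0) : Lau n × Lau n), ?_, ?_⟩
  · have h4 := (nonempty_equiv_iff_finrank θ.ker 2).2 (by
      have := finrank_ker_add_one θ hθ
      simp only [Nat.card_eq_fintype_card, Fintype.card_fin] at h3
      omega)
    change Nonempty ((Q.toricLayers a θ).stab _ ≃+ _)
    rw [hs]
    exact h4
  · exact congrArg (fun H : AddSubgroup Q.T => Submodule.span ℝ (Q.η '' (H : Set Q.T))) hs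

open Classical in
/-- `R` toric code layers for each `a`. -/
def toricStack {n : ℕ} (Q : PData n) {α : Type} [Fintype α] (pl : α → Plane) (θ : α → Q.T →+ ℤ)
    (R : ℕ) : PData n where
  T := Q.T
  S := (Σ _ : α, Fin R) → Lau n × Lau n
  act g := LinearMap.pi fun k => (Algebra.lsmul (ZMod n) (ZMod n) (Lau n × Lau n)
    (T (θ k.1 g) : Lau n)).comp (LinearMap.proj k)
  act_zero := LinearMap.ext fun x => funext fun k => by simp
  act_add g h := LinearMap.ext fun x => funext fun k => by
    change (T (θ k.1 (g + h)) : Lau n) • x k = (T (θ k.1 g) : Lau n) • (T (θ k.1 h) : Lau n) • x k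
    rw [map_add, T_add, mul_smul]
  η := Q.η
  normal := Q.normal
  form b p := ∑ k, if b = pl k.1 then (layerForm (p k)).comp (LinearMap.proj k) else 0

theorem eq_top_of_single_mem {n : ℕ} {κ : Type} [Fintype κ] [DecidableEq κ]
    (U : Submodule (ZMod n) (κ → Lau n × Lau n))
    (h₁ : ∀ k j, Pi.single k ((T j, 0) : Lau n × Lau n) ∈ U)
    (h₂ : ∀ k j, Pi.single k ((0, T j) : Lau n × Lau n) ∈ U) : U = ⊤ := by
  have key₁ : ∀ k (f : Lau n), Pi.single k ((f, 0) : Lau n × Lau n) ∈ U := by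
    intro k f
    induction f using LaurentPolynomial.induction_on' with
    | add p q hp hq =>
      have := Submodule.add_mem _ hp hq
      rw [← Pi.single_add (f := fun _ : κ => Lau n × Lau n)] at this
      simpa using this
    | C_mul_T j c =>
      have h3 := Submodule.smul_mem U c (h₁ k j)
      rw [← Pi.single_smul (f := fun _ : κ => Lau n × Lau n)] at h3
      simpa [smul_eq_C_mul] using h3
  have key₂ : ∀ k (f : Lau n), Pi.single k ((0, f) : Lau n × Lau n) ∈ U := by
    intro k f
    induction f using LaurentPolynomial.induction_on' with
    | add p q hp hq =>
      have := Submodule.add_mem _ hp hq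
      rw [← Pi.single_add (f := fun _ : κ => Lau n × Lau n)] at this
      simpa using this
    | C_mul_T j c =>
      have h3 := Submodule.smul_mem U c (h₂ k j)
      rw [← Pi.single_smul (f := fun _ : κ => Lau n × Lau n)] at h3
      simpa [smul_eq_C_mul] using h3
  rw [eq_top_iff]
  intro x _
  rw [← Finset.univ_sum_single x]
  refine Submodule.sum_mem _ fun k _ => ?_
  have h5 := Submodule.add_mem _ (key₁ k (x k).1) (key₂ k (x k).2)
  rw [← Pi.single_add (f := fun _ : κ => Lau n × Lau n)] at h5
  simpa using h5

section ToricStack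

variable {n : ℕ} (Q : PData n) {α : Type} [Fintype α] (pl : α → Plane) (θ : α → Q.T →+ ℤ) (R : ℕ)

theorem toricStack_act (g : Q.T) (x : (Σ _ : α, Fin R) → Lau n × Lau n) (k : Σ _ : α, Fin R) :
    ((toricStack Q pl θ R).act g x : (Σ _ : α, Fin R) → Lau n × Lau n) k =
      (T (θ k.1 g) : Lau n) • x k := rfl

variable {pl}

theorem toricStack_form (hpl : Function.Injective pl) (a : α)
    (p x : (Σ _ : α, Fin R) → Lau n × Lau n) :
    (toricStack Q pl θ R).form (pl a) p x = ∑ j, layerForm (p ⟨a, j⟩) (x ⟨a, j⟩) := by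
  classical
  have h1 : (toricStack Q pl θ R).form (pl a) p x =
      ∑ k : Σ _ : α, Fin R, if a = k.1 then layerForm (p k) (x k) else 0 := by
    have h2 := LinearMap.sum_apply (Finset.univ : Finset (Σ _ : α, Fin R))
      (fun k => if pl a = pl k.1 then (layerForm (p k)).comp (LinearMap.proj k) else 0) x
    refine h2.trans (Finset.sum_congr rfl fun k _ => ?_)
    by_cases h : a = k.1
    · rw [if_pos h, if_pos (congrArg pl h)]
      rfl
    · rw [if_neg h, if_neg fun he => h (hpl he)]
      rfl
  rw [h1, Fintype.sum_sigma, Finset.sum_eq_single a]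
  · simp
  · intro b _ hb
    simp [Ne.symm hb]
  · simp

/-- A stack of toric code layers in terms of its plane charges. -/
def toricStackModel (hn : 1 < n) (hR : 0 < R) (hT : Nonempty (Q.T ≃+ (Fin 3 → ℤ)))
    (hη : IsLatticeEmbedding Q.η) (hθ : ∀ a, Function.Surjective (θ a))
    (hind : ∀ a b, a ≠ b → ∃ g, θ a g = 0 ∧ θ b g ≠ 0) (hpl : ∀ a, pl a = kerPlane Q.η (θ a))
    (hinj : Function.Injective pl) :
    ChargeModel (toricStack Q pl θ R) R α where
  θ := θ
  sgn _ _ := 1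
  c a := LinearMap.pi fun j => LinearMap.proj (⟨a, j⟩ : Σ _ : α, Fin R)
  Δ _ _ := 1
  one_lt := hn
  pos := hR
  lattice := hT
  embedding := hη
  surj := hθ
  indep := hind
  sgn_sq _ _ := one_mul 1
  c_act a g x k := by
    rw [map_one, one_mul]
    rfl
  inj x hx := funext fun k => congrFun (hx k.1) k.2
  surj_c a f := by
    classical
    refine ⟨fun k => if k.1 = a then f k.2 else 0, ?_⟩
    funext j
    exact if_pos rfl
  Δ_reg a k f hf := by rwa [one_mul] at hf
  planon a p hp := ⟨fun j => (p ⟨a, j⟩).1, fun j => (p ⟨a, j⟩).2, fun k => by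
    rw [map_one, one_mul, one_mul]
    rfl⟩
  exists_planon a u v := by
    classical
    refine ⟨fun k => if k.1 = a then (u k.2, v k.2) else 0, fun b hb => ?_, fun k => ?_⟩
    · funext j
      exact if_neg hb
    · rw [map_one, one_mul, one_mul]
      exact if_pos rfl
  form_eq a p x u v hp hc := by
    have h1 : (toricStack Q pl θ R).form (pl a) p x = _ := toricStack_form Q θ R hinj a p x
    rw [hpl a] at h1
    refine h1.trans ?_
    rw [AddMonoidAlgebra.coeff_sum, Finsupp.finsetSum_apply]
    refine Finset.sum_congr rfl fun k _ => ?_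
    have h2 : p ⟨a, k⟩ = (u k, v k) := by
      have := hc k
      rw [map_one, one_mul, one_mul] at this
      exact this
    rw [layerForm_apply, h2]
    rfl

theorem toricStack_fg (hθ : ∀ a, Function.Surjective (θ a)) :
    ∃ G : Finset (toricStack Q pl θ R).S, Submodule.span (ZMod n)
      {y | ∃ g, ∃ x ∈ G, y = (toricStack Q pl θ R).act g x} = ⊤ := by
  classical
  let e₁ : (Σ _ : α, Fin R) → (toricStack Q pl θ R).S :=
    fun k => (Pi.single k (1, 0) : (Σ _ : α, Fin R) → Lau n × Lau n)
  let e₂ : (Σ _ : α, Fin R) → (toricStack Q pl θ R).S :=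
    fun k => (Pi.single k (0, 1) : (Σ _ : α, Fin R) → Lau n × Lau n)
  refine ⟨Finset.univ.image e₁ ∪ Finset.univ.image e₂, ?_⟩
  have hact : ∀ k g (z : Lau n × Lau n), (toricStack Q pl θ R).act g
      (Pi.single k z : (Σ _ : α, Fin R) → Lau n × Lau n) =
        (Pi.single k ((T (θ k.1 g) : Lau n) • z) : (Σ _ : α, Fin R) → Lau n × Lau n) := by
    intro k g z
    refine funext fun l => (toricStack_act Q pl θ R _ _ _).trans ?_
    by_cases hl : l = k
    · subst hl
      rw [Pi.single_eq_same, Pi.single_eq_same]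
    · rw [Pi.single_eq_of_ne hl, Pi.single_eq_of_ne hl, smul_zero]
  refine eq_top_of_single_mem (κ := Σ _ : α, Fin R) _ (fun k j => ?_) fun k j => ?_
  · obtain ⟨g, hg⟩ := hθ k.1 j
    refine Submodule.subset_span (M := (toricStack Q pl θ R).S) ⟨g, e₁ k, Finset.mem_union_left _
      (Finset.mem_image_of_mem _ (Finset.mem_univ k)), ?_⟩
    refine Eq.trans ?_ (hact k g (1, 0)).symm
    rw [hg]
    simp
    rfl
  · obtain ⟨g, hg⟩ := hθ k.1 j
    refine Submodule.subset_span (M := (toricStack Q pl θ R).S) ⟨g, e₂ k, Finset.mem_union_right _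
      (Finset.mem_image_of_mem _ (Finset.mem_univ k)), ?_⟩
    refine Eq.trans ?_ (hact k g (0, 1)).symm
    rw [hg]
    simp
    rfl

theorem toricStack_isStackOf (hn : 1 < n) (hT : Nonempty (Q.T ≃+ (Fin 3 → ℤ)))
    (hθ : ∀ a, Function.Surjective (θ a)) (hpl : ∀ a, pl a = kerPlane Q.η (θ a)) :
    (toricStack Q pl θ R).IsStackOf fun i : (Σ _ : α, Fin R) =>
      Q.toricLayers (pl i.1) (θ i.1) := by
  classical
  refine ⟨fun i => AddEquiv.refl Q.T, LinearEquiv.refl (ZMod n) ((Σ _ : α, Fin R) → Lau n × Lau n),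
    fun i g => rfl, fun g x i => rfl, fun i a ha => rfl, fun a ha p hp x => ?_⟩
  rw [finsum_eq_sum_of_fintype]
  have h2 := LinearMap.sum_apply (Finset.univ : Finset (Σ _ : α, Fin R))
    (fun k => if a = pl k.1 then
      (layerForm ((p : (Σ _ : α, Fin R) → Lau n × Lau n) k)).comp (LinearMap.proj k) else 0) x
  refine h2.trans (Finset.sum_congr rfl fun k _ => ?_)
  change _ = if a ∈ (Q.toricLayers (pl k.1) (θ k.1)).A then
    (Q.toricLayers (pl k.1) (θ k.1)).form a ((p : (Σ _ : α, Fin R) → Lau n × Lau n) k)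
      ((x : (Σ _ : α, Fin R) → Lau n × Lau n) k) else 0
  rw [PData.toricLayers_form]
  by_cases h : a = pl k.1
  · rw [if_pos h, if_pos h, if_pos]
    · rfl
    · rw [h]
      obtain ⟨g, hg⟩ := hθ k.1 1
      have h3 := PData.kerPlane_mem_toricLayers_A hn Q hT (pl k.1) (θ k.1)
        ⟨g, by rw [hg]; exact one_ne_zero⟩
      rwa [← hpl] at h3
  · rw [if_neg h, if_neg h, ite_self]
    rfl

end ToricStack

open LaurentPolynomial

theorem PData.scale_A {n : ℕ} (P : PData n) {m : ℕ} (hm : m ≠ 0) : (P.scale m).A = P.A := by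
  have h : ∀ x : P.S, (P.scale m).orientation x = P.orientation x := by
    intro x
    have hm' : (m : ℝ) ≠ 0 := Nat.cast_ne_zero.2 hm
    refine le_antisymm (Submodule.span_le.2 ?_) (Submodule.span_le.2 ?_)
    · rintro _ ⟨g, hg, rfl⟩
      exact Submodule.smul_of_tower_mem _ m (Submodule.subset_span ⟨g, hg, rfl⟩)
    · rintro _ ⟨g, hg, rfl⟩
      have h1 : (m : ℝ)⁻¹ • (m • P.η g) ∈ (P.scale m).orientation x :=
        Submodule.smul_mem _ _ (Submodule.subset_span ⟨g, hg, rfl⟩)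
      rwa [← Nat.cast_smul_eq_nsmul ℝ, smul_smul, inv_mul_cancel₀ hm', one_smul] at h1
  ext a
  exact exists_congr fun x => and_congr Iff.rfl (Eq.congr_left (h x))

/-- Division of multiples of translations. -/
def multiplesEquiv {n : ℕ} (P : PData n) (hT : Nonempty (P.T ≃+ (Fin 3 → ℤ))) (m : ℕ) (hm : m ≠ 0) :
    P.T ≃+ P.multiples m :=
  AddMonoidHom.ofInjective (f := (nsmulAddMonoidHom m : P.T →+ P.T)) (by
    obtain ⟨e⟩ := hT
    intro g h hgh
    have h1 : m • e g = m • e h := by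
      rw [← map_nsmul, ← map_nsmul]
      exact congrArg e hgh
    exact e.injective (nsmul_right_injective hm h1))

namespace ChargeModel

variable {n r : ℕ} {P : PData n} {ι : Type} (M : ChargeModel P r ι) {N : ℕ}
  (D : ∀ i k, LayerSplit n N (M.Δ i k))

/-- The plane charges of the layers that split off. -/
def layerCharge (i : ι) : P.S →ₗ[ZMod n] (Fin (r * N) → Lau n × Lau n) :=
  LinearMap.pi fun j => LinearMap.prod
    (LinearMap.proj (finProdFinEquiv.symm j).2 ∘ₗ LinearMap.snd _ _ _ ∘ₗ
      (D i (finProdFinEquiv.symm j).1).E.toLinearMap ∘ₗ LinearMap.fst _ _ _ ∘ₗ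
        LinearMap.proj (finProdFinEquiv.symm j).1 ∘ₗ M.c i)
    (LinearMap.proj (finProdFinEquiv.symm j).2 ∘ₗ LinearMap.snd _ _ _ ∘ₗ
      (D i (finProdFinEquiv.symm j).1).G.toLinearMap ∘ₗ LinearMap.snd _ _ _ ∘ₗ
        LinearMap.proj (finProdFinEquiv.symm j).1 ∘ₗ M.c i)

theorem layerCharge_apply (i : ι) (x : P.S) (j : Fin (r * N)) : M.layerCharge D i x j =
    (((D i (finProdFinEquiv.symm j).1).E (M.c i x (finProdFinEquiv.symm j).1).1).2
        (finProdFinEquiv.symm j).2,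
      ((D i (finProdFinEquiv.symm j).1).G (M.c i x (finProdFinEquiv.symm j).1).2).2
        (finProdFinEquiv.symm j).2) := rfl

theorem layerCharge_finProd (i : ι) (x : P.S) (k : Fin r) (j : Fin N) :
    M.layerCharge D i x (finProdFinEquiv (k, j)) =
      (((D i k).E (M.c i x k).1).2 j, ((D i k).G (M.c i x k).2).2 j) := by
  rw [layerCharge_apply, Equiv.symm_apply_apply]

/-- The plane charges of the scaled copy that splits off. -/
def copyCharge (i : ι) : P.S →ₗ[ZMod n] (Fin r → Lau n × Lau n) :=
  LinearMap.pi fun k => LinearMap.prod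
    (LinearMap.fst _ _ _ ∘ₗ (D i k).E.toLinearMap ∘ₗ LinearMap.fst _ _ _ ∘ₗ
      LinearMap.proj k ∘ₗ M.c i)
    (LinearMap.fst _ _ _ ∘ₗ (D i k).G.toLinearMap ∘ₗ LinearMap.snd _ _ _ ∘ₗ
      LinearMap.proj k ∘ₗ M.c i)

theorem copyCharge_apply (i : ι) (x : P.S) (k : Fin r) : M.copyCharge D i x k =
    (((D i k).E (M.c i x k).1).1, ((D i k).G (M.c i x k).2).1) := rfl

theorem exists_copy [Finite ι] (x : P.S) : ∃ y, ∀ i, M.c i y = M.copyCharge D i x := by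
  obtain ⟨z, hz⟩ := M.exists_of_dvd (fun i => M.c i x - M.copyCharge D i x) fun i k =>
    ⟨(D i k).E_dvd _, (D i k).G_dvd _⟩
  exact ⟨x - z, fun i => by rw [map_sub, hz, sub_sub_cancel]⟩

theorem ext_charge {x y : P.S} (h : ∀ i, M.c i x = M.c i y) : x = y := by
  rw [← sub_eq_zero]
  refine M.inj _ fun i => ?_
  rw [map_sub, h, sub_self]

/-- The sector of the scaled copy. -/
def copy [Finite ι] : P.S →ₗ[ZMod n] P.S where
  toFun x := (M.exists_copy D x).choose
  map_add' x y := M.ext_charge fun i => by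
    rw [(M.exists_copy D (x + y)).choose_spec, map_add, map_add,
      (M.exists_copy D x).choose_spec, (M.exists_copy D y).choose_spec]
  map_smul' c x := M.ext_charge fun i => by
    rw [(M.exists_copy D (c • x)).choose_spec, map_smul, map_smul,
      (M.exists_copy D x).choose_spec, RingHom.id_apply]

theorem c_copy [Finite ι] (x : P.S) (i : ι) : M.c i (M.copy D x) = M.copyCharge D i x :=
  (M.exists_copy D x).choose_spec i

/-- The decomposition of sectors into a scaled copy and layers. -/
def splitEquiv [Finite ι] {α : Type} (f : α ≃ ι) :
    P.S ≃ₗ[ZMod n] P.S × ((Σ _ : α, Fin (r * N)) → Lau n × Lau n) :=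
  LinearEquiv.ofBijective ((M.copy D).prod
    (LinearMap.pi fun k => LinearMap.proj k.2 ∘ₗ M.layerCharge D (f k.1))) (by
    constructor
    · rw [injective_iff_map_eq_zero]
      intro x hx
      refine M.inj x fun i => ?_
      obtain ⟨a, rfl⟩ := f.surjective i
      have h1 : M.copyCharge D (f a) x = 0 := by
        rw [← M.c_copy, show M.copy D x = 0 from congrArg Prod.fst hx, map_zero]
      have h2 : M.layerCharge D (f a) x = 0 := funext fun j =>
        congrFun (congrArg Prod.snd hx) (⟨a, j⟩ : Σ _ : α, Fin (r * N))
      funext k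
      have h3 := congrFun h1 k
      rw [copyCharge_apply, Pi.zero_apply] at h3
      have h4 : ∀ j, ((D (f a) k).E (M.c (f a) x k).1).2 j = 0 ∧ ((D (f a) k).G (M.c (f a) x k).2).2 j = 0 := by
        intro j
        have := congrFun h2 (finProdFinEquiv (k, j))
        rw [layerCharge_apply, Equiv.symm_apply_apply] at this
        exact ⟨congrArg Prod.fst this, congrArg Prod.snd this⟩
      refine Prod.ext ((D (f a) k).E.map_eq_zero_iff.1 ?_) ((D (f a) k).G.map_eq_zero_iff.1 ?_)
      · exact Prod.ext (Prod.ext_iff.1 h3).1 (funext fun j => (h4 j).1)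
      · exact Prod.ext (Prod.ext_iff.1 h3).2 (funext fun j => (h4 j).2)
    · rintro ⟨y, ℓ⟩
      let q : ι → Fin r → Lau n × Lau n := fun i k =>
        ((D i k).E.symm ((M.c i y k).1, fun j => (ℓ ⟨f.symm i, finProdFinEquiv (k, j)⟩).1),
          (D i k).G.symm ((M.c i y k).2, fun j => (ℓ ⟨f.symm i, finProdFinEquiv (k, j)⟩).2))
      obtain ⟨z, hz⟩ := M.exists_of_dvd (fun i => q i - M.c i y) fun i k => by
        have h1 := (D i k).E_dvd (q i k).1
        have h2 := (D i k).G_dvd (q i k).2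
        simp only [q, LinearEquiv.apply_symm_apply] at h1 h2
        exact ⟨h1, h2⟩
      have hx : ∀ i, M.c i (z + y) = q i := fun i => by rw [map_add, hz, sub_add_cancel]
      refine ⟨z + y, Prod.ext ?_ ?_⟩
      · refine M.ext_charge fun i => ?_
        refine (M.c_copy D _ i).trans (funext fun k => ?_)
        rw [copyCharge_apply, hx]
        simp only [q, LinearEquiv.apply_symm_apply]
      · funext k
        obtain ⟨i, j⟩ := k
        obtain ⟨⟨k, j⟩, rfl⟩ := finProdFinEquiv.surjective j
        refine (M.layerCharge_apply D (f i) _ _).trans ?_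
        rw [hx, Equiv.symm_apply_apply]
        simp only [q, LinearEquiv.apply_symm_apply, Equiv.symm_apply_apply])

section Translations

variable (hs : ∀ i g, M.sgn i g = 1)
include hs

theorem c_act_smul (i : ι) (g : P.T) (x : P.S) (k : Fin r) : M.c i (P.act ((N + 1) • g) x) k =
    (T (((N + 1 : ℕ) : ℤ) * M.θ i g) : Lau n) • M.c i x k := by
  rw [M.c_act, hs, map_one, one_mul, map_nsmul, nsmul_eq_mul]

theorem copy_act [Finite ι] (g : P.T) (x : P.S) :
    M.copy D (P.act ((N + 1) • g) x) = P.act g (M.copy D x) := by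
  refine M.ext_charge fun i => funext fun k => ?_
  rw [M.c_copy, copyCharge_apply, M.c_act_smul hs, Prod.smul_fst, Prod.smul_snd, smul_eq_mul,
    smul_eq_mul, (D i k).E_T, (D i k).G_T, M.c_act, hs, map_one, one_mul, M.c_copy, copyCharge_apply]
  rfl

theorem layerCharge_act (i : ι) (g : P.T) (x : P.S) (j : Fin (r * N)) :
    M.layerCharge D i (P.act ((N + 1) • g) x) j =
      (T (M.θ i g) : Lau n) • M.layerCharge D i x j := by
  rw [layerCharge_apply, M.c_act_smul hs, Prod.smul_fst, Prod.smul_snd, smul_eq_mul,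
    smul_eq_mul, LayerSplit.E_T, LayerSplit.G_T, layerCharge_apply]
  rfl

end Translations

theorem form_split [Finite ι] (i : ι) (p x : P.S) (hp : p ∈ P.Sa (M.plane i)) :
    P.form (M.plane i) p x = P.form (M.plane i) (M.copy D p) (M.copy D x) +
      ∑ j, layerForm (M.layerCharge D i p j) (M.layerCharge D i x j) := by
  have hp' := (M.mem_Sa_iff i p).1 hp
  obtain ⟨u, v, hc⟩ := M.planon i p hp'
  choose u' hu hu' using fun k => (D i k).E_mul (u k)
  choose v' hv hv' using fun k => (D i k).G_mul (v k)
  rw [M.form_eq i p x u v hp' hc, M.form_eq i (M.copy D p) (M.copy D x) u' v'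
    (fun j hj => by
      funext k
      rw [M.c_copy, copyCharge_apply, hp' j hj]
      simp)
    (fun k => by rw [M.c_copy, copyCharge_apply, hc, ← hu, ← hv])]
  rw [← finProdFinEquiv.sum_comp, Fintype.sum_prod_type, AddMonoidAlgebra.coeff_sum,
    AddMonoidAlgebra.coeff_sum, Finsupp.finsetSum_apply, Finsupp.finsetSum_apply,
    ← Finset.sum_add_distrib]
  refine Finset.sum_congr rfl fun k _ => ?_
  simp only [layerForm_apply, layerCharge_finProd, AddMonoidAlgebra.coeff_add,
    Finsupp.add_apply, Finset.sum_add_distrib, M.c_copy, copyCharge_apply, hc]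
  rw [hu', hv']
  ring

theorem admitsFoliatedRG [Finite ι] (hN : P.IsUnitNormal P.normal)
    (hs : ∀ i g, M.sgn i g = 1)
    (D : ∀ i k, LayerSplit n N (M.Δ i k)) (hN0 : 0 < N) :
    P.AdmitsFoliatedRG (N + 1) fun _ => r := by
  classical
  have hA : Finite P.A := by
    rw [M.A_eq]
    infer_instance
  have := Fintype.ofFinite P.A
  let e : ι ≃ P.A := (Equiv.ofInjective M.plane M.plane_injective).trans
    (Equiv.setCongr M.A_eq.symm)
  have he : ∀ i, (e i : Plane) = M.plane i := fun i => rfl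
  let Q := P.coarsen (P.multiples (N + 1))
  let d : P.T ≃+ Q.T := multiplesEquiv P M.lattice (N + 1) N.succ_ne_zero
  have hH : Nonempty (P.multiples (N + 1) ≃+ (Fin 3 → ℤ)) := M.lattice.map fun f => d.symm.trans f
  have hd : ∀ g, (P.multiples (N + 1)).subtype (d g) = (N + 1) • g := fun g => rfl
  have hact : ∀ g (x : P.S), Q.act g x = P.act ((N + 1) • d.symm g) x := fun g x => by
    rw [← hd, AddEquiv.apply_symm_apply]
    rfl
  let θ : P.A → Q.T →+ ℤ := fun a => (M.θ (e.symm a)).comp d.symm.toAddMonoidHom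
  have hθ_apply : ∀ a g, θ a g = M.θ (e.symm a) (d.symm g) := fun a g => rfl
  have hθ_d : ∀ a g, θ a (d g) = M.θ (e.symm a) g := fun a g => by
    rw [hθ_apply, AddEquiv.symm_apply_apply]
  have hθ : ∀ a, Function.Surjective (θ a) := fun a => (M.surj _).comp d.symm.surjective
  have hηQ : ∀ g : Q.T, Q.η g = ((N + 1 : ℕ) : ℝ) • P.η (d.symm g) := fun g => by
    rw [Nat.cast_smul_eq_nsmul, ← map_nsmul, ← hd, AddEquiv.apply_symm_apply]
    rfl
  have hmQ : ∀ a g, θ a g = 0 ↔ Q.η g ∈ (a : Plane) := by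
    intro a g
    obtain ⟨i, rfl⟩ := e.surjective a
    rw [hηQ, Submodule.smul_mem_iff _ (Nat.cast_ne_zero.2 N.succ_ne_zero), he,
      mem_kerPlane_iff M.embedding M.lattice, hθ_apply, Equiv.symm_apply_apply]
  have hembQ : IsLatticeEmbedding Q.η :=
    M.embedding.of_smul M.lattice (P.multiples (N + 1)).subtype Subtype.val_injective fun g => rfl
  have hplane : ∀ a : P.A, (a : Plane) = kerPlane Q.η (θ a) := by
    intro a
    obtain ⟨i, rfl⟩ := e.surjective a
    refine le_antisymm (Submodule.span_le.2 ?_) (Submodule.span_le.2 ?_)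
    · rintro _ ⟨g, hg, rfl⟩
      have h1 : Q.η (d g) ∈ kerPlane Q.η (θ (e i)) := Submodule.subset_span ⟨d g,
        (hθ_d (e i) g).trans ((congrArg (fun j => M.θ j g) (e.symm_apply_apply i)).trans hg), rfl⟩
      rwa [hηQ, Submodule.smul_mem_iff _ (Nat.cast_ne_zero.2 N.succ_ne_zero),
        AddEquiv.symm_apply_apply] at h1
    · rintro _ ⟨g, hg, rfl⟩
      exact (hmQ _ _).1 hg
  let ML := toricStackModel Q (pl := fun a : P.A => (a : Plane)) θ (r * N) M.one_lt
    (Nat.mul_pos M.pos hN0) hH hembQ hθ (by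
      intro a b hab
      obtain ⟨g, hg, hg'⟩ := M.indep (e.symm a) (e.symm b) (e.symm.injective.ne hab)
      exact ⟨d g, (hθ_d a g).trans hg, fun h => hg' ((hθ_d b g).symm.trans h)⟩) hplane Subtype.val_injective
  have hAL : (toricStack Q (fun a : P.A => (a : Plane)) θ (r * N)).A = P.A := by
    rw [ML.A_eq]
    refine Set.ext fun a => ⟨?_, fun ha => ⟨⟨a, ha⟩, (hplane _).symm⟩⟩
    rintro ⟨b, rfl⟩
    have h1 : ML.plane b = b := (hplane b).symm
    rw [h1]
    exact b.2
  refine ⟨toricStack Q (fun a : P.A => (a : Plane)) θ (r * N),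
    ML.isPTheory (fun a ha => hN a (hAL ▸ ha)) (toricStack_fg Q θ (r * N) hθ), ?_, θ, fun a => ⟨hθ a, hmQ a⟩,
    toricStack_isStackOf Q θ (r * N) M.one_lt hH hθ hplane⟩
  rw [PData.isStackOf_pair_iff]
  refine ⟨d.symm, AddEquiv.refl _, M.splitEquiv D e.symm, fun g => ?_, fun g => rfl, fun g x => ?_,
    fun g x => ?_, fun a _ => rfl, fun a _ => rfl, fun a ha p hp x => ?_⟩
  · rw [hηQ, Nat.cast_smul_eq_nsmul]
    rfl
  · exact (congrArg (M.copy D) (hact g x)).trans (copy_act M D hs _ _)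
  · exact funext fun k => (congrArg (fun y => M.layerCharge D (e.symm k.1) y k.2) (hact g x)).trans
      (layerCharge_act M D hs _ _ _ _)
  · have ha' : a ∈ P.A := (congrArg (fun s => a ∈ s) (coarsen_A M.lattice hH)).mp ha
    have hp' : p ∈ P.Sa a :=
      (congrArg (fun s : Submodule (ZMod n) P.S => p ∈ s) (coarsen_Sa M.lattice hH a)).mp hp
    obtain ⟨i, hi⟩ := e.surjective ⟨a, ha'⟩
    obtain rfl : M.plane i = a := congrArg Subtype.val hi
    rw [if_pos (by rw [PData.scale_A P N.succ_ne_zero]; exact ha'), if_pos (by rw [hAL]; exact ha')]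
    refine (M.form_split D i p x hp').trans (congrArg (_ + ·) ?_)
    refine Eq.trans ?_ (toricStack_form Q θ (r * N) Subtype.val_injective (e i) _ _).symm
    refine Finset.sum_congr rfl fun j _ => ?_
    have h1 : e.symm (e i) = i := e.symm_apply_apply i
    change _ = layerForm (M.layerCharge D (e.symm (e i)) p j) (M.layerCharge D (e.symm (e i)) x j)
    rw [h1]

theorem isFoliated [Finite ι] (hN : P.IsUnitNormal P.normal)
    (hs : ∀ i g, M.sgn i g = 1) (D : ∀ N i k, LayerSplit n N (M.Δ i k)) (hΔ : ∀ i k, PData.UnitEnds (M.Δ i k))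
    (hd : ∀ i k j, M.Δ i k ∣ T j - 1) : P.IsFoliated r := by
  refine ⟨M.foliationHypotheses hs hΔ, M.trivialOnC hs hd, fun m hm => ?_⟩
  obtain ⟨N, rfl⟩ : ∃ N, m = N + 1 := ⟨m - 1, by omega⟩
  exact M.admitsFoliatedRG hN hs (D N) (by omega)

theorem coeff_one_lau (k : ℤ) : (1 : Lau n).coeff k = if 0 = k then 1 else 0 := by
  rw [← T_zero, T_apply]

theorem isFoliated_of_planar [Finite ι] (hN : P.IsUnitNormal P.normal)
    (hs : ∀ i g, M.sgn i g = 1) (hΔ : ∀ i k, M.Δ i k = 1 - T 1) : P.IsFoliated r := by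
  have : Fact (1 < n) := ⟨M.one_lt⟩
  refine M.isFoliated hN hs (fun N i k => (hΔ i k) ▸ layerSplitPlanar n N) (fun i k => ?_)
    fun i k j => ?_
  · rw [hΔ]
    refine ⟨0, 1, zero_le_one, ?_, ?_, fun k hk => ?_⟩
    · simp [T_apply]
    · simp [coeff_one_lau, T_apply]
    · have h0 : (0 : ℤ) ≠ k := by omega
      have h1 : (1 : ℤ) ≠ k := by omega
      simp [coeff_one_lau, T_apply, h0, h1]
  · rw [hΔ]
    simpa using one_sub_T_dvd (n := n) 1 j

theorem isFoliated_of_one [Finite ι] (hN : P.IsUnitNormal P.normal)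
    (hs : ∀ i g, M.sgn i g = 1) (hΔ : ∀ i k, M.Δ i k = 1) : P.IsFoliated r := by
  refine M.isFoliated hN hs (fun N i k => (hΔ i k) ▸ layerSplitOne n N) (fun i k => ?_)
    fun i k j => ?_
  · rw [hΔ]
    refine ⟨0, 0, le_rfl, ?_, ?_, fun k hk => ?_⟩
    · simp
    · simp
    · have h0 : (0 : ℤ) ≠ k := by omega
      simp [coeff_one_lau, h0]
  · rw [hΔ]
    exact one_dvd _

end ChargeModel

section IntegerLattice

/-- The sum of the coefficients. -/
def augZ (G : Type) [AddCommGroup G] : AddMonoidAlgebra ℤ G →ₐ[ℤ] ℤ := AddMonoidAlgebra.lift ℤ ℤ G 1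

theorem augZ_single {G : Type} [AddCommGroup G] (g : G) (c : ℤ) :
    augZ G (AddMonoidAlgebra.single g c) = c := by
  rw [augZ, AddMonoidAlgebra.lift_single]
  simp

theorem augZ_eq_sum {G : Type} [AddCommGroup G] [Fintype G] (f : AddMonoidAlgebra ℤ G) :
    augZ G f = ∑ g, f.coeff g := by
  classical
  induction f using AddMonoidAlgebra.induction_linear with
  | zero => simp
  | add p q hp hq => simp [hp, hq, Finset.sum_add_distrib]
  | single g c =>
    rw [augZ_single]
    simp [Finsupp.single_apply]

/-- The map of group rings of a quotient. -/
def quotRing {G : Type} [AddCommGroup G] (L : AddSubgroup G) :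
    AddMonoidAlgebra ℤ G →+* AddMonoidAlgebra ℤ (G ⧸ L) :=
  AddMonoidAlgebra.mapDomainRingHom ℤ (QuotientAddGroup.mk' L)

theorem quotRing_single {G : Type} [AddCommGroup G] (L : AddSubgroup G) (g : G) (c : ℤ) :
    quotRing L (AddMonoidAlgebra.single g c) = AddMonoidAlgebra.single (QuotientAddGroup.mk' L g) c := by
  simp [quotRing]

open Classical in
theorem coeff_quotRing {G : Type} [AddCommGroup G] (L : AddSubgroup G) (D : AddMonoidAlgebra ℤ G)
    (m : G) : (quotRing L D).coeff (QuotientAddGroup.mk' L m) =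
      D.coeff.sum fun d c => if m - d ∈ L then c else 0 := by
  induction D using AddMonoidAlgebra.induction_linear with
  | zero => simp
  | add p q hp hq =>
    rw [map_add, AddMonoidAlgebra.coeff_add, Finsupp.add_apply, hp, hq, AddMonoidAlgebra.coeff_add,
      Finsupp.sum_add_index' (by simp) (by intro a b c; split_ifs <;> simp)]
  | single g c =>
    rw [quotRing_single, AddMonoidAlgebra.coeff_single, AddMonoidAlgebra.coeff_single,
      Finsupp.sum_single_index (by simp), Finsupp.single_apply]
    have : QuotientAddGroup.mk' L g = QuotientAddGroup.mk' L m ↔ m - g ∈ L := by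
      rw [QuotientAddGroup.mk'_apply, QuotientAddGroup.mk'_apply, QuotientAddGroup.eq, neg_add_eq_sub]
    simp only [this]

theorem augZ_quotRing {G : Type} [AddCommGroup G] (L : AddSubgroup G) (D : AddMonoidAlgebra ℤ G) :
    augZ _ (quotRing L D) = augZ _ D := by
  induction D using AddMonoidAlgebra.induction_linear with
  | zero => simp
  | add p q hp hq => rw [map_add, map_add, map_add, hp, hq]
  | single g c => rw [quotRing_single, augZ_single, augZ_single]

/-- The group ring of a plane lattice. -/
abbrev PlaneRing : Type := AddMonoidAlgebra ℤ (Fin 2 → ℤ)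

theorem plane_induction {p : (Fin 2 → ℤ) → Prop} (h0 : p 0) (hadd : ∀ v w, p v → p w → p (v + w))
    (hneg : ∀ v, p v → p (-v)) (hx : p ![1, 0]) (hy : p ![0, 1]) (v : Fin 2 → ℤ) : p v := by
  let H : AddSubgroup (Fin 2 → ℤ) :=
    { carrier := {v | p v}
      zero_mem' := h0
      add_mem' := fun {v w} hv hw => hadd v w hv hw
      neg_mem' := fun {v} hv => hneg v hv }
  have hv : v = v 0 • ![1, 0] + v 1 • ![0, 1] := by
    funext i
    fin_cases i <;> simp
  have : v ∈ H := by
    rw [hv]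
    exact H.add_mem (H.zsmul_mem hx _) (H.zsmul_mem hy _)
  exact this

/-- The monomial of an element of a plane lattice. -/
def pm (v : Fin 2 → ℤ) : PlaneRing := AddMonoidAlgebra.single v 1

theorem pm_add (v w : Fin 2 → ℤ) : pm (v + w) = pm v * pm w := by
  simp [pm, AddMonoidAlgebra.single_mul_single]

theorem pm_zero : pm 0 = 1 := rfl

theorem augZ_pm (v : Fin 2 → ℤ) : augZ _ (pm v) = 1 := augZ_single _ _

theorem exists_pm_sub_one (v : Fin 2 → ℤ) : ∃ α β : PlaneRing,
    pm v - 1 = α * (pm ![1, 0] - 1) + β * (pm ![0, 1] - 1) ∧ augZ _ α = v 0 ∧ augZ _ β = v 1 := by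
  induction v using plane_induction with
  | h0 => exact ⟨0, 0, by simp [pm_zero], by simp, by simp⟩
  | hadd v w hv hw =>
    obtain ⟨α, β, h1, h2, h3⟩ := hv
    obtain ⟨α', β', h1', h2', h3'⟩ := hw
    refine ⟨α + pm v * α', β + pm v * β', ?_, ?_, ?_⟩
    · rw [pm_add]
      linear_combination h1 + pm v * h1'
    · simp [h2, h2', augZ_pm]
    · simp [h3, h3', augZ_pm]
  | hneg v hv =>
    obtain ⟨α, β, h1, h2, h3⟩ := hv
    have hv : pm (-v) * pm v = 1 := by rw [← pm_add, neg_add_cancel, pm_zero]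
    refine ⟨-pm (-v) * α, -pm (-v) * β, ?_, ?_, ?_⟩
    · linear_combination hv - pm (-v) * h1
    · simp [h2, augZ_pm]
    · simp [h3, augZ_pm]
  | hx => exact ⟨1, 0, by simp, by simp, by simp⟩
  | hy => exact ⟨0, 1, by simp, by simp, by simp⟩

open Classical in
/-- A sublattice given by a matrix of positive determinant: the relations that express its
generators by those of the lattice have a determinant with all coset sums equal to `1`. -/
theorem exists_refinement (A : Matrix (Fin 2) (Fin 2) ℤ) (hA : 0 < A.det) :
    ∃ α β γ δ : PlaneRing,
      pm (fun i => A i 0) - 1 = α * (pm ![1, 0] - 1) + β * (pm ![0, 1] - 1) ∧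
      pm (fun i => A i 1) - 1 = γ * (pm ![1, 0] - 1) + δ * (pm ![0, 1] - 1) ∧
      ∀ m, ((α * δ - β * γ).coeff.sum fun d c =>
        if m - d ∈ (LinearMap.range A.mulVecLin).toAddSubgroup then c else 0) = 1 := by
  obtain ⟨α, β, h1, hα, hβ⟩ := exists_pm_sub_one fun i => A i 0
  obtain ⟨γ, δ, h2, hγ, hδ⟩ := exists_pm_sub_one fun i => A i 1
  refine ⟨α, β, γ, δ, h1, h2, fun m => ?_⟩
  set L := (LinearMap.range A.mulVecLin).toAddSubgroup with hL
  rw [← coeff_quotRing]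
  set E := quotRing L (α * δ - β * γ) with hE
  have hmem : ∀ j : Fin 2, (fun i => A i j) ∈ L := fun j =>
    ⟨Pi.single j 1, by
      rw [Matrix.mulVecLin_apply, Matrix.mulVec_single_one]
      rfl⟩
  have hone : ∀ j : Fin 2, quotRing L (pm fun i => A i j) = 1 := fun j => by
    have h0 : QuotientAddGroup.mk' L (fun i => A i j) = 0 := (QuotientAddGroup.eq_zero_iff _).2 (hmem j)
    rw [pm, quotRing_single, h0]
    rfl
  have hx : E * (quotRing L (pm ![1, 0]) - 1) = 0 := by
    have h3 : (α * δ - β * γ) * (pm ![1, 0] - 1) =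
        δ * (pm (fun i => A i 0) - 1) - β * (pm (fun i => A i 1) - 1) := by
      linear_combination -δ * h1 + β * h2
    have h4 := congrArg (quotRing L) h3
    rw [map_mul, ← hE, map_sub _ (pm _) 1, map_one] at h4
    rw [h4]
    simp only [map_mul, map_sub, map_one, hone, sub_self, mul_zero]
  have hy : E * (quotRing L (pm ![0, 1]) - 1) = 0 := by
    have h3 : (α * δ - β * γ) * (pm ![0, 1] - 1) =
        α * (pm (fun i => A i 1) - 1) - γ * (pm (fun i => A i 0) - 1) := by
      linear_combination γ * h1 - α * h2
    have h4 := congrArg (quotRing L) h3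
    rw [map_mul, ← hE, map_sub _ (pm _) 1, map_one] at h4
    rw [h4]
    simp only [map_mul, map_sub, map_one, hone, sub_self, mul_zero]
  have hinv : ∀ v, E * quotRing L (pm v) = E := by
    intro v
    induction v using plane_induction with
    | h0 => rw [pm_zero, map_one, mul_one]
    | hadd v w hv hw => rw [pm_add, map_mul, ← mul_assoc, hv, hw]
    | hneg v hv =>
      nth_rewrite 1 [← hv]
      rw [mul_assoc, ← map_mul, ← pm_add, add_neg_cancel, pm_zero, map_one, mul_one]
    | hx => linear_combination hx
    | hy => linear_combination hy
  have hconst : ∀ v, E.coeff (QuotientAddGroup.mk' L v) = E.coeff 0 := by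
    intro v
    have h3 := congrArg (fun f => f.coeff (QuotientAddGroup.mk' L v)) (hinv v)
    simp only [pm, quotRing_single] at h3
    rw [mul_comm, AddMonoidAlgebra.coeff_single_mul_apply] at h3
    simpa using h3.symm
  have hinj : Function.Injective A.mulVecLin := by
    rw [Matrix.mulVecLin, ← LinearMap.ker_eq_bot]
    exact Matrix.ker_toLin'_eq_bot_iff.2 fun v hv => by
      by_contra hne
      exact hA.ne' (Matrix.exists_mulVec_eq_zero_iff.1 ⟨v, hne, hv⟩)
  have hcard : A.det.natAbs = Nat.card ((Fin 2 → ℤ) ⧸ LinearMap.range A.mulVecLin) := by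
    rw [← Submodule.natAbs_det_equiv _ (LinearEquiv.ofInjective A.mulVecLin hinj)]
    congr 1
    rw [← LinearMap.det_toLin']
    rfl
  have hcard' : (Nat.card ((Fin 2 → ℤ) ⧸ L) : ℤ) = A.det := by
    have : Nat.card ((Fin 2 → ℤ) ⧸ L) = A.det.natAbs := hcard.symm
    rw [this]
    omega
  have hfin : Finite ((Fin 2 → ℤ) ⧸ L) := Nat.finite_of_card_ne_zero (by
    intro h0
    rw [h0] at hcard'
    simp only [Nat.cast_zero] at hcard'
    omega)
  have := Fintype.ofFinite ((Fin 2 → ℤ) ⧸ L)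
  have hsum := augZ_eq_sum E
  have hall : ∀ z, E.coeff z = E.coeff 0 := fun z => by
    obtain ⟨v, rfl⟩ := QuotientAddGroup.mk'_surjective L z
    exact hconst v
  rw [hE, augZ_quotRing, map_sub, map_mul, map_mul, hα, hβ, hγ, hδ, ← hE] at hsum
  rw [Finset.sum_congr rfl fun z _ => hall z, Finset.sum_const, Finset.card_univ,
    ← Nat.card_eq_fintype_card, nsmul_eq_mul, hcard'] at hsum
  rw [hconst]
  have hdet := Matrix.det_fin_two A
  have h5 : A.det * (E.coeff 0 - 1) = 0 := by
    linear_combination -hsum - hdet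
  rcases mul_eq_zero.1 h5 with h6 | h6
  · exact absurd h6 hA.ne'
  · exact sub_eq_zero.1 h6

end IntegerLattice

section CoeffSum

variable {n : ℕ} (H : AddSubgroup Z3)

open Classical in
/-- The sum of coefficients as a linear map. -/
def coeffSumL : GroupRing n →ₗ[ZMod n] ZMod n where
  toFun := coeffSum H
  map_add' f g := by
    rw [coeffSum, AddMonoidAlgebra.coeff_add,
      Finsupp.sum_add_index' (by simp) (by intro a b c; split_ifs <;> simp)]
    rfl
  map_smul' c f := by
    rw [coeffSum, AddMonoidAlgebra.coeff_smul, Finsupp.sum_smul_index' (by simp), RingHom.id_apply,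
      coeffSum, smul_eq_mul, Finsupp.mul_sum]
    refine Finsupp.sum_congr fun g _ => ?_
    rw [mul_ite, mul_zero, smul_eq_mul]

theorem coeffSumL_apply (f : GroupRing n) : coeffSumL H f = coeffSum H f := rfl

open Classical in
theorem coeffSum_smul_mono (c : ZMod n) (g : Z3) :
    coeffSum H (c • mono n g) = if g ∈ H then c else 0 := by
  have h1 : c • mono n g = AddMonoidAlgebra.single g c := by simp [mono]
  rw [h1, coeffSum, AddMonoidAlgebra.coeff_single, Finsupp.sum_single_index (by simp)]

open Classical in
theorem coeffSum_mono (g : Z3) : coeffSum (n := n) H (mono n g) = if g ∈ H then 1 else 0 := by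
  rw [← one_smul (ZMod n) (mono n g), coeffSum_smul_mono]

/-- Induction on elements of the group ring, by linearity from monomials. -/
theorem groupRing_linear_ext {M : Type} [AddCommGroup M] [Module (ZMod n) M]
    {φ ψ : GroupRing n →ₗ[ZMod n] M} (h : ∀ g, φ (mono n g) = ψ (mono n g)) : φ = ψ :=
  AddMonoidAlgebra.lhom_ext' fun g => LinearMap.ext_ring (h g)

open Classical in
theorem coeffSum_mono_mul {g : Z3} (hg : g ∈ H) (f : GroupRing n) :
    coeffSum H (mono n g * f) = coeffSum H f := by
  have : (coeffSumL H).comp (LinearMap.mulLeft (ZMod n) (mono n g)) = coeffSumL (n := n) H := by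
    refine groupRing_linear_ext fun k => ?_
    rw [LinearMap.comp_apply, LinearMap.mulLeft_apply, mono_mul, coeffSumL_apply, coeffSumL_apply,
      coeffSum_mono, coeffSum_mono]
    exact if_congr (add_mem_cancel_left hg) rfl rfl
  exact LinearMap.congr_fun this f

theorem coeffSum_one_sub_mono_mul {g : Z3} (hg : g ∈ H) (f : GroupRing n) :
    coeffSum H ((1 - mono n g) * f) = 0 := by
  rw [sub_mul, one_mul, ← coeffSumL_apply, map_sub, coeffSumL_apply, coeffSumL_apply,
    coeffSum_mono_mul H hg, sub_self]

end CoeffSum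

namespace CSSCode

variable {n : ℕ} (X : CSSCode n)

/-- The total eigenvalue on the excitation `x` of the stabilizers in `w` and all their translates,
as an element of the group ring. -/
def braid (w x : X.Exc) : GroupRing n := ∑ j, antipode n (w j) * x j

theorem braid_add_left (w w' x : X.Exc) : X.braid (w + w') x = X.braid w x + X.braid w' x := by
  simp [braid, add_mul, Finset.sum_add_distrib]

theorem braid_smul_left (r : GroupRing n) (w x : X.Exc) :
    X.braid (r • w) x = antipode n r * X.braid w x := by
  simp only [braid, Finset.mul_sum, Pi.smul_apply, smul_eq_mul, map_mul]
  exact Finset.sum_congr rfl fun j _ => by ring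

theorem braid_sub_left (w w' x : X.Exc) : X.braid (w - w') x = X.braid w x - X.braid w' x := by
  simp [braid, sub_mul]

theorem braid_smul_right (r : GroupRing n) (w x : X.Exc) :
    X.braid w (r • x) = r * X.braid w x := by
  simp only [braid, Finset.mul_sum, Pi.smul_apply, smul_eq_mul]
  exact Finset.sum_congr rfl fun j _ => by ring

theorem sum_coeffSum (H : AddSubgroup Z3) (w x : X.Exc) :
    ∑ j, coeffSum H (antipode n (w j) * x j) = coeffSum H (X.braid w x) := by
  rw [braid, ← coeffSumL_apply, map_sum]
  rfl

theorem eps_inl (y : X.Pauli) (j : Fin X.tZ) :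
    X.eps y (Sum.inl j) = ∑ k, X.eZ j k * y (Sum.inr k) := by
  simp [eps, epsMat, Matrix.mulVec, dotProduct, Fintype.sum_sum_type]

theorem eps_inr (y : X.Pauli) (j : Fin X.tX) :
    X.eps y (Sum.inr j) = ∑ k, X.eX j k * y (Sum.inl k) := by
  simp [eps, epsMat, Matrix.mulVec, dotProduct, Fintype.sum_sum_type]

theorem sigma_inl (w : X.Exc) (k : Fin X.q) :
    X.sigma w (Sum.inl k) = ∑ j, antipode n (X.eZ j k) * w (Sum.inl j) := by
  have h : X.sigma w = X.lam.mulVec ((X.epsMat.map (antipode n)).transpose.mulVec w) := by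
    rw [sigma, Matrix.mulVecLin_apply, Matrix.mulVec_mulVec]
  rw [h]
  simp [lam, epsMat, Matrix.mulVec, dotProduct, Fintype.sum_sum_type, Matrix.one_apply]

theorem sigma_inr (w : X.Exc) (k : Fin X.q) :
    X.sigma w (Sum.inr k) = -∑ j, antipode n (X.eX j k) * w (Sum.inr j) := by
  have h : X.sigma w = X.lam.mulVec ((X.epsMat.map (antipode n)).transpose.mulVec w) := by
    rw [sigma, Matrix.mulVecLin_apply, Matrix.mulVec_mulVec]
  rw [h]
  simp [lam, epsMat, Matrix.mulVec, dotProduct, Fintype.sum_sum_type, Matrix.one_apply]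

/-- Moving `e` around the parallelogram spanned by `g` and `h`, with the product `w` of stabilizers. -/
structure IsLoop (e : X.Exc) (g h : Z3) (sg sh : X.Pauli) (w : X.Exc) : Prop where
  left : X.eps sg = (mono n g - 1) • e
  right : X.eps sh = (mono n h - 1) • e
  loop : X.sigma w = (1 - mono n h) • sg - (1 - mono n g) • sh

variable {X}

theorem antipode_one_sub (g : Z3) : antipode n (1 - mono n g) = 1 - mono n (-g) := by
  rw [map_sub, map_one, antipode_mono]

namespace IsLoop

variable {e : X.Exc} {g h : Z3} {sg sh : X.Pauli} {w : X.Exc}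

theorem add_eps (L : X.IsLoop e g h sg sh w) (u : X.Pauli) :
    X.IsLoop (e + X.eps u) g h (sg + (mono n g - 1) • u) (sh + (mono n h - 1) • u) w where
  left := by rw [map_add, map_smul, L.left, smul_add]
  right := by rw [map_add, map_smul, L.right, smul_add]
  loop := by
    rw [L.loop]
    module

theorem add {e' : X.Exc} {sg' sh' : X.Pauli} {w' : X.Exc} (L : X.IsLoop e g h sg sh w)
    (L' : X.IsLoop e' g h sg' sh' w') : X.IsLoop (e + e') g h (sg + sg') (sh + sh') (w + w') where
  left := by rw [map_add, L.left, L'.left, smul_add]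
  right := by rw [map_add, L.right, L'.right, smul_add]
  loop := by
    rw [map_add, L.loop, L'.loop]
    module

theorem smul (L : X.IsLoop e g h sg sh w) (r : GroupRing n) :
    X.IsLoop (r • e) g h (r • sg) (r • sh) (r • w) where
  left := by rw [map_smul, L.left, smul_comm]
  right := by rw [map_smul, L.right, smul_comm]
  loop := by
    rw [map_smul, L.loop]
    module

theorem swap (L : X.IsLoop e g h sg sh w) : X.IsLoop e h g sh sg (-w) where
  left := L.right
  right := L.left
  loop := by
    rw [map_neg, L.loop]
    module

/-- The loop operator is determined up to a product of stabilizers that does not contribute. -/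
theorem unique (hinj : Function.Injective X.sigma) (hex : Function.Exact X.sigma X.eps)
    {sg' sh' : X.Pauli} {w' : X.Exc} {H : AddSubgroup Z3} (hg : g ∈ H) (hh : h ∈ H)
    (L : X.IsLoop e g h sg sh w) (L' : X.IsLoop e g h sg' sh' w') (x : X.Exc) :
    coeffSum H (X.braid w x) = coeffSum H (X.braid w' x) := by
  obtain ⟨u, hu⟩ := (hex (sg - sg')).1 (by rw [map_sub, L.left, L'.left, sub_self])
  obtain ⟨v, hv⟩ := (hex (sh - sh')).1 (by rw [map_sub, L.right, L'.right, sub_self])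
  have h1 : w - w' = (1 - mono n h) • u - (1 - mono n g) • v := by
    apply hinj
    rw [map_sub, map_sub, map_smul, map_smul, hu, hv, L.loop, L'.loop]
    module
  rw [← sub_eq_zero, ← coeffSumL_apply, ← coeffSumL_apply, ← map_sub, ← braid_sub_left, h1,
    braid_sub_left, braid_smul_left, braid_smul_left, antipode_one_sub, antipode_one_sub, map_sub,
    coeffSumL_apply, coeffSumL_apply, coeffSum_one_sub_mono_mul H (H.neg_mem hh),
    coeffSum_one_sub_mono_mul H (H.neg_mem hg), sub_self]

end IsLoop

/-- The embedding of a plane lattice with generators `g` and `h`. -/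
def planeMap (g h : Z3) : (Fin 2 → ℤ) →+ Z3 where
  toFun v := v 0 • g + v 1 • h
  map_zero' := by simp
  map_add' v w := by
    simp only [Pi.add_apply, add_smul]
    abel

theorem planeMap_apply (g h : Z3) (v : Fin 2 → ℤ) : planeMap g h v = v 0 • g + v 1 • h := rfl

/-- The map from the group ring of a plane lattice. -/
def planeRingHom (n : ℕ) (g h : Z3) : PlaneRing →ₐ[ℤ] GroupRing n :=
  AddMonoidAlgebra.lift ℤ (GroupRing n) (Fin 2 → ℤ)
    { toFun := fun v => mono n (planeMap g h v.toAdd)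
      map_one' := by simp [mono_zero]
      map_mul' := by
        intro v w
        rw [toAdd_mul, map_add, mono_mul] }

theorem planeRingHom_single (g h : Z3) (v : Fin 2 → ℤ) (c : ℤ) :
    planeRingHom n g h (AddMonoidAlgebra.single v c) = (c : ZMod n) • mono n (planeMap g h v) := by
  rw [planeRingHom, AddMonoidAlgebra.lift_single, Int.cast_smul_eq_zsmul]
  rfl

theorem planeRingHom_pm (g h : Z3) (v : Fin 2 → ℤ) :
    planeRingHom n g h (pm v) = mono n (planeMap g h v) := by
  rw [pm, planeRingHom_single, Int.cast_one, one_smul]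

theorem mem_closure_pair_iff (g h m : Z3) :
    m ∈ AddSubgroup.closure {g, h} ↔ ∃ v, planeMap g h v = m := by
  rw [AddSubgroup.mem_closure_pair]
  constructor
  · rintro ⟨a, b, rfl⟩
    exact ⟨![a, b], by simp [planeMap_apply]⟩
  · rintro ⟨v, rfl⟩
    exact ⟨v 0, v 1, rfl⟩

open Classical in
theorem coeffSum_antipode_planeRingHom (g h : Z3) (H : AddSubgroup Z3) (D : PlaneRing) (m : Z3) :
    coeffSum H (antipode n (planeRingHom n g h D) * mono n m) =
      ((D.coeff.sum fun d c => if m - planeMap g h d ∈ H then c else 0 : ℤ) : ZMod n) := by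
  induction D using AddMonoidAlgebra.induction_linear with
  | zero => rw [map_zero, map_zero, zero_mul, ← coeffSumL_apply]; simp
  | add p q hp hq =>
    rw [map_add, map_add, add_mul, ← coeffSumL_apply, map_add, coeffSumL_apply, coeffSumL_apply, hp,
      hq, AddMonoidAlgebra.coeff_add,
      Finsupp.sum_add_index' (by simp) (by intro a b c; split_ifs <;> simp), Int.cast_add]
  | single v c =>
    rw [planeRingHom_single, map_smul, antipode_mono, smul_mul_assoc, mono_mul, coeffSum_smul_mono,
      AddMonoidAlgebra.coeff_single, Finsupp.sum_single_index (by simp), neg_add_eq_sub]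
    split_ifs <;> simp

/-- Loops that are multiples of a given one. -/
theorem IsLoop.refine {e : X.Exc} {g h : Z3} {sg sh : X.Pauli} {w : X.Exc}
    (L : X.IsLoop e g h sg sh w) (hind : Function.Injective (planeMap g h))
    (A : Matrix (Fin 2) (Fin 2) ℤ) (hA : 0 < A.det) {g' h' : Z3}
    (hg' : g' = planeMap g h fun i => A i 0) (hh' : h' = planeMap g h fun i => A i 1) :
    ∃ sg' sh' w', X.IsLoop e g' h' sg' sh' w' ∧
      ∀ x, coeffSum (AddSubgroup.closure {g', h'}) (X.braid w' x) =
        coeffSum (AddSubgroup.closure {g, h}) (X.braid w x) := by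
  classical
  obtain ⟨α, β, γ, δ, h1, h2, h3⟩ := exists_refinement A hA
  have k1 := congrArg (planeRingHom n g h) h1
  have k2 := congrArg (planeRingHom n g h) h2
  have e1 : planeMap g h ![1, 0] = g := by simp [planeMap_apply]
  have e2 : planeMap g h ![0, 1] = h := by simp [planeMap_apply]
  simp only [map_add, map_sub, map_mul, map_one, planeRingHom_pm, e1, e2, ← hg', ← hh'] at k1 k2
  set ρ := planeRingHom n g h
  refine ⟨ρ α • sg + ρ β • sh, ρ γ • sg + ρ δ • sh, ρ (α * δ - β * γ) • w,
    ⟨?_, ?_, ?_⟩, fun x => ?_⟩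
  · rw [map_add, map_smul, map_smul, L.left, L.right, k1]
    module
  · rw [map_add, map_smul, map_smul, L.left, L.right, k2]
    module
  · have k1' : 1 - mono n g' = -(ρ α * (mono n g - 1) + ρ β * (mono n h - 1)) := by rw [← k1]; ring
    have k2' : 1 - mono n h' = -(ρ γ * (mono n g - 1) + ρ δ * (mono n h - 1)) := by rw [← k2]; ring
    rw [map_smul, L.loop, k1', k2', map_sub, map_mul, map_mul]
    module
  · rw [braid_smul_left]
    generalize X.braid w x = f
    have : (coeffSumL (AddSubgroup.closure {g', h'})).comp
        (LinearMap.mulLeft (ZMod n) (antipode n (ρ (α * δ - β * γ)))) =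
          coeffSumL (AddSubgroup.closure {g, h}) := by
      refine groupRing_linear_ext fun m => ?_
      rw [LinearMap.comp_apply, LinearMap.mulLeft_apply, coeffSumL_apply, coeffSumL_apply,
        coeffSum_antipode_planeRingHom, coeffSum_mono]
      have hsub : ∀ v, planeMap g h v ∈ AddSubgroup.closure {g', h'} ↔
          v ∈ (LinearMap.range A.mulVecLin).toAddSubgroup := by
        intro v
        rw [mem_closure_pair_iff]
        have hmap : ∀ u, planeMap g' h' u = planeMap g h (A.mulVecLin u) := by
          intro u
          rw [hg', hh', planeMap_apply, planeMap_apply, planeMap_apply, planeMap_apply,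
            Matrix.mulVecLin_apply]
          simp only [Matrix.mulVec, dotProduct, Fin.sum_univ_two]
          module
        constructor
        · rintro ⟨u, hu⟩
          exact ⟨u, hind (by rw [← hu, hmap])⟩
        · rintro ⟨u, rfl⟩
          exact ⟨u, hmap u⟩
      by_cases hm : m ∈ AddSubgroup.closure {g, h}
      · rw [if_pos hm]
        obtain ⟨v, rfl⟩ := (mem_closure_pair_iff g h m).1 hm
        simp only [← map_sub, hsub]
        rw [h3 v, Int.cast_one]
      · rw [if_neg hm, Finsupp.sum, Finset.sum_eq_zero, Int.cast_zero]
        intro d _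
        rw [if_neg]
        intro hd
        apply hm
        have hle : AddSubgroup.closure {g', h'} ≤ AddSubgroup.closure {g, h} := by
          rw [AddSubgroup.closure_le]
          rintro _ (rfl | rfl)
          · exact (mem_closure_pair_iff g h _).2 ⟨_, hg'.symm⟩
          · exact (mem_closure_pair_iff g h _).2 ⟨_, hh'.symm⟩
        have := add_mem (hle hd) ((mem_closure_pair_iff g h _).2 ⟨d, rfl⟩)
        rwa [sub_add_cancel] at this
    exact LinearMap.congr_fun this f

end CSSCode

namespace CSSCode

/-- The oriented volume spanned by the normal vector and two translations. -/
def vol (η : Z3 →+ E3) (N : E3) (g h : Z3) : ℝ :=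
  (Matrix.of ![(fun i => N i), (fun i => η g i), (fun i => η h i)]).det

theorem vol_planeMap (η : Z3 →+ E3) (N : E3) (g h : Z3) (u v : Fin 2 → ℤ) :
    vol η N (planeMap g h u) (planeMap g h v) =
      ((u 0 * v 1 - v 0 * u 1 : ℤ) : ℝ) * vol η N g h := by
  have h1 : ∀ (w : Fin 2 → ℤ) (i : Fin 3),
      η (planeMap g h w) i = (w 0 : ℝ) * η g i + (w 1 : ℝ) * η h i := by
    intro w i
    rw [planeMap_apply, map_add, map_zsmul, map_zsmul, ← Int.cast_smul_eq_zsmul ℝ (w 0),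
      ← Int.cast_smul_eq_zsmul ℝ (w 1)]
    rfl
  simp only [vol, Matrix.det_fin_three, Matrix.of_apply, Matrix.cons_val, h1]
  push_cast
  ring

theorem vol_swap (η : Z3 →+ E3) (N : E3) (g h : Z3) : vol η N h g = -vol η N g h := by
  simp only [vol, Matrix.det_fin_three, Matrix.of_apply, Matrix.cons_val]
  ring

theorem injective_planeMap_of_vol {η : Z3 →+ E3} {N : E3} {g h : Z3} (hv : vol η N g h ≠ 0) :
    Function.Injective (planeMap g h) := by
  rw [injective_iff_map_eq_zero]
  intro u hu
  have h1 : ∀ v : Fin 2 → ℤ, u 0 * v 1 - v 0 * u 1 = 0 := by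
    intro v
    have h2 := vol_planeMap η N g h u v
    have h3 : vol η N (planeMap g h u) (planeMap g h v) = 0 := by
      rw [hu, vol, Matrix.det_fin_three]
      simp
    rw [h3] at h2
    exact_mod_cast (mul_eq_zero.1 h2.symm).resolve_right hv
  funext i
  fin_cases i
  · simpa using h1 ![0, 1]
  · simpa using h1 ![1, 0]

theorem vol_ne_zero {η : Z3 →+ E3} (hη : IsLatticeEmbedding η) {N : E3} (hN : ‖N‖ = 1)
    {θ : Z3 →+ ℤ} (hθ : ∃ k, θ k ≠ 0) (hperp : ∀ v ∈ kerPlane η θ, inner ℝ N v = 0) {g h : Z3}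
    (hg : θ g = 0) (hh : θ h = 0) (hind : Function.Injective (planeMap g h)) : vol η N g h ≠ 0 := by
  intro hv
  obtain ⟨v, hv0, hv⟩ := Matrix.exists_vecMul_eq_zero_iff.2 hv
  have h1 : v 0 • N + v 1 • η g + v 2 • η h = 0 := by
    ext i
    have := congrFun hv i
    simpa [Matrix.vecMul, dotProduct, Fin.sum_univ_three] using this
  have hg' := hperp (η g) (Submodule.subset_span ⟨g, hg, rfl⟩)
  have hh' := hperp (η h) (Submodule.subset_span ⟨h, hh, rfl⟩)
  have h2 := congrArg (inner ℝ N) h1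
  rw [inner_add_right, inner_add_right, inner_smul_right, inner_smul_right, inner_smul_right,
    hg', hh', inner_zero_right, real_inner_self_eq_norm_sq, hN] at h2
  have h3 : v 0 = 0 := by simpa using h2
  obtain ⟨k, hk⟩ := hθ
  have hli : LinearIndependent ℤ ![k, g, h] := by
    rw [Fintype.linearIndependent_iff]
    intro c hc
    rw [Fin.sum_univ_three] at hc
    simp only [Matrix.cons_val] at hc
    have h4 := congrArg θ hc
    rw [map_add, map_add, map_zsmul, map_zsmul, map_zsmul, hg, hh, map_zero] at h4
    have h5 : c 0 = 0 := by simpa [hk] using h4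
    have h6 : planeMap g h ![c 1, c 2] = 0 := by
      rw [planeMap_apply]
      simpa [h5] using hc
    have h7 := (injective_iff_map_eq_zero _).1 hind _ h6
    intro i
    fin_cases i
    · exact h5
    · simpa using congrFun h7 0
    · simpa using congrFun h7 1
  have h8 := Fintype.linearIndependent_iff.1
    (hη.linearIndependent ⟨AddEquiv.refl Z3⟩ hli) ![0, v 1, v 2] (by
      rw [Fin.sum_univ_three]
      simp only [Matrix.cons_val, zero_smul, zero_add]
      rw [h3, zero_smul, zero_add] at h1
      exact h1)
  apply hv0
  funext i
  fin_cases i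
  · exact h3
  · simpa using h8 1
  · simpa using h8 2

theorem exists_smul_mem_closure_pair {θ : Z3 →+ ℤ} (hθ : ∃ k, θ k ≠ 0) {g h : Z3} (hg : θ g = 0)
    (hh : θ h = 0) (hind : Function.Injective (planeMap g h)) :
    ∃ N : ℕ, N ≠ 0 ∧ ∀ k, θ k = 0 → ∃ v, planeMap g h v = N • k := by
  have h1 := finrank_ker_add_one θ hθ
  rw [show Module.finrank ℤ Z3 = 3 by simp] at h1
  have h2 : Module.finrank ℤ (planeMap g h).range = 2 :=
    (nonempty_equiv_iff_finrank _ 2).1 ⟨(AddMonoidHom.ofInjective hind).symm⟩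
  obtain ⟨N, hN, hm⟩ := exists_smul_mem_of_finrank_le (M := (planeMap g h).range) (H := θ.ker) (by
    rintro _ ⟨v, rfl⟩
    rw [AddMonoidHom.mem_ker, planeMap_apply, map_add, map_zsmul, map_zsmul, hg, hh]
    simp) (by omega)
  exact ⟨N, hN, fun k hk => hm k hk⟩

variable {n : ℕ} {X : CSSCode n}

/-- The braiding phase does not depend on the choice of the loop. -/
theorem IsLoop.compare (hinj : Function.Injective X.sigma) (hex : Function.Exact X.sigma X.eps)
    {η : Z3 →+ E3} {N : E3} {θ : Z3 →+ ℤ} (hθ : ∃ k, θ k ≠ 0)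
    {e : X.Exc} {g h g' h' : Z3} {sg sh sg' sh' : X.Pauli} {w w' : X.Exc}
    (L : X.IsLoop e g h sg sh w) (L' : X.IsLoop e g' h' sg' sh' w')
    (hg : θ g = 0) (hh : θ h = 0) (hg' : θ g' = 0) (hh' : θ h' = 0)
    (hv : 0 < vol η N g h) (hv' : 0 < vol η N g' h') (x : X.Exc) :
    coeffSum (AddSubgroup.closure {g, h}) (X.braid w x) =
      coeffSum (AddSubgroup.closure {g', h'}) (X.braid w' x) := by
  have hind := injective_planeMap_of_vol hv.ne'
  obtain ⟨m, hm, hmem⟩ := exists_smul_mem_closure_pair hθ hg hh hind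
  obtain ⟨u, hu⟩ := hmem g' hg'
  obtain ⟨v, hv0⟩ := hmem h' hh'
  have hmu : ∀ k l : Z3, planeMap k l ![(m : ℤ), 0] = m • k ∧ planeMap k l ![0, (m : ℤ)] = m • l := by
    intro k l
    simp [planeMap_apply]
  have hm' : (0 : ℤ) < m := by
    have := Nat.pos_of_ne_zero hm
    exact_mod_cast this
  obtain ⟨s₁, s₂, w₁, L₁, h₁⟩ := L'.refine (injective_planeMap_of_vol hv'.ne')
    !![(m : ℤ), 0; 0, (m : ℤ)] (by
      rw [Matrix.det_fin_two_of]
      nlinarith) (g' := m • g') (h' := m • h')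
    (by
      rw [← (hmu g' h').1]
      congr 1
      funext i
      fin_cases i <;> rfl)
    (by
      rw [← (hmu g' h').2]
      congr 1
      funext i
      fin_cases i <;> rfl)
  obtain ⟨s₃, s₄, w₂, L₂, h₂⟩ := L.refine hind (Matrix.of fun i j => ![u i, v i] j) (by
      have h1 := vol_planeMap η N g h u v
      have h2 := vol_planeMap η N g' h' ![(m : ℤ), 0] ![0, (m : ℤ)]
      rw [(hmu g' h').1, (hmu g' h').2] at h2
      rw [hu, hv0, h2] at h1
      have h3 : 0 < ((u 0 * v 1 - v 0 * u 1 : ℤ) : ℝ) * vol η N g h := by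
        rw [← h1]
        refine mul_pos ?_ hv'
        have : (0 : ℤ) < ![(m : ℤ), 0] 0 * ![0, (m : ℤ)] 1 - ![0, (m : ℤ)] 0 * ![(m : ℤ), 0] 1 := by
          simpa using hm
        exact_mod_cast this
      have h4 := (pos_iff_pos_of_mul_pos h3).2 hv
      rw [Matrix.det_fin_two]
      simpa using (Int.cast_pos (R := ℝ)).1 h4) (g' := m • g') (h' := m • h')
    (by rw [← hu]; rfl) (by rw [← hv0]; rfl)
  rw [← h₁, ← h₂]
  refine IsLoop.unique hinj hex (AddSubgroup.subset_closure ?_) (AddSubgroup.subset_closure ?_) L₂ L₁ x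
  · simp
  · simp

end CSSCode

open LaurentPolynomial

theorem kerPlane_injective_of_indep {T : Type} [AddCommGroup T] {ι : Type} {η : T →+ E3}
    (hη : IsLatticeEmbedding η) (hT : Nonempty (T ≃+ (Fin 3 → ℤ))) {θ : ι → T →+ ℤ}
    (hind : ∀ i j, i ≠ j → ∃ g, θ i g = 0 ∧ θ j g ≠ 0) :
    Function.Injective fun i => kerPlane η (θ i) := by
  intro i j hij
  by_contra hne
  obtain ⟨g, hg, hg'⟩ := hind i j hne
  have h1 := (mem_kerPlane_iff hη hT (θ i) g).2 hg
  have h2 : kerPlane η (θ i) = kerPlane η (θ j) := hij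
  rw [h2] at h1
  exact hg' ((mem_kerPlane_iff hη hT (θ j) g).1 h1)

theorem proj_surjective {n : ℕ} {θ χ : Z3 →+ ℤ} (hθ : Function.Surjective θ) :
    Function.Surjective (proj n θ χ) := by
  intro f
  induction f using LaurentPolynomial.induction_on' with
  | add p q hp hq =>
    obtain ⟨a, rfl⟩ := hp
    obtain ⟨b, rfl⟩ := hq
    exact ⟨a + b, map_add _ _ _⟩
  | C_mul_T k c =>
    obtain ⟨g, rfl⟩ := hθ k
    set u : (ZMod n)ˣ := (-1) ^ χ g with hu
    refine ⟨(c * ((u⁻¹ : (ZMod n)ˣ) : ZMod n)) • mono n g, ?_⟩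
    rw [map_smul, proj_mono, smul_eq_C_mul, ← mul_assoc, ← map_mul, mul_assoc, ← hu, Units.inv_mul,
      mul_one]

namespace SeqData

variable {n : ℕ} {X : CSSCode n} (M : SeqData X)

theorem pi_smul (r : GroupRing n) (v : X.Exc) (i : Fin M.k) :
    M.pi (r • v) (Sum.inl i) = proj n (M.θ i) (M.χ i) r * M.pi v (Sum.inl i) ∧
      M.pi (r • v) (Sum.inr i) = proj n (M.θ i) (M.χ i) r * M.pi v (Sum.inr i) := by
  constructor
  · simp only [pi, Sum.elim_inl, Pi.smul_apply, smul_eq_mul, map_mul, Finset.mul_sum]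
    exact Finset.sum_congr rfl fun j _ => by ring
  · simp only [pi, Sum.elim_inr, Pi.smul_apply, smul_eq_mul, map_mul, Finset.mul_sum]
    exact Finset.sum_congr rfl fun j _ => by ring

/-- The plane charge map as a linear map. -/
def piLin : X.Exc →ₗ[ZMod n] (Fin M.k ⊕ Fin M.k → Lau n) where
  toFun := M.pi
  map_add' v w := by
    funext s
    rcases s with i | i <;> simp [pi, mul_add, Finset.sum_add_distrib]
  map_smul' c v := by
    funext s
    rcases s with i | i <;> simp [pi, Finset.smul_sum]

theorem piLin_apply (v : X.Exc) : M.piLin v = M.pi v := rfl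

end SeqData

/-- Canonical loops for the planons of each orientation of a code with an exact sequence `M`: planons
with plane charges `Δ` and its antipode generate all others, and the statistics of each is a
coefficient of the other kind of plane charge. -/
structure BraidData {n : ℕ} {X : CSSCode n} (M : SeqData X) where
  one_lt : 1 < n
  exact : M.IsExact
  surj : ∀ i, Function.Surjective (M.θ i)
  indep : ∀ i j, i ≠ j → ∃ g, M.θ i g = 0 ∧ M.θ j g ≠ 0
  Δ : Fin M.k → Lau n
  κ : Fin M.k → ℤ
  Δ_reg : ∀ i f, Δ i * f = 0 → f = 0
  surjZ : ∀ i, ∃ v, M.pi v (Sum.inl i) = 1 ∧ M.pi v (Sum.inr i) = 0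
  surjX : ∀ i, ∃ v, M.pi v (Sum.inl i) = 0 ∧ M.pi v (Sum.inr i) = 1
  dvd : ∀ i v, (∀ j, j ≠ i → M.pi v (Sum.inl j) = 0 ∧ M.pi v (Sum.inr j) = 0) →
    Δ i ∣ M.pi v (Sum.inl i) ∧ invert (Δ i) ∣ M.pi v (Sum.inr i)
  g : Fin M.k → Z3
  h : Fin M.k → Z3
  θ_g : ∀ i, M.θ i (g i) = 0
  θ_h : ∀ i, M.θ i (h i) = 0
  ind : ∀ i, Function.Injective (CSSCode.planeMap (g i) (h i))
  loopZ : ∀ i, ∃ e sg sh w, X.IsLoop e (g i) (h i) sg sh w ∧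
    M.pi e = Pi.single (Sum.inl i) (Δ i) ∧
    ∀ x, coeffSum (AddSubgroup.closure {g i, h i}) (X.braid w x) =
      (T (κ i) * M.pi x (Sum.inr i)).coeff 0
  loopX : ∀ i, ∃ e sg sh w, X.IsLoop e (g i) (h i) sg sh w ∧
    M.pi e = Pi.single (Sum.inr i) (T (-κ i) * invert (Δ i)) ∧
    ∀ x, coeffSum (AddSubgroup.closure {g i, h i}) (X.braid w x) = (M.pi x (Sum.inl i)).coeff 0

namespace BraidData

variable {n : ℕ} {X : CSSCode n} {M : SeqData X} (B : BraidData M)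

include B in
theorem pi_eq_zero_iff (v : X.Exc) : M.pi v = 0 ↔ v ∈ LinearMap.range X.eps :=
  B.exact.2.2.1 v

/-- The plane charges of a sector. -/
def piSec : X.Sec →ₗ[ZMod n] (Fin M.k ⊕ Fin M.k → Lau n) where
  toFun := Quotient.lift (fun v => M.pi v) (by
    intro a b hab
    have h1 : a - b ∈ LinearMap.range X.eps := (Submodule.quotientRel_def _).1 hab
    rw [← B.pi_eq_zero_iff, ← M.piLin_apply, map_sub, sub_eq_zero] at h1
    exact h1)
  map_add' := by
    rintro ⟨a⟩ ⟨b⟩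
    exact M.piLin.map_add a b
  map_smul' := by
    rintro c ⟨a⟩
    exact M.piLin.map_smul c a

theorem piSec_sec (v : X.Exc) : B.piSec (X.sec v) = M.pi v := rfl

theorem sec_surjective (x : X.Sec) : ∃ v, X.sec v = x := Submodule.Quotient.mk_surjective _ x

theorem piSec_injective : Function.Injective B.piSec := by
  rw [injective_iff_map_eq_zero]
  intro x hx
  obtain ⟨v, rfl⟩ := sec_surjective x
  rw [B.piSec_sec, B.pi_eq_zero_iff] at hx
  exact (Submodule.Quotient.mk_eq_zero _).2 hx

/-- The electric and magnetic plane charges, up to a sign and a translation. -/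
def charge (s : Fin M.k → ZMod n) (i : Fin M.k) : X.Sec →ₗ[ZMod n] (Fin 1 → Lau n × Lau n) :=
  LinearMap.pi fun _ => LinearMap.prod (LinearMap.proj (Sum.inl i) ∘ₗ B.piSec)
    (LinearMap.mulLeft (ZMod n) (C (s i) * T (B.κ i) : Lau n) ∘ₗ LinearMap.proj (Sum.inr i) ∘ₗ B.piSec)

theorem charge_apply (s : Fin M.k → ZMod n) (i : Fin M.k) (x : X.Sec) (k : Fin 1) :
    B.charge s i x k =
      (B.piSec x (Sum.inl i), C (s i) * T (B.κ i) * B.piSec x (Sum.inr i)) := rfl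

theorem charge_eq_zero_iff {s : Fin M.k → ZMod n} (hs : ∀ i, s i * s i = 1) (i : Fin M.k)
    (x : X.Sec) : B.charge s i x = 0 ↔ B.piSec x (Sum.inl i) = 0 ∧ B.piSec x (Sum.inr i) = 0 := by
  constructor
  · intro h0
    have h1 := congrFun h0 0
    rw [charge_apply] at h1
    obtain ⟨h2, h3⟩ := Prod.ext_iff.1 h1
    refine ⟨h2, ?_⟩
    have h4 : IsUnit (C (s i) * T (B.κ i) : Lau n) :=
      ((IsUnit.of_mul_eq_one _ (hs i)).map C).mul (isUnit_T _)
    exact (h4.mul_right_eq_zero).1 h3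
  · rintro ⟨h1, h2⟩
    funext k
    rw [charge_apply, h1, h2, mul_zero]
    rfl

theorem charge_act {s : Fin M.k → ZMod n} (i : Fin M.k) (g : Z3) (x : X.Sec) (k : Fin 1)
    (η : Z3 →+ E3) : B.charge s i ((X.fusion η).act g x) k =
      (C (((-1 : (ZMod n)ˣ) ^ M.χ i g : (ZMod n)ˣ) : ZMod n) * T (M.θ i g) : Lau n) •
        B.charge s i x k := by
  obtain ⟨v, rfl⟩ := sec_surjective x
  have h1 : (X.fusion η).act g (X.sec v) = X.sec (mono n g • v) := rfl
  rw [h1, charge_apply, charge_apply, B.piSec_sec, B.piSec_sec, (M.pi_smul _ _ _).1,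
    (M.pi_smul _ _ _).2, proj_mono]
  apply Prod.ext
  · rfl
  · simp only [Prod.smul_snd, smul_eq_mul]
    ring

/-- A sector with only one plane charge. -/
theorem exists_sec {s : Fin M.k → ZMod n} (hs : ∀ i, s i * s i = 1) (i : Fin M.k) (u v : Lau n) :
    ∃ e sg sh w, X.IsLoop e (B.g i) (B.h i) sg sh w ∧
      (∀ j, j ≠ i → B.charge s j (X.sec e) = 0) ∧
      (∀ k, B.charge s i (X.sec e) k = (B.Δ i * u, invert (B.Δ i) * v)) ∧
      ∀ x, s i * coeffSum (AddSubgroup.closure {B.g i, B.h i}) (X.braid w x) =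
        layerForm (u, v) (B.charge s i (X.sec x) 0) := by
  obtain ⟨e₁, sg₁, sh₁, w₁, L₁, hp₁, hb₁⟩ := B.loopZ i
  obtain ⟨e₂, sg₂, sh₂, w₂, L₂, hp₂, hb₂⟩ := B.loopX i
  obtain ⟨f₁, hf₁⟩ := proj_surjective (n := n) (χ := M.χ i) (B.surj i) u
  obtain ⟨f₂, hf₂⟩ := proj_surjective (n := n) (χ := M.χ i) (B.surj i) (C (s i) * v)
  have hpl : ∀ j, M.pi (f₁ • e₁ + f₂ • e₂) (Sum.inl j) =
      (Pi.single (Sum.inl i) (B.Δ i * u) : Fin M.k ⊕ Fin M.k → Lau n) (Sum.inl j) := by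
    intro j
    rw [← M.piLin_apply, map_add, Pi.add_apply, M.piLin_apply, M.piLin_apply, (M.pi_smul _ _ _).1,
      (M.pi_smul _ _ _).1, hp₁, hp₂]
    by_cases hj : j = i
    · subst hj
      have h1 : (Sum.inl j : Fin M.k ⊕ Fin M.k) ≠ Sum.inr j := Sum.inl_ne_inr
      rw [Pi.single_eq_of_ne h1, Pi.single_eq_same, Pi.single_eq_same, hf₁, mul_zero, add_zero,
        mul_comm]
    · have : (Sum.inl j : Fin M.k ⊕ Fin M.k) ≠ Sum.inl i := fun h => hj (Sum.inl_injective h)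
      simp [Pi.single_eq_of_ne this]
  have hpr : ∀ j, M.pi (f₁ • e₁ + f₂ • e₂) (Sum.inr j) =
      (Pi.single (Sum.inr i) (C (s i) * v * (T (-B.κ i) * invert (B.Δ i))) :
        Fin M.k ⊕ Fin M.k → Lau n) (Sum.inr j) := by
    intro j
    rw [← M.piLin_apply, map_add, Pi.add_apply, M.piLin_apply, M.piLin_apply, (M.pi_smul _ _ _).2,
      (M.pi_smul _ _ _).2, hp₁, hp₂]
    by_cases hj : j = i
    · subst hj
      have h1 : (Sum.inr j : Fin M.k ⊕ Fin M.k) ≠ Sum.inl j := Sum.inr_ne_inl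
      rw [Pi.single_eq_of_ne h1, Pi.single_eq_same, Pi.single_eq_same, hf₂, mul_zero, zero_add]
    · have : (Sum.inr j : Fin M.k ⊕ Fin M.k) ≠ Sum.inr i := fun h => hj (Sum.inr_injective h)
      simp [Pi.single_eq_of_ne this]
  have hss : (C (s i) : Lau n) * C (s i) = 1 := by rw [← map_mul, hs, map_one]
  refine ⟨_, _, _, _, (L₁.smul f₁).add (L₂.smul f₂), fun j hj => ?_, fun k => ?_, fun x => ?_⟩
  · rw [B.charge_eq_zero_iff hs, B.piSec_sec, hpl, hpr]
    have h1 : (Sum.inl j : Fin M.k ⊕ Fin M.k) ≠ Sum.inl i := fun h => hj (Sum.inl_injective h)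
    have h2 : (Sum.inr j : Fin M.k ⊕ Fin M.k) ≠ Sum.inr i := fun h => hj (Sum.inr_injective h)
    exact ⟨Pi.single_eq_of_ne h1 _, Pi.single_eq_of_ne h2 _⟩
  · rw [charge_apply, B.piSec_sec, hpl, hpr, Pi.single_eq_same, Pi.single_eq_same]
    refine Prod.ext rfl ?_
    have ht : (T (B.κ i) : Lau n) * T (-B.κ i) = 1 := by
      rw [← T_add, add_neg_cancel, T_zero]
    simp only
    linear_combination (T (B.κ i) * T (-B.κ i) * v * invert (B.Δ i)) * hss +
      v * invert (B.Δ i) * ht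
  · have hl : coeffSum (AddSubgroup.closure {B.g i, B.h i}) (X.braid (f₁ • w₁ + f₂ • w₂) x) =
        (invert u * (T (B.κ i) * M.pi x (Sum.inr i))).coeff 0 +
          s i * (invert v * M.pi x (Sum.inl i)).coeff 0 := by
      rw [X.braid_add_left, X.braid_smul_left, X.braid_smul_left, ← X.braid_smul_right,
        ← X.braid_smul_right, ← coeffSumL_apply, map_add, coeffSumL_apply, coeffSumL_apply, hb₁, hb₂,
        (M.pi_smul _ _ _).1, (M.pi_smul _ _ _).2, proj_antipode, proj_antipode, hf₁, hf₂, map_mul,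
        invert_C, mul_assoc, coeff_C_mul, mul_left_comm]
    rw [hl, layerForm_apply, charge_apply, B.piSec_sec]
    simp only
    have h1 : C (s i) * T (B.κ i) * M.pi x (Sum.inr i) * invert u =
        C (s i) * (invert u * (T (B.κ i) * M.pi x (Sum.inr i))) := by ring
    rw [AddMonoidAlgebra.coeff_add, Finsupp.add_apply, coeff_zero_invert_mul u,
      coeff_zero_invert_mul v, h1, coeff_C_mul, mul_comm (M.pi x (Sum.inl i))]
    linear_combination (invert v * M.pi x (Sum.inl i)).coeff 0 * hs i

theorem charge_surjective {s : Fin M.k → ZMod n} (hs : ∀ i, s i * s i = 1) (i : Fin M.k) :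
    Function.Surjective (B.charge s i) := by
  intro f
  obtain ⟨v₁, h₁, h₁'⟩ := B.surjZ i
  obtain ⟨v₂, h₂, h₂'⟩ := B.surjX i
  obtain ⟨f₁, hf₁⟩ := proj_surjective (n := n) (χ := M.χ i) (B.surj i) (f 0).1
  obtain ⟨f₂, hf₂⟩ := proj_surjective (n := n) (χ := M.χ i) (B.surj i)
    (C (s i) * T (-B.κ i) * (f 0).2)
  refine ⟨X.sec (f₁ • v₁ + f₂ • v₂), ?_⟩
  funext k
  rw [Subsingleton.elim k 0, charge_apply, B.piSec_sec, ← M.piLin_apply, map_add, Pi.add_apply,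
    Pi.add_apply, M.piLin_apply, M.piLin_apply, (M.pi_smul _ _ _).1, (M.pi_smul _ _ _).1,
    (M.pi_smul _ _ _).2, (M.pi_smul _ _ _).2, h₁, h₁', h₂, h₂', hf₁, hf₂]
  have hss : (C (s i) : Lau n) * C (s i) = 1 := by rw [← map_mul, hs, map_one]
  have ht : (T (B.κ i) : Lau n) * T (-B.κ i) = 1 := by
    rw [← T_add, add_neg_cancel, T_zero]
  refine Prod.ext (by simp) ?_
  simp only
  linear_combination (f 0).2 * T (B.κ i) * T (-B.κ i) * hss + (f 0).2 * ht

theorem exists_mul_eq_charge {s : Fin M.k → ZMod n} (hs : ∀ i, s i * s i = 1) (i : Fin M.k)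
    (p : X.Sec) (hp : ∀ j, j ≠ i → B.charge s j p = 0) :
    ∃ u v, ∀ k, B.charge s i p k = (B.Δ i * u, invert (B.Δ i) * v) := by
  obtain ⟨e, rfl⟩ := sec_surjective p
  obtain ⟨⟨u, hu⟩, ⟨v, hv⟩⟩ := B.dvd i e fun j hj => (B.charge_eq_zero_iff hs j _).1 (hp j hj)
  refine ⟨u, C (s i) * T (B.κ i) * v, fun k => ?_⟩
  rw [charge_apply, B.piSec_sec, hu, hv]
  refine Prod.ext rfl ?_
  simp only
  ring

variable (η : Z3 →+ E3) (normal : Plane → E3)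

/-- The plane of the `i`-th orientation. -/
abbrev plane (_ : BraidData M) (η : Z3 →+ E3) (i : Fin M.k) : Plane := kerPlane η (M.θ i)

open Classical in
/-- The orientation of the canonical loops with respect to the normal vectors. -/
def sign (i : Fin M.k) : ZMod n :=
  if 0 < CSSCode.vol η (normal (B.plane η i)) (B.g i) (B.h i) then 1 else -1

theorem sign_sq (i : Fin M.k) : B.sign η normal i * B.sign η normal i = 1 := by
  rw [sign]
  split_ifs <;> simp

theorem invert_Δ_reg (i : Fin M.k) (f : Lau n) (hf : invert (B.Δ i) * f = 0) : f = 0 := by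
  have h1 := congrArg (invert (R := ZMod n)) hf
  rw [map_mul, involutive_invert, map_zero] at h1
  have h2 := B.Δ_reg i _ h1
  rw [← involutive_invert f, h2, map_zero]

/-- The charge model of a theory whose statistics is determined by the plane charges. -/
def model (hη : IsLatticeEmbedding η)
    (form : Plane → X.Sec → (X.Sec →ₗ[ZMod n] ZMod n))
    (hform : ∀ i p x u v, (∀ j, j ≠ i → B.charge (B.sign η normal) j p = 0) →
      B.charge (B.sign η normal) i p 0 = (B.Δ i * u, invert (B.Δ i) * v) →
      form (B.plane η i) p x = layerForm (u, v) (B.charge (B.sign η normal) i x 0)) :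
    ChargeModel (X.theory η normal form) 1 (Fin M.k) where
  θ := M.θ
  sgn i g := (((-1 : (ZMod n)ˣ) ^ M.χ i g : (ZMod n)ˣ) : ZMod n)
  c := B.charge (B.sign η normal)
  Δ i _ := B.Δ i
  one_lt := B.one_lt
  pos := one_pos
  lattice := ⟨AddEquiv.refl Z3⟩
  embedding := hη
  surj := B.surj
  indep := B.indep
  sgn_sq i g := by
    rw [← Units.val_mul, ← mul_zpow]
    simp
  c_act i g x k := B.charge_act i g x k η
  inj x hx := by
    refine (injective_iff_map_eq_zero _).1 B.piSec_injective x ?_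
    funext j
    rcases j with j | j
    · exact ((B.charge_eq_zero_iff (B.sign_sq η normal) j x).1 (hx j)).1
    · exact ((B.charge_eq_zero_iff (B.sign_sq η normal) j x).1 (hx j)).2
  surj_c := B.charge_surjective (B.sign_sq η normal)
  Δ_reg i _ := B.Δ_reg i
  planon i p hp := by
    obtain ⟨u, v, h⟩ := B.exists_mul_eq_charge (B.sign_sq η normal) i p hp
    exact ⟨fun _ => u, fun _ => v, h⟩
  exists_planon i u v := by
    obtain ⟨e, _, _, _, _, h1, h2, -⟩ := B.exists_sec (B.sign_sq η normal) i (u 0) (v 0)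
    exact ⟨X.sec e, h1, fun k => by rw [Subsingleton.elim k 0]; exact h2 0⟩
  form_eq i p x u v hp hc := by
    have := hform i p x (u 0) (v 0) hp (hc 0)
    rw [Fin.sum_univ_one]
    exact this

open Classical in
/-- The statistics that is determined by the plane charges. -/
def form (a : Plane) (p : X.Sec) : X.Sec →ₗ[ZMod n] ZMod n :=
  if h : ∃ y : Fin M.k × Lau n × Lau n, a = B.plane η y.1 ∧
      (∀ j, j ≠ y.1 → B.charge (B.sign η normal) j p = 0) ∧
      B.charge (B.sign η normal) y.1 p 0 = (B.Δ y.1 * y.2.1, invert (B.Δ y.1) * y.2.2)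
  then layerForm h.choose.2 ∘ₗ LinearMap.proj 0 ∘ₗ B.charge (B.sign η normal) h.choose.1
  else 0

theorem form_eq (hη : IsLatticeEmbedding η) (i : Fin M.k) (p x : X.Sec) (u v : Lau n)
    (hp : ∀ j, j ≠ i → B.charge (B.sign η normal) j p = 0)
    (hc : B.charge (B.sign η normal) i p 0 = (B.Δ i * u, invert (B.Δ i) * v)) :
    B.form η normal (B.plane η i) p x =
      layerForm (u, v) (B.charge (B.sign η normal) i x 0) := by
  have h : ∃ y : Fin M.k × Lau n × Lau n, B.plane η i = B.plane η y.1 ∧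
      (∀ j, j ≠ y.1 → B.charge (B.sign η normal) j p = 0) ∧
      B.charge (B.sign η normal) y.1 p 0 = (B.Δ y.1 * y.2.1, invert (B.Δ y.1) * y.2.2) :=
    ⟨(i, u, v), rfl, hp, hc⟩
  rw [form, dif_pos h]
  obtain ⟨h1, -, h3⟩ := h.choose_spec
  have h4 : h.choose.1 = i :=
    (kerPlane_injective_of_indep hη ⟨AddEquiv.refl Z3⟩ B.indep h1).symm
  generalize h.choose = y at h3 h4 ⊢
  obtain ⟨j, u', v'⟩ := y
  simp only at h3 h4 ⊢
  subst h4
  rw [hc] at h3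
  obtain ⟨h5, h6⟩ := Prod.ext_iff.1 h3
  have h7 : u = u' := sub_eq_zero.1 (B.Δ_reg j _ (by rw [mul_sub]; exact sub_eq_zero.2 h5))
  have h8 : v = v' := sub_eq_zero.1 (B.invert_Δ_reg j _ (by rw [mul_sub]; exact sub_eq_zero.2 h6))
  rw [h7, h8]
  rfl

end BraidData

open LaurentPolynomial

theorem CSSCode.fusion_fg {n : ℕ} (X : CSSCode n) (η : Z3 →+ E3) :
    ∃ G : Finset (X.fusion η).S, Submodule.span (ZMod n)
      {y | ∃ g, ∃ x ∈ G, y = (X.fusion η).act g x} = ⊤ := by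
  classical
  refine ⟨Finset.univ.image fun j => X.sec (Pi.single j 1), ?_⟩
  have key : ∀ j (f : GroupRing n), X.sec (Pi.single j f) ∈ Submodule.span (ZMod n)
      {y | ∃ g, ∃ x ∈ Finset.univ.image (fun j => X.sec (Pi.single j 1)),
        y = (X.fusion η).act g x} := by
    intro j f
    induction f using AddMonoidAlgebra.induction_linear with
    | zero =>
      rw [Pi.single_zero]
      exact Submodule.zero_mem _
    | add p q hp hq =>
      rw [Pi.single_add]
      exact Submodule.add_mem _ hp hq
    | single g c =>
      have h1 : X.sec (Pi.single j (AddMonoidAlgebra.single g c)) =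
          c • (X.fusion η).act g (X.sec (Pi.single j 1)) := by
        have h2 : (Pi.single j (AddMonoidAlgebra.single g c) : X.Exc) =
            c • (mono n g • Pi.single j 1) := by
          rw [← Pi.single_smul (f := fun _ => GroupRing n), ← Pi.single_smul (f := fun _ => GroupRing n)]
          congr 1
          simp [mono]
        rw [h2]
        rfl
      rw [h1]
      exact Submodule.smul_mem (M := (X.fusion η).S) _ _ (Submodule.subset_span
        ⟨g, _, Finset.mem_image_of_mem _ (Finset.mem_univ j), rfl⟩)
  rw [eq_top_iff]
  intro x _
  obtain ⟨v, rfl⟩ := BraidData.sec_surjective x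
  have h1 : X.sec v = ∑ j, X.sec (Pi.single j (v j)) := by
    have h2 : X.sec (∑ j, Pi.single j (v j)) = ∑ j, X.sec (Pi.single j (v j)) :=
      map_sum (LinearMap.range X.eps).mkQ _ _
    rw [← h2, Finset.univ_sum_single]
  rw [h1]
  exact Submodule.sum_mem _ fun j _ => key j (v j)

namespace BraidData

variable {n : ℕ} {X : CSSCode n} {M : SeqData X} (B : BraidData M)
  {η : Z3 →+ E3} {normal : Plane → E3} {form : Plane → X.Sec → (X.Sec →ₗ[ZMod n] ZMod n)}

theorem charge_injective {s : Fin M.k → ZMod n} (hs : ∀ i, s i * s i = 1) {x y : X.Sec}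
    (h : ∀ i, B.charge s i x = B.charge s i y) : x = y := by
  rw [← sub_eq_zero]
  refine (injective_iff_map_eq_zero _).1 B.piSec_injective _ ?_
  have h0 : ∀ i, B.charge s i (x - y) = 0 := fun i => by rw [map_sub, h, sub_self]
  funext j
  rcases j with j | j
  · exact ((B.charge_eq_zero_iff hs j _).1 (h0 j)).1
  · exact ((B.charge_eq_zero_iff hs j _).1 (h0 j)).2

/-- The braiding phase of any positively oriented loop. -/
theorem loop_value (hη : IsLatticeEmbedding η) (i : Fin M.k)
    (hN : ‖normal (B.plane η i)‖ = 1 ∧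
      ∀ v ∈ B.plane η i, inner ℝ (normal (B.plane η i)) v = 0)
    {e : X.Exc} {g h : Z3} {sg sh : X.Pauli} {w : X.Exc} (L : X.IsLoop e g h sg sh w)
    (hg : M.θ i g = 0) (hh : M.θ i h = 0)
    (hv : 0 < CSSCode.vol η (normal (B.plane η i)) g h) {u v : Lau n}
    (hp : ∀ j, j ≠ i → B.charge (B.sign η normal) j (X.sec e) = 0)
    (hc : B.charge (B.sign η normal) i (X.sec e) 0 = (B.Δ i * u, invert (B.Δ i) * v)) (x : X.Exc) :
    coeffSum (AddSubgroup.closure {g, h}) (X.braid w x) =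
      layerForm (u, v) (B.charge (B.sign η normal) i (X.sec x) 0) := by
  obtain ⟨e₀, sg₀, sh₀, w₀, L₀, hp₀, hc₀, hb₀⟩ := B.exists_sec (B.sign_sq η normal) i u v
  have he : X.sec e = X.sec e₀ := by
    refine B.charge_injective (B.sign_sq η normal) fun j => ?_
    by_cases hj : j = i
    · subst hj
      funext k
      rw [hc₀, Subsingleton.elim k 0, hc]
    · rw [hp j hj, hp₀ j hj]
  obtain ⟨y, hy⟩ := (Submodule.Quotient.eq _).1 he
  obtain rfl : e = e₀ + X.eps y := by rw [hy]; abel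
  have L₁ := L₀.add_eps y
  obtain ⟨k, hk⟩ := B.surj i 1
  have hθ : ∃ k, M.θ i k ≠ 0 := ⟨k, by rw [hk]; exact one_ne_zero⟩
  rw [← hb₀]
  by_cases hs : 0 < CSSCode.vol η (normal (B.plane η i)) (B.g i) (B.h i)
  · rw [sign, if_pos hs, one_mul]
    exact L.compare B.exact.1 B.exact.2.1 hθ L₁ hg hh (B.θ_g i) (B.θ_h i) hv hs x
  · have hs' : 0 < CSSCode.vol η (normal (B.plane η i)) (B.h i) (B.g i) := by
      have := CSSCode.vol_ne_zero hη hN.1 hθ hN.2 (B.θ_g i) (B.θ_h i) (B.ind i)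
      rw [CSSCode.vol_swap]
      exact neg_pos.2 (lt_of_le_of_ne (not_lt.1 hs) this)
    rw [sign, if_neg hs, L.compare B.exact.1 B.exact.2.1 hθ L₁.swap hg hh (B.θ_h i) (B.θ_g i) hv hs' x,
      Set.pair_comm, ← zero_sub, X.braid_sub_left, ← coeffSumL_apply, map_sub, coeffSumL_apply,
      coeffSumL_apply]
    have h0 : X.braid 0 x = 0 := by simp [CSSCode.braid]
    rw [h0, ← coeffSumL_apply, map_zero]
    ring

/-- The auxiliary charge model that describes the planons. -/
def fusionModel (hη : IsLatticeEmbedding η) (normal : Plane → E3) :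
    ChargeModel (X.theory η normal (B.form η normal)) 1 (Fin M.k) :=
  B.model η normal hη (B.form η normal) (B.form_eq η normal hη)

theorem fusion_A (hη : IsLatticeEmbedding η) : (X.fusion η).A = Set.range (B.plane η) :=
  (B.fusionModel hη 0).A_eq

theorem mem_fusion_Sa (hη : IsLatticeEmbedding η) (normal : Plane → E3) (i : Fin M.k) (p : X.Sec) :
    p ∈ (X.fusion η).Sa (B.plane η i) ↔ ∀ j, j ≠ i → B.charge (B.sign η normal) j p = 0 :=
  (B.fusionModel hη normal).mem_Sa_iff i p

include B in
theorem hasTheory : X.HasTheory := by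
  intro η normal hη hN
  refine ⟨B.form η normal, hη, hN, ?_⟩
  intro a ha e x he g h hg hh hv sg sh w h1 h2 h3
  have hNa := hN a ha
  rw [B.fusion_A hη] at ha
  obtain ⟨i, rfl⟩ := ha
  have hp := (B.mem_fusion_Sa hη normal i _).1 he
  obtain ⟨u, v, hc⟩ := B.exists_mul_eq_charge (B.sign_sq η normal) i _ hp
  rw [B.form_eq η normal hη i _ _ u v hp (hc 0), X.sum_coeffSum]
  exact (B.loop_value hη i hNa ⟨h1, h2, h3⟩
    ((mem_kerPlane_iff hη ⟨AddEquiv.refl Z3⟩ _ g).1 hg)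
    ((mem_kerPlane_iff hη ⟨AddEquiv.refl Z3⟩ _ h).1 hh) hv hp (hc 0) x).symm

theorem unitNormal (hT : X.IsTheory η normal form) (i : Fin M.k) :
    ‖normal (B.plane η i)‖ = 1 ∧ ∀ v ∈ B.plane η i, inner ℝ (normal (B.plane η i)) v = 0 :=
  hT.unitNormal _ (by rw [B.fusion_A hT.embedding]; exact ⟨i, rfl⟩)

theorem form_eq_of_isTheory (hT : X.IsTheory η normal form) (i : Fin M.k) (p x : X.Sec)
    (u v : Lau n) (hp : ∀ j, j ≠ i → B.charge (B.sign η normal) j p = 0)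
    (hc : B.charge (B.sign η normal) i p 0 = (B.Δ i * u, invert (B.Δ i) * v)) :
    form (B.plane η i) p x = layerForm (u, v) (B.charge (B.sign η normal) i x 0) := by
  have hη := hT.embedding
  obtain ⟨e₀, sg, sh, w, L₀, hp₀, hc₀, -⟩ := B.exists_sec (B.sign_sq η normal) i u v
  obtain rfl : p = X.sec e₀ := by
    refine B.charge_injective (B.sign_sq η normal) fun j => ?_
    by_cases hj : j = i
    · subst hj
      funext k
      rw [hc₀, Subsingleton.elim k 0, hc]
    · rw [hp j hj, hp₀ j hj]
  obtain ⟨x, rfl⟩ := sec_surjective x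
  obtain ⟨k, hk⟩ := B.surj i 1
  have hN := B.unitNormal hT i
  have hne := CSSCode.vol_ne_zero hη hN.1 ⟨k, by rw [hk]; exact one_ne_zero⟩ hN.2 (B.θ_g i)
    (B.θ_h i) (B.ind i)
  have hloop : ∃ g h sg sh w, X.IsLoop e₀ g h sg sh w ∧ M.θ i g = 0 ∧ M.θ i h = 0 ∧
      0 < CSSCode.vol η (normal (B.plane η i)) g h := by
    rcases lt_or_gt_of_ne hne with hneg | hpos
    · refine ⟨_, _, _, _, _, L₀.swap, B.θ_h i, B.θ_g i, ?_⟩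
      rw [CSSCode.vol_swap]
      exact neg_pos.2 hneg
    · exact ⟨_, _, _, _, _, L₀, B.θ_g i, B.θ_h i, hpos⟩
  obtain ⟨g, h, sg, sh, w, L, hg, hh, hv⟩ := hloop
  have hstat := hT.statistics (B.plane η i) (by rw [B.fusion_A hη]; exact ⟨i, rfl⟩) e₀ x
    ((B.mem_fusion_Sa hη normal i _).2 hp) g h (Submodule.subset_span ⟨g, hg, rfl⟩)
    (Submodule.subset_span ⟨h, hh, rfl⟩) hv sg sh w L.left L.right L.loop
  rw [hstat, X.sum_coeffSum]
  exact B.loop_value hη i hN L hg hh hv hp hc x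

/-- The charge model of the theory of the code. -/
def theoryModel (hT : X.IsTheory η normal form) :
    ChargeModel (X.theory η normal form) 1 (Fin M.k) :=
  B.model η normal hT.embedding form (B.form_eq_of_isTheory hT)

include B in
theorem theory_isPTheory (hT : X.IsTheory η normal form) : (X.theory η normal form).IsPTheory :=
  (B.theoryModel hT).isPTheory hT.unitNormal (X.fusion_fg η)

include B in
theorem exponent_eq (i : Fin M.k) : AddMonoid.exponent X.Sec = n := by
  refine Nat.dvd_antisymm ?_ ?_
  · refine AddMonoid.exponent_dvd_of_forall_nsmul_eq_zero fun x => ?_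
    rw [← Nat.cast_smul_eq_nsmul (ZMod n), ZMod.natCast_self, zero_smul]
  · obtain ⟨v, hv, -⟩ := B.surjZ i
    have h1 := AddMonoid.exponent_nsmul_eq_zero (X.sec v)
    have h2 := congrArg (fun x => B.piSec x (Sum.inl i)) h1
    simp only [map_nsmul, B.piSec_sec, Pi.smul_apply, hv, map_zero, Pi.zero_apply] at h2
    have h3 := congrArg (aug n) h2
    rw [map_nsmul, map_one, map_zero, nsmul_one] at h3
    exact (ZMod.natCast_eq_zero_iff _ _).1 h3

include B in
theorem isSequenceOf (hT : X.IsTheory η normal form) : M.IsSequenceOf η normal form := by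
  refine ⟨(B.theoryModel hT).plane_injective, (B.theoryModel hT).A_eq, fun i => ⟨fun v => ?_,
    fun f g => ?_⟩⟩
  · exact ((B.theoryModel hT).mem_K_iff i (X.sec v)).trans
      (B.charge_eq_zero_iff (B.sign_sq η normal) i (X.sec v))
  · obtain ⟨x, hx⟩ := B.charge_surjective (s := fun _ => 1) (fun _ => one_mul 1) i
      fun _ => (f, T (B.κ i) * g)
    obtain ⟨v, rfl⟩ := sec_surjective x
    have h1 := congrFun hx 0
    rw [charge_apply, B.piSec_sec, map_one, one_mul] at h1
    obtain ⟨h2, h3⟩ := Prod.ext_iff.1 h1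
    exact ⟨v, h2, (isUnit_T _).mul_left_cancel h3⟩

end BraidData

open LaurentPolynomial

/-- A weighted sum of coefficients. -/
def wsum {n : ℕ} (o : ℤ → ZMod n) : Lau n →ₗ[ZMod n] ZMod n where
  toFun f := f.coeff.sum fun d c => o d * c
  map_add' f g := by
    rw [AddMonoidAlgebra.coeff_add, Finsupp.sum_add_index' (by simp) (by intro a b c; ring)]
  map_smul' c f := by
    rw [AddMonoidAlgebra.coeff_smul, Finsupp.sum_smul_index' (by simp), RingHom.id_apply,
      smul_eq_mul, Finsupp.mul_sum]
    refine Finsupp.sum_congr fun g _ => ?_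
    rw [smul_eq_mul]
    ring

theorem wsum_C_mul_T {n : ℕ} (o : ℤ → ZMod n) (k : ℤ) (c : ZMod n) :
    wsum o (C c * T k) = o k * c := by
  change (C c * T k : Lau n).coeff.sum (fun d c => o d * c) = _
  rw [← single_eq_C_mul_T, AddMonoidAlgebra.coeff_single, Finsupp.sum_single_index (by simp)]

theorem wsum_const {n : ℕ} (a : ZMod n) (f : Lau n) : wsum (fun _ => a) f = a * aug n f := by
  induction f using LaurentPolynomial.induction_on' with
  | add p q hp hq => rw [map_add, map_add, hp, hq, mul_add]
  | C_mul_T k c => rw [wsum_C_mul_T, map_mul, aug_C, aug_T, mul_one]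

theorem abGrp_replicate (n m : ℕ) {α : Type} [Fintype α] (h : Fintype.card α = m) :
    Nonempty ((α → ZMod n) ≃+ AbGrp (List.replicate m n)) := by
  have h1 : (List.replicate m n).length = m := List.length_replicate
  have h2 : ∀ j : Fin (List.replicate m n).length, (List.replicate m n).get j = n := fun j => by simp
  let e : α ≃ Fin (List.replicate m n).length := (Fintype.equivFinOfCardEq h).trans (finCongr h1.symm)
  exact ⟨(LinearEquiv.funCongrLeft ℤ (ZMod n) e.symm).toAddEquiv.trans
    (AddEquiv.piCongrRight fun j => (ZMod.ringEquivCongr (h2 j)).toAddEquiv.symm)⟩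

open Classical in
/-- The number of orientations with a plane charge. -/
def wt {n k : ℕ} (q : Fin k ⊕ Fin k → Lau n) : ℕ :=
  {i | ¬(q (Sum.inl i) = 0 ∧ q (Sum.inr i) = 0)}.ncard

theorem wt_le_card {n k : ℕ} (q : Fin k ⊕ Fin k → Lau n) : wt q ≤ k := by
  refine (Set.ncard_le_ncard (Set.subset_univ _)).trans ?_
  rw [Set.ncard_univ, Nat.card_eq_fintype_card, Fintype.card_fin]

theorem wt_le {n k : ℕ} {q : Fin k ⊕ Fin k → Lau n} (s : Finset (Fin k))
    (h : ∀ i, i ∉ s → q (Sum.inl i) = 0 ∧ q (Sum.inr i) = 0) : wt q ≤ s.card := by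
  rw [← Set.ncard_coe_finset]
  refine Set.ncard_le_ncard (fun i hi => ?_)
  by_contra hn
  exact hi (h i hn)

theorem exists_of_wt_lt {n k : ℕ} {q : Fin k ⊕ Fin k → Lau n} (s : Finset (Fin k))
    (h : wt q < s.card) : ∃ i ∈ s, q (Sum.inl i) = 0 ∧ q (Sum.inr i) = 0 := by
  by_contra! hc
  have : s.card ≤ wt q := by
    rw [← Set.ncard_coe_finset]
    exact Set.ncard_le_ncard fun i hi h0 => hc i hi h0.1 h0.2
  omega

namespace SeqData

variable {n : ℕ} {X : CSSCode n} (M : SeqData X)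

/-- The constraint map as a linear map. -/
def omegaLin : (Fin M.k ⊕ Fin M.k → Lau n) →ₗ[ZMod n] (Fin M.cZ ⊕ Fin M.cX → ZMod n) where
  toFun := M.omega
  map_add' p q := by
    funext l
    rcases l with l | l
    · change ∑ i, wsum (M.oZ l i) _ = ∑ i, wsum (M.oZ l i) _ + ∑ i, wsum (M.oZ l i) _
      simp [Finset.sum_add_distrib]
    · change ∑ i, wsum (M.oX l i) _ = ∑ i, wsum (M.oX l i) _ + ∑ i, wsum (M.oX l i) _
      simp [Finset.sum_add_distrib]
  map_smul' c q := by
    funext l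
    rcases l with l | l
    · change ∑ i, wsum (M.oZ l i) _ = c • ∑ i, wsum (M.oZ l i) _
      simp [Finset.mul_sum]
    · change ∑ i, wsum (M.oX l i) _ = c • ∑ i, wsum (M.oX l i) _
      simp [Finset.mul_sum]

theorem omegaLin_apply (q : Fin M.k ⊕ Fin M.k → Lau n) : M.omegaLin q = M.omega q := rfl

end SeqData

namespace BraidData

variable {n : ℕ} {X : CSSCode n} {M : SeqData X} (B : BraidData M)
  {η : Z3 →+ E3} {normal : Plane → E3} {form : Plane → X.Sec → (X.Sec →ₗ[ZMod n] ZMod n)}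

include B in
theorem omega_eq_zero_iff (q : Fin M.k ⊕ Fin M.k → Lau n) : M.omega q = 0 ↔ ∃ v, M.pi v = q :=
  B.exact.2.2.2.1 q

/-- The orientations of the theory. -/
def orientationEquiv (hT : X.IsTheory η normal form) : Fin M.k ≃ (X.theory η normal form).A :=
  (Equiv.ofInjective _ (B.theoryModel hT).plane_injective).trans
    (Equiv.setCongr (B.theoryModel hT).A_eq.symm)

/-- The plane charges as pairs of Laurent polynomials. -/
def qMap (hT : X.IsTheory η normal form) :
    (X.theory η normal form).Q →ₗ[ZMod n] (Fin M.k ⊕ Fin M.k → Lau n) :=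
  LinearMap.pi (Sum.elim
    (fun i => LinearMap.fst _ _ _ ∘ₗ LinearMap.proj 0 ∘ₗ
      ((B.theoryModel hT).qaEquiv i).toLinearMap ∘ₗ LinearMap.proj (B.orientationEquiv hT i))
    (fun i => LinearMap.mulLeft (ZMod n) (C (B.sign η normal i) * T (-B.κ i) : Lau n) ∘ₗ
      LinearMap.snd _ _ _ ∘ₗ LinearMap.proj 0 ∘ₗ
      ((B.theoryModel hT).qaEquiv i).toLinearMap ∘ₗ LinearMap.proj (B.orientationEquiv hT i)))

theorem qMap_eq_iff (hT : X.IsTheory η normal form) (q : (X.theory η normal form).Q)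
    (r : Fin M.k ⊕ Fin M.k → Lau n) : B.qMap hT q = r ↔
      ∀ i, (B.theoryModel hT).qaEquiv i (q (B.orientationEquiv hT i)) =
        fun _ => (r (Sum.inl i), C (B.sign η normal i) * T (B.κ i) * r (Sum.inr i)) := by
  have key : ∀ i (a b : Lau n), C (B.sign η normal i) * T (-B.κ i) * a = b ↔
      a = C (B.sign η normal i) * T (B.κ i) * b := by
    intro i a b
    have hss : (C (B.sign η normal i) : Lau n) * C (B.sign η normal i) = 1 := by
      rw [← map_mul, B.sign_sq, map_one]
    have ht : (T (B.κ i) : Lau n) * T (-B.κ i) = 1 := by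
      rw [← T_add, add_neg_cancel, T_zero]
    constructor
    · rintro rfl
      linear_combination -a * T (B.κ i) * T (-B.κ i) * hss - a * ht
    · rintro rfl
      linear_combination b * T (B.κ i) * T (-B.κ i) * hss + b * ht
  constructor
  · rintro rfl i
    funext k
    rw [Subsingleton.elim k 0]
    exact Prod.ext rfl ((key i _ _).1 rfl)
  · intro h
    funext j
    rcases j with i | i
    · exact congrArg (fun f => (f 0).1) (h i)
    · exact (key i _ _).2 (congrArg (fun f => (f 0).2) (h i))

theorem qMap_surjective (hT : X.IsTheory η normal form) : Function.Surjective (B.qMap hT) := by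
  intro r
  choose y hy using fun i => B.charge_surjective (B.sign_sq η normal) i
    fun _ => (r (Sum.inl i), C (B.sign η normal i) * T (B.κ i) * r (Sum.inr i))
  refine ⟨fun a => (((X.theory η normal form).K a).mkQ (y ((B.orientationEquiv hT).symm a)) :), ?_⟩
  rw [B.qMap_eq_iff]
  intro i
  have h1 := (B.theoryModel hT).qaEquiv_mk i (y ((B.orientationEquiv hT).symm (B.orientationEquiv hT i)))
  rw [Equiv.symm_apply_apply] at h1
  refine Eq.trans ?_ (hy i)
  refine Eq.trans ?_ h1
  have h2 := Equiv.symm_apply_apply (B.orientationEquiv hT) i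
  exact congrArg (fun j => (B.theoryModel hT).qaEquiv i
    ((((X.theory η normal form).K (B.plane η i)).mkQ (y j)))) h2

theorem range_pi_eq (hT : X.IsTheory η normal form) :
    LinearMap.range (X.theory η normal form).pi = LinearMap.ker (M.omegaLin ∘ₗ B.qMap hT) := by
  ext q
  rw [(B.theoryModel hT).mem_range_pi_iff, LinearMap.mem_ker, LinearMap.comp_apply,
    M.omegaLin_apply, B.omega_eq_zero_iff]
  constructor
  · rintro ⟨x, hx⟩
    obtain ⟨v, rfl⟩ := sec_surjective x
    exact ⟨v, ((B.qMap_eq_iff hT q (M.pi v)).2 fun i => (hx i).symm).symm⟩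
  · rintro ⟨v, hv⟩
    exact ⟨X.sec v, fun i => ((B.qMap_eq_iff hT q (M.pi v)).1 hv.symm i).symm⟩

include B in
theorem nonempty_C_equiv (hT : X.IsTheory η normal form) :
    Nonempty ((X.theory η normal form).C ≃+ (Fin M.cZ ⊕ Fin M.cX → ZMod n)) :=
  ⟨((Submodule.quotEquivOfEq _ _ (B.range_pi_eq hT)).trans
    (LinearMap.quotKerEquivOfSurjective _ (B.exact.2.2.2.2.comp (B.qMap_surjective hT) :
      Function.Surjective (M.omegaLin ∘ₗ B.qMap hT)))).toAddEquiv⟩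

include B in
theorem weight_eq (hT : X.IsTheory η normal form) (v : X.Exc) :
    (X.theory η normal form).weight (X.sec v) = wt (M.pi v) := by
  have h1 : {a ∈ (X.theory η normal form).A | X.sec v ∉ (X.theory η normal form).K a} =
      B.plane η '' {i | ¬(M.pi v (Sum.inl i) = 0 ∧ M.pi v (Sum.inr i) = 0)} := by
    ext a
    rw [(B.theoryModel hT).A_eq]
    constructor
    · rintro ⟨⟨i, rfl⟩, hi⟩
      exact ⟨i, fun h => hi (((B.isSequenceOf hT).2.2 i).1 v |>.2 h), rfl⟩
    · rintro ⟨i, hi, rfl⟩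
      exact ⟨⟨i, rfl⟩, fun h => hi (((B.isSequenceOf hT).2.2 i).1 v |>.1 h)⟩
  exact (congrArg Set.ncard h1).trans
    (Set.ncard_image_of_injective _ (B.theoryModel hT).plane_injective)

include B in
/-- The weighted quotients in terms of plane charges. -/
theorem nonempty_W_equiv (hT : X.IsTheory η normal form) (i : ℕ) {A : Type} [AddCommGroup A]
    (φ : (Fin M.k ⊕ Fin M.k → Lau n) →+ A) (hsurj : ∀ a, ∃ q, M.omega q = 0 ∧ φ q = a)
    (hvan : ∀ q, M.omega q = 0 → wt q ≤ i → φ q = 0)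
    (hgen : ∀ q, M.omega q = 0 → φ q = 0 →
      q ∈ AddSubgroup.closure {r | M.omega r = 0 ∧ wt r ≤ i}) :
    Nonempty ((X.theory η normal form).W i ≃+ A) := by
  let P := X.theory η normal form
  let ψ : P.S →+ A := φ.comp B.piSec.toAddMonoidHom
  have hψ : ∀ v, ψ (X.sec v) = φ (M.pi v) := fun v => rfl
  have hψs : Function.Surjective ψ := fun a => by
    obtain ⟨q, hq, rfl⟩ := hsurj a
    obtain ⟨v, rfl⟩ := (B.omega_eq_zero_iff q).1 hq
    exact ⟨X.sec v, rfl⟩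
  have hker : ψ.ker = (P.Sle i).toAddSubgroup := by
    refine le_antisymm (fun x hx => ?_) (fun x hx => ?_)
    · obtain ⟨v, rfl⟩ := sec_surjective x
      have hle : AddSubgroup.closure {r | M.omega r = 0 ∧ wt r ≤ i} ≤
          ((P.Sle i).toAddSubgroup).map B.piSec.toAddMonoidHom := by
        rw [AddSubgroup.closure_le]
        rintro r ⟨hr, hw⟩
        obtain ⟨v, rfl⟩ := (B.omega_eq_zero_iff r).1 hr
        have hm : (X.sec v : P.S) ∈ P.Sle i :=
          Submodule.subset_span (s := {x : P.S | P.weight x ≤ i}) ((B.weight_eq hT v).trans_le hw)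
        exact ⟨X.sec v, hm, rfl⟩
      obtain ⟨y, hy, hyv⟩ := hle (hgen (M.pi v) ((B.omega_eq_zero_iff _).2 ⟨v, rfl⟩) hx)
      obtain rfl : y = X.sec v := B.piSec_injective hyv
      exact hy
    · have hle : AddSubgroup.closure {x : P.S | P.weight x ≤ i} ≤ ψ.ker := by
        rw [AddSubgroup.closure_le]
        intro y hy
        obtain ⟨v, rfl⟩ := sec_surjective y
        exact hvan _ ((B.omega_eq_zero_iff _).2 ⟨v, rfl⟩) ((B.weight_eq hT v).symm.trans_le hy)
      refine Submodule.span_induction (p := fun x _ => x ∈ ψ.ker)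
        (fun y hy => hle (AddSubgroup.subset_closure hy)) (zero_mem _) (fun y z _ _ => add_mem) ?_ hx
      intro c y _ hy
      have h1 : c • y = (c.cast : ℤ) • y :=
        (congrArg (· • y) (ZMod.intCast_zmod_cast c).symm).trans
          (Int.cast_smul_eq_zsmul (ZMod n) (c.cast : ℤ) y)
      exact h1 ▸ zsmul_mem hy _
  exact ⟨(QuotientAddGroup.quotientAddEquivOfEq hker.symm).trans
    (QuotientAddGroup.quotientKerEquivOfSurjective ψ hψs)⟩

include B in
/-- All assertions about the theories of a code, from canonical loops and from descriptions of the
weighted quotients. -/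
theorem isPModularWith (i₀ : Fin M.k) {c : List ℕ} (hc : c = List.replicate (M.cZ + M.cX) n)
    {w : List (List ℕ)} (hk : M.k = w.length)
    (hw : ∀ η normal form, X.IsTheory η normal form → ∀ i : Fin w.length,
      Nonempty ((X.theory η normal form).W (i + 1) ≃+ AbGrp (w.get i))) :
    X.IsPModularWith M c w := by
  refine ⟨B.exact, B.hasTheory, fun η normal form hT => ⟨B.theory_isPTheory hT, B.exponent_eq i₀,
    (B.theoryModel hT).pModular, B.isSequenceOf hT, ?_, ?_, hw η normal form hT⟩⟩
  · obtain ⟨e⟩ := B.nonempty_C_equiv hT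
    subst hc
    obtain ⟨e'⟩ := abGrp_replicate n (M.cZ + M.cX) (α := Fin M.cZ ⊕ Fin M.cX) (by simp)
    exact ⟨e.trans e'⟩
  · rw [← hk, (B.theoryModel hT).A_eq, Set.ncard_range_of_injective (B.theoryModel hT).plane_injective,
      Nat.card_eq_fintype_card, Fintype.card_fin]

end BraidData

open LaurentPolynomial

/-- Exactness of the part of a sequence with excitations of one type. -/
structure HalfExact {n t t' q k c : ℕ} (a : Matrix (Fin t) (Fin q) (GroupRing n))
    (b : Matrix (Fin t') (Fin q) (GroupRing n)) (θ χ : Fin k → (Z3 →+ ℤ))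
    (p : Matrix (Fin k) (Fin t) (Lau n)) (o : Fin c → Fin k → ℤ → ZMod n) : Prop where
  inj : ∀ w : Fin t' → GroupRing n, (∀ k, ∑ j, antipode n (b j k) * w j = 0) → w = 0
  comp : ∀ i j, ∑ k, a i k * antipode n (b j k) = 0
  exP : ∀ s : Fin q → GroupRing n, (∀ j, ∑ k, a j k * s k = 0) →
    ∃ w : Fin t' → GroupRing n, ∀ k, ∑ j, antipode n (b j k) * w j = s k
  compE : ∀ i k, ∑ j, p i j * proj n (θ i) (χ i) (a j k) = 0
  exE : ∀ v : Fin t → GroupRing n, (∀ i, ∑ j, p i j * proj n (θ i) (χ i) (v j) = 0) →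
    ∃ s : Fin q → GroupRing n, ∀ j, ∑ k, a j k * s k = v j
  compQ : ∀ (v : Fin t → GroupRing n) l,
    ∑ i, wsum (o l i) (∑ j, p i j * proj n (θ i) (χ i) (v j)) = 0
  exQ : ∀ q : Fin k → Lau n, (∀ l, ∑ i, wsum (o l i) (q i) = 0) →
    ∃ v : Fin t → GroupRing n, ∀ i, ∑ j, p i j * proj n (θ i) (χ i) (v j) = q i
  surj : ∀ r : Fin c → ZMod n, ∃ q : Fin k → Lau n, ∀ l, ∑ i, wsum (o l i) (q i) = r l

section Half

variable {n : ℕ} {X : CSSCode n} {M : SeqData X}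

theorem HalfExact.isExact (HZ : HalfExact X.eZ X.eX M.θ M.χ M.pZ M.oZ)
    (HX : HalfExact X.eX X.eZ M.θ M.χ M.pX M.oX) : M.IsExact := by
  refine ⟨?_, fun s => ⟨fun h => ?_, ?_⟩, fun v => ⟨fun h => ?_, ?_⟩, fun q => ⟨fun h => ?_, ?_⟩,
    fun r => ?_⟩
  · rw [injective_iff_map_eq_zero]
    intro w hw
    have h1 := HX.inj (fun j => w (Sum.inl j)) fun k => by
      rw [← X.sigma_inl, hw]
      rfl
    have h2 := HZ.inj (fun j => w (Sum.inr j)) fun k => by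
      rw [← neg_eq_zero, ← X.sigma_inr, hw]
      rfl
    funext j
    rcases j with j | j
    · exact congrFun h1 j
    · exact congrFun h2 j
  · obtain ⟨w, hw⟩ := HZ.exP (fun k => s (Sum.inr k)) fun j => by
      rw [← X.eps_inl, h]
      rfl
    obtain ⟨w', hw'⟩ := HX.exP (fun k => s (Sum.inl k)) fun j => by
      rw [← X.eps_inr, h]
      rfl
    refine ⟨Sum.elim w' (-w), ?_⟩
    funext k
    rcases k with k | k
    · rw [X.sigma_inl, ← hw']
      rfl
    · rw [X.sigma_inr, ← hw]
      simp
  · rintro ⟨w, rfl⟩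
    funext j
    rcases j with j | j
    · rw [X.eps_inl]
      simp only [X.sigma_inr, mul_neg, Finset.sum_neg_distrib, Finset.mul_sum, Pi.zero_apply]
      rw [Finset.sum_comm, neg_eq_zero]
      refine Finset.sum_eq_zero fun l _ => ?_
      simp only [← mul_assoc]
      rw [← Finset.sum_mul, HZ.comp, zero_mul]
    · rw [X.eps_inr]
      simp only [X.sigma_inl, Finset.mul_sum, Pi.zero_apply]
      rw [Finset.sum_comm]
      refine Finset.sum_eq_zero fun l _ => ?_
      simp only [← mul_assoc]
      rw [← Finset.sum_mul, HX.comp, zero_mul]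
  · obtain ⟨s, hs⟩ := HZ.exE (fun k => v (Sum.inl k)) fun i => congrFun h (Sum.inl i)
    obtain ⟨s', hs'⟩ := HX.exE (fun k => v (Sum.inr k)) fun i => congrFun h (Sum.inr i)
    refine ⟨Sum.elim s' s, ?_⟩
    funext j
    rcases j with j | j
    · rw [X.eps_inl]
      exact hs j
    · rw [X.eps_inr]
      exact hs' j
  · rintro ⟨s, rfl⟩
    funext i
    rcases i with i | i
    · change ∑ j, M.pZ i j * proj n (M.θ i) (M.χ i) (X.eps s (Sum.inl j)) = 0
      simp only [X.eps_inl, map_sum, map_mul, Finset.mul_sum]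
      rw [Finset.sum_comm]
      refine Finset.sum_eq_zero fun l _ => ?_
      simp only [← mul_assoc]
      rw [← Finset.sum_mul, HZ.compE, zero_mul]
    · change ∑ j, M.pX i j * proj n (M.θ i) (M.χ i) (X.eps s (Sum.inr j)) = 0
      simp only [X.eps_inr, map_sum, map_mul, Finset.mul_sum]
      rw [Finset.sum_comm]
      refine Finset.sum_eq_zero fun l _ => ?_
      simp only [← mul_assoc]
      rw [← Finset.sum_mul, HX.compE, zero_mul]
  · obtain ⟨s, hs⟩ := HZ.exQ (fun k => q (Sum.inl k)) fun i => congrFun h (Sum.inl i)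
    obtain ⟨s', hs'⟩ := HX.exQ (fun k => q (Sum.inr k)) fun i => congrFun h (Sum.inr i)
    refine ⟨Sum.elim s s', ?_⟩
    funext j
    rcases j with j | j
    · exact hs j
    · exact hs' j
  · rintro ⟨v, rfl⟩
    funext i
    rcases i with i | i
    · exact HZ.compQ (fun j => v (Sum.inl j)) i
    · exact HX.compQ (fun j => v (Sum.inr j)) i
  · obtain ⟨s, hs⟩ := HZ.surj fun k => r (Sum.inl k)
    obtain ⟨s', hs'⟩ := HX.surj fun k => r (Sum.inr k)
    refine ⟨Sum.elim s s', ?_⟩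
    funext j
    rcases j with j | j
    · exact hs j
    · exact hs' j

end Half

/-- A loop of operators of one type that moves the excitation `e`, with plane charge `d` of the
orientation `i` only, and with statistics `u` times the `i`-th plane charge of the other type. -/
structure HalfLoop {n t t' q k : ℕ} (a : Matrix (Fin t) (Fin q) (GroupRing n))
    (b : Matrix (Fin t') (Fin q) (GroupRing n)) (θ χ : Fin k → (Z3 →+ ℤ))
    (p : Matrix (Fin k) (Fin t) (Lau n)) (p' : Matrix (Fin k) (Fin t') (Lau n)) (g h : Z3)
    (i : Fin k) (d u : Lau n) (e : Fin t → GroupRing n) (sg sh : Fin q → GroupRing n)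
    (w : Fin t' → GroupRing n) : Prop where
  left : ∀ j, ∑ k, a j k * sg k = (mono n g - 1) * e j
  right : ∀ j, ∑ k, a j k * sh k = (mono n h - 1) * e j
  loop : ∀ k, ∑ j, antipode n (b j k) * w j = (1 - mono n h) * sg k - (1 - mono n g) * sh k
  charge : ∀ l, ∑ j, p l j * proj n (θ l) (χ l) (e j) = Pi.single (M := fun _ => Lau n) i d l
  stat : ∀ (f : GroupRing n) j, coeffSum (AddSubgroup.closure {g, h}) (antipode n (w j) * f) =
    (u * p' i j * proj n (θ i) (χ i) f).coeff 0

section HalfLoop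

variable {n : ℕ} {X : CSSCode n} {M : SeqData X} {g h : Z3} {i : Fin M.k} {d u : Lau n}

theorem HalfLoop.loopZ {e : Fin X.tZ → GroupRing n} {sg sh : Fin X.q → GroupRing n}
    {w : Fin X.tX → GroupRing n}
    (L : HalfLoop X.eZ X.eX M.θ M.χ M.pZ M.pX g h i d (-u) e sg sh w) :
    ∃ e sg sh w, X.IsLoop e g h sg sh w ∧ M.pi e = Pi.single (Sum.inl i) d ∧
      ∀ x, coeffSum (AddSubgroup.closure {g, h}) (X.braid w x) = (u * M.pi x (Sum.inr i)).coeff 0 := by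
  refine ⟨Sum.elim e 0, Sum.elim 0 sg, Sum.elim 0 sh, Sum.elim 0 (-w), ⟨?_, ?_, ?_⟩, ?_, fun x => ?_⟩
  · funext j
    rcases j with j | j
    · rw [X.eps_inl]
      exact L.left j
    · rw [X.eps_inr]
      simp
  · funext j
    rcases j with j | j
    · rw [X.eps_inl]
      exact L.right j
    · rw [X.eps_inr]
      simp
  · funext k
    rcases k with k | k
    · rw [X.sigma_inl]
      simp
    · rw [X.sigma_inr]
      refine Eq.trans ?_ (L.loop k)
      simp
  · funext l
    rcases l with l | l
    · refine (L.charge l).trans ?_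
      by_cases hl : l = i
      · subst hl
        simp
      · simp [hl]
    · simp [SeqData.pi]
  · rw [CSSCode.braid, Fintype.sum_sum_type, ← coeffSumL_apply]
    simp only [Sum.elim_inl, Sum.elim_inr, Pi.zero_apply, map_zero, zero_mul, Finset.sum_const_zero,
      zero_add, map_sum, Pi.neg_apply, map_neg, neg_mul, coeffSumL_apply, L.stat]
    simp only [SeqData.pi, Sum.elim_inr, Finset.mul_sum, AddMonoidAlgebra.coeff_sum,
      Finsupp.coe_finsetSum, Finset.sum_apply, ← mul_assoc, AddMonoidAlgebra.coeff_neg, neg_neg,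
      Finsupp.coe_neg, Pi.neg_apply]

theorem HalfLoop.loopX {e : Fin X.tX → GroupRing n} {sg sh : Fin X.q → GroupRing n}
    {w : Fin X.tZ → GroupRing n}
    (L : HalfLoop X.eX X.eZ M.θ M.χ M.pX M.pZ g h i d 1 e sg sh w) :
    ∃ e sg sh w, X.IsLoop e g h sg sh w ∧ M.pi e = Pi.single (Sum.inr i) d ∧
      ∀ x, coeffSum (AddSubgroup.closure {g, h}) (X.braid w x) = (M.pi x (Sum.inl i)).coeff 0 := by
  refine ⟨Sum.elim 0 e, Sum.elim sg 0, Sum.elim sh 0, Sum.elim w 0, ⟨?_, ?_, ?_⟩, ?_, fun x => ?_⟩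
  · funext j
    rcases j with j | j
    · rw [X.eps_inl]
      simp
    · rw [X.eps_inr]
      exact L.left j
  · funext j
    rcases j with j | j
    · rw [X.eps_inl]
      simp
    · rw [X.eps_inr]
      exact L.right j
  · funext k
    rcases k with k | k
    · rw [X.sigma_inl]
      exact L.loop k
    · rw [X.sigma_inr]
      simp
  · funext l
    rcases l with l | l
    · simp [SeqData.pi]
    · refine (L.charge l).trans ?_
      by_cases hl : l = i
      · subst hl
        simp
      · simp [hl]
  · rw [CSSCode.braid, Fintype.sum_sum_type, ← coeffSumL_apply]
    simp only [Sum.elim_inl, Sum.elim_inr, Pi.zero_apply, map_zero, zero_mul, Finset.sum_const_zero,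
      add_zero, map_sum, coeffSumL_apply, L.stat]
    simp only [SeqData.pi, Sum.elim_inl, one_mul, AddMonoidAlgebra.coeff_sum,
      Finsupp.coe_finsetSum, Finset.sum_apply]

end HalfLoop

theorem exists_half_charge {n t k : ℕ} {θ χ : Fin k → (Z3 →+ ℤ)} {p : Matrix (Fin k) (Fin t) (Lau n)}
    {i : Fin k} (hθ : Function.Surjective (θ i)) {j : Fin t} (hj : IsUnit (p i j)) :
    ∃ v : Fin t → GroupRing n, ∑ j, p i j * proj n (θ i) (χ i) (v j) = 1 := by
  obtain ⟨s, hs⟩ := hj.exists_right_inv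
  obtain ⟨r, rfl⟩ := proj_surjective (χ := χ i) hθ s
  refine ⟨Pi.single j r, ?_⟩
  rw [Finset.sum_eq_single j, Pi.single_eq_same, hs]
  · intro l _ hl
    rw [Pi.single_eq_of_ne hl, map_zero, mul_zero]
  · simp

theorem SeqData.exists_pi_eq_one {n : ℕ} {X : CSSCode n} (M : SeqData X) {i : Fin M.k}
    (hθ : Function.Surjective (M.θ i)) (hZ : ∃ j, IsUnit (M.pZ i j)) (hX : ∃ j, IsUnit (M.pX i j)) :
    (∃ v, M.pi v (Sum.inl i) = 1 ∧ M.pi v (Sum.inr i) = 0) ∧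
      ∃ v, M.pi v (Sum.inl i) = 0 ∧ M.pi v (Sum.inr i) = 1 := by
  obtain ⟨j, hj⟩ := hZ
  obtain ⟨j', hj'⟩ := hX
  obtain ⟨v, hv⟩ := exists_half_charge (χ := M.χ) hθ hj
  obtain ⟨v', hv'⟩ := exists_half_charge (χ := M.χ) hθ hj'
  exact ⟨⟨Sum.elim v 0, hv, by simp [SeqData.pi]⟩, Sum.elim 0 v', by simp [SeqData.pi], hv'⟩

theorem coeffSum_closure_eq_coeff {n : ℕ} {θ : Z3 →+ ℤ} {g h : Z3} (hg : θ g = 0) (hh : θ h = 0)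
    (hspan : ∀ m, θ m = 0 → ∃ a b : ℤ, a • g + b • h = m) (f : GroupRing n) :
    coeffSum (AddSubgroup.closure {g, h}) f = (proj n θ 0 f).coeff 0 := by
  classical
  have key : coeffSumL (n := n) (AddSubgroup.closure {g, h}) =
      { toFun := fun f => (proj n θ 0 f).coeff 0
        map_add' := fun x y => by rw [map_add, AddMonoidAlgebra.coeff_add, Finsupp.add_apply]
        map_smul' := fun c x => by
          rw [map_smul, AddMonoidAlgebra.coeff_smul, Finsupp.smul_apply, RingHom.id_apply] } := by
    refine groupRing_linear_ext fun m => ?_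
    rw [coeffSumL_apply, coeffSum_mono, LinearMap.coe_mk, AddHom.coe_mk, proj_mono_zero, T,
      AddMonoidAlgebra.coeff_single, Finsupp.single_apply]
    refine if_congr ?_ rfl rfl
    rw [AddSubgroup.mem_closure_pair]
    refine ⟨?_, hspan m⟩
    rintro ⟨a, b, rfl⟩
    rw [map_add, map_zsmul, map_zsmul, hg, hh, smul_zero, smul_zero, add_zero]
  exact LinearMap.congr_fun key f

/-- The sum of all coefficients. -/
def augR (n : ℕ) : GroupRing n →ₐ[ZMod n] ZMod n := (aug n).comp (proj n 0 0)

theorem augR_mono {n : ℕ} (g : Z3) : augR n (mono n g) = 1 := by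
  rw [augR, AlgHom.comp_apply, proj_mono_zero, aug_T]

theorem aug_proj {n : ℕ} (θ : Z3 →+ ℤ) (f : GroupRing n) : aug n (proj n θ 0 f) = augR n f := by
  have : (aug n).comp (proj n θ 0) = augR n :=
    AddMonoidAlgebra.algHom_ext (fun g => by
      change aug n (proj n θ 0 (mono n g)) = augR n (mono n g)
      rw [augR_mono, proj_mono_zero, aug_T]) (by ext)
  exact DFunLike.congr_fun this f

open LaurentPolynomial

section Cube

variable (n : ℕ)

theorem tx_mul_txi : tx n * txi n = 1 := by
  rw [tx, txi, mono_mul, ← mono_zero]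
  congr 1
  decide

theorem ty_mul_tyi : ty n * tyi n = 1 := by
  rw [ty, tyi, mono_mul, ← mono_zero]
  congr 1
  decide

theorem tz_mul_tzi : tz n * tzi n = 1 := by
  rw [tz, tzi, mono_mul, ← mono_zero]
  congr 1
  decide

theorem val_zpow_eq_mono {u : (GroupRing n)ˣ} {g : Z3} (hu : (u : GroupRing n) = mono n g) (k : ℤ) :
    ((u ^ k : (GroupRing n)ˣ) : GroupRing n) = mono n (k • g) := by
  let f : Multiplicative Z3 →* (GroupRing n)ˣ :=
    { toFun := fun g => monoU n g.toAdd
      map_one' := Units.ext mono_zero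
      map_mul' := fun a b => Units.ext (mono_mul _ _).symm }
  have h : u = f (Multiplicative.ofAdd g) := Units.ext hu
  rw [h, ← map_zpow]
  rfl

variable {n}

section Antipode

@[simp] theorem antipode_tx : antipode n (tx n) = txi n := by
  rw [tx, antipode_mono, txi]; congr 1; decide
@[simp] theorem antipode_ty : antipode n (ty n) = tyi n := by
  rw [ty, antipode_mono, tyi]; congr 1; decide
@[simp] theorem antipode_tz : antipode n (tz n) = tzi n := by
  rw [tz, antipode_mono, tzi]; congr 1; decide
@[simp] theorem antipode_txi : antipode n (txi n) = tx n := by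
  rw [← antipode_tx, antipode_antipode]
@[simp] theorem antipode_tyi : antipode n (tyi n) = ty n := by
  rw [← antipode_ty, antipode_antipode]
@[simp] theorem antipode_tzi : antipode n (tzi n) = tz n := by
  rw [← antipode_tz, antipode_antipode]

end Antipode

section Proj

@[simp] theorem proj_tx (θ : Z3 →+ ℤ) : proj n θ 0 (tx n) = T (θ ![1, 0, 0]) := proj_mono_zero _ _
@[simp] theorem proj_ty (θ : Z3 →+ ℤ) : proj n θ 0 (ty n) = T (θ ![0, 1, 0]) := proj_mono_zero _ _
@[simp] theorem proj_tz (θ : Z3 →+ ℤ) : proj n θ 0 (tz n) = T (θ ![0, 0, 1]) := proj_mono_zero _ _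
@[simp] theorem proj_txi (θ : Z3 →+ ℤ) : proj n θ 0 (txi n) = T (θ ![-1, 0, 0]) := proj_mono_zero _ _
@[simp] theorem proj_tyi (θ : Z3 →+ ℤ) : proj n θ 0 (tyi n) = T (θ ![0, -1, 0]) := proj_mono_zero _ _
@[simp] theorem proj_tzi (θ : Z3 →+ ℤ) : proj n θ 0 (tzi n) = T (θ ![0, 0, -1]) := proj_mono_zero _ _

@[simp] theorem deg_apply (i : Fin 3) (g : Z3) : deg i g = g i := rfl

end Proj

/-- The substitution of units for the three generators. -/
def subst (u v w : (GroupRing n)ˣ) : GroupRing n →ₐ[ZMod n] GroupRing n := evalR ![u, v, w]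

section Subst

variable (u v w : (GroupRing n)ˣ)

@[simp] theorem subst_tx : subst u v w (tx n) = u := by
  simp [subst, tx, evalR_mono, Fin.prod_univ_three]
@[simp] theorem subst_ty : subst u v w (ty n) = v := by
  simp [subst, ty, evalR_mono, Fin.prod_univ_three]
@[simp] theorem subst_tz : subst u v w (tz n) = w := by
  simp [subst, tz, evalR_mono, Fin.prod_univ_three]
@[simp] theorem subst_txi : subst u v w (txi n) = (u⁻¹ : (GroupRing n)ˣ) := by
  simp [subst, txi, evalR_mono, Fin.prod_univ_three]
@[simp] theorem subst_tyi : subst u v w (tyi n) = (v⁻¹ : (GroupRing n)ˣ) := by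
  simp [subst, tyi, evalR_mono, Fin.prod_univ_three]
@[simp] theorem subst_tzi : subst u v w (tzi n) = (w⁻¹ : (GroupRing n)ˣ) := by
  simp [subst, tzi, evalR_mono, Fin.prod_univ_three]

end Subst

/-- The generators as units. -/
def ux (n : ℕ) : (GroupRing n)ˣ := ⟨tx n, txi n, tx_mul_txi n, by rw [mul_comm, tx_mul_txi]⟩
def uy (n : ℕ) : (GroupRing n)ˣ := ⟨ty n, tyi n, ty_mul_tyi n, by rw [mul_comm, ty_mul_tyi]⟩
def uz (n : ℕ) : (GroupRing n)ˣ := ⟨tz n, tzi n, tz_mul_tzi n, by rw [mul_comm, tz_mul_tzi]⟩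

@[simp] theorem val_ux : (ux n : GroupRing n) = tx n := rfl
@[simp] theorem val_uy : (uy n : GroupRing n) = ty n := rfl
@[simp] theorem val_uz : (uz n : GroupRing n) = tz n := rfl
@[simp] theorem val_inv_ux : ((ux n)⁻¹ : (GroupRing n)ˣ) = txi n := rfl
@[simp] theorem val_inv_uy : ((uy n)⁻¹ : (GroupRing n)ˣ) = tyi n := rfl
@[simp] theorem val_inv_uz : ((uz n)⁻¹ : (GroupRing n)ˣ) = tzi n := rfl

theorem exists_eq_subst_add (a : GroupRing n) (φ : GroupRing n →ₐ[ZMod n] GroupRing n)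
    (hx : a ∣ tx n - φ (tx n)) (hy : a ∣ ty n - φ (ty n)) (hz : a ∣ tz n - φ (tz n))
    (f : GroupRing n) : ∃ c, f = φ f + a * c := by
  obtain ⟨c, hc⟩ := Ideal.mem_span_singleton.1 (sub_mem_of_generators (Ideal.span {a}) φ
    (Ideal.mem_span_singleton.2 hx) (Ideal.mem_span_singleton.2 hy) (Ideal.mem_span_singleton.2 hz) f)
  exact ⟨c, by rw [← hc]; ring⟩

/-- A homomorphism to Laurent polynomials factors through two substitutions. -/
theorem subst_subst_eq {θ χ : Z3 →+ ℤ} {φ ψ : GroupRing n →ₐ[ZMod n] GroupRing n}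
    {J : Lau n →ₐ[ZMod n] GroupRing n} (hx : ψ (φ (tx n)) = J (proj n θ χ (tx n)))
    (hy : ψ (φ (ty n)) = J (proj n θ χ (ty n))) (hz : ψ (φ (tz n)) = J (proj n θ χ (tz n)))
    (f : GroupRing n) : ψ (φ f) = J (proj n θ χ f) :=
  DFunLike.congr_fun (groupRing_hom_ext (φ := ψ.comp φ) (ψ := J.comp (proj n θ χ)) hx hy hz) f

theorem eq_zero_of_one_sub_mono_mul {g : Z3} (hg : g ≠ 0) {f : GroupRing n}
    (hf : (1 - mono n g) * f = 0) : f = 0 := by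
  refine eq_zero_of_mono_mul (u := 1) (v := -1) hg.symm isUnit_one isUnit_one.neg ?_
  rw [mono_zero, one_smul, neg_smul, one_smul, ← sub_eq_add_neg, hf]

theorem eq_zero_of_mono_sub_mul {g h : Z3} (hg : g ≠ h) {f : GroupRing n}
    (hf : (mono n g - mono n h) * f = 0) : f = 0 := by
  refine eq_zero_of_mono_mul (u := 1) (v := -1) hg isUnit_one isUnit_one.neg ?_
  rw [one_smul, neg_smul, one_smul, ← sub_eq_add_neg, hf]

section Regular

variable {f : GroupRing n}

theorem of_x (h : (1 - tx n) * f = 0) : f = 0 := eq_zero_of_one_sub_mono_mul (by decide) h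
theorem of_y (h : (1 - ty n) * f = 0) : f = 0 := eq_zero_of_one_sub_mono_mul (by decide) h
theorem of_z (h : (1 - tz n) * f = 0) : f = 0 := eq_zero_of_one_sub_mono_mul (by decide) h
theorem of_xi (h : (1 - txi n) * f = 0) : f = 0 := eq_zero_of_one_sub_mono_mul (by decide) h
theorem of_yi (h : (1 - tyi n) * f = 0) : f = 0 := eq_zero_of_one_sub_mono_mul (by decide) h
theorem of_zi (h : (1 - tzi n) * f = 0) : f = 0 := eq_zero_of_one_sub_mono_mul (by decide) h

end Regular

/-- Substitution of `1` for a generator. -/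
def atX (n : ℕ) : GroupRing n →ₐ[ZMod n] GroupRing n := subst 1 (uy n) (uz n)
def atY (n : ℕ) : GroupRing n →ₐ[ZMod n] GroupRing n := subst (ux n) 1 (uz n)
def atZ (n : ℕ) : GroupRing n →ₐ[ZMod n] GroupRing n := subst (ux n) (uy n) 1

section At

@[simp] theorem atX_tx : atX n (tx n) = 1 := by simp [atX]
@[simp] theorem atX_ty : atX n (ty n) = ty n := by simp [atX]
@[simp] theorem atX_tz : atX n (tz n) = tz n := by simp [atX]
@[simp] theorem atX_txi : atX n (txi n) = 1 := by simp [atX]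
@[simp] theorem atX_tyi : atX n (tyi n) = tyi n := by simp [atX]
@[simp] theorem atX_tzi : atX n (tzi n) = tzi n := by simp [atX]
@[simp] theorem atY_tx : atY n (tx n) = tx n := by simp [atY]
@[simp] theorem atY_ty : atY n (ty n) = 1 := by simp [atY]
@[simp] theorem atY_tz : atY n (tz n) = tz n := by simp [atY]
@[simp] theorem atY_txi : atY n (txi n) = txi n := by simp [atY]
@[simp] theorem atY_tyi : atY n (tyi n) = 1 := by simp [atY]
@[simp] theorem atY_tzi : atY n (tzi n) = tzi n := by simp [atY]
@[simp] theorem atZ_tx : atZ n (tx n) = tx n := by simp [atZ]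
@[simp] theorem atZ_ty : atZ n (ty n) = ty n := by simp [atZ]
@[simp] theorem atZ_tz : atZ n (tz n) = 1 := by simp [atZ]
@[simp] theorem atZ_txi : atZ n (txi n) = txi n := by simp [atZ]
@[simp] theorem atZ_tyi : atZ n (tyi n) = tyi n := by simp [atZ]
@[simp] theorem atZ_tzi : atZ n (tzi n) = 1 := by simp [atZ]

variable (f : GroupRing n)

theorem eq_atX : ∃ c, f = atX n f + (1 - tx n) * c :=
  exists_eq_subst_add _ _ ⟨-1, by simp⟩ (by simp) (by simp) f
theorem eq_atY : ∃ c, f = atY n f + (1 - ty n) * c :=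
  exists_eq_subst_add _ _ (by simp) ⟨-1, by simp⟩ (by simp) f
theorem eq_atZ : ∃ c, f = atZ n f + (1 - tz n) * c :=
  exists_eq_subst_add _ _ (by simp) (by simp) ⟨-1, by simp⟩ f

variable {f}

theorem of_atX (h : atX n f = 0) : ∃ c, f = (1 - tx n) * c := by
  obtain ⟨c, hc⟩ := eq_atX f
  exact ⟨c, by rw [hc, h, zero_add]⟩
theorem of_atY (h : atY n f = 0) : ∃ c, f = (1 - ty n) * c := by
  obtain ⟨c, hc⟩ := eq_atY f
  exact ⟨c, by rw [hc, h, zero_add]⟩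
theorem of_atZ (h : atZ n f = 0) : ∃ c, f = (1 - tz n) * c := by
  obtain ⟨c, hc⟩ := eq_atZ f
  exact ⟨c, by rw [hc, h, zero_add]⟩

end At

/-- Laurent polynomials in one generator. -/
def jx (n : ℕ) : Lau n →ₐ[ZMod n] GroupRing n := evalL (ux n)
def jy (n : ℕ) : Lau n →ₐ[ZMod n] GroupRing n := evalL (uy n)
def jz (n : ℕ) : Lau n →ₐ[ZMod n] GroupRing n := evalL (uz n)

section Inclusion

theorem atYZ (f : GroupRing n) : atZ n (atY n f) = jx n (proj n (deg 0) 0 f) := by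
  refine subst_subst_eq ?_ ?_ ?_ f <;> simp [jx, evalL_T]
theorem atXZ (f : GroupRing n) : atZ n (atX n f) = jy n (proj n (deg 1) 0 f) := by
  refine subst_subst_eq ?_ ?_ ?_ f <;> simp [jy, evalL_T]
theorem atXY (f : GroupRing n) : atY n (atX n f) = jz n (proj n (deg 2) 0 f) := by
  refine subst_subst_eq ?_ ?_ ?_ f <;> simp [jz, evalL_T]

theorem proj_evalL_self {u : (GroupRing n)ˣ} {g : Z3} (hu : (u : GroupRing n) = mono n g)
    {θ : Z3 →+ ℤ} (hg : θ g = 1) (f : Lau n) : proj n θ 0 (evalL u f) = f := by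
  refine DFunLike.congr_fun (lau_hom_ext (φ := (proj n θ 0).comp (evalL u)) (ψ := AlgHom.id _ _)
    fun k => ?_) f
  change proj n θ 0 (evalL u (T k)) = T k
  rw [evalL_T, val_zpow_eq_mono n hu, proj_mono_zero, map_zsmul, hg, smul_eq_mul, mul_one]

theorem proj_evalL_zero {u : (GroupRing n)ˣ} {g : Z3} (hu : (u : GroupRing n) = mono n g)
    {θ : Z3 →+ ℤ} (hg : θ g = 0) (f : Lau n) : proj n θ 0 (evalL u f) = C (aug n f) := by
  refine DFunLike.congr_fun (lau_hom_ext (φ := (proj n θ 0).comp (evalL u))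
    (ψ := (Algebra.ofId (ZMod n) (Lau n)).comp (aug n)) fun k => ?_) f
  change proj n θ 0 (evalL u (T k)) = C (aug n (T k))
  rw [evalL_T, val_zpow_eq_mono n hu, proj_mono_zero, map_zsmul, hg, smul_zero, aug_T, map_one, T_zero]

theorem proj_jx {θ : Z3 →+ ℤ} (hg : θ ![1, 0, 0] = 1) (f : Lau n) : proj n θ 0 (jx n f) = f :=
  proj_evalL_self rfl hg f
theorem proj_jy {θ : Z3 →+ ℤ} (hg : θ ![0, 1, 0] = 1) (f : Lau n) : proj n θ 0 (jy n f) = f :=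
  proj_evalL_self rfl hg f
theorem proj_jz {θ : Z3 →+ ℤ} (hg : θ ![0, 0, 1] = 1) (f : Lau n) : proj n θ 0 (jz n f) = f :=
  proj_evalL_self rfl hg f
theorem proj_jx' {θ : Z3 →+ ℤ} (hg : θ ![1, 0, 0] = 0) (f : Lau n) :
    proj n θ 0 (jx n f) = C (aug n f) := proj_evalL_zero rfl hg f
theorem proj_jy' {θ : Z3 →+ ℤ} (hg : θ ![0, 1, 0] = 0) (f : Lau n) :
    proj n θ 0 (jy n f) = C (aug n f) := proj_evalL_zero rfl hg f
theorem proj_jz' {θ : Z3 →+ ℤ} (hg : θ ![0, 0, 1] = 0) (f : Lau n) :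
    proj n θ 0 (jz n f) = C (aug n f) := proj_evalL_zero rfl hg f

@[simp] theorem proj_deg0_jx (f : Lau n) : proj n (deg 0) 0 (jx n f) = f := proj_jx rfl f
@[simp] theorem proj_deg0_jy (f : Lau n) : proj n (deg 0) 0 (jy n f) = C (aug n f) :=
  proj_jy' rfl f
@[simp] theorem proj_deg0_jz (f : Lau n) : proj n (deg 0) 0 (jz n f) = C (aug n f) :=
  proj_jz' rfl f
@[simp] theorem proj_deg1_jx (f : Lau n) : proj n (deg 1) 0 (jx n f) = C (aug n f) :=
  proj_jx' rfl f
@[simp] theorem proj_deg1_jy (f : Lau n) : proj n (deg 1) 0 (jy n f) = f := proj_jy rfl f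
@[simp] theorem proj_deg1_jz (f : Lau n) : proj n (deg 1) 0 (jz n f) = C (aug n f) :=
  proj_jz' rfl f
@[simp] theorem proj_deg2_jx (f : Lau n) : proj n (deg 2) 0 (jx n f) = C (aug n f) :=
  proj_jx' rfl f
@[simp] theorem proj_deg2_jy (f : Lau n) : proj n (deg 2) 0 (jy n f) = C (aug n f) :=
  proj_jy' rfl f
@[simp] theorem proj_deg2_jz (f : Lau n) : proj n (deg 2) 0 (jz n f) = f := proj_jz rfl f

end Inclusion

section Monomials

@[simp] theorem mono_ex : mono n ![1, 0, 0] = tx n := rfl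
@[simp] theorem mono_ey : mono n ![0, 1, 0] = ty n := rfl
@[simp] theorem mono_ez : mono n ![0, 0, 1] = tz n := rfl

end Monomials

section Kernel

variable {f : GroupRing n}

theorem of_proj_x (h : proj n (deg 0) 0 f = 0) : ∃ a b, f = (1 - ty n) * a + (1 - tz n) * b := by
  obtain ⟨a, ha⟩ := eq_atY f
  obtain ⟨b, hb⟩ := of_atZ (f := atY n f) (by rw [atYZ, h, map_zero])
  exact ⟨a, b, by rw [ha, hb, add_comm]⟩

theorem of_proj_y (h : proj n (deg 1) 0 f = 0) : ∃ a b, f = (1 - tx n) * a + (1 - tz n) * b := by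
  obtain ⟨a, ha⟩ := eq_atX f
  obtain ⟨b, hb⟩ := of_atZ (f := atX n f) (by rw [atXZ, h, map_zero])
  exact ⟨a, b, by rw [ha, hb, add_comm]⟩

theorem of_proj_z (h : proj n (deg 2) 0 f = 0) : ∃ a b, f = (1 - tx n) * a + (1 - ty n) * b := by
  obtain ⟨a, ha⟩ := eq_atX f
  obtain ⟨b, hb⟩ := of_atY (f := atX n f) (by rw [atXY, h, map_zero])
  exact ⟨a, b, by rw [ha, hb, add_comm]⟩

theorem of_proj_yz (hy : proj n (deg 1) 0 f = 0) (hz : proj n (deg 2) 0 f = 0) :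
    ∃ a b, f = (1 - tx n) * a + (1 - ty n) * (1 - tz n) * b := by
  obtain ⟨a, ha⟩ := eq_atX f
  obtain ⟨b, hb⟩ := of_atZ (f := atX n f) (by rw [atXZ, hy, map_zero])
  have h1 : atY n (atX n f) = 0 := by rw [atXY, hz, map_zero]
  rw [hb] at h1
  simp only [map_mul, map_sub, map_one, atY_tz] at h1
  obtain ⟨c, rfl⟩ := of_atY (of_z h1)
  exact ⟨a, c, by rw [ha, hb]; ring⟩

theorem of_proj_xy (hx : proj n (deg 0) 0 f = 0) (hy : proj n (deg 1) 0 f = 0) :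
    ∃ a b, f = (1 - tz n) * a + (1 - tx n) * (1 - ty n) * b := by
  obtain ⟨a, ha⟩ := eq_atZ f
  have hx' : proj n (deg 0) 0 (atZ n f) = 0 := by
    rw [ha] at hx
    simpa using hx
  have hy' : proj n (deg 1) 0 (atZ n f) = 0 := by
    rw [ha] at hy
    simpa using hy
  obtain ⟨a', b', h'⟩ := of_proj_x hx'
  have h2 : atX n (atZ n f) = 0 := by
    have h3 : ∀ f : GroupRing n, atX n (atZ n f) = jy n (proj n (deg 1) 0 f) := fun f => by
      refine subst_subst_eq ?_ ?_ ?_ f <;> simp [jy, evalL_T]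
    rw [h3, hy, map_zero]
  obtain ⟨b, hb⟩ := of_atX h2
  have h4 : atY n (atZ n f) = 0 := by
    have h3 : ∀ f : GroupRing n, atY n (atZ n f) = jx n (proj n (deg 0) 0 f) := fun f => by
      refine subst_subst_eq ?_ ?_ ?_ f <;> simp [jx, evalL_T]
    rw [h3, hx, map_zero]
  rw [hb] at h4
  simp only [map_mul, map_sub, map_one, atY_tx] at h4
  obtain ⟨c, rfl⟩ := of_atY (of_x h4)
  exact ⟨a, c, by rw [ha, hb]; ring⟩

theorem of_proj_xyz (hx : proj n (deg 0) 0 f = 0) (hy : proj n (deg 1) 0 f = 0)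
    (hz : proj n (deg 2) 0 f = 0) : ∃ a b c, f = (1 - ty n) * (1 - tz n) * a +
      (1 - tz n) * (1 - tx n) * b + (1 - tx n) * (1 - ty n) * c := by
  obtain ⟨a, b, rfl⟩ := of_proj_yz hy hz
  have h1 : (1 - T 1 : Lau n) * proj n (deg 0) 0 a = 0 := by simpa using hx
  have h2 : proj n (deg 0) 0 a = 0 := by
    refine lau_eq_zero_of_T_sub_one_mul (k := 1) one_ne_zero (c := 1) isUnit_one ?_
    rw [map_one, one_mul]
    linear_combination -h1
  obtain ⟨c, d, rfl⟩ := of_proj_x h2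
  exact ⟨b, d, c, by ring⟩

theorem cube_syzygy {f₁ f₂ f₃ : GroupRing n} (h : (1 - tyi n) * (1 - tzi n) * f₁ +
    (1 - tzi n) * (1 - txi n) * f₂ + (1 - txi n) * (1 - tyi n) * f₃ = 0) :
    ∃ h₁ h₂, f₁ = (1 - txi n) * h₁ ∧ f₂ = (1 - tyi n) * h₂ ∧ f₃ = (1 - tzi n) * (-h₁ - h₂) := by
  have h1 := congrArg (atX n) h
  have h2 := congrArg (atY n) h
  have h3 := congrArg (atZ n) h
  simp only [map_add, map_mul, map_sub, map_one, map_zero, atX_txi, atX_tyi, atX_tzi, atY_txi,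
    atY_tyi, atY_tzi, atZ_txi, atZ_tyi, atZ_tzi, sub_self, mul_zero, zero_mul, add_zero,
    zero_add, mul_assoc] at h1 h2 h3
  obtain ⟨g₁, rfl⟩ := of_atX (of_zi (of_yi h1))
  obtain ⟨g₂, rfl⟩ := of_atY (of_xi (of_zi h2))
  obtain ⟨g₃, rfl⟩ := of_atZ (of_yi (of_xi h3))
  have h4 : -tx n * g₁ + -ty n * g₂ + -tz n * g₃ = 0 := by
    refine of_xi (of_yi (of_zi ?_))
    linear_combination h + (1 - tyi n) * (1 - tzi n) * g₁ * tx_mul_txi n +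
      (1 - tzi n) * (1 - txi n) * g₂ * ty_mul_tyi n + (1 - txi n) * (1 - tyi n) * g₃ * tz_mul_tzi n
  refine ⟨-tx n * g₁, -ty n * g₂, ?_, ?_, ?_⟩
  · linear_combination -g₁ * tx_mul_txi n
  · linear_combination -g₂ * ty_mul_tyi n
  · linear_combination -g₃ * tz_mul_tzi n + (1 - tzi n) * h4

end Kernel

end Cube

open LaurentPolynomial

theorem HalfLoop.of_proj {n t t' q k : ℕ} {a : Matrix (Fin t) (Fin q) (GroupRing n)}
    {b : Matrix (Fin t') (Fin q) (GroupRing n)} {θ : Fin k → (Z3 →+ ℤ)}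
    {p : Matrix (Fin k) (Fin t) (Lau n)} {p' : Matrix (Fin k) (Fin t') (Lau n)} {g h : Z3}
    {i : Fin k} {d u : Lau n} {e : Fin t → GroupRing n} {sg sh : Fin q → GroupRing n}
    {w : Fin t' → GroupRing n} (left : ∀ j, ∑ k, a j k * sg k = (mono n g - 1) * e j)
    (right : ∀ j, ∑ k, a j k * sh k = (mono n h - 1) * e j)
    (loop : ∀ k, ∑ j, antipode n (b j k) * w j = (1 - mono n h) * sg k - (1 - mono n g) * sh k)
    (charge : ∀ l, ∑ j, p l j * proj n (θ l) 0 (e j) = Pi.single (M := fun _ => Lau n) i d l)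
    (hg : θ i g = 0) (hh : θ i h = 0) (hspan : ∀ m, θ i m = 0 → ∃ a b : ℤ, a • g + b • h = m)
    (hw : ∀ j, proj n (θ i) 0 (antipode n (w j)) = u * p' i j) :
    HalfLoop a b θ 0 p p' g h i d u e sg sh w where
  left := left
  right := right
  loop := loop
  charge := charge
  stat f j := by
    rw [coeffSum_closure_eq_coeff hg hh hspan, map_mul, hw]
    rfl

theorem T_one_mul_eq_self {n : ℕ} {f : Lau n} (h : (1 - T 1 : Lau n) * f = 0) : f = 0 := by
  refine lau_eq_zero_of_T_sub_one_mul (k := 1) one_ne_zero (c := 1) isUnit_one ?_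
  rw [map_one, one_mul]
  linear_combination -h

namespace XCube

variable (n : ℕ)

theorem halfExactZ : HalfExact (n := n) (t := 2) (t' := 1) (q := 3) (k := 3) (c := 1)
    (xCube n).eZ (xCube n).eX deg 0 (xCubeSeq n).pZ (xCubeSeq n).oZ where
  inj w h := by
    have h1 := h 0
    simp [xCube] at h1
    funext j
    rw [Subsingleton.elim j 0]
    refine of_z (of_y ?_)
    linear_combination h1
  comp i j := by
    rw [Subsingleton.elim j 0]
    fin_cases i <;> simp [xCube, Fin.sum_univ_three] <;> ring
  exP s h := by
    have h1 := h 0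
    have h2 := h 1
    simp [xCube, Fin.sum_univ_three] at h1 h2
    have h3 := congrArg (atZ n) h1
    simp at h3
    obtain ⟨c, hc⟩ := of_atZ (f := s 1) (of_y (by linear_combination -h3))
    have h4 : s 2 - (1 - ty n) * c = 0 := of_z (by linear_combination h1 + (1 - ty n) * hc)
    have h5 := congrArg (atX n) h2
    rw [sub_eq_zero] at h4
    rw [h4] at h5
    simp at h5
    obtain ⟨d, rfl⟩ := of_atX (of_y (of_z h5))
    have h6 : s 0 - (1 - ty n) * (1 - tz n) * d = 0 :=
      of_x (by linear_combination -h2 + (1 - tz n) * h4)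
    refine ⟨![-d], fun k => ?_⟩
    match k with
    | 0 => simp [xCube]; linear_combination -h6
    | 1 => simp [xCube]; linear_combination -hc
    | 2 => simp [xCube]; linear_combination -h4
  compE i k := by
    fin_cases i <;> fin_cases k <;> simp [xCube, xCubeSeq, Fin.sum_univ_two]
  exE v h := by
    have h1 := h 0
    have h2 := h 1
    have h3 := h 2
    simp [xCubeSeq, Fin.sum_univ_two] at h1 h2 h3
    obtain ⟨a, b, hab⟩ := of_proj_x h1
    obtain ⟨c, d, hcd⟩ := of_proj_yz (f := v 1 - (1 - tz n) * b) (by simp [h2]) (by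
      rw [hab] at h3
      simp at h3 ⊢
      linear_combination -h3)
    refine ⟨![-c, -a + (1 - tz n) * d, b + (1 - ty n) * d], fun j => ?_⟩
    match j with
    | 0 => simp [xCube, Fin.sum_univ_three]; linear_combination -hab
    | 1 => simp [xCube, Fin.sum_univ_three]; linear_combination -hcd
  compQ v l := by
    rw [Subsingleton.elim l 0]
    simp [xCubeSeq, Fin.sum_univ_three, Fin.sum_univ_two, wsum_const, aug_proj]
    ring
  exQ q h := by
    have h1 := h 0
    simp [xCubeSeq, Fin.sum_univ_three, wsum_const] at h1
    refine ⟨![-jx n (q 0) + jz n (q 2 - C (aug n (q 2))), jy n (q 1)], fun i => ?_⟩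
    match i with
    | 0 => simp [xCubeSeq, Fin.sum_univ_two]
    | 1 => simp [xCubeSeq, Fin.sum_univ_two]
    | 2 =>
      simp [xCubeSeq, Fin.sum_univ_two]
      have h2 := congrArg (C : ZMod n → Lau n) h1
      simp only [map_add, map_zero] at h2
      linear_combination -h2
  surj r := by
    refine ⟨![C (r 0), 0, 0], fun l => ?_⟩
    rw [Subsingleton.elim l 0]
    simp [xCubeSeq, Fin.sum_univ_three, wsum_const]

theorem halfExactX : HalfExact (n := n) (t := 1) (t' := 2) (q := 3) (k := 3) (c := 2)
    (xCube n).eX (xCube n).eZ deg 0 (xCubeSeq n).pX (xCubeSeq n).oX where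
  inj w h := by
    have h1 := h 0
    have h2 := h 1
    simp [xCube, Fin.sum_univ_two] at h1 h2
    funext j
    match j with
    | 0 => exact of_yi (by linear_combination -h2)
    | 1 => exact of_xi (by linear_combination -h1)
  comp i j := by
    rw [Subsingleton.elim i 0]
    fin_cases j <;> simp [xCube, Fin.sum_univ_three] <;> ring
  exP s h := by
    have h1 := h 0
    simp [xCube, Fin.sum_univ_three] at h1
    obtain ⟨a, b, ha, hb, hc⟩ := cube_syzygy (f₁ := s 0) (f₂ := s 1) (f₃ := s 2)
      (by linear_combination -h1)
    refine ⟨![-b, -a], fun k => ?_⟩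
    match k with
    | 0 => simp [xCube, Fin.sum_univ_two]; linear_combination -ha
    | 1 => simp [xCube, Fin.sum_univ_two]; linear_combination -hb
    | 2 => simp [xCube, Fin.sum_univ_two]; linear_combination -hc
  compE i k := by
    fin_cases i <;> fin_cases k <;> simp [xCube, xCubeSeq]
  exE v h := by
    have h1 := h 0
    have h2 := h 1
    have h3 := h 2
    simp [xCubeSeq] at h1 h2 h3
    obtain ⟨a, b, c, hv⟩ := of_proj_xyz h1 h2 h3
    refine ⟨![-(ty n * tz n * a), -(tz n * tx n * b), -(tx n * ty n * c)], fun j => ?_⟩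
    rw [Subsingleton.elim j 0]
    simp [xCube, Fin.sum_univ_three]
    have e1 := tx_mul_txi n
    have e2 := ty_mul_tyi n
    have e3 := tz_mul_tzi n
    clear h h1 h2 h3
    grind
  compQ v l := by
    fin_cases l <;> simp [xCubeSeq, Fin.sum_univ_three, wsum_const, aug_proj]
  exQ q h := by
    have h1 := h 0
    have h2 := h 1
    simp [xCubeSeq, Fin.sum_univ_three, wsum_const] at h1 h2
    have h1' : aug n (q 0) = aug n (q 2) := by linear_combination h1
    have h2' : aug n (q 1) = aug n (q 2) := by linear_combination h2
    refine ⟨![jx n (q 0) + jy n (q 1) + jz n (q 2 - C (aug n (q 2) + aug n (q 2)))], fun i => ?_⟩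
    match i with
    | 0 => simp [xCubeSeq, h2']
    | 1 => simp [xCubeSeq, h1']
    | 2 => simp [xCubeSeq, h1', h2']
  surj r := by
    refine ⟨![C (r 0), C (r 1), 0], fun l => ?_⟩
    fin_cases l <;> simp [xCubeSeq, Fin.sum_univ_three, wsum_const]

theorem exists_span (i : Fin 3) (m : Z3) (hm : deg i m = 0) : ∃ a b : ℤ,
    a • (![![0, 0, 1], ![1, 0, 0], ![0, 1, 0]] i : Z3) + b • (![![0, 1, 0], ![0, 0, 1], ![1, 0, 0]] i : Z3) = m := by
  match i with
  | 0 =>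
    have hm0 : m 0 = 0 := hm
    refine ⟨m 2, m 1, ?_⟩
    funext k
    fin_cases k <;> simp [hm0]
  | 1 =>
    have hm0 : m 1 = 0 := hm
    refine ⟨m 0, m 2, ?_⟩
    funext k
    fin_cases k <;> simp [hm0]
  | 2 =>
    have hm0 : m 2 = 0 := hm
    refine ⟨m 1, m 0, ?_⟩
    funext k
    fin_cases k <;> simp [hm0]

theorem loopsZ (i : Fin 3) : ∃ e sg sh w, HalfLoop (n := n) (t := 2) (t' := 1) (q := 3) (k := 3)
    (xCube n).eZ (xCube n).eX deg 0 (xCubeSeq n).pZ (xCubeSeq n).pX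
    (![![0, 0, 1], ![1, 0, 0], ![0, 1, 0]] i) (![![0, 1, 0], ![0, 0, 1], ![1, 0, 0]] i) i (1 - T 1)
    (-1) e sg sh w := by
  match i with
  | 0 =>
    refine ⟨![-(1 - tx n), 0], ![1 - tz n, 0, 1 - tx n], ![0, -(1 - tx n), 0], ![-1],
      HalfLoop.of_proj ?_ ?_ ?_ ?_ rfl rfl (exists_span 0) ?_⟩
    · intro j
      fin_cases j <;> simp [xCube, Fin.sum_univ_three] <;> ring
    · intro j
      fin_cases j <;> simp [xCube, Fin.sum_univ_three]
    · intro k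
      fin_cases k <;> simp [xCube] <;> ring
    · intro l
      fin_cases l <;> simp [xCubeSeq, Fin.sum_univ_two]
    · intro j
      rw [Subsingleton.elim j 0]
      simp [xCubeSeq]
  | 1 =>
    refine ⟨![0, 1 - ty n], ![1 - ty n, 0, 0], ![0, -(1 - tz n), -(1 - ty n)], ![-1],
      HalfLoop.of_proj ?_ ?_ ?_ ?_ rfl rfl (exists_span 1) ?_⟩
    · intro j
      fin_cases j <;> simp [xCube, Fin.sum_univ_three]
    · intro j
      fin_cases j <;> simp [xCube, Fin.sum_univ_three] <;> ring
    · intro k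
      fin_cases k <;> simp [xCube] <;> ring
    · intro l
      fin_cases l <;> simp [xCubeSeq, Fin.sum_univ_two]
    · intro j
      rw [Subsingleton.elim j 0]
      simp [xCubeSeq]
  | 2 =>
    refine ⟨![1 - tz n, 0], ![0, 1 - tz n, 0], ![-(1 - tz n), 0, -(1 - tx n)], ![-1],
      HalfLoop.of_proj ?_ ?_ ?_ ?_ rfl rfl (exists_span 2) ?_⟩
    · intro j
      fin_cases j <;> simp [xCube, Fin.sum_univ_three]
    · intro j
      fin_cases j <;> simp [xCube, Fin.sum_univ_three] <;> ring
    · intro k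
      fin_cases k <;> simp [xCube] <;> ring
    · intro l
      fin_cases l <;> simp [xCubeSeq, Fin.sum_univ_two]
    · intro j
      rw [Subsingleton.elim j 0]
      simp [xCubeSeq]

theorem loopsX (i : Fin 3) : ∃ e sg sh w, HalfLoop (n := n) (t := 1) (t' := 2) (q := 3) (k := 3)
    (xCube n).eX (xCube n).eZ deg 0 (xCubeSeq n).pX (xCubeSeq n).pZ
    (![![0, 0, 1], ![1, 0, 0], ![0, 1, 0]] i) (![![0, 1, 0], ![0, 0, 1], ![1, 0, 0]] i) i
    (1 - T (-1)) 1 e sg sh w := by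
  have e1 := tx_mul_txi n
  have e2 := ty_mul_tyi n
  have e3 := tz_mul_tzi n
  match i with
  | 0 =>
    refine ⟨![1 - txi n], ![0, -tz n, 0], ![0, 0, -ty n], ![-(ty n * tz n), 0],
      HalfLoop.of_proj ?_ ?_ ?_ ?_ rfl rfl (exists_span 0) ?_⟩
    · intro j
      rw [Subsingleton.elim j 0]
      simp [xCube, Fin.sum_univ_three]
      grind
    · intro j
      rw [Subsingleton.elim j 0]
      simp [xCube, Fin.sum_univ_three]
      grind
    · intro k
      fin_cases k <;> simp [xCube] <;> grind
    · intro l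
      fin_cases l <;> simp [xCubeSeq]
    · intro j
      fin_cases j <;> simp [xCubeSeq]
  | 1 =>
    refine ⟨![1 - tyi n], ![0, 0, -tx n], ![-tz n, 0, 0], ![0, tx n * tz n],
      HalfLoop.of_proj ?_ ?_ ?_ ?_ rfl rfl (exists_span 1) ?_⟩
    · intro j
      rw [Subsingleton.elim j 0]
      simp [xCube, Fin.sum_univ_three]
      grind
    · intro j
      rw [Subsingleton.elim j 0]
      simp [xCube, Fin.sum_univ_three]
      grind
    · intro k
      fin_cases k <;> simp [xCube] <;> grind
    · intro l
      fin_cases l <;> simp [xCubeSeq]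
    · intro j
      fin_cases j <;> simp [xCubeSeq]
  | 2 =>
    refine ⟨![1 - tzi n], ![-ty n, 0, 0], ![0, -tx n, 0], ![tx n * ty n, -(tx n * ty n)],
      HalfLoop.of_proj ?_ ?_ ?_ ?_ rfl rfl (exists_span 2) ?_⟩
    · intro j
      rw [Subsingleton.elim j 0]
      simp [xCube, Fin.sum_univ_three]
      grind
    · intro j
      rw [Subsingleton.elim j 0]
      simp [xCube, Fin.sum_univ_three]
      grind
    · intro k
      fin_cases k <;> simp [xCube, Fin.sum_univ_two] <;> grind
    · intro l
      fin_cases l <;> simp [xCubeSeq]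
    · intro j
      fin_cases j <;> simp [xCubeSeq]

end XCube

open LaurentPolynomial

/-- The plane charges of one orientation. -/
def part {n k : ℕ} (i : Fin k) (q : Fin k ⊕ Fin k → Lau n) : Fin k ⊕ Fin k → Lau n :=
  Sum.elim (Pi.single i (q (Sum.inl i))) (Pi.single i (q (Sum.inr i)))

theorem sum_part {n k : ℕ} (q : Fin k ⊕ Fin k → Lau n) : ∑ i, part i q = q := by
  funext s
  rw [Finset.sum_apply]
  rcases s with l | l
  · simp only [part, Sum.elim_inl]
    rw [Finset.sum_eq_single l]
    · simp
    · intro b _ hb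
      exact Pi.single_eq_of_ne hb.symm _
    · simp
  · simp only [part, Sum.elim_inr]
    rw [Finset.sum_eq_single l]
    · simp
    · intro b _ hb
      exact Pi.single_eq_of_ne hb.symm _
    · simp

theorem wt_part {n k : ℕ} (i : Fin k) (q : Fin k ⊕ Fin k → Lau n) : wt (part i q) ≤ 1 := by
  refine wt_le {i} fun j hj => ?_
  rw [Finset.mem_singleton] at hj
  exact ⟨Pi.single_eq_of_ne hj _, Pi.single_eq_of_ne hj _⟩

/-- The sum of coefficients of one plane charge. -/
def augAt {n k : ℕ} (s : Fin k ⊕ Fin k) : (Fin k ⊕ Fin k → Lau n) →ₗ[ZMod n] ZMod n :=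
  (aug n).toLinearMap ∘ₗ LinearMap.proj s

@[simp] theorem augAt_apply {n k : ℕ} (s : Fin k ⊕ Fin k) (q : Fin k ⊕ Fin k → Lau n) :
    augAt s q = aug n (q s) := rfl

/-- A description of the charges that satisfy constraints modulo those of weight at most `i`. -/
def HasWeights {n k : ℕ} (Ω : Set (Fin k ⊕ Fin k → Lau n)) (i : ℕ) (A : Type) [AddCommGroup A] :
    Prop :=
  ∃ φ : (Fin k ⊕ Fin k → Lau n) →+ A, (∀ a, ∃ q ∈ Ω, φ q = a) ∧ (∀ q ∈ Ω, wt q ≤ i → φ q = 0) ∧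
    ∀ q ∈ Ω, φ q = 0 → q ∈ AddSubgroup.closure {r | r ∈ Ω ∧ wt r ≤ i}

theorem mem_closure_of_part {n k : ℕ} {Ω : Set (Fin k ⊕ Fin k → Lau n)}
    {q : Fin k ⊕ Fin k → Lau n} {i : ℕ} (hi : 1 ≤ i) (h : ∀ l, part l q ∈ Ω) :
    q ∈ AddSubgroup.closure {r | r ∈ Ω ∧ wt r ≤ i} := by
  have h1 : ∑ l, part l q ∈ AddSubgroup.closure {r | r ∈ Ω ∧ wt r ≤ i} :=
    sum_mem fun l _ => AddSubgroup.subset_closure ⟨h l, (wt_part l q).trans hi⟩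
  rwa [sum_part] at h1

theorem hasWeights_of_functionals {n k : ℕ} {Ω : Set (Fin k ⊕ Fin k → Lau n)} {i m : ℕ}
    (ℓ : Fin m → (Fin k ⊕ Fin k → Lau n) →ₗ[ZMod n] ZMod n)
    (hsurj : ∀ a : Fin m → ZMod n, ∃ q ∈ Ω, ∀ j, ℓ j q = a j)
    (hvan : ∀ q ∈ Ω, wt q ≤ i → ∀ j, ℓ j q = 0)
    (hgen : ∀ q ∈ Ω, (∀ j, ℓ j q = 0) → q ∈ AddSubgroup.closure {r | r ∈ Ω ∧ wt r ≤ i}) :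
    HasWeights Ω i (AbGrp (List.replicate m n)) := by
  obtain ⟨e⟩ := abGrp_replicate n m (α := Fin m) (by simp)
  refine ⟨(e : (Fin m → ZMod n) →+ _).comp (LinearMap.pi ℓ).toAddMonoidHom, fun a => ?_,
    fun q hq h => ?_, fun q hq h => hgen q hq fun j => ?_⟩
  · obtain ⟨q, hq, h⟩ := hsurj (e.symm a)
    exact ⟨q, hq, (congrArg e (funext h)).trans (e.apply_symm_apply a)⟩
  · exact (congrArg e (funext (hvan q hq h))).trans e.map_zero
  · exact congrFun (e.map_eq_zero_iff.1 h) j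

theorem hasWeights_nil {n k : ℕ} {Ω : Set (Fin k ⊕ Fin k → Lau n)} {i : ℕ} (h0 : 0 ∈ Ω) (hi : k ≤ i) :
    HasWeights Ω i (AbGrp []) :=
  ⟨0, fun _ => ⟨0, h0, funext fun j => j.elim0⟩, fun _ _ _ => rfl,
    fun q hq _ => AddSubgroup.subset_closure ⟨hq, (wt_le_card q).trans hi⟩⟩

namespace BraidData

variable {n : ℕ} {X : CSSCode n} {M : SeqData X} (B : BraidData M)
  {η : Z3 →+ E3} {normal : Plane → E3} {form : Plane → X.Sec → (X.Sec →ₗ[ZMod n] ZMod n)}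

include B in
theorem nonempty_W_equiv_of_hasWeights (hT : X.IsTheory η normal form) {i : ℕ} {A : Type}
    [AddCommGroup A] {Ω : Set (Fin M.k ⊕ Fin M.k → Lau n)} (hΩ : ∀ q, M.omega q = 0 ↔ q ∈ Ω)
    (h : HasWeights Ω i A) : Nonempty ((X.theory η normal form).W i ≃+ A) := by
  obtain ⟨φ, h1, h2, h3⟩ := h
  obtain rfl : {q | M.omega q = 0} = Ω := Set.ext hΩ
  exact B.nonempty_W_equiv hT i φ h1 h2 h3

include B in
/-- The foliation of a theory with untwisted planar constraints. -/
theorem isFoliated_of_planar (hχ : M.χ = 0) (hΔ : ∀ i, B.Δ i = 1 - T 1)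
    (hT : X.IsTheory η normal form) : (X.theory η normal form).IsFoliated 1 :=
  (B.theoryModel hT).isFoliated_of_planar hT.unitNormal (fun i g => by
    change ((((-1 : (ZMod n)ˣ) ^ M.χ i g : (ZMod n)ˣ)) : ZMod n) = 1
    rw [hχ]
    exact congrArg Units.val (zpow_zero (-1 : (ZMod n)ˣ))) fun i _ => hΔ i

include B in
/-- The foliation of a theory without constraints. -/
theorem isFoliated_of_one (hχ : M.χ = 0) (hΔ : ∀ i, B.Δ i = 1) (hT : X.IsTheory η normal form) :
    (X.theory η normal form).IsFoliated 1 :=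
  (B.theoryModel hT).isFoliated_of_one hT.unitNormal (fun i g => by
    change ((((-1 : (ZMod n)ˣ) ^ M.χ i g : (ZMod n)ˣ)) : ZMod n) = 1
    rw [hχ]
    exact congrArg Units.val (zpow_zero (-1 : (ZMod n)ˣ))) fun i _ => hΔ i

end BraidData

theorem invert_one_sub_T_dvd {n : ℕ} {f : Lau n} (h : aug n f = 0) :
    invert (1 - T 1 : Lau n) ∣ f := by
  rw [← aug_invert, ← one_sub_T_dvd_iff] at h
  obtain ⟨c, hc⟩ := h
  refine ⟨invert c, ?_⟩
  rw [← map_mul, ← hc, involutive_invert f]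

theorem planeMap_injective_of_coord {g h : Z3} {s t : Fin 3} (hd : g s * h t - g t * h s ≠ 0) :
    Function.Injective (CSSCode.planeMap g h) := by
  rw [injective_iff_map_eq_zero]
  intro v hv
  have hs : v 0 * g s + v 1 * h s = 0 := congrFun hv s
  have ht : v 0 * g t + v 1 * h t = 0 := congrFun hv t
  have h0 : v 0 * (g s * h t - g t * h s) = 0 := by linear_combination h t * hs - h s * ht
  have h1 : v 1 * (g s * h t - g t * h s) = 0 := by linear_combination g s * ht - g t * hs
  funext i
  match i with
  | 0 => exact (mul_eq_zero.1 h0).resolve_right hd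
  | 1 => exact (mul_eq_zero.1 h1).resolve_right hd

theorem deg_surjective (i : Fin 3) : Function.Surjective (deg i) := fun k =>
  ⟨Pi.single i k, by simp⟩

theorem exists_deg {i j : Fin 3} (hij : i ≠ j) : ∃ g, deg i g = 0 ∧ deg j g ≠ 0 :=
  ⟨Pi.single j 1, by simp [hij], by simp⟩

namespace XCube

variable {n : ℕ}

/-- The constraints on plane charges. -/
def Constraints (n : ℕ) : Set (Fin 3 ⊕ Fin 3 → Lau n) :=
  {q | aug n (q (Sum.inl 0)) + aug n (q (Sum.inl 1)) + aug n (q (Sum.inl 2)) = 0 ∧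
      aug n (q (Sum.inr 0)) = aug n (q (Sum.inr 2)) ∧
      aug n (q (Sum.inr 1)) = aug n (q (Sum.inr 2))}

theorem omega_eq_zero_iff (q : Fin 3 ⊕ Fin 3 → Lau n) :
    (xCubeSeq n).omega q = 0 ↔ q ∈ Constraints n := by
  change _ ↔ _ ∧ _ ∧ _
  have hZ : (xCubeSeq n).omega q (Sum.inl (0 : Fin 1)) = _ :=
    Fin.sum_univ_three fun i => wsum ((xCubeSeq n).oZ (0 : Fin 1) i) (q (Sum.inl i))
  have h0 : (xCubeSeq n).omega q (Sum.inr (0 : Fin 2)) = _ :=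
    Fin.sum_univ_three fun i => wsum ((xCubeSeq n).oX (0 : Fin 2) i) (q (Sum.inr i))
  have h1 : (xCubeSeq n).omega q (Sum.inr (1 : Fin 2)) = _ :=
    Fin.sum_univ_three fun i => wsum ((xCubeSeq n).oX (1 : Fin 2) i) (q (Sum.inr i))
  simp [xCubeSeq, wsum_const, ← sub_eq_add_neg] at hZ h0 h1
  rw [← sub_eq_zero (a := aug n (q (Sum.inr 0))), ← sub_eq_zero (a := aug n (q (Sum.inr 1))),
    ← hZ, ← h0, ← h1]
  refine ⟨fun h => ⟨congrFun h _, congrFun h _, congrFun h _⟩, fun h => ?_⟩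
  funext l
  match l with
  | Sum.inl (0 : Fin 1) => exact h.1
  | Sum.inr (0 : Fin 2) => exact h.2.1
  | Sum.inr (1 : Fin 2) => exact h.2.2

theorem dvd_of_omega_eq_zero (i : Fin 3) (q : Fin 3 ⊕ Fin 3 → Lau n) (hq : (xCubeSeq n).omega q = 0)
    (h : ∀ j, j ≠ i → q (Sum.inl j) = 0 ∧ q (Sum.inr j) = 0) :
    1 - T 1 ∣ q (Sum.inl i) ∧ invert (1 - T 1) ∣ q (Sum.inr i) := by
  obtain ⟨h1, h2, h3⟩ := (omega_eq_zero_iff _).1 hq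
  rw [one_sub_T_dvd_iff]
  refine And.imp_right invert_one_sub_T_dvd ?_
  match i with
  | 0 =>
    simp [h 1 (by decide), h 2 (by decide)] at h1 h2 h3
    exact ⟨h1, h2⟩
  | 1 =>
    simp [h 0 (by decide), h 2 (by decide)] at h1 h2 h3
    exact ⟨h1, h3⟩
  | 2 =>
    simp [h 0 (by decide), h 1 (by decide)] at h1 h2 h3
    exact ⟨h1, h2.symm⟩

theorem exists_pi_eq_one (i : Fin 3) :
    (∃ v, (xCubeSeq n).pi v (Sum.inl i) = 1 ∧ (xCubeSeq n).pi v (Sum.inr i) = 0) ∧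
      ∃ v, (xCubeSeq n).pi v (Sum.inl i) = 0 ∧ (xCubeSeq n).pi v (Sum.inr i) = 1 :=
  (xCubeSeq n).exists_pi_eq_one (deg_surjective i)
    (match i with
      | 0 => ⟨(0 : Fin 2), by simp [xCubeSeq]⟩
      | 1 => ⟨(1 : Fin 2), by simp [xCubeSeq]⟩
      | 2 => ⟨(0 : Fin 2), by simp [xCubeSeq]⟩)
    (match i with
      | 0 => ⟨(0 : Fin 1), by simp [xCubeSeq]⟩
      | 1 => ⟨(0 : Fin 1), by simp [xCubeSeq]⟩
      | 2 => ⟨(0 : Fin 1), by simp [xCubeSeq]⟩)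

theorem isExact : (xCubeSeq n).IsExact :=
  HalfExact.isExact (M := xCubeSeq n) (halfExactZ n) (halfExactX n)

/-- The canonical loops of the X-cube model. -/
def braidData (hn : 1 < n) : BraidData (xCubeSeq n) where
  one_lt := hn
  exact := isExact
  surj := deg_surjective
  indep _ _ := exists_deg
  Δ _ := 1 - T 1
  κ _ := 0
  Δ_reg _ _ := T_one_mul_eq_self
  surjZ i := (exists_pi_eq_one i).1
  surjX i := (exists_pi_eq_one i).2
  dvd i v h := dvd_of_omega_eq_zero i _ ((isExact.2.2.2.1 _).2 ⟨v, rfl⟩) h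
  g := ![![0, 0, 1], ![1, 0, 0], ![0, 1, 0]]
  h := ![![0, 1, 0], ![0, 0, 1], ![1, 0, 0]]
  θ_g i := match i with
    | (0 : Fin 3) => rfl
    | (1 : Fin 3) => rfl
    | (2 : Fin 3) => rfl
  θ_h i := match i with
    | (0 : Fin 3) => rfl
    | (1 : Fin 3) => rfl
    | (2 : Fin 3) => rfl
  ind i := match i with
    | (0 : Fin 3) => planeMap_injective_of_coord (s := 1) (t := 2) (by decide)
    | (1 : Fin 3) => planeMap_injective_of_coord (s := 0) (t := 2) (by decide)
    | (2 : Fin 3) => planeMap_injective_of_coord (s := 0) (t := 1) (by decide)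
  loopZ i := by
    obtain ⟨e, sg, sh, w, L⟩ := loopsZ n i
    rw [T_zero]
    exact L.loopZ (X := xCube n) (M := xCubeSeq n)
  loopX i := by
    obtain ⟨e, sg, sh, w, L⟩ := loopsX n i
    have := L.loopX (X := xCube n) (M := xCubeSeq n)
    simpa using this

section Weights

variable {q : Fin 3 ⊕ Fin 3 → Lau n}

theorem mem_closure_of_aug {i : ℕ} (hi : 1 ≤ i) (hq : q ∈ Constraints n)
    (h0 : aug n (q (Sum.inl 0)) = 0) (h1 : aug n (q (Sum.inl 1)) = 0)
    (h2 : aug n (q (Sum.inr 0)) = 0) :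
    q ∈ AddSubgroup.closure {r | r ∈ Constraints n ∧ wt r ≤ i} := by
  obtain ⟨e0, e1, e2⟩ := hq
  rw [h2] at e1
  rw [← e1] at e2
  rw [h0, h1, add_zero, zero_add] at e0
  refine mem_closure_of_part hi fun l => ?_
  unfold Constraints
  match l with
  | 0 => simp [part, h0, h2]
  | 1 => simp [part, h1, e2]
  | 2 => simp [part, e0, ← e1]

theorem aug_inr_of_wt (hq : q ∈ Constraints n) (h : wt q ≤ 2) :
    aug n (q (Sum.inr 0)) = 0 := by
  obtain ⟨e0, e1, e2⟩ := hq
  obtain ⟨i, -, hi⟩ := exists_of_wt_lt (q := q) Finset.univ (by rw [Finset.card_fin]; omega)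
  match i with
  | 0 => rw [hi.2, map_zero]
  | 1 => rw [e1, ← e2, hi.2, map_zero]
  | 2 => rw [e1, hi.2, map_zero]

theorem aug_inl_of_wt (hq : q ∈ Constraints n) (h : wt q ≤ 1) (i : Fin 3) :
    aug n (q (Sum.inl i)) = 0 := by
  obtain ⟨e0, -⟩ := hq
  have key : ∀ i j : Fin 3, i ≠ j → q (Sum.inl i) = 0 ∨ q (Sum.inl j) = 0 := by
    intro i j hij
    obtain ⟨l, hl, h0⟩ := exists_of_wt_lt (q := q) {i, j} (by rw [Finset.card_pair hij]; omega)
    rcases Finset.mem_insert.1 hl with rfl | hl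
    · exact Or.inl h0.1
    · rw [Finset.mem_singleton.1 hl] at h0
      exact Or.inr h0.1
  rcases key 0 1 (by decide) with h1 | h1 <;> rcases key 0 2 (by decide) with h2 | h2 <;>
    rcases key 1 2 (by decide) with h3 | h3 <;> fin_cases i <;> simp_all

end Weights

theorem hasWeights (i : Fin 3) : HasWeights (Constraints n) (i + 1)
    (AbGrp (([[n, n, n], [n], []] : List (List ℕ)).get i)) := by
  match i with
  | 0 =>
    refine hasWeights_of_functionals (i := 1) (m := 3)
      ![augAt (Sum.inl 0), augAt (Sum.inl 1), augAt (Sum.inr 0)]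
      (fun a => ?_) (fun q hq hw j => ?_) fun q hq h => ?_
    · refine ⟨Sum.elim ![C (a 0), C (a 1), C (-a 0 - a 1)] fun _ => C (a 2), ?_, fun j => ?_⟩
      · simp [Constraints]
      · fin_cases j <;> simp
    · fin_cases j
      · exact aug_inl_of_wt hq hw 0
      · exact aug_inl_of_wt hq hw 1
      · exact aug_inr_of_wt hq (hw.trans one_le_two)
    · exact mem_closure_of_aug le_rfl hq (h 0) (h 1) (h 2)
  | 1 =>
    refine hasWeights_of_functionals (i := 2) (m := 1) (fun _ => augAt (Sum.inr 0))
      (fun a => ?_) (fun q hq hw j => aug_inr_of_wt hq hw) fun q hq h => ?_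
    · refine ⟨Sum.elim 0 fun _ => C (a 0), ?_, fun j => ?_⟩
      · simp [Constraints]
      · rw [Subsingleton.elim j 0]
        simp
    · have h0 : aug n (q (Sum.inr 0)) = 0 := h 0
      have hc := hq
      obtain ⟨e0, e1, e2⟩ := hq
      set a := aug n (q (Sum.inl 0)) with ha
      set b := aug n (q (Sum.inl 1)) with hb
      let q₁ : Fin 3 ⊕ Fin 3 → Lau n := Sum.elim ![C a, 0, C (-a)] 0
      let q₂ : Fin 3 ⊕ Fin 3 → Lau n := Sum.elim ![0, C b, C (-b)] 0
      have h1 : q₁ ∈ Constraints n := by simp [Constraints, q₁]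
      have h2 : q₂ ∈ Constraints n := by simp [Constraints, q₂]
      have w1 : wt q₁ ≤ 2 := wt_le {0, 2} fun i hi => by
        fin_cases i <;> simp [q₁] at hi ⊢
      have w2 : wt q₂ ≤ 2 := wt_le {1, 2} fun i hi => by
        fin_cases i <;> simp [q₂] at hi ⊢
      have h3 : q - q₁ - q₂ ∈ AddSubgroup.closure {r | r ∈ Constraints n ∧ wt r ≤ 2} := by
        refine mem_closure_of_aug one_le_two ?_ ?_ ?_ ?_
        · simp [Constraints, q₁, q₂, e1, e2]
          linear_combination e0
        · simp [q₁, q₂, ← ha]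
        · simp [q₁, q₂, ← hb]
        · simp [q₁, q₂, h0]
      have h4 := add_mem (add_mem h3 (AddSubgroup.subset_closure ⟨h2, w2⟩))
        (AddSubgroup.subset_closure ⟨h1, w1⟩)
      rwa [sub_add_cancel, sub_add_cancel] at h4
  | 2 => exact hasWeights_nil (by simp [Constraints]) le_rfl

theorem isPModularWith (hn : 1 < n) :
    (xCube n).IsPModularWith (xCubeSeq n) [n, n, n] [[n, n, n], [n], []] :=
  (braidData hn).isPModularWith (0 : Fin 3) rfl rfl fun _ _ _ hT i =>
    (braidData hn).nonempty_W_equiv_of_hasWeights hT omega_eq_zero_iff (hasWeights i)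

theorem isFoliated (hn : 1 < n) {η : Z3 →+ E3} {normal : Plane → E3}
    {form : Plane → (xCube n).Sec → ((xCube n).Sec →ₗ[ZMod n] ZMod n)}
    (hT : (xCube n).IsTheory η normal form) : ((xCube n).theory η normal form).IsFoliated 1 :=
  (braidData hn).isFoliated_of_planar rfl (fun _ => rfl) hT

end XCube

open LaurentPolynomial

namespace ToricCodeLayers

variable (n : ℕ)

theorem halfExactZ : HalfExact (n := n) (t := 1) (t' := 1) (q := 2) (k := 1) (c := 0)
    (toricCodeLayers n).eZ (toricCodeLayers n).eX (fun _ => deg 2) 0 (toricCodeLayersSeq n).pZ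
    (toricCodeLayersSeq n).oZ where
  inj w h := by
    have h1 := h 0
    simp [toricCodeLayers] at h1
    funext j
    rw [Subsingleton.elim j 0]
    exact of_y (by linear_combination -h1)
  comp i j := by
    rw [Subsingleton.elim i 0, Subsingleton.elim j 0]
    simp [toricCodeLayers]
    ring
  exP s h := by
    have h1 := h 0
    simp [toricCodeLayers] at h1
    have h2 := congrArg (atX n) h1
    simp at h2
    obtain ⟨c, hc⟩ := of_atX (f := s 1) (of_y h2)
    have h3 : s 0 - (1 - ty n) * c = 0 := of_x (by linear_combination -h1 + (1 - ty n) * hc)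
    refine ⟨![-c], fun k => ?_⟩
    match k with
    | 0 => simp [toricCodeLayers]; linear_combination -h3
    | 1 => simp [toricCodeLayers]; linear_combination -hc
  compE i k := by
    rw [Subsingleton.elim i 0]
    fin_cases k <;> simp [toricCodeLayers, toricCodeLayersSeq]
  exE v h := by
    have h1 := h 0
    simp [toricCodeLayersSeq] at h1
    obtain ⟨a, b, hab⟩ := of_proj_z h1
    refine ⟨![-a, b], fun j => ?_⟩
    rw [Subsingleton.elim j 0]
    simp [toricCodeLayers]
    linear_combination -hab
  compQ v l := l.elim0
  exQ q h := ⟨![jz n (q 0)], fun i => by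
    rw [Subsingleton.elim i 0]
    simp [toricCodeLayersSeq]⟩
  surj r := ⟨0, fun l => l.elim0⟩

theorem halfExactX : HalfExact (n := n) (t := 1) (t' := 1) (q := 2) (k := 1) (c := 0)
    (toricCodeLayers n).eX (toricCodeLayers n).eZ (fun _ => deg 2) 0 (toricCodeLayersSeq n).pX
    (toricCodeLayersSeq n).oX where
  inj w h := by
    have h1 := h 0
    simp [toricCodeLayers] at h1
    funext j
    rw [Subsingleton.elim j 0]
    exact of_xi (by linear_combination -h1)
  comp i j := by
    rw [Subsingleton.elim i 0, Subsingleton.elim j 0]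
    simp [toricCodeLayers]
    ring
  exP s h := by
    have h1 := h 0
    simp [toricCodeLayers] at h1
    have h2 := congrArg (atX n) h1
    simp at h2
    obtain ⟨c, hc⟩ := of_atX (f := s 0) (of_yi (by linear_combination -h2))
    have h3 : s 1 - (1 - tyi n) * (tx n * c) = 0 := of_xi (by
      linear_combination -h1 - (1 - tyi n) * hc + (1 - tyi n) * c * tx_mul_txi n)
    refine ⟨![tx n * c], fun k => ?_⟩
    match k with
    | 0 => simp [toricCodeLayers]; linear_combination -hc + c * tx_mul_txi n
    | 1 => simp [toricCodeLayers]; linear_combination -h3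
  compE i k := by
    rw [Subsingleton.elim i 0]
    fin_cases k <;> simp [toricCodeLayers, toricCodeLayersSeq]
  exE v h := by
    have h1 := h 0
    simp [toricCodeLayersSeq] at h1
    obtain ⟨a, b, hab⟩ := of_proj_z h1
    refine ⟨![ty n * b, tx n * a], fun j => ?_⟩
    rw [Subsingleton.elim j 0]
    simp [toricCodeLayers]
    linear_combination -hab + a * tx_mul_txi n + b * ty_mul_tyi n
  compQ v l := l.elim0
  exQ q h := ⟨![jz n (q 0)], fun i => by
    rw [Subsingleton.elim i 0]
    simp [toricCodeLayersSeq]⟩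
  surj r := ⟨0, fun l => l.elim0⟩

theorem exists_span (m : Z3) (hm : deg 2 m = 0) :
    ∃ a b : ℤ, a • (![1, 0, 0] : Z3) + b • (![0, 1, 0] : Z3) = m := by
  have hm0 : m 2 = 0 := hm
  refine ⟨m 0, m 1, ?_⟩
  funext k
  fin_cases k <;> simp [hm0]

theorem loopsZ (i : Fin 1) : ∃ e sg sh w, HalfLoop (n := n) (t := 1) (t' := 1) (q := 2) (k := 1)
    (toricCodeLayers n).eZ (toricCodeLayers n).eX (fun _ => deg 2) 0 (toricCodeLayersSeq n).pZ
    (toricCodeLayersSeq n).pX ![1, 0, 0] ![0, 1, 0] i 1 (-1) e sg sh w := by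
  refine ⟨![1], ![1, 0], ![0, -1], ![-1], HalfLoop.of_proj ?_ ?_ ?_ ?_ rfl rfl exists_span ?_⟩
  · intro j
    rw [Subsingleton.elim j 0]
    simp [toricCodeLayers]
  · intro j
    rw [Subsingleton.elim j 0]
    simp [toricCodeLayers]
  · intro k
    fin_cases k <;> simp [toricCodeLayers]
  · intro l
    rw [Subsingleton.elim l 0, Subsingleton.elim i 0]
    simp [toricCodeLayersSeq]
  · intro j
    rw [Subsingleton.elim j 0, Subsingleton.elim i 0]
    simp [toricCodeLayersSeq]

theorem loopsX (i : Fin 1) : ∃ e sg sh w, HalfLoop (n := n) (t := 1) (t' := 1) (q := 2) (k := 1)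
    (toricCodeLayers n).eX (toricCodeLayers n).eZ (fun _ => deg 2) 0 (toricCodeLayersSeq n).pX
    (toricCodeLayersSeq n).pZ ![1, 0, 0] ![0, 1, 0] i 1 1 e sg sh w := by
  have e1 := tx_mul_txi n
  have e2 := ty_mul_tyi n
  refine ⟨![1], ![0, -tx n], ![-ty n, 0], ![tx n * ty n],
    HalfLoop.of_proj ?_ ?_ ?_ ?_ rfl rfl exists_span ?_⟩
  · intro j
    rw [Subsingleton.elim j 0]
    simp [toricCodeLayers]
    grind
  · intro j
    rw [Subsingleton.elim j 0]
    simp [toricCodeLayers]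
    grind
  · intro k
    fin_cases k <;> simp [toricCodeLayers] <;> grind
  · intro l
    rw [Subsingleton.elim l 0, Subsingleton.elim i 0]
    simp [toricCodeLayersSeq]
  · intro j
    rw [Subsingleton.elim j 0, Subsingleton.elim i 0]
    simp [toricCodeLayersSeq]

variable {n}

theorem omega_eq_zero_iff (q : Fin 1 ⊕ Fin 1 → Lau n) :
    (toricCodeLayersSeq n).omega q = 0 ↔ q ∈ Set.univ := by
  refine ⟨fun _ => trivial, fun _ => funext fun l => ?_⟩
  rcases l with l | l
  · exact Fin.elim0 l
  · exact Fin.elim0 l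

theorem isExact : (toricCodeLayersSeq n).IsExact :=
  HalfExact.isExact (M := toricCodeLayersSeq n) (halfExactZ n) (halfExactX n)

theorem exists_pi_eq_one (i : Fin 1) :
    (∃ v, (toricCodeLayersSeq n).pi v (Sum.inl i) = 1 ∧
        (toricCodeLayersSeq n).pi v (Sum.inr i) = 0) ∧
      ∃ v, (toricCodeLayersSeq n).pi v (Sum.inl i) = 0 ∧
        (toricCodeLayersSeq n).pi v (Sum.inr i) = 1 :=
  (toricCodeLayersSeq n).exists_pi_eq_one (deg_surjective 2)
    ⟨(0 : Fin 1), by rw [Subsingleton.elim i 0]; simp [toricCodeLayersSeq]⟩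
    ⟨(0 : Fin 1), by rw [Subsingleton.elim i 0]; simp [toricCodeLayersSeq]⟩

/-- The canonical loops of the toric code layers. -/
def braidData (hn : 1 < n) : BraidData (toricCodeLayersSeq n) where
  one_lt := hn
  exact := isExact
  surj _ := deg_surjective 2
  indep i j hij := (hij (Subsingleton.elim (α := Fin 1) i j)).elim
  Δ _ := 1
  κ _ := 0
  Δ_reg _ f h := by rwa [one_mul] at h
  surjZ i := (exists_pi_eq_one i).1
  surjX i := (exists_pi_eq_one i).2
  dvd _ _ _ := ⟨one_dvd _, by rw [map_one]; exact one_dvd _⟩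
  g _ := ![1, 0, 0]
  h _ := ![0, 1, 0]
  θ_g _ := rfl
  θ_h _ := rfl
  ind _ := planeMap_injective_of_coord (s := 0) (t := 1) (by decide)
  loopZ i := by
    obtain ⟨e, sg, sh, w, L⟩ := loopsZ n i
    rw [T_zero]
    exact L.loopZ (X := toricCodeLayers n) (M := toricCodeLayersSeq n)
  loopX i := by
    obtain ⟨e, sg, sh, w, L⟩ := loopsX n i
    have := L.loopX (X := toricCodeLayers n) (M := toricCodeLayersSeq n)
    simpa using this

theorem isPModularWith (hn : 1 < n) :
    (toricCodeLayers n).IsPModularWith (toricCodeLayersSeq n) [] [[]] :=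
  (braidData hn).isPModularWith (0 : Fin 1) rfl rfl fun _ _ _ hT i => by
    obtain rfl : i = 0 := Subsingleton.elim (α := Fin 1) i 0
    exact (braidData hn).nonempty_W_equiv_of_hasWeights hT omega_eq_zero_iff
      (hasWeights_nil (i := 1) trivial le_rfl)

theorem isFoliated (hn : 1 < n) {η : Z3 →+ E3} {normal : Plane → E3}
    {form : Plane → (toricCodeLayers n).Sec → ((toricCodeLayers n).Sec →ₗ[ZMod n] ZMod n)}
    (hT : (toricCodeLayers n).IsTheory η normal form) :
    ((toricCodeLayers n).theory η normal form).IsFoliated 1 :=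
  (braidData hn).isFoliated_of_one rfl (fun _ => rfl) hT

end ToricCodeLayers

namespace Anisotropic

variable (n : ℕ)

theorem halfExactZ : HalfExact (n := n) (t := 1) (t' := 1) (q := 2) (k := 2) (c := 1)
    (anisotropic n).eZ (anisotropic n).eX ![deg 0, deg 1] 0 (anisotropicSeq n).pZ
    (anisotropicSeq n).oZ where
  inj w h := by
    have h1 := h 1
    simp [anisotropic] at h1
    funext j
    rw [Subsingleton.elim j 0]
    exact of_z (by linear_combination -h1)
  comp i j := by
    rw [Subsingleton.elim i 0, Subsingleton.elim j 0]
    simp [anisotropic]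
    ring
  exP s h := by
    have h1 := h 0
    simp [anisotropic] at h1
    have h2 := congrArg (atZ n) h1
    simp [mul_assoc] at h2
    obtain ⟨c, hc⟩ := of_atZ (f := s 1) (of_y (of_x h2))
    have h3 : s 0 - (1 - tx n) * (1 - ty n) * c = 0 :=
      of_z (by linear_combination -h1 + (1 - tx n) * (1 - ty n) * hc)
    refine ⟨![-c], fun k => ?_⟩
    match k with
    | 0 => simp [anisotropic]; linear_combination -h3
    | 1 => simp [anisotropic]; linear_combination -hc
  compE i k := by
    fin_cases i <;> fin_cases k <;> simp [anisotropic, anisotropicSeq]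
  exE v h := by
    have h1 := h 0
    have h2 := h 1
    simp [anisotropicSeq] at h1 h2
    obtain ⟨a, b, hab⟩ := of_proj_xy h1 h2
    refine ⟨![-a, b], fun j => ?_⟩
    rw [Subsingleton.elim j 0]
    simp [anisotropic]
    linear_combination -hab
  compQ v l := by
    rw [Subsingleton.elim l 0]
    simp [anisotropicSeq, wsum_const, aug_proj]
  exQ q h := by
    have h1 := h 0
    simp [anisotropicSeq, wsum_const] at h1
    refine ⟨![jx n (q 0) - jy n (q 1 - C (aug n (q 1)))], fun i => ?_⟩
    match i with
    | 0 => simp [anisotropicSeq]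
    | 1 =>
      have h2 := congrArg (C : ZMod n → Lau n) h1
      simp only [map_add, map_zero] at h2
      simp [anisotropicSeq]
      linear_combination -h2
  surj r := by
    refine ⟨![C (r 0), 0], fun l => ?_⟩
    rw [Subsingleton.elim l 0]
    simp [anisotropicSeq, wsum_const]

theorem halfExactX : HalfExact (n := n) (t := 1) (t' := 1) (q := 2) (k := 2) (c := 1)
    (anisotropic n).eX (anisotropic n).eZ ![deg 0, deg 1] 0 (anisotropicSeq n).pX
    (anisotropicSeq n).oX where
  inj w h := by
    have h1 := h 0
    simp [anisotropic] at h1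
    funext j
    rw [Subsingleton.elim j 0]
    exact of_zi (by linear_combination -h1)
  comp i j := by
    rw [Subsingleton.elim i 0, Subsingleton.elim j 0]
    simp [anisotropic]
    ring
  exP s h := by
    have h1 := h 0
    simp [anisotropic] at h1
    have h2 := congrArg (atZ n) h1
    simp [mul_assoc] at h2
    obtain ⟨c, hc⟩ := of_atZ (f := s 0) (of_yi (of_xi (by linear_combination h2)))
    have h3 : s 1 - (1 - txi n) * (1 - tyi n) * (tz n * c) = 0 := of_zi (by
      linear_combination -h1 - (1 - txi n) * (1 - tyi n) * hc +
        (1 - txi n) * (1 - tyi n) * c * tz_mul_tzi n)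
    refine ⟨![tz n * c], fun k => ?_⟩
    match k with
    | 0 => simp [anisotropic]; linear_combination -hc + c * tz_mul_tzi n
    | 1 => simp [anisotropic]; linear_combination -h3
  compE i k := by
    fin_cases i <;> fin_cases k <;> simp [anisotropic, anisotropicSeq]
  exE v h := by
    have h1 := h 0
    have h2 := h 1
    simp [anisotropicSeq] at h1 h2
    obtain ⟨a, b, hab⟩ := of_proj_xy h1 h2
    refine ⟨![-(tx n * ty n * b), tz n * a], fun j => ?_⟩
    rw [Subsingleton.elim j 0]
    simp [anisotropic]
    have e1 := tx_mul_txi n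
    have e2 := ty_mul_tyi n
    have e3 := tz_mul_tzi n
    clear h h1 h2
    grind
  compQ v l := by
    rw [Subsingleton.elim l 0]
    simp [anisotropicSeq, wsum_const, aug_proj]
  exQ q h := by
    have h1 := h 0
    simp [anisotropicSeq, wsum_const] at h1
    refine ⟨![jx n (q 0) + jy n (q 1 - C (aug n (q 1)))], fun i => ?_⟩
    match i with
    | 0 => simp [anisotropicSeq]
    | 1 =>
      have h2 := congrArg (C : ZMod n → Lau n) h1
      simp only [map_add, map_neg, map_zero] at h2
      simp [anisotropicSeq]
      linear_combination h2
  surj r := by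
    refine ⟨![C (r 0), 0], fun l => ?_⟩
    rw [Subsingleton.elim l 0]
    simp [anisotropicSeq, wsum_const]

theorem exists_span (i : Fin 2) (m : Z3) (hm : (![deg 0, deg 1] : Fin 2 → (Z3 →+ ℤ)) i m = 0) :
    ∃ a b : ℤ, a • (![![0, 0, 1], ![1, 0, 0]] i : Z3) + b • (![![0, 1, 0], ![0, 0, 1]] i : Z3) = m := by
  match i with
  | 0 =>
    have hm0 : m 0 = 0 := hm
    refine ⟨m 2, m 1, ?_⟩
    funext k
    fin_cases k <;> simp [hm0]
  | 1 =>
    have hm0 : m 1 = 0 := hm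
    refine ⟨m 0, m 2, ?_⟩
    funext k
    fin_cases k <;> simp [hm0]

theorem loopsZ (i : Fin 2) : ∃ e sg sh w, HalfLoop (n := n) (t := 1) (t' := 1) (q := 2) (k := 2)
    (anisotropic n).eZ (anisotropic n).eX ![deg 0, deg 1] 0 (anisotropicSeq n).pZ
    (anisotropicSeq n).pX (![![0, 0, 1], ![1, 0, 0]] i) (![![0, 1, 0], ![0, 0, 1]] i) i (1 - T 1)
    (-1) e sg sh w := by
  match i with
  | 0 =>
    refine ⟨![1 - tx n], ![1 - tx n, 0], ![0, -1], ![-1],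
      HalfLoop.of_proj ?_ ?_ ?_ ?_ rfl rfl (exists_span 0) ?_⟩
    · intro j
      rw [Subsingleton.elim j 0]
      simp [anisotropic]
    · intro j
      rw [Subsingleton.elim j 0]
      simp [anisotropic]
      ring
    · intro k
      fin_cases k <;> simp [anisotropic] <;> ring
    · intro l
      fin_cases l <;> simp [anisotropicSeq]
    · intro j
      rw [Subsingleton.elim j 0]
      simp [anisotropicSeq]
  | 1 =>
    refine ⟨![-(1 - ty n)], ![0, 1], ![-(1 - ty n), 0], ![-1],
      HalfLoop.of_proj ?_ ?_ ?_ ?_ rfl rfl (exists_span 1) ?_⟩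
    · intro j
      rw [Subsingleton.elim j 0]
      simp [anisotropic]
      ring
    · intro j
      rw [Subsingleton.elim j 0]
      simp [anisotropic]
    · intro k
      fin_cases k <;> simp [anisotropic] <;> ring
    · intro l
      fin_cases l <;> simp [anisotropicSeq]
    · intro j
      rw [Subsingleton.elim j 0]
      simp [anisotropicSeq]

theorem loopsX (i : Fin 2) : ∃ e sg sh w, HalfLoop (n := n) (t := 1) (t' := 1) (q := 2) (k := 2)
    (anisotropic n).eX (anisotropic n).eZ ![deg 0, deg 1] 0 (anisotropicSeq n).pX
    (anisotropicSeq n).pZ (![![0, 0, 1], ![1, 0, 0]] i) (![![0, 1, 0], ![0, 0, 1]] i) i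
    (1 - T (-1)) 1 e sg sh w := by
  have e1 := tx_mul_txi n
  have e2 := ty_mul_tyi n
  have e3 := tz_mul_tzi n
  match i with
  | 0 =>
    refine ⟨![1 - txi n], ![0, -(tz n * (1 - txi n))], ![-ty n, 0], ![ty n * tz n],
      HalfLoop.of_proj ?_ ?_ ?_ ?_ rfl rfl (exists_span 0) ?_⟩
    · intro j
      rw [Subsingleton.elim j 0]
      simp [anisotropic]
      grind
    · intro j
      rw [Subsingleton.elim j 0]
      simp [anisotropic]
      grind
    · intro k
      fin_cases k <;> simp [anisotropic] <;> grind
    · intro l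
      fin_cases l <;> simp [anisotropicSeq]
    · intro j
      rw [Subsingleton.elim j 0]
      simp [anisotropicSeq]
  | 1 =>
    refine ⟨![1 - tyi n], ![-tx n, 0], ![0, -(tz n * (1 - tyi n))], ![-(tx n * tz n)],
      HalfLoop.of_proj ?_ ?_ ?_ ?_ rfl rfl (exists_span 1) ?_⟩
    · intro j
      rw [Subsingleton.elim j 0]
      simp [anisotropic]
      grind
    · intro j
      rw [Subsingleton.elim j 0]
      simp [anisotropic]
      grind
    · intro k
      fin_cases k <;> simp [anisotropic] <;> grind
    · intro l
      fin_cases l <;> simp [anisotropicSeq]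
    · intro j
      rw [Subsingleton.elim j 0]
      simp [anisotropicSeq]

variable {n}

/-- The constraints on plane charges. -/
def Constraints (n : ℕ) : Set (Fin 2 ⊕ Fin 2 → Lau n) :=
  {q | aug n (q (Sum.inl 0)) + aug n (q (Sum.inl 1)) = 0 ∧
      aug n (q (Sum.inr 0)) = aug n (q (Sum.inr 1))}

theorem omega_eq_zero_iff (q : Fin 2 ⊕ Fin 2 → Lau n) :
    (anisotropicSeq n).omega q = 0 ↔ q ∈ Constraints n := by
  change _ ↔ _ ∧ _
  have hZ : (anisotropicSeq n).omega q (Sum.inl (0 : Fin 1)) = _ :=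
    Fin.sum_univ_two fun i => wsum ((anisotropicSeq n).oZ (0 : Fin 1) i) (q (Sum.inl i))
  have h0 : (anisotropicSeq n).omega q (Sum.inr (0 : Fin 1)) = _ :=
    Fin.sum_univ_two fun i => wsum ((anisotropicSeq n).oX (0 : Fin 1) i) (q (Sum.inr i))
  simp [anisotropicSeq, wsum_const, ← sub_eq_add_neg] at hZ h0
  rw [← sub_eq_zero (a := aug n (q (Sum.inr 0))), ← hZ, ← h0]
  refine ⟨fun h => ⟨congrFun h _, congrFun h _⟩, fun h => ?_⟩
  funext l
  match l with
  | Sum.inl (0 : Fin 1) => exact h.1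
  | Sum.inr (0 : Fin 1) => exact h.2

theorem isExact : (anisotropicSeq n).IsExact :=
  HalfExact.isExact (M := anisotropicSeq n) (halfExactZ n) (halfExactX n)

theorem surj (i : Fin 2) : Function.Surjective ((![deg 0, deg 1] : Fin 2 → (Z3 →+ ℤ)) i) := by
  match i with
  | 0 => exact deg_surjective 0
  | 1 => exact deg_surjective 1

theorem indep {i j : Fin 2} (hij : i ≠ j) : ∃ g, (![deg 0, deg 1] : Fin 2 → (Z3 →+ ℤ)) i g = 0 ∧
    (![deg 0, deg 1] : Fin 2 → (Z3 →+ ℤ)) j g ≠ 0 := by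
  fin_cases i <;> fin_cases j
  · exact (hij rfl).elim
  · exact exists_deg (i := 0) (j := 1) (by decide)
  · exact exists_deg (i := 1) (j := 0) (by decide)
  · exact (hij rfl).elim

theorem dvd_of_omega_eq_zero (i : Fin 2) (q : Fin 2 ⊕ Fin 2 → Lau n)
    (hq : (anisotropicSeq n).omega q = 0)
    (h : ∀ j, j ≠ i → q (Sum.inl j) = 0 ∧ q (Sum.inr j) = 0) :
    1 - T 1 ∣ q (Sum.inl i) ∧ invert (1 - T 1) ∣ q (Sum.inr i) := by
  obtain ⟨h1, h2⟩ := (omega_eq_zero_iff _).1 hq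
  rw [one_sub_T_dvd_iff]
  refine And.imp_right invert_one_sub_T_dvd ?_
  match i with
  | 0 =>
    simp [h 1 (by decide)] at h1 h2
    exact ⟨h1, h2⟩
  | 1 =>
    simp [h 0 (by decide)] at h1 h2
    exact ⟨h1, h2.symm⟩

theorem exists_pi_eq_one (i : Fin 2) :
    (∃ v, (anisotropicSeq n).pi v (Sum.inl i) = 1 ∧ (anisotropicSeq n).pi v (Sum.inr i) = 0) ∧
      ∃ v, (anisotropicSeq n).pi v (Sum.inl i) = 0 ∧ (anisotropicSeq n).pi v (Sum.inr i) = 1 :=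
  (anisotropicSeq n).exists_pi_eq_one (surj i)
    ⟨(0 : Fin 1), by fin_cases i <;> simp [anisotropicSeq]⟩
    ⟨(0 : Fin 1), by fin_cases i <;> simp [anisotropicSeq]⟩

/-- The canonical loops of the anisotropic model. -/
def braidData (hn : 1 < n) : BraidData (anisotropicSeq n) where
  one_lt := hn
  exact := isExact
  surj := surj
  indep _ _ := indep
  Δ _ := 1 - T 1
  κ _ := 0
  Δ_reg _ _ := T_one_mul_eq_self
  surjZ i := (exists_pi_eq_one i).1
  surjX i := (exists_pi_eq_one i).2
  dvd i v h := dvd_of_omega_eq_zero i _ ((isExact.2.2.2.1 _).2 ⟨v, rfl⟩) h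
  g := ![![0, 0, 1], ![1, 0, 0]]
  h := ![![0, 1, 0], ![0, 0, 1]]
  θ_g i := match i with
    | (0 : Fin 2) => rfl
    | (1 : Fin 2) => rfl
  θ_h i := match i with
    | (0 : Fin 2) => rfl
    | (1 : Fin 2) => rfl
  ind i := match i with
    | (0 : Fin 2) => planeMap_injective_of_coord (s := 1) (t := 2) (by decide)
    | (1 : Fin 2) => planeMap_injective_of_coord (s := 0) (t := 2) (by decide)
  loopZ i := by
    obtain ⟨e, sg, sh, w, L⟩ := loopsZ n i
    rw [T_zero]
    exact L.loopZ (X := anisotropic n) (M := anisotropicSeq n)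
  loopX i := by
    obtain ⟨e, sg, sh, w, L⟩ := loopsX n i
    have := L.loopX (X := anisotropic n) (M := anisotropicSeq n)
    simpa using this

theorem hasWeights (i : Fin 2) : HasWeights (Constraints n) (i + 1)
    (AbGrp (([[n, n], []] : List (List ℕ)).get i)) := by
  match i with
  | 0 =>
    refine hasWeights_of_functionals (i := 1) (m := 2) ![augAt (Sum.inl 0), augAt (Sum.inr 0)]
      (fun a => ?_) (fun q hq hw => ?_) fun q hq h => ?_
    · refine ⟨Sum.elim ![C (a 0), C (-a 0)] fun _ => C (a 1), ?_, fun j => ?_⟩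
      · simp [Constraints]
      · fin_cases j <;> simp
    · obtain ⟨e0, e1⟩ := hq
      obtain ⟨l, -, h0⟩ := exists_of_wt_lt (q := q) Finset.univ (by rw [Finset.card_fin]; omega)
      fin_cases l <;> intro j <;> fin_cases j <;> simp_all
    · have h0 : aug n (q (Sum.inl 0)) = 0 := h 0
      have h1 : aug n (q (Sum.inr 0)) = 0 := h 1
      obtain ⟨e0, e1⟩ := hq
      rw [h1] at e1
      rw [h0, zero_add] at e0
      refine mem_closure_of_part le_rfl fun l => ?_
      unfold Constraints
      match l with
      | 0 => simp [part, h0, h1]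
      | 1 => simp [part, e0, ← e1]
  | 1 => exact hasWeights_nil (by simp [Constraints]) le_rfl

theorem isPModularWith (hn : 1 < n) :
    (anisotropic n).IsPModularWith (anisotropicSeq n) [n, n] [[n, n], []] :=
  (braidData hn).isPModularWith (0 : Fin 2) rfl rfl fun _ _ _ hT i =>
    (braidData hn).nonempty_W_equiv_of_hasWeights hT omega_eq_zero_iff (hasWeights i)

theorem isFoliated (hn : 1 < n) {η : Z3 →+ E3} {normal : Plane → E3}
    {form : Plane → (anisotropic n).Sec → ((anisotropic n).Sec →ₗ[ZMod n] ZMod n)}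
    (hT : (anisotropic n).IsTheory η normal form) :
    ((anisotropic n).theory η normal form).IsFoliated 1 :=
  (braidData hn).isFoliated_of_planar rfl (fun _ => rfl) hT

end Anisotropic

open LaurentPolynomial

namespace FourPlanar

variable (n : ℕ)

section Diagonal

variable {n} {f : GroupRing n}

@[simp] theorem proj_diag_jx (f : Lau n) : proj n (deg 0 + deg 1 + deg 2) 0 (jx n f) = f :=
  proj_jx rfl f
@[simp] theorem proj_diag_jy (f : Lau n) : proj n (deg 0 + deg 1 + deg 2) 0 (jy n f) = f :=
  proj_jy rfl f
@[simp] theorem proj_diag_jz (f : Lau n) : proj n (deg 0 + deg 1 + deg 2) 0 (jz n f) = f :=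
  proj_jz rfl f

theorem of_xy (h : (tx n - ty n) * f = 0) : f = 0 := eq_zero_of_mono_sub_mul (by decide) h
theorem of_xz (h : (tx n - tz n) * f = 0) : f = 0 := eq_zero_of_mono_sub_mul (by decide) h
theorem of_xyi (h : (txi n - tyi n) * f = 0) : f = 0 := eq_zero_of_mono_sub_mul (by decide) h
theorem of_xzi (h : (txi n - tzi n) * f = 0) : f = 0 := eq_zero_of_mono_sub_mul (by decide) h
theorem of_yzi (h : (tyi n - tzi n) * f = 0) : f = 0 := eq_zero_of_mono_sub_mul (by decide) h

theorem eq_substYX (f : GroupRing n) :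
    ∃ c, f = subst (ux n) (ux n) (uz n) f + (tx n - ty n) * c :=
  exists_eq_subst_add _ _ (by simp) ⟨-1, by simp⟩ (by simp) f

theorem eq_substZX (f : GroupRing n) :
    ∃ c, f = subst (ux n) (uy n) (ux n) f + (tx n - tz n) * c :=
  exists_eq_subst_add _ _ (by simp) (by simp) ⟨-1, by simp⟩ f

theorem substZX_substYX (f : GroupRing n) :
    subst (ux n) (uy n) (ux n) (subst (ux n) (ux n) (uz n) f) =
      jx n (proj n (deg 0 + deg 1 + deg 2) 0 f) := by
  refine subst_subst_eq ?_ ?_ ?_ f <;> simp [jx, evalL_T]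

theorem of_proj_diag (h : proj n (deg 0 + deg 1 + deg 2) 0 f = 0) :
    ∃ a b, f = (tyi n - txi n) * a + (tzi n - txi n) * b := by
  obtain ⟨a, ha⟩ := eq_substYX f
  obtain ⟨b, hb⟩ := eq_substZX (subst (ux n) (ux n) (uz n) f)
  rw [substZX_substYX, h, map_zero, zero_add] at hb
  rw [hb] at ha
  refine ⟨tx n * ty n * a, tx n * tz n * b, ?_⟩
  linear_combination ha - tx n * a * ty_mul_tyi n + ty n * a * tx_mul_txi n -
    tx n * b * tz_mul_tzi n + tz n * b * tx_mul_txi n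

theorem of_proj_z_diag (hz : proj n (deg 2) 0 f = 0)
    (hw : proj n (deg 0 + deg 1 + deg 2) 0 f = 0) :
    ∃ a b, f = (1 - tx n) * (tx n - tz n) * a + (tx n - ty n) * b := by
  obtain ⟨b, hb⟩ := eq_substYX f
  have h1 : atX n (subst (ux n) (ux n) (uz n) f) = jz n (proj n (deg 2) 0 f) := by
    refine subst_subst_eq ?_ ?_ ?_ f <;> simp [jz, evalL_T]
  rw [hz, map_zero] at h1
  obtain ⟨c, hc⟩ := of_atX h1
  have h2 := substZX_substYX f
  rw [hw, hc] at h2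
  simp at h2
  obtain ⟨a, ha⟩ := eq_substZX c
  rw [of_x h2, zero_add] at ha
  exact ⟨a, b, by rw [hb, hc, ha]; ring⟩

end Diagonal

theorem halfExactZ : HalfExact (n := n) (t := 3) (t' := 3) (q := 6) (k := 4) (c := 1)
    (fourPlanar n).eZ (fourPlanar n).eX ![deg 0, deg 1, deg 2, deg 0 + deg 1 + deg 2] 0
    (fourPlanarSeq n).pZ (fourPlanarSeq n).oZ where
  inj w h := by
    have h0 := h 0
    have h1 := h 1
    have h3 := h 3
    have h4 := h 4
    simp [fourPlanar, Fin.sum_univ_three] at h0 h1 h3 h4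
    have e1 : w 1 - w 2 = 0 := of_xy (by linear_combination h3 - h4)
    have e2 : w 1 - tz n * w 2 = 0 := of_xy (by linear_combination h1 - h0)
    have e3 : w 2 = 0 := of_z (by linear_combination e2 - e1)
    have e4 : w 1 = 0 := by linear_combination e1 + e3
    have e5 : w 0 = 0 := by linear_combination -h3 + (1 + tx n) * e4 - tx n * e3
    funext j
    match j with
    | 0 => exact e5
    | 1 => exact e4
    | 2 => exact e3
  comp i j := by
    fin_cases i <;> fin_cases j <;> simp [fourPlanar, Fin.sum_univ_six] <;> ring
  exP s h := by
    have h0 := h 0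
    have h1 := h 1
    have h2 := h 2
    simp [fourPlanar, Fin.sum_univ_six] at h0 h1 h2
    have a1 : (1 - ty n) * (s 1 - s 3) = (1 - tz n) * (s 2 - s 3) := by linear_combination h0
    have a2 := congrArg (atZ n) a1
    simp at a2
    obtain ⟨k, hk⟩ := of_atZ (f := s 1 - s 3) (of_y (by simpa using a2))
    have hk' : s 2 - s 3 - (1 - ty n) * k = 0 :=
      of_z (by linear_combination -a1 + (1 - ty n) * hk)
    set u := s 0 - s 3 - (1 + tx n - ty n - tz n) * k with hu
    have b1 : (1 - tx n) * u + (tx n - tz n) * (s 4 - s 3 - (tx n - ty n) * k) = 0 := by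
      linear_combination -h1 + (1 - tz n) * hk' + (1 - tx n) * hu
    have b2 := congrArg (subst (ux n) (uy n) (ux n)) b1
    simp only [map_add, map_mul, map_sub, map_one, subst_tx, subst_tz, val_ux, sub_self, zero_mul,
      add_zero, map_zero] at b2
    obtain ⟨l, hl⟩ := eq_substZX u
    rw [of_x b2, zero_add] at hl
    have b3 : s 4 - s 3 - (tx n - ty n) * k + (1 - tx n) * l = 0 :=
      of_xz (by linear_combination b1 - (1 - tx n) * hl)
    have b4 : (1 - tx n) * (tx n - tz n) * l +
        (tx n - ty n) * (s 5 - s 3 - (tx n - tz n) * k) = 0 := by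
      linear_combination h2 + (1 - ty n) * hk - (1 - tx n) * hl - (1 - tx n) * hu
    have b5 := congrArg (subst (ux n) (ux n) (uz n)) b4
    simp only [map_add, map_mul, map_sub, map_one, subst_tx, subst_ty, subst_tz, val_ux, val_uz,
      sub_self, zero_mul, add_zero, map_zero, mul_assoc] at b5
    obtain ⟨m, hm⟩ := eq_substYX l
    rw [of_xz (of_x b5), zero_add] at hm
    have b6 : s 5 - s 3 - (tx n - tz n) * k + (1 - tx n) * (tx n - tz n) * m = 0 :=
      of_xy (by linear_combination b4 - (1 - tx n) * (tx n - tz n) * hm)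
    refine ⟨![-s 3 - (1 + tx n) * k - tx n * tx n * m, -k - tx n * m, -m], fun j => ?_⟩
    match j with
    | 0 =>
      simp [fourPlanar, Fin.sum_univ_three]
      linear_combination -hu - hl - (tx n - tz n) * hm
    | 1 => simp [fourPlanar, Fin.sum_univ_three]; linear_combination -hk
    | 2 => simp [fourPlanar, Fin.sum_univ_three]; linear_combination -hk'
    | 3 => simp [fourPlanar, Fin.sum_univ_three]; ring
    | 4 =>
      simp [fourPlanar, Fin.sum_univ_three]
      linear_combination -b3 + (1 - tx n) * hm
    | 5 => simp [fourPlanar, Fin.sum_univ_three]; linear_combination -b6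
  compE i k := by
    fin_cases i <;> fin_cases k <;> simp [fourPlanar, fourPlanarSeq, Fin.sum_univ_three]
  exE v h := by
    have h0 := h 0
    have h1 := h 1
    have h2 := h 2
    have h3 := h 3
    simp [fourPlanarSeq, Fin.sum_univ_three] at h0 h1 h2 h3
    obtain ⟨a, b, hab⟩ := of_proj_x h0
    obtain ⟨c, d, hcd⟩ := of_proj_y (f := v 1 + (1 - tz n) * b) (by simp [h1])
    obtain ⟨g, e, hge⟩ := of_proj_z_diag (f := v 2 + (1 - ty n) * a + (1 - tx n) * (c + d))
      (by simp [h2]) (by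
        have e1 := congrArg (proj n (deg 0 + deg 1 + deg 2) 0) hab
        have e2 := congrArg (proj n (deg 0 + deg 1 + deg 2) 0) hcd
        simp at e1 e2 ⊢
        linear_combination -h3 - e1 - e2)
    refine ⟨![-(c + d) + (tx n - tz n) * g, a, -b, 0, -d - (1 - tx n) * g, e], fun j => ?_⟩
    match j with
    | 0 => simp [fourPlanar, Fin.sum_univ_six]; linear_combination -hab
    | 1 => simp [fourPlanar, Fin.sum_univ_six]; linear_combination -hcd
    | 2 => simp [fourPlanar, Fin.sum_univ_six]; linear_combination -hge
  compQ v l := by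
    rw [Subsingleton.elim l 0]
    simp [fourPlanarSeq, Fin.sum_univ_four, Fin.sum_univ_three, wsum_const, aug_proj]
    ring
  exQ q h := by
    have h1 := h 0
    simp [fourPlanarSeq, Fin.sum_univ_four, wsum_const] at h1
    have h2 : aug n (-(q 0 + q 1 + q 2 + q 3)) = 0 := by simp only [map_neg, map_add, h1, neg_zero]
    set r := -(q 0 + q 1 + q 2 + q 3) with hr
    refine ⟨![jx n (q 0) + jy n r, jy n (q 1), jz n (q 2)], fun i => ?_⟩
    match i with
    | 0 => simp [fourPlanarSeq, Fin.sum_univ_three, h2]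
    | 1 => simp [fourPlanarSeq, Fin.sum_univ_three]
    | 2 => simp [fourPlanarSeq, Fin.sum_univ_three]
    | 3 => simp [fourPlanarSeq, Fin.sum_univ_three]; linear_combination -hr
  surj r := by
    refine ⟨![C (r 0), 0, 0, 0], fun l => ?_⟩
    rw [Subsingleton.elim l 0]
    simp [fourPlanarSeq, Fin.sum_univ_four, wsum_const]

theorem halfExactX : HalfExact (n := n) (t := 3) (t' := 3) (q := 6) (k := 4) (c := 3)
    (fourPlanar n).eX (fourPlanar n).eZ ![deg 0, deg 1, deg 2, deg 0 + deg 1 + deg 2] 0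
    (fourPlanarSeq n).pX (fourPlanarSeq n).oX where
  inj w h := by
    have h3 := h 3
    have h4 := h 4
    have h5 := h 5
    simp [fourPlanar, Fin.sum_univ_three] at h3 h4 h5
    funext j
    match j with
    | 0 => exact of_yzi (by simpa using h3)
    | 1 => exact of_xzi (by linear_combination -h4)
    | 2 => exact of_xyi (by simpa using h5)
  comp i j := by
    fin_cases i <;> fin_cases j <;> simp [fourPlanar, Fin.sum_univ_six] <;> ring
  exP s h := by
    have h0 := h 0
    have h1 := h 1
    have h2 := h 2
    simp [fourPlanar, Fin.sum_univ_six] at h0 h1 h2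
    obtain ⟨a, b, ha, hb, hc⟩ := cube_syzygy (f₁ := s 0) (f₂ := s 1) (f₃ := s 2)
      (by linear_combination -h0 - h1 - h2)
    set t := s 4 + (tzi n - txi n) * a with ht
    have c1 : (txi n - tyi n) * t + (txi n - tzi n) * s 5 = 0 := by
      linear_combination h2 - txi n * h0 + (txi n - tyi n) * ht +
        (tyi n * tzi n - txi n) * ha + (tzi n * txi n - txi n) * hb +
        (txi n * tyi n - txi n) * hc
    have c2 := congrArg (subst (ux n) (uy n) (ux n)) c1
    simp only [map_add, map_mul, map_sub, subst_txi, subst_tyi, subst_tzi, val_inv_ux, val_inv_uy,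
      sub_self, zero_mul, add_zero, map_zero] at c2
    obtain ⟨k, hk⟩ := eq_substZX t
    rw [of_xyi c2, zero_add] at hk
    have e1 := tx_mul_txi n
    have e3 := tz_mul_tzi n
    have hk' : t = (tzi n - txi n) * (tx n * tz n * k) := by
      linear_combination hk + tz n * k * e1 - tx n * k * e3
    set l := tx n * tz n * k
    have c3 : s 5 - (txi n - tyi n) * l = 0 :=
      of_xzi (by linear_combination c1 - (txi n - tyi n) * hk')
    refine ⟨![b + l, -a + l, l], fun j => ?_⟩
    match j with
    | 0 => simp [fourPlanar, Fin.sum_univ_three]; linear_combination -ha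
    | 1 => simp [fourPlanar, Fin.sum_univ_three]; linear_combination -hb
    | 2 => simp [fourPlanar, Fin.sum_univ_three]; linear_combination -hc
    | 3 =>
      simp [fourPlanar, Fin.sum_univ_three]
      linear_combination h0 + ha + hb + hc + c3 + hk' - ht
    | 4 => simp [fourPlanar, Fin.sum_univ_three]; linear_combination ht - hk'
    | 5 => simp [fourPlanar, Fin.sum_univ_three]; linear_combination -c3
  compE i k := by
    have t2 : (T 1 : Lau n) * T (-1) = 1 := by rw [← T_add, add_neg_cancel, T_zero]
    fin_cases i <;> fin_cases k <;> simp [fourPlanar, fourPlanarSeq, Fin.sum_univ_three, mul_add, t2]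
  exE v h := by
    have h0 := h 0
    have h1 := h 1
    have h2 := h 2
    have h3 := h 3
    simp [fourPlanarSeq, Fin.sum_univ_three] at h0 h1 h2 h3
    obtain ⟨a', b', c', hv⟩ := of_proj_xyz (f := v 0 + v 1 + v 2) (by simpa using h0)
      (by simpa using h1) (by simpa using h2)
    have e1 := tx_mul_txi n
    have e2 := ty_mul_tyi n
    have e3 := tz_mul_tzi n
    obtain ⟨a, ha⟩ : ∃ a, (1 - ty n) * (1 - tz n) * a' = (1 - tyi n) * (1 - tzi n) * a :=
      ⟨ty n * tz n * a', by clear h h0 h1 h2 h3 hv; grind⟩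
    obtain ⟨b, hb⟩ : ∃ b, (1 - tz n) * (1 - tx n) * b' = (1 - tzi n) * (1 - txi n) * b :=
      ⟨tz n * tx n * b', by clear h h0 h1 h2 h3 hv ha; grind⟩
    obtain ⟨c, hc⟩ : ∃ c, (1 - tx n) * (1 - ty n) * c' = (1 - txi n) * (1 - tyi n) * c :=
      ⟨tx n * ty n * c', by clear h h0 h1 h2 h3 hv ha hb; grind⟩
    rw [ha, hb, hc] at hv
    clear ha hb hc e1 e2 e3
    set f := v 0 - a - b - c with hf
    set g := -(v 2 - tyi n * tzi n * a - tzi n * txi n * b - txi n * tyi n * c) with hg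
    obtain ⟨k, l, hkl⟩ := of_proj_diag (f := g + txi n * f) (by
      refine T_one_mul_eq_self ?_
      have e1 := congrArg (proj n (deg 0 + deg 1 + deg 2) 0) hv
      have t1 : (T 1 : Lau n) * T (-1) = 1 := by rw [← T_add, add_neg_cancel, T_zero]
      simp [hf, hg] at e1 ⊢
      generalize proj n (deg 0 + deg 1 + deg 2) 0 (v 0) = v0 at *
      generalize proj n (deg 0 + deg 1 + deg 2) 0 (v 1) = v1 at *
      generalize proj n (deg 0 + deg 1 + deg 2) 0 (v 2) = v2 at *
      generalize proj n (deg 0 + deg 1 + deg 2) 0 a = a at *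
      generalize proj n (deg 0 + deg 1 + deg 2) 0 b = b at *
      generalize proj n (deg 0 + deg 1 + deg 2) 0 c = c at *
      generalize (T 1 : Lau n) = t at *
      generalize (T (-1) : Lau n) = s at *
      grind)
    refine ⟨![-a, -b, -c, -f - k - l, k, l], fun j => ?_⟩
    match j with
    | 0 => simp [fourPlanar, Fin.sum_univ_six]; linear_combination hf
    | 1 => simp [fourPlanar, Fin.sum_univ_six]; linear_combination -hv - hf + hg - hkl
    | 2 => simp [fourPlanar, Fin.sum_univ_six]; linear_combination -hg + hkl
  compQ v l := by
    fin_cases l <;>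
      simp [fourPlanarSeq, Fin.sum_univ_four, Fin.sum_univ_three, wsum_const, aug_proj]
  exQ q h := by
    have h1 := h 0
    have h2 := h 1
    have h3 := h 2
    simp [fourPlanarSeq, Fin.sum_univ_four, wsum_const] at h1 h2 h3
    set c := aug n (q 3) with hc
    have h1' : aug n (q 0) = c := by linear_combination h1
    have h2' : aug n (q 1) = c := by linear_combination h2
    have h3' : aug n (q 2) = c := by linear_combination h3
    obtain ⟨r, hr⟩ := (one_sub_T_dvd_iff (q 3 - (q 0 + q 1 + (q 2 - C (c + c))))).2 (by
      simp [h1', h2', h3', ← hc])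
    refine ⟨![0, jx n (q 0) + jy n (q 1) + jz n (q 2 - C (c + c)) + jx n r, -jx n r], fun i => ?_⟩
    match i with
    | 0 => simp [fourPlanarSeq, Fin.sum_univ_three, h2', h3']
    | 1 => simp [fourPlanarSeq, Fin.sum_univ_three, h1', h3']
    | 2 => simp [fourPlanarSeq, Fin.sum_univ_three, h1', h2']
    | 3 =>
      simp [fourPlanarSeq, Fin.sum_univ_three] at hr ⊢
      linear_combination -hr
  surj r := by
    refine ⟨![C (r 0), C (r 1), C (r 2), 0], fun l => ?_⟩
    fin_cases l <;> simp [fourPlanarSeq, Fin.sum_univ_four, wsum_const]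

end FourPlanar

open LaurentPolynomial

namespace FourPlanar

variable (n : ℕ)

theorem mono_yzi : mono n ![0, 1, -1] = ty n * tzi n := by
  simp only [ty, tzi, mono_mul]
  congr 1
  decide

theorem mono_xyi : mono n ![1, -1, 0] = tx n * tyi n := by
  simp only [tx, tyi, mono_mul]
  congr 1
  decide

theorem exists_span (i : Fin 4) (m : Z3)
    (hm : (![deg 0, deg 1, deg 2, deg 0 + deg 1 + deg 2] : Fin 4 → (Z3 →+ ℤ)) i m = 0) :
    ∃ a b : ℤ, a • (![![0, 0, 1], ![1, 0, 0], ![0, 1, 0], ![0, 1, -1]] i : Z3) +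
      b • (![![0, 1, 0], ![0, 0, 1], ![1, 0, 0], ![1, -1, 0]] i : Z3) = m := by
  match i with
  | 0 =>
    have hm0 : m 0 = 0 := hm
    refine ⟨m 2, m 1, ?_⟩
    funext k
    fin_cases k <;> simp [hm0]
  | 1 =>
    have hm0 : m 1 = 0 := hm
    refine ⟨m 0, m 2, ?_⟩
    funext k
    fin_cases k <;> simp [hm0]
  | 2 =>
    have hm0 : m 2 = 0 := hm
    refine ⟨m 1, m 0, ?_⟩
    funext k
    fin_cases k <;> simp [hm0]
  | 3 =>
    have hm0 : m 0 + m 1 + m 2 = 0 := hm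
    refine ⟨-m 2, m 0, ?_⟩
    funext k
    fin_cases k <;> simp <;> omega

theorem loopsZ (i : Fin 4) : ∃ e sg sh w, HalfLoop (n := n) (t := 3) (t' := 3) (q := 6) (k := 4)
    (fourPlanar n).eZ (fourPlanar n).eX ![deg 0, deg 1, deg 2, deg 0 + deg 1 + deg 2] 0
    (fourPlanarSeq n).pZ (fourPlanarSeq n).pX
    (![![0, 0, 1], ![1, 0, 0], ![0, 1, 0], ![0, 1, -1]] i)
    (![![0, 1, 0], ![0, 0, 1], ![1, 0, 0], ![1, -1, 0]] i) i (1 - T 1)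
    (-T (![0, 0, 0, 1] i)) e sg sh w := by
  match i with
  | 0 =>
    refine ⟨![1 - tx n, -(1 - tx n), 0], ![0, 0, 1 - tx n, 0, 0, 0],
      ![-(1 - ty n), -(1 - tx n), 0, 0, 0, 0], ![-1, -1, -1],
      HalfLoop.of_proj ?_ ?_ ?_ ?_ rfl rfl (exists_span 0) ?_⟩
    · intro j
      fin_cases j <;> simp [fourPlanar, Fin.sum_univ_six] <;> ring
    · intro j
      fin_cases j <;> simp [fourPlanar, Fin.sum_univ_six] <;> ring
    · intro k
      fin_cases k <;> simp [fourPlanar, Fin.sum_univ_three] <;> ring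
    · intro l
      fin_cases l <;> simp [fourPlanarSeq, Fin.sum_univ_three]
    · intro j
      fin_cases j <;> simp [fourPlanarSeq]
  | 1 =>
    refine ⟨![0, 1 - ty n, -(1 - ty n)], ![1 - ty n, 0, 0, 0, 0, 0],
      ![0, -(1 - tz n), -(1 - ty n), 0, 0, 0], ![-1, -1, -1],
      HalfLoop.of_proj ?_ ?_ ?_ ?_ rfl rfl (exists_span 1) ?_⟩
    · intro j
      fin_cases j <;> simp [fourPlanar, Fin.sum_univ_six] <;> ring
    · intro j
      fin_cases j <;> simp [fourPlanar, Fin.sum_univ_six] <;> ring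
    · intro k
      fin_cases k <;> simp [fourPlanar, Fin.sum_univ_three] <;> ring
    · intro l
      fin_cases l <;> simp [fourPlanarSeq, Fin.sum_univ_three]
    · intro j
      fin_cases j <;> simp [fourPlanarSeq]
  | 2 =>
    refine ⟨![-(1 - tz n), 0, 1 - tz n], ![0, 1 - tz n, 0, 0, 0, 0],
      ![-(1 - tz n), 0, -(1 - tx n), 0, 0, 0], ![-1, -1, -1],
      HalfLoop.of_proj ?_ ?_ ?_ ?_ rfl rfl (exists_span 2) ?_⟩
    · intro j
      fin_cases j <;> simp [fourPlanar, Fin.sum_univ_six] <;> ring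
    · intro j
      fin_cases j <;> simp [fourPlanar, Fin.sum_univ_six] <;> ring
    · intro k
      fin_cases k <;> simp [fourPlanar, Fin.sum_univ_three] <;> ring
    · intro l
      fin_cases l <;> simp [fourPlanarSeq, Fin.sum_univ_three]
    · intro j
      fin_cases j <;> simp [fourPlanarSeq]
  | 3 =>
    have e1 := tx_mul_txi n
    have e2 := ty_mul_tyi n
    have e3 := tz_mul_tzi n
    refine ⟨![-(1 - ty n), 0, 0], ![0, 0, 0, -(tzi n * (1 - ty n)), 0, 0],
      ![0, -(tyi n * (tx n - ty n)), 0, 0, 0, -(tyi n * (1 - ty n))],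
      ![-(ty n * tzi n), -tzi n, -(tyi n * tzi n)],
      HalfLoop.of_proj ?_ ?_ ?_ ?_ rfl rfl (exists_span 3) ?_⟩
    · intro j
      fin_cases j <;> simp [fourPlanar, Fin.sum_univ_six, mono_yzi] <;> grind
    · intro j
      fin_cases j <;> simp [fourPlanar, Fin.sum_univ_six, mono_xyi] <;> grind
    · intro k
      fin_cases k <;> simp [fourPlanar, Fin.sum_univ_three, mono_yzi, mono_xyi] <;> grind
    · intro l
      fin_cases l <;> simp [fourPlanarSeq, Fin.sum_univ_three]
    · intro j
      have t1 : (T (-1) : Lau n) * T 1 = 1 := by rw [← T_add, neg_add_cancel, T_zero]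
      have t2 : (T 1 : Lau n) * T (-1) = 1 := by rw [← T_add, add_neg_cancel, T_zero]
      fin_cases j <;> simp [fourPlanarSeq, t1, t2]

theorem loopX_diag : ∃ e sg sh w, HalfLoop (n := n) (t := 3) (t' := 3) (q := 6) (k := 4)
    (fourPlanar n).eX (fourPlanar n).eZ ![deg 0, deg 1, deg 2, deg 0 + deg 1 + deg 2] 0
    (fourPlanarSeq n).pX (fourPlanarSeq n).pZ ![0, 1, -1] ![1, -1, 0] 3 (T (-1) * (1 - T (-1))) 1
    e sg sh w := by
  have e1 := tx_mul_txi n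
  have e2 := ty_mul_tyi n
  have e3 := tz_mul_tzi n
  refine ⟨![-tyi n, tyi n, 0], ![0, 0, 0, 0, tzi n, -tyi n],
    ![0, 0, 0, tx n * tyi n * tyi n, -tyi n, 0],
    ![-(tx n * tyi n), -(tx n * tyi n), -(tx n * tyi n)],
    HalfLoop.of_proj ?_ ?_ ?_ ?_ rfl rfl (exists_span 3) ?_⟩
  · intro j
    fin_cases j <;> simp [fourPlanar, Fin.sum_univ_six, mono_yzi] <;> grind
  · intro j
    fin_cases j <;> simp [fourPlanar, Fin.sum_univ_six, mono_xyi] <;> grind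
  · intro k
    fin_cases k <;> simp [fourPlanar, Fin.sum_univ_three, mono_yzi, mono_xyi] <;> grind
  · intro l
    fin_cases l <;> simp [fourPlanarSeq, Fin.sum_univ_three]
    ring
  · intro j
    have t1 : (T (-1) : Lau n) * T 1 = 1 := by rw [← T_add, neg_add_cancel, T_zero]
    fin_cases j <;> simp [fourPlanarSeq, t1]

theorem loopsX (i : Fin 4) : ∃ e sg sh w, HalfLoop (n := n) (t := 3) (t' := 3) (q := 6) (k := 4)
    (fourPlanar n).eX (fourPlanar n).eZ ![deg 0, deg 1, deg 2, deg 0 + deg 1 + deg 2] 0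
    (fourPlanarSeq n).pX (fourPlanarSeq n).pZ
    (![![0, 0, 1], ![1, 0, 0], ![0, 1, 0], ![0, 1, -1]] i)
    (![![0, 1, 0], ![0, 0, 1], ![1, 0, 0], ![1, -1, 0]] i) i
    (T (-![0, 0, 0, 1] i) * (1 - T (-1))) 1 e sg sh w := by
  have e1 := tx_mul_txi n
  have e2 := ty_mul_tyi n
  have e3 := tz_mul_tzi n
  match i with
  | 0 =>
    refine ⟨![1, -txi n, 0], ![0, -tz n, 0, 1, 0, 0], ![0, 0, -ty n, 1, 0, 0],
      ![ty n * tz n, 0, 0], HalfLoop.of_proj ?_ ?_ ?_ ?_ rfl rfl (exists_span 0) ?_⟩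
    · intro j
      fin_cases j <;> simp [fourPlanar, Fin.sum_univ_six] <;> grind
    · intro j
      fin_cases j <;> simp [fourPlanar, Fin.sum_univ_six] <;> grind
    · intro k
      fin_cases k <;> simp [fourPlanar, Fin.sum_univ_three] <;> grind
    · intro l
      fin_cases l <;> simp [fourPlanarSeq, Fin.sum_univ_three, sub_eq_add_neg]
    · intro j
      fin_cases j <;> simp [fourPlanarSeq]
  | 1 =>
    refine ⟨![1, -tyi n, 0], ![0, 0, -tx n, 0, 1, 0], ![-tz n, 0, 0, 0, 1, 0],
      ![0, tx n * tz n, 0], HalfLoop.of_proj ?_ ?_ ?_ ?_ rfl rfl (exists_span 1) ?_⟩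
    · intro j
      fin_cases j <;> simp [fourPlanar, Fin.sum_univ_six] <;> grind
    · intro j
      fin_cases j <;> simp [fourPlanar, Fin.sum_univ_six] <;> grind
    · intro k
      fin_cases k <;> simp [fourPlanar, Fin.sum_univ_three] <;> grind
    · intro l
      fin_cases l <;> simp [fourPlanarSeq, Fin.sum_univ_three, sub_eq_add_neg]
    · intro j
      fin_cases j <;> simp [fourPlanarSeq]
  | 2 =>
    refine ⟨![1, -tzi n, 0], ![-ty n, 0, 0, 0, 0, 1], ![0, -tx n, 0, 0, 0, 1],
      ![0, 0, tx n * ty n], HalfLoop.of_proj ?_ ?_ ?_ ?_ rfl rfl (exists_span 2) ?_⟩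
    · intro j
      fin_cases j <;> simp [fourPlanar, Fin.sum_univ_six] <;> grind
    · intro j
      fin_cases j <;> simp [fourPlanar, Fin.sum_univ_six] <;> grind
    · intro k
      fin_cases k <;> simp [fourPlanar, Fin.sum_univ_three] <;> grind
    · intro l
      fin_cases l <;> simp [fourPlanarSeq, Fin.sum_univ_three, sub_eq_add_neg]
    · intro j
      fin_cases j <;> simp [fourPlanarSeq]
  | 3 => exact loopX_diag n

variable {n}

/-- The constraints on plane charges. -/
def Constraints (n : ℕ) : Set (Fin 4 ⊕ Fin 4 → Lau n) :=
  {q | aug n (q (Sum.inl 0)) + aug n (q (Sum.inl 1)) + aug n (q (Sum.inl 2)) +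
      aug n (q (Sum.inl 3)) = 0 ∧ aug n (q (Sum.inr 0)) = aug n (q (Sum.inr 3)) ∧
      aug n (q (Sum.inr 1)) = aug n (q (Sum.inr 3)) ∧
      aug n (q (Sum.inr 2)) = aug n (q (Sum.inr 3))}

theorem omega_eq_zero_iff (q : Fin 4 ⊕ Fin 4 → Lau n) :
    (fourPlanarSeq n).omega q = 0 ↔ q ∈ Constraints n := by
  change _ ↔ _ ∧ _ ∧ _ ∧ _
  have hZ : (fourPlanarSeq n).omega q (Sum.inl (0 : Fin 1)) = _ :=
    Fin.sum_univ_four fun i => wsum ((fourPlanarSeq n).oZ (0 : Fin 1) i) (q (Sum.inl i))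
  have h0 : (fourPlanarSeq n).omega q (Sum.inr (0 : Fin 3)) = _ :=
    Fin.sum_univ_four fun i => wsum ((fourPlanarSeq n).oX (0 : Fin 3) i) (q (Sum.inr i))
  have h1 : (fourPlanarSeq n).omega q (Sum.inr (1 : Fin 3)) = _ :=
    Fin.sum_univ_four fun i => wsum ((fourPlanarSeq n).oX (1 : Fin 3) i) (q (Sum.inr i))
  have h2 : (fourPlanarSeq n).omega q (Sum.inr (2 : Fin 3)) = _ :=
    Fin.sum_univ_four fun i => wsum ((fourPlanarSeq n).oX (2 : Fin 3) i) (q (Sum.inr i))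
  simp [fourPlanarSeq, wsum_const, ← sub_eq_add_neg] at hZ h0 h1 h2
  rw [← sub_eq_zero (a := aug n (q (Sum.inr 0))), ← sub_eq_zero (a := aug n (q (Sum.inr 1))),
    ← sub_eq_zero (a := aug n (q (Sum.inr 2))), ← hZ, ← h0, ← h1, ← h2]
  refine ⟨fun h => ⟨congrFun h _, congrFun h _, congrFun h _, congrFun h _⟩, fun h => ?_⟩
  funext l
  match l with
  | Sum.inl (0 : Fin 1) => exact h.1
  | Sum.inr (0 : Fin 3) => exact h.2.1
  | Sum.inr (1 : Fin 3) => exact h.2.2.1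
  | Sum.inr (2 : Fin 3) => exact h.2.2.2

theorem isExact : (fourPlanarSeq n).IsExact :=
  HalfExact.isExact (M := fourPlanarSeq n) (halfExactZ n) (halfExactX n)

theorem surj (i : Fin 4) : Function.Surjective
    ((![deg 0, deg 1, deg 2, deg 0 + deg 1 + deg 2] : Fin 4 → (Z3 →+ ℤ)) i) := by
  match i with
  | 0 => exact deg_surjective 0
  | 1 => exact deg_surjective 1
  | 2 => exact deg_surjective 2
  | 3 => exact fun k => ⟨![k, 0, 0], by simp [deg]⟩

theorem indep {i j : Fin 4} (hij : i ≠ j) :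
    ∃ g, (![deg 0, deg 1, deg 2, deg 0 + deg 1 + deg 2] : Fin 4 → (Z3 →+ ℤ)) i g = 0 ∧
      (![deg 0, deg 1, deg 2, deg 0 + deg 1 + deg 2] : Fin 4 → (Z3 →+ ℤ)) j g ≠ 0 := by
  fin_cases i <;> fin_cases j <;> first
    | exact (hij rfl).elim
    | exact ⟨![1, 0, 0], by decide⟩
    | exact ⟨![0, 1, 0], by decide⟩
    | exact ⟨![0, 0, 1], by decide⟩
    | exact ⟨![1, -1, 0], by decide⟩
    | exact ⟨![0, 1, -1], by decide⟩

theorem dvd_of_omega_eq_zero (i : Fin 4) (q : Fin 4 ⊕ Fin 4 → Lau n)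
    (hq : (fourPlanarSeq n).omega q = 0)
    (h : ∀ j, j ≠ i → q (Sum.inl j) = 0 ∧ q (Sum.inr j) = 0) :
    1 - T 1 ∣ q (Sum.inl i) ∧ invert (1 - T 1) ∣ q (Sum.inr i) := by
  obtain ⟨h1, h2, h3, h4⟩ := (omega_eq_zero_iff _).1 hq
  rw [one_sub_T_dvd_iff]
  refine And.imp_right invert_one_sub_T_dvd ?_
  match i with
  | 0 =>
    simp [h 1 (by decide), h 2 (by decide), h 3 (by decide)] at h1 h2
    exact ⟨h1, h2⟩
  | 1 =>
    simp [h 0 (by decide), h 2 (by decide), h 3 (by decide)] at h1 h3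
    exact ⟨h1, h3⟩
  | 2 =>
    simp [h 0 (by decide), h 1 (by decide), h 3 (by decide)] at h1 h4
    exact ⟨h1, h4⟩
  | 3 =>
    simp [h 0 (by decide), h 1 (by decide), h 2 (by decide)] at h1 h2
    exact ⟨h1, h2.symm⟩

theorem exists_pi_eq_one (i : Fin 4) :
    (∃ v, (fourPlanarSeq n).pi v (Sum.inl i) = 1 ∧ (fourPlanarSeq n).pi v (Sum.inr i) = 0) ∧
      ∃ v, (fourPlanarSeq n).pi v (Sum.inl i) = 0 ∧ (fourPlanarSeq n).pi v (Sum.inr i) = 1 :=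
  (fourPlanarSeq n).exists_pi_eq_one (surj i)
    (match i with
      | 0 => ⟨(0 : Fin 3), by simp [fourPlanarSeq]⟩
      | 1 => ⟨(1 : Fin 3), by simp [fourPlanarSeq]⟩
      | 2 => ⟨(2 : Fin 3), by simp [fourPlanarSeq]⟩
      | 3 => ⟨(0 : Fin 3), by simp [fourPlanarSeq]⟩)
    ⟨(1 : Fin 3), by fin_cases i <;> simp [fourPlanarSeq]⟩

/-- The canonical loops of the 4-planar X-cube model. -/
def braidData (hn : 1 < n) : BraidData (fourPlanarSeq n) where
  one_lt := hn
  exact := isExact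
  surj := surj
  indep _ _ := indep
  Δ _ := 1 - T 1
  κ := ![0, 0, 0, 1]
  Δ_reg _ _ := T_one_mul_eq_self
  surjZ i := (exists_pi_eq_one i).1
  surjX i := (exists_pi_eq_one i).2
  dvd i v h := dvd_of_omega_eq_zero i _ ((isExact.2.2.2.1 _).2 ⟨v, rfl⟩) h
  g := ![![0, 0, 1], ![1, 0, 0], ![0, 1, 0], ![0, 1, -1]]
  h := ![![0, 1, 0], ![0, 0, 1], ![1, 0, 0], ![1, -1, 0]]
  θ_g i := match i with
    | (0 : Fin 4) => rfl
    | (1 : Fin 4) => rfl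
    | (2 : Fin 4) => rfl
    | (3 : Fin 4) => rfl
  θ_h i := match i with
    | (0 : Fin 4) => rfl
    | (1 : Fin 4) => rfl
    | (2 : Fin 4) => rfl
    | (3 : Fin 4) => rfl
  ind i := match i with
    | (0 : Fin 4) => planeMap_injective_of_coord (s := 1) (t := 2) (by decide)
    | (1 : Fin 4) => planeMap_injective_of_coord (s := 0) (t := 2) (by decide)
    | (2 : Fin 4) => planeMap_injective_of_coord (s := 0) (t := 1) (by decide)
    | (3 : Fin 4) => planeMap_injective_of_coord (s := 0) (t := 1) (by decide)
  loopZ i := by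
    obtain ⟨e, sg, sh, w, L⟩ := loopsZ n i
    exact L.loopZ (X := fourPlanar n) (M := fourPlanarSeq n)
  loopX i := by
    obtain ⟨e, sg, sh, w, L⟩ := loopsX n i
    have := L.loopX (X := fourPlanar n) (M := fourPlanarSeq n)
    simpa using this

section Weights

variable {q : Fin 4 ⊕ Fin 4 → Lau n}

theorem mem_closure_of_aug {i : ℕ} (hi : 1 ≤ i) (hq : q ∈ Constraints n)
    (h0 : aug n (q (Sum.inl 0)) = 0) (h1 : aug n (q (Sum.inl 1)) = 0)
    (h2 : aug n (q (Sum.inl 2)) = 0) (h3 : aug n (q (Sum.inr 0)) = 0) :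
    q ∈ AddSubgroup.closure {r | r ∈ Constraints n ∧ wt r ≤ i} := by
  obtain ⟨e0, e1, e2, e3⟩ := hq
  rw [h0, h1, h2, add_zero, add_zero, zero_add] at e0
  rw [h3] at e1
  rw [← e1] at e2 e3
  refine mem_closure_of_part hi fun l => ?_
  unfold Constraints
  fin_cases l <;> simp [part, h0, h1, h2, h3, e0, ← e1, e2, e3]

theorem aug_inr_of_wt (hq : q ∈ Constraints n) (h : wt q ≤ 3) : aug n (q (Sum.inr 0)) = 0 := by
  obtain ⟨-, e1, e2, e3⟩ := hq
  obtain ⟨l, -, -, h0⟩ := exists_of_wt_lt (q := q) Finset.univ (by rw [Finset.card_fin]; omega)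
  fin_cases l <;> simp_all

theorem aug_inl_of_wt (hq : q ∈ Constraints n) (h : wt q ≤ 1) (i : Fin 4) :
    aug n (q (Sum.inl i)) = 0 := by
  by_cases hi : q (Sum.inl i) = 0
  · rw [hi, map_zero]
  have h0 (j : Fin 4) (hj : j ≠ i) : q (Sum.inl j) = 0 := by
    obtain ⟨l, hl, h1, -⟩ := exists_of_wt_lt (q := q) {j, i} (by rw [Finset.card_pair hj]; omega)
    rcases Finset.mem_insert.1 hl with rfl | hl
    · exact h1
    · rw [Finset.mem_singleton.1 hl] at h1
      exact (hi h1).elim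
  have e0 := hq.1
  fin_cases i
  · simpa [h0 1 (by decide), h0 2 (by decide), h0 3 (by decide)] using e0
  · simpa [h0 0 (by decide), h0 2 (by decide), h0 3 (by decide)] using e0
  · simpa [h0 0 (by decide), h0 1 (by decide), h0 3 (by decide)] using e0
  · simpa [h0 0 (by decide), h0 1 (by decide), h0 2 (by decide)] using e0

theorem hasWeights_of_mem {i : ℕ} (hi : 2 ≤ i) (hi' : i ≤ 3) :
    HasWeights (Constraints n) i (AbGrp (List.replicate 1 n)) := by
  refine hasWeights_of_functionals (fun _ => augAt (Sum.inr 0))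
    (fun a => ?_) (fun q hq hw j => aug_inr_of_wt hq (hw.trans hi')) fun q hq h => ?_
  · refine ⟨Sum.elim 0 fun _ => C (a 0), ?_, fun j => ?_⟩
    · simp [Constraints]
    · rw [Subsingleton.elim j 0]
      simp
  · have h0 : aug n (q (Sum.inr 0)) = 0 := h 0
    obtain ⟨e0, e1, e2, e3⟩ := hq
    set a := aug n (q (Sum.inl 0)) with ha
    set b := aug n (q (Sum.inl 1)) with hb
    set c := aug n (q (Sum.inl 2)) with hc
    let q₁ : Fin 4 ⊕ Fin 4 → Lau n := Sum.elim ![C a, 0, 0, C (-a)] 0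
    let q₂ : Fin 4 ⊕ Fin 4 → Lau n := Sum.elim ![0, C b, 0, C (-b)] 0
    let q₃ : Fin 4 ⊕ Fin 4 → Lau n := Sum.elim ![0, 0, C c, C (-c)] 0
    have h1 : q₁ ∈ Constraints n := by simp [Constraints, q₁]
    have h2 : q₂ ∈ Constraints n := by simp [Constraints, q₂]
    have h3 : q₃ ∈ Constraints n := by simp [Constraints, q₃]
    have w1 : wt q₁ ≤ i := (wt_le {0, 3} fun i hi => by fin_cases i <;> simp [q₁] at hi ⊢).trans hi
    have w2 : wt q₂ ≤ i := (wt_le {1, 3} fun i hi => by fin_cases i <;> simp [q₂] at hi ⊢).trans hi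
    have w3 : wt q₃ ≤ i := (wt_le {2, 3} fun i hi => by fin_cases i <;> simp [q₃] at hi ⊢).trans hi
    have h4 : q - q₁ - q₂ - q₃ ∈ AddSubgroup.closure {r | r ∈ Constraints n ∧ wt r ≤ i} := by
      refine mem_closure_of_aug (one_le_two.trans hi) ?_ ?_ ?_ ?_ ?_
      · simp [Constraints, q₁, q₂, q₃, e1, e2, e3]
        linear_combination e0
      · simp [q₁, q₂, q₃, ← ha]
      · simp [q₁, q₂, q₃, ← hb]
      · simp [q₁, q₂, q₃, ← hc]
      · simp [q₁, q₂, q₃, h0]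
    have h5 := add_mem (add_mem (add_mem h4 (AddSubgroup.subset_closure ⟨h3, w3⟩))
      (AddSubgroup.subset_closure ⟨h2, w2⟩)) (AddSubgroup.subset_closure ⟨h1, w1⟩)
    rwa [sub_add_cancel, sub_add_cancel, sub_add_cancel] at h5

theorem hasWeights (i : Fin 4) : HasWeights (Constraints n) (i + 1)
    (AbGrp (([[n, n, n, n], [n], [n], []] : List (List ℕ)).get i)) := by
  match i with
  | 0 =>
    refine hasWeights_of_functionals (i := 1) (m := 4)
      ![augAt (Sum.inl 0), augAt (Sum.inl 1), augAt (Sum.inl 2), augAt (Sum.inr 0)]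
      (fun a => ?_) (fun q hq hw j => ?_) fun q hq h => ?_
    · refine ⟨Sum.elim ![C (a 0), C (a 1), C (a 2), C (-a 0 - a 1 - a 2)] fun _ => C (a 3), ?_,
        fun j => ?_⟩
      · simp [Constraints]
      · fin_cases j <;> simp
    · fin_cases j
      · exact aug_inl_of_wt hq hw 0
      · exact aug_inl_of_wt hq hw 1
      · exact aug_inl_of_wt hq hw 2
      · exact aug_inr_of_wt hq (hw.trans (by norm_num))
    · exact mem_closure_of_aug le_rfl hq (h 0) (h 1) (h 2) (h 3)
  | 1 => exact hasWeights_of_mem le_rfl (by norm_num)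
  | 2 => exact hasWeights_of_mem (by norm_num) le_rfl
  | 3 => exact hasWeights_nil (by simp [Constraints]) le_rfl

end Weights

theorem isPModularWith (hn : 1 < n) :
    (fourPlanar n).IsPModularWith (fourPlanarSeq n) [n, n, n, n] [[n, n, n, n], [n], [n], []] :=
  (braidData hn).isPModularWith (0 : Fin 4) rfl rfl fun _ _ _ hT i =>
    (braidData hn).nonempty_W_equiv_of_hasWeights hT omega_eq_zero_iff (hasWeights i)

theorem isFoliated (hn : 1 < n) {η : Z3 →+ E3} {normal : Plane → E3}
    {form : Plane → (fourPlanar n).Sec → ((fourPlanar n).Sec →ₗ[ZMod n] ZMod n)}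
    (hT : (fourPlanar n).IsTheory η normal form) :
    ((fourPlanar n).theory η normal form).IsFoliated 1 :=
  (braidData hn).isFoliated_of_planar rfl (fun _ => rfl) hT

end FourPlanar

open LaurentPolynomial

namespace Checkerboard

variable (n : ℕ)

/-- The plane charges with signs. -/
def px : GroupRing n →ₐ[ZMod n] Lau n := proj n (deg 1 + deg 2) (deg 0 + deg 1)
def py : GroupRing n →ₐ[ZMod n] Lau n := proj n (deg 2 + deg 0) (deg 1 + deg 2)
def pz : GroupRing n →ₐ[ZMod n] Lau n := proj n (deg 0 + deg 1) (deg 2 + deg 0)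

section Generators

@[simp] theorem px_tx : px n (tx n) = -1 := (proj_mono _ _ _).trans (by simp)
@[simp] theorem px_ty : px n (ty n) = -T 1 := (proj_mono _ _ _).trans (by simp)
@[simp] theorem px_tz : px n (tz n) = T 1 := (proj_mono _ _ _).trans (by simp)
@[simp] theorem px_txi : px n (txi n) = -1 := (proj_mono _ _ _).trans (by simp)
@[simp] theorem px_tyi : px n (tyi n) = -T (-1) := (proj_mono _ _ _).trans (by simp)
@[simp] theorem px_tzi : px n (tzi n) = T (-1) := (proj_mono _ _ _).trans (by simp)
@[simp] theorem py_tx : py n (tx n) = T 1 := (proj_mono _ _ _).trans (by simp)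
@[simp] theorem py_ty : py n (ty n) = -1 := (proj_mono _ _ _).trans (by simp)
@[simp] theorem py_tz : py n (tz n) = -T 1 := (proj_mono _ _ _).trans (by simp)
@[simp] theorem py_txi : py n (txi n) = T (-1) := (proj_mono _ _ _).trans (by simp)
@[simp] theorem py_tyi : py n (tyi n) = -1 := (proj_mono _ _ _).trans (by simp)
@[simp] theorem py_tzi : py n (tzi n) = -T (-1) := (proj_mono _ _ _).trans (by simp)
@[simp] theorem pz_tx : pz n (tx n) = -T 1 := (proj_mono _ _ _).trans (by simp)
@[simp] theorem pz_ty : pz n (ty n) = T 1 := (proj_mono _ _ _).trans (by simp)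
@[simp] theorem pz_tz : pz n (tz n) = -1 := (proj_mono _ _ _).trans (by simp)
@[simp] theorem pz_txi : pz n (txi n) = -T (-1) := (proj_mono _ _ _).trans (by simp)
@[simp] theorem pz_tyi : pz n (tyi n) = T (-1) := (proj_mono _ _ _).trans (by simp)
@[simp] theorem pz_tzi : pz n (tzi n) = -1 := (proj_mono _ _ _).trans (by simp)

theorem tau_eq : tau n = 1 + tx n + ty n + tz n := rfl
theorem antipode_tau : antipode n (tau n) = 1 + txi n + tyi n + tzi n := by simp [tau_eq]

theorem tau_bar : tx n * ty n * tz n * antipode n (tau n) =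
    tau n * (tx n * ty n + tx n + ty n) - (tx n + ty n) * ((1 + tx n) * (1 + ty n)) := by
  rw [antipode_tau, tau_eq]
  linear_combination ty n * tz n * tx_mul_txi n + tx n * tz n * ty_mul_tyi n +
    tx n * ty n * tz_mul_tzi n

end Generators

variable {n} {f : GroupRing n}

section Kernel

theorem proj_evalL {u : (GroupRing n)ˣ} {g : Z3} (hu : (u : GroupRing n) = mono n g)
    {θ χ : Z3 →+ ℤ} (hg : θ g = 1) (hχ : χ g = 0) (f : Lau n) : proj n θ χ (evalL u f) = f := by
  refine DFunLike.congr_fun (lau_hom_ext (φ := (proj n θ χ).comp (evalL u)) (ψ := AlgHom.id _ _)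
    fun k => ?_) f
  change proj n θ χ (evalL u (T k)) = T k
  rw [evalL_T, val_zpow_eq_mono n hu, proj_mono, map_zsmul, map_zsmul, hg, hχ]
  simp

@[simp] theorem px_jz (f : Lau n) : px n (jz n f) = f := proj_evalL rfl rfl rfl f
@[simp] theorem py_jx (f : Lau n) : py n (jx n f) = f := proj_evalL rfl rfl rfl f
@[simp] theorem pz_jy (f : Lau n) : pz n (jy n f) = f := proj_evalL rfl rfl rfl f

theorem eq_zero_of_one_add_mono_mul {g : Z3} (hg : g ≠ 0) (hf : (1 + mono n g) * f = 0) : f = 0 := by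
  refine eq_zero_of_mono_mul (u := 1) (v := 1) hg.symm isUnit_one isUnit_one ?_
  rw [mono_zero, one_smul, one_smul, hf]

theorem eq_zero_of_mono_add_mul {g h : Z3} (hg : g ≠ h) (hf : (mono n g + mono n h) * f = 0) :
    f = 0 := by
  refine eq_zero_of_mono_mul (u := 1) (v := 1) hg isUnit_one isUnit_one ?_
  rw [one_smul, one_smul, hf]

theorem of_tau (h : tau n * f = 0) : f = 0 := by
  refine eq_zero_of_mul_eq_zero_of_top (deg 2) (g₀ := ![0, 0, 1]) (u := 1) isUnit_one
    (r := 1 + tx n + ty n) (fun g hg => ?_) (by rw [← h, tau_eq]; exact congrArg (· * f) (add_comm _ _))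
  change g 2 < 1
  by_contra hc
  refine hg ?_
  have h0 : (0 : Z3) ≠ g := fun e => hc (by rw [← e]; decide)
  have h1 : ![1, 0, 0] ≠ g := fun e => hc (by rw [← e]; decide)
  have h2 : ![0, 1, 0] ≠ g := fun e => hc (by rw [← e]; decide)
  rw [tx, ty, ← mono_zero]
  simp [mono, AddMonoidAlgebra.coeff_add, AddMonoidAlgebra.coeff_single, h0, h1,
    h2]

/-- Substitutions with which a generator or a sum of two vanishes. -/
def atNegX (n : ℕ) : GroupRing n →ₐ[ZMod n] GroupRing n := subst (-1) (uy n) (uz n)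
def atNegY (n : ℕ) : GroupRing n →ₐ[ZMod n] GroupRing n := subst (ux n) (-1) (uz n)
def atNegZ (n : ℕ) : GroupRing n →ₐ[ZMod n] GroupRing n := subst (ux n) (uy n) (-1)

theorem eq_atNegX (f : GroupRing n) : ∃ c, f = atNegX n f + (1 + tx n) * c :=
  exists_eq_subst_add _ _ ⟨1, by simp [atNegX]; ring⟩ (by simp [atNegX]) (by simp [atNegX]) f
theorem eq_atNegY (f : GroupRing n) : ∃ c, f = atNegY n f + (1 + ty n) * c :=
  exists_eq_subst_add _ _ (by simp [atNegY]) ⟨1, by simp [atNegY]; ring⟩ (by simp [atNegY]) f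
theorem eq_atNegZ (f : GroupRing n) : ∃ c, f = atNegZ n f + (1 + tz n) * c :=
  exists_eq_subst_add _ _ (by simp [atNegZ]) (by simp [atNegZ]) ⟨1, by simp [atNegZ]; ring⟩ f
theorem eq_substYNegX (f : GroupRing n) :
    ∃ c, f = subst (ux n) (-ux n) (uz n) f + (tx n + ty n) * c :=
  exists_eq_subst_add _ _ (by simp) ⟨1, by simp; ring⟩ (by simp) f
theorem eq_substXNegY (f : GroupRing n) :
    ∃ c, f = subst (-uy n) (uy n) (uz n) f + (tx n + ty n) * c :=
  exists_eq_subst_add _ _ ⟨1, by simp⟩ (by simp) (by simp) f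
theorem eq_substYNegZ (f : GroupRing n) :
    ∃ c, f = subst (ux n) (-uz n) (uz n) f + (ty n + tz n) * c :=
  exists_eq_subst_add _ _ (by simp) ⟨1, by simp⟩ (by simp) f
theorem eq_substZNegX (f : GroupRing n) :
    ∃ c, f = subst (ux n) (uy n) (-ux n) f + (tz n + tx n) * c :=
  exists_eq_subst_add _ _ (by simp) (by simp) ⟨1, by simp⟩ f

theorem tau_dvd_of_x (h : tau n ∣ (1 + tx n) * f) : tau n ∣ f := by
  obtain ⟨g, hg⟩ := h
  obtain ⟨c, hc⟩ := eq_atNegX g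
  have h1 := congrArg (atNegX n) hg
  simp [tau_eq, atNegX] at h1
  have h2 : atNegX n g = 0 := eq_zero_of_mono_add_mul (g := ![0, 1, 0]) (h := ![0, 0, 1]) (by decide)
    h1.symm
  rw [h2, zero_add] at hc
  refine ⟨c, sub_eq_zero.1 (eq_zero_of_one_add_mono_mul (g := ![1, 0, 0]) (by decide) ?_)⟩
  rw [mono_ex]
  linear_combination hg + tau n * hc

theorem tau_dvd_of_y (h : tau n ∣ (1 + ty n) * f) : tau n ∣ f := by
  obtain ⟨g, hg⟩ := h
  obtain ⟨c, hc⟩ := eq_atNegY g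
  have h1 := congrArg (atNegY n) hg
  simp [tau_eq, atNegY] at h1
  have h2 : atNegY n g = 0 := eq_zero_of_mono_add_mul (g := ![1, 0, 0]) (h := ![0, 0, 1]) (by decide)
    h1.symm
  rw [h2, zero_add] at hc
  refine ⟨c, sub_eq_zero.1 (eq_zero_of_one_add_mono_mul (g := ![0, 1, 0]) (by decide) ?_)⟩
  rw [mono_ey]
  linear_combination hg + tau n * hc

theorem tau_dvd_of_xy (h : tau n ∣ (tx n + ty n) * f) : tau n ∣ f := by
  obtain ⟨g, hg⟩ := h
  obtain ⟨c, hc⟩ := eq_substYNegX g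
  have h1 := congrArg (subst (ux n) (-ux n) (uz n)) hg
  simp [tau_eq] at h1
  have h2 : subst (ux n) (-ux n) (uz n) g = 0 :=
    eq_zero_of_one_add_mono_mul (g := ![0, 0, 1]) (by decide) h1.symm
  rw [h2, zero_add] at hc
  refine ⟨c, sub_eq_zero.1 (eq_zero_of_mono_add_mul (g := ![1, 0, 0]) (h := ![0, 1, 0])
    (by decide) ?_)⟩
  rw [mono_ex, mono_ey]
  linear_combination hg + tau n * hc

theorem of_px (h : px n f = 0) : ∃ a b, f = (1 + tx n) * a + tau n * b := by
  obtain ⟨a, ha⟩ := eq_atNegX f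
  obtain ⟨b, hb⟩ := eq_substYNegZ (atNegX n f)
  have h1 : subst (ux n) (-uz n) (uz n) (atNegX n f) = jz n (px n f) := by
    refine subst_subst_eq ?_ ?_ ?_ f <;> change _ = jz n (px n _) <;> simp [atNegX, jz, evalL_T]
  rw [h1, h, map_zero, zero_add] at hb
  exact ⟨a - b, b, by rw [ha, hb, tau_eq]; ring⟩

theorem of_py (h : py n f = 0) : ∃ a b, f = (1 + ty n) * a + tau n * b := by
  obtain ⟨a, ha⟩ := eq_atNegY f
  obtain ⟨b, hb⟩ := eq_substZNegX (atNegY n f)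
  have h1 : subst (ux n) (uy n) (-ux n) (atNegY n f) = jx n (py n f) := by
    refine subst_subst_eq ?_ ?_ ?_ f <;> change _ = jx n (py n _) <;> simp [atNegY, jx, evalL_T]
  rw [h1, h, map_zero, zero_add] at hb
  exact ⟨a - b, b, by rw [ha, hb, tau_eq]; ring⟩

theorem of_pz (h : pz n f = 0) : ∃ a b, f = (tx n + ty n) * a + tau n * b := by
  obtain ⟨a, ha⟩ := eq_atNegZ f
  obtain ⟨b, hb⟩ := eq_substXNegY (atNegZ n f)
  have h1 : subst (-uy n) (uy n) (uz n) (atNegZ n f) = jy n (pz n f) := by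
    refine subst_subst_eq ?_ ?_ ?_ f <;> change _ = jy n (pz n _) <;> simp [atNegZ, jy, evalL_T]
  rw [h1, h, map_zero, zero_add] at hb
  exact ⟨b - a, a, by rw [ha, hb, tau_eq]; ring⟩

end Kernel

section Laurent

/-- The sums of the coefficients in even and in odd degrees. -/
def esum (n : ℕ) : Lau n →ₗ[ZMod n] ZMod n := wsum (alt n 1 0)
def osum (n : ℕ) : Lau n →ₗ[ZMod n] ZMod n := wsum (alt n 0 1)

theorem esum_C_mul_T (k : ℤ) (c : ZMod n) : esum n (C c * T k) = if Even k then c else 0 := by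
  rw [esum, wsum_C_mul_T, alt]
  split_ifs <;> simp

theorem osum_C_mul_T (k : ℤ) (c : ZMod n) : osum n (C c * T k) = if Even k then 0 else c := by
  rw [osum, wsum_C_mul_T, alt]
  split_ifs <;> simp

@[simp] theorem esum_C (c : ZMod n) : esum n (C c) = c := by
  simpa using esum_C_mul_T 0 c
@[simp] theorem osum_C (c : ZMod n) : osum n (C c) = 0 := by
  simpa using osum_C_mul_T 0 c
@[simp] theorem esum_C_mul_T_one (c : ZMod n) : esum n (C c * T 1) = 0 := by
  simpa using esum_C_mul_T 1 c
@[simp] theorem osum_C_mul_T_one (c : ZMod n) : osum n (C c * T 1) = c := by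
  simpa using osum_C_mul_T 1 c

theorem wsum_alt (c d : ZMod n) (f : Lau n) : wsum (alt n c d) f = c * esum n f + d * osum n f := by
  induction f using LaurentPolynomial.induction_on' with
  | add p q hp hq => rw [map_add, map_add, map_add, hp, hq]; ring
  | C_mul_T k a =>
    rw [esum_C_mul_T, osum_C_mul_T, wsum_C_mul_T, alt]
    split_ifs <;> simp

theorem one_sub_T_two_dvd {f : Lau n} (he : esum n f = 0) (ho : osum n f = 0) : 1 - T 2 ∣ f := by
  have key : ∀ f : Lau n, 1 - T 2 ∣ f - C (esum n f) - C (osum n f) * T 1 := by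
    intro f
    induction f using LaurentPolynomial.induction_on' with
    | add p q hp hq =>
      have := dvd_add hp hq
      rw [map_add, map_add, map_add, map_add]
      convert this using 1
      ring
    | C_mul_T k c =>
      rw [esum_C_mul_T, osum_C_mul_T]
      split_ifs with h
      · obtain ⟨j, rfl⟩ := h
        have h1 := dvd_mul_of_dvd_right (one_sub_T_dvd (n := n) 2 j) (C c)
        simpa [mul_sub, mul_two] using h1
      · obtain ⟨j, rfl⟩ := Int.not_even_iff_odd.1 h
        have h1 := dvd_mul_of_dvd_right (one_sub_T_dvd (n := n) 2 j) (C c * T 1)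
        rw [mul_sub, mul_assoc, ← T_add, mul_one, show 1 + j * 2 = 2 * j + 1 by ring] at h1
        simpa using h1
  simpa [he, ho] using key f

theorem invert_one_sub_T_two_dvd {f : Lau n} (h : 1 - T 2 ∣ f) : invert (1 - T 2) ∣ f := by
  obtain ⟨g, rfl⟩ := h
  have t2 : (T 2 : Lau n) * T (-2) = 1 := by rw [← T_add, add_neg_cancel, T_zero]
  refine ⟨-T 2 * g, ?_⟩
  simp
  linear_combination -g * t2

theorem of_one_add_T_mul {f : Lau n} (h : (1 + T 1) * f = 0) : f = 0 :=
  lau_eq_zero_of_mul (j := 0) (k := 1) (u := 1) (v := 1) (by norm_num) isUnit_one isUnit_one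
    (by simpa using h)

theorem of_one_sub_T_two_mul {f : Lau n} (h : (1 - T 2) * f = 0) : f = 0 :=
  lau_eq_zero_of_T_sub_one_mul (k := 2) (c := 1) two_ne_zero isUnit_one
    (by rw [map_one]; linear_combination -h)

end Laurent

theorem charge_eq (i : Fin 3) (v : Fin 1 → GroupRing n) :
    ∑ j, (!![1; 1; 1] : Matrix (Fin 3) (Fin 1) (Lau n)) i j *
      proj n ((![deg 1 + deg 2, deg 2 + deg 0, deg 0 + deg 1] : Fin 3 → (Z3 →+ ℤ)) i)
        ((![deg 0 + deg 1, deg 1 + deg 2, deg 2 + deg 0] : Fin 3 → (Z3 →+ ℤ)) i) (v j) =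
      (![px n (v 0), py n (v 0), pz n (v 0)] : Fin 3 → Lau n) i := by
  fin_cases i <;> simp [px, py, pz]

theorem comp_constraint (f : GroupRing n) :
    osum n (px n f) - esum n (py n f) + esum n (pz n f) = 0 ∧
      esum n (px n f) + osum n (py n f) - esum n (pz n f) = 0 ∧
      -esum n (px n f) + esum n (py n f) + osum n (pz n f) = 0 := by
  have hs (k : ℤ) : (((-1 : (ZMod n)ˣ) ^ k : (ZMod n)ˣ) : ZMod n) = if Even k then 1 else -1 := by
    split_ifs with h
    · rw [h.neg_one_zpow, Units.val_one]
    · rw [(Int.not_even_iff_odd.1 h).neg_one_zpow, Units.val_neg, Units.val_one]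
  have key (L : GroupRing n →ₗ[ZMod n] ZMod n) (h : ∀ m, L (mono n m) = 0) : L f = 0 := by
    rw [groupRing_linear_ext (φ := L) (ψ := 0) h]
    rfl
  refine ⟨key (osum n ∘ₗ (px n).toLinearMap - esum n ∘ₗ (py n).toLinearMap +
      esum n ∘ₗ (pz n).toLinearMap) fun m => ?_,
    key (esum n ∘ₗ (px n).toLinearMap + osum n ∘ₗ (py n).toLinearMap -
      esum n ∘ₗ (pz n).toLinearMap) fun m => ?_,
    key (-(esum n ∘ₗ (px n).toLinearMap) + esum n ∘ₗ (py n).toLinearMap +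
      osum n ∘ₗ (pz n).toLinearMap) fun m => ?_⟩ <;>
  · simp only [LinearMap.add_apply, LinearMap.sub_apply, LinearMap.neg_apply, LinearMap.comp_apply,
      AlgHom.toLinearMap_apply, px, py, pz, proj_mono, esum_C_mul_T, osum_C_mul_T, hs,
      AddMonoidHom.add_apply, deg_apply, Int.even_add]
    by_cases h0 : Even (m 0) <;> by_cases h1 : Even (m 1) <;> by_cases h2 : Even (m 2) <;>
      simp [h0, h1, h2]

theorem halfExact {u : GroupRing n} (hu : u = 1 ∨ u = -1) :
    HalfExact (n := n) (t := 1) (t' := 1) (q := 2) (k := 3) (c := 3)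
      !![u * antipode n (tau n), tau n] !![-(u * antipode n (tau n)), tau n]
      ![deg 1 + deg 2, deg 2 + deg 0, deg 0 + deg 1] ![deg 0 + deg 1, deg 1 + deg 2, deg 2 + deg 0]
      !![1; 1; 1] ![![alt n 0 1, alt n (-1) 0, alt n 1 0], ![alt n 1 0, alt n 0 1, alt n (-1) 0],
        ![alt n (-1) 0, alt n 1 0, alt n 0 1]] := by
  have hu2 : u * u = 1 := by rcases hu with rfl | rfl <;> ring
  have hua : antipode n u = u := by rcases hu with rfl | rfl <;> simp
  refine ⟨fun w h => ?_, fun i j => ?_, fun s h => ?_, fun i k => ?_, fun v h => ?_, fun v l => ?_,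
    fun q h => ?_, fun r => ?_⟩
  · have h1 := congrArg (antipode n) (h 1)
    simp at h1
    funext j
    rw [Subsingleton.elim j 0, ← antipode_antipode (w 0), of_tau h1, map_zero]
    rfl
  · rw [Subsingleton.elim i 0, Subsingleton.elim j 0]
    simp [hua]
    linear_combination -antipode n (tau n) * tau n * hu2
  · have h1 := h 0
    simp at h1
    have h2 : tau n ∣ (tx n + ty n) * ((1 + tx n) * ((1 + ty n) * s 0)) := by
      refine ⟨(tx n * ty n + tx n + ty n) * s 0 + tx n * ty n * tz n * u * s 1, ?_⟩
      linear_combination s 0 * tau_bar n - tx n * ty n * tz n * u * h1 +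
        tx n * ty n * tz n * antipode n (tau n) * s 0 * hu2
    obtain ⟨f, hf⟩ := tau_dvd_of_y (tau_dvd_of_x (tau_dvd_of_xy h2))
    have h3 : s 1 + u * antipode n (tau n) * f = 0 :=
      of_tau (by linear_combination h1 - u * antipode n (tau n) * hf)
    refine ⟨![-u * f], fun k => ?_⟩
    match k with
    | 0 => simp [hua]; linear_combination -hf + tau n * f * hu2
    | 1 => simp; linear_combination -h3
  · have h1 (θ χ) (h : proj n θ χ (tau n) = 0) :
        proj n θ χ ((!![u * antipode n (tau n), tau n] : Matrix (Fin 1) (Fin 2) (GroupRing n)) 0 k) = 0 := by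
      fin_cases k
      · simp [proj_antipode, h]
      · simpa using h
    rw [charge_eq]
    fin_cases i
    · exact h1 _ _ (show px n _ = 0 by simp [tau_eq])
    · exact h1 _ _ (show py n _ = 0 by simp [tau_eq])
    · exact h1 _ _ (show pz n _ = 0 by simp [tau_eq])
  · simp only [charge_eq] at h
    have h0 : px n (v 0) = 0 := h 0
    have h1 : py n (v 0) = 0 := h 1
    have h2 : pz n (v 0) = 0 := h 2
    obtain ⟨a, a', ha⟩ := of_px h0
    rw [ha] at h1
    have h1' : py n a = 0 := of_one_add_T_mul (by simpa [tau_eq] using h1)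
    obtain ⟨b, b', rfl⟩ := of_py h1'
    rw [ha] at h2
    have h2' : pz n b = 0 := of_one_sub_T_two_mul (by
      have t2 : (T 2 : Lau n) = T 1 * T 1 := by rw [← T_add]; rfl
      simp [tau_eq] at h2
      rw [t2]
      linear_combination h2)
    obtain ⟨c, c', rfl⟩ := of_pz h2'
    refine ⟨![-u * (tx n * ty n * tz n) * c, (tx n * ty n + tx n + ty n) * c +
      (1 + tx n) * (1 + ty n) * c' + (1 + tx n) * b' + a'], fun j => ?_⟩
    rw [Subsingleton.elim j 0, ha]
    simp
    linear_combination -c * tau_bar n - tx n * ty n * tz n * antipode n (tau n) * c * hu2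
  · obtain ⟨h0, h1, h2⟩ := comp_constraint (v 0)
    simp only [charge_eq]
    fin_cases l <;> simp [Fin.sum_univ_three, wsum_alt]
    · linear_combination h0
    · linear_combination h1
    · linear_combination h2
  · have h0 := h 0
    have h1 := h 1
    have h2 := h 2
    simp [Fin.sum_univ_three, wsum_alt] at h0 h1 h2
    obtain ⟨α, hα⟩ : ∃ α, α = esum n (q 2) := ⟨_, rfl⟩
    obtain ⟨β, hβ⟩ : ∃ β, β = α - esum n (q 0) := ⟨_, rfl⟩
    obtain ⟨γ, hγ⟩ : ∃ γ, γ = α - esum n (q 1) := ⟨_, rfl⟩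
    obtain ⟨r, hr⟩ := one_sub_T_two_dvd (f := q 0 - (C α - C β - C γ * T 1))
      (by simp; linear_combination hβ) (by simp; linear_combination h0 + hα + hγ)
    obtain ⟨s, hs⟩ := one_sub_T_two_dvd (f := q 1 - (C α + C β * T 1 - C γ))
      (by simp; linear_combination hγ) (by simp; linear_combination h1 - hα - hβ)
    obtain ⟨t, ht⟩ := one_sub_T_two_dvd (f := q 2 - (C α - C β * T 1 + C γ * T 1))
      (by simp; linear_combination -hα) (by simp; linear_combination h2 + hβ - hγ)
    have t2 : (T 2 : Lau n) = T 1 * T 1 := by rw [← T_add]; rfl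
    rw [t2] at hr hs ht
    refine ⟨![α • 1 + β • tx n + γ • ty n +
      (1 + ty n) * (1 + tz n) * jz n r + (1 + tz n) * (1 + tx n) * jx n s +
      (1 + tx n) * (1 + ty n) * jy n t], fun i => ?_⟩
    rw [charge_eq]
    match i with
    | 0 => simp [smul_eq_C_mul]; linear_combination -hr
    | 1 => simp [smul_eq_C_mul]; linear_combination -hs
    | 2 => simp [smul_eq_C_mul]; linear_combination -ht
  · refine ⟨![C (r 0) * T 1, C (r 1) * T 1, C (r 2) * T 1], fun l => ?_⟩
    fin_cases l <;> simp [Fin.sum_univ_three, wsum_alt]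

variable (n) in
theorem halfExactZ : HalfExact (n := n) (t := 1) (t' := 1) (q := 2) (k := 3) (c := 3)
    (checkerboard n).eZ (checkerboard n).eX (checkerboardSeq n).θ (checkerboardSeq n).χ
    (checkerboardSeq n).pZ (checkerboardSeq n).oZ := by
  have h := halfExact (n := n) (Or.inl rfl)
  rw [one_mul] at h
  exact h

variable (n) in
theorem halfExactX : HalfExact (n := n) (t := 1) (t' := 1) (q := 2) (k := 3) (c := 3)
    (checkerboard n).eX (checkerboard n).eZ (checkerboardSeq n).θ (checkerboardSeq n).χ
    (checkerboardSeq n).pX (checkerboardSeq n).oX := by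
  have h := halfExact (n := n) (Or.inr rfl)
  rw [neg_mul, one_mul, neg_neg] at h
  exact h

theorem isExact : (checkerboardSeq n).IsExact :=
  HalfExact.isExact (M := checkerboardSeq n) (halfExactZ n) (halfExactX n)

end Checkerboard

open LaurentPolynomial

namespace Checkerboard

variable {n : ℕ}

theorem neg_one_zpow_eq_ite (k : ℤ) :
    (((-1 : (ZMod n)ˣ) ^ k : (ZMod n)ˣ) : ZMod n) = if Even k then 1 else -1 := by
  split_ifs with h
  · rw [h.neg_one_zpow, Units.val_one]
  · rw [(Int.not_even_iff_odd.1 h).neg_one_zpow, Units.val_neg, Units.val_one]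

/-- Statistics of a loop around the cosets of the even part of a plane. -/
theorem coeffSum_eq_coeff {θ χ : Z3 →+ ℤ} {H : AddSubgroup Z3} (hH : ∀ m, m ∈ H ↔ θ m = 0 ∧ Even (χ m))
    {k l : Z3} {j : ℤ} (hk : θ k = j) (hl : θ l = j) (hk' : Even (χ k)) (hl' : ¬Even (χ l))
    (f : GroupRing n) : coeffSum H ((mono n (-k) - mono n (-l)) * f) =
      (T (-j) * proj n θ χ f).coeff 0 := by
  classical
  have key : coeffSumL (n := n) H ∘ₗ LinearMap.mulLeft (ZMod n) (mono n (-k) - mono n (-l)) =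
      { toFun := fun f => (T (-j) * proj n θ χ f).coeff 0
        map_add' := fun x y => by rw [map_add, mul_add, AddMonoidAlgebra.coeff_add, Finsupp.add_apply]
        map_smul' := fun c x => by
          rw [map_smul, mul_smul_comm, AddMonoidAlgebra.coeff_smul, Finsupp.smul_apply,
            RingHom.id_apply] } := by
    refine groupRing_linear_ext fun m => ?_
    rw [LinearMap.comp_apply, LinearMap.mulLeft_apply, sub_mul, mono_mul, mono_mul, map_sub,
      coeffSumL_apply, coeffSumL_apply, coeffSum_mono, coeffSum_mono, LinearMap.coe_mk, AddHom.coe_mk,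
      proj_mono, neg_one_zpow_eq_ite, coeff_T_mul, coeff_C_mul, T_apply]
    simp only [hH, map_add, map_neg, hk, hl, Int.even_add, even_neg, hk', hl', true_iff, false_iff]
    by_cases hm : θ m = j
    · by_cases hc : Even (χ m) <;> simp [hm, hc]
    · have h1 : -j + θ m ≠ 0 := fun h => hm (by omega)
      simp [hm, h1]
  exact LinearMap.congr_fun key f

theorem mem_closure_x (m : Z3) : m ∈ AddSubgroup.closure {![1, 1, -1], ![1, -1, 1]} ↔
    (deg 1 + deg 2) m = 0 ∧ Even ((deg 0 + deg 1) m) := by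
  rw [AddSubgroup.mem_closure_pair]
  change _ ↔ m 1 + m 2 = 0 ∧ Even (m 0 + m 1)
  constructor
  · rintro ⟨a, b, rfl⟩
    exact ⟨by simp; ring, ⟨a, by simp; ring⟩⟩
  · rintro ⟨h1, a, h2⟩
    refine ⟨a, m 0 - a, ?_⟩
    funext i
    fin_cases i <;> simp <;> omega

theorem mem_closure_y (m : Z3) : m ∈ AddSubgroup.closure {![-1, 1, 1], ![1, 1, -1]} ↔
    (deg 2 + deg 0) m = 0 ∧ Even ((deg 1 + deg 2) m) := by
  rw [AddSubgroup.mem_closure_pair]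
  change _ ↔ m 2 + m 0 = 0 ∧ Even (m 1 + m 2)
  constructor
  · rintro ⟨a, b, rfl⟩
    exact ⟨by simp; ring, ⟨a, by simp; ring⟩⟩
  · rintro ⟨h1, a, h2⟩
    refine ⟨a, m 1 - a, ?_⟩
    funext i
    fin_cases i <;> simp <;> omega

theorem mem_closure_z (m : Z3) : m ∈ AddSubgroup.closure {![1, -1, 1], ![-1, 1, 1]} ↔
    (deg 0 + deg 1) m = 0 ∧ Even ((deg 2 + deg 0) m) := by
  rw [AddSubgroup.mem_closure_pair]
  change _ ↔ m 0 + m 1 = 0 ∧ Even (m 2 + m 0)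
  constructor
  · rintro ⟨a, b, rfl⟩
    exact ⟨by simp; ring, ⟨a, by simp; ring⟩⟩
  · rintro ⟨h1, a, h2⟩
    refine ⟨a, m 2 - a, ?_⟩
    funext i
    fin_cases i <;> simp <;> omega

section Statistics

variable {θ χ : Z3 →+ ℤ} {H : AddSubgroup Z3} (hH : ∀ m, m ∈ H ↔ θ m = 0 ∧ Even (χ m)) {k l : Z3}
  (hk' : Even (χ k)) (hl' : ¬Even (χ l)) (f : GroupRing n)

include hH hk' hl'

theorem coeffSum_antipode_one (hk : θ k = 1) (hl : θ l = 1) :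
    coeffSum H (antipode n (mono n l - mono n k) * f) = (-T (-1) * 1 * proj n θ χ f).coeff 0 := by
  rw [map_sub, antipode_mono, antipode_mono, ← neg_sub, neg_mul, ← coeffSumL_apply, map_neg,
    coeffSumL_apply, coeffSum_eq_coeff hH hk hl hk' hl', mul_one, neg_mul,
    AddMonoidAlgebra.coeff_neg, Finsupp.neg_apply]

theorem coeffSum_antipode_zero (hk : θ k = 0) (hl : θ l = 0) :
    coeffSum H (antipode n (mono n k - mono n l) * f) = (1 * 1 * proj n θ χ f).coeff 0 := by
  rw [map_sub, antipode_mono, antipode_mono, coeffSum_eq_coeff hH hk hl hk' hl', mul_one, neg_zero,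
    T_zero]

end Statistics

section Loops

variable (n)

theorem mono_xy : mono n ![1, 1, 0] = tx n * ty n := by
  rw [tx, ty, mono_mul]; congr 1; decide
theorem mono_xz : mono n ![1, 0, 1] = tx n * tz n := by
  rw [tx, tz, mono_mul]; congr 1; decide
theorem mono_yz : mono n ![0, 1, 1] = ty n * tz n := by
  rw [ty, tz, mono_mul]; congr 1; decide
theorem mono_xy_zi : mono n ![1, 1, -1] = tx n * ty n * tzi n := by
  rw [tx, ty, tzi, mono_mul, mono_mul]; congr 1; decide
theorem mono_xz_yi : mono n ![1, -1, 1] = tx n * tz n * tyi n := by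
  rw [tx, tz, tyi, mono_mul, mono_mul]; congr 1; decide
theorem mono_yz_xi : mono n ![-1, 1, 1] = ty n * tz n * txi n := by
  rw [ty, tz, txi, mono_mul, mono_mul]; congr 1; decide

theorem loopsZ (i : Fin 3) : ∃ e sg sh w, HalfLoop (n := n) (t := 1) (t' := 1) (q := 2) (k := 3)
    (checkerboard n).eZ (checkerboard n).eX (checkerboardSeq n).θ (checkerboardSeq n).χ
    (checkerboardSeq n).pZ (checkerboardSeq n).pX
    (![![1, 1, -1], ![-1, 1, 1], ![1, -1, 1]] i) (![![1, -1, 1], ![1, 1, -1], ![-1, 1, 1]] i) i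
    (1 - T 2) (-T (-1)) e sg sh w := by
  have e1 := tx_mul_txi n
  have e2 := ty_mul_tyi n
  have e3 := tz_mul_tzi n
  have t2 : (T 2 : Lau n) = T 1 * T 1 := by rw [← T_add]; rfl
  match i with
  | 0 =>
    refine ⟨![(1 + ty n) * (1 + tz n)],
      ![tx n * ty n * (1 + ty n), -(1 + ty n)], ![tx n * tz n * (1 + tz n), -(1 + tz n)],
      ![mono n ![1, 0, 1] - mono n ![1, 1, 0]], ?_, ?_, ?_, ?_, ?_⟩
    · intro j
      rw [Subsingleton.elim j 0]
      simp [checkerboard, tau_eq, mono_xy_zi]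
      grind
    · intro j
      rw [Subsingleton.elim j 0]
      simp [checkerboard, tau_eq, mono_xz_yi]
      grind
    · intro k
      fin_cases k <;> simp [checkerboard, tau_eq, mono_xy_zi, mono_xz_yi, mono_xy, mono_xz] <;> grind
    · intro l
      refine (charge_eq l _).trans ?_
      fin_cases l
      · simp [t2]; ring
      · simp
      · simp
    · intro f j
      rw [Subsingleton.elim j 0]
      exact coeffSum_antipode_one mem_closure_x (k := ![1, 1, 0]) (l := ![1, 0, 1])
        (by decide) (by decide) f rfl rfl
  | 1 =>
    refine ⟨![(1 + tz n) * (1 + tx n)],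
      ![ty n * tz n * (1 + tz n), -(1 + tz n)], ![ty n * tx n * (1 + tx n), -(1 + tx n)],
      ![mono n ![1, 1, 0] - mono n ![0, 1, 1]], ?_, ?_, ?_, ?_, ?_⟩
    · intro j
      rw [Subsingleton.elim j 0]
      simp [checkerboard, tau_eq, mono_yz_xi]
      grind
    · intro j
      rw [Subsingleton.elim j 0]
      simp [checkerboard, tau_eq, mono_xy_zi]
      grind
    · intro k
      fin_cases k <;> simp [checkerboard, tau_eq, mono_yz_xi, mono_xy_zi, mono_xy, mono_yz] <;> grind
    · intro l
      refine (charge_eq l _).trans ?_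
      fin_cases l
      · simp
      · simp [t2]; ring
      · simp
    · intro f j
      rw [Subsingleton.elim j 0]
      exact coeffSum_antipode_one mem_closure_y (k := ![0, 1, 1]) (l := ![1, 1, 0])
        (by decide) (by decide) f rfl rfl
  | 2 =>
    refine ⟨![(1 + tx n) * (1 + ty n)],
      ![tz n * tx n * (1 + tx n), -(1 + tx n)], ![tz n * ty n * (1 + ty n), -(1 + ty n)],
      ![mono n ![0, 1, 1] - mono n ![1, 0, 1]], ?_, ?_, ?_, ?_, ?_⟩
    · intro j
      rw [Subsingleton.elim j 0]
      simp [checkerboard, tau_eq, mono_xz_yi]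
      grind
    · intro j
      rw [Subsingleton.elim j 0]
      simp [checkerboard, tau_eq, mono_yz_xi]
      grind
    · intro k
      fin_cases k <;> simp [checkerboard, tau_eq, mono_xz_yi, mono_yz_xi, mono_xz, mono_yz] <;> grind
    · intro l
      refine (charge_eq l _).trans ?_
      fin_cases l
      · simp
      · simp
      · simp [t2]; ring
    · intro f j
      rw [Subsingleton.elim j 0]
      exact coeffSum_antipode_one mem_closure_z (k := ![1, 0, 1]) (l := ![0, 1, 1])
        (by decide) (by decide) f rfl rfl

theorem loopsX (i : Fin 3) : ∃ e sg sh w, HalfLoop (n := n) (t := 1) (t' := 1) (q := 2) (k := 3)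
    (checkerboard n).eX (checkerboard n).eZ (checkerboardSeq n).θ (checkerboardSeq n).χ
    (checkerboardSeq n).pX (checkerboardSeq n).pZ
    (![![1, 1, -1], ![-1, 1, 1], ![1, -1, 1]] i) (![![1, -1, 1], ![1, 1, -1], ![-1, 1, 1]] i) i
    (T 1 - T (-1)) 1 e sg sh w := by
  have e1 := tx_mul_txi n
  have e2 := ty_mul_tyi n
  have e3 := tz_mul_tzi n
  have t1 : (T 1 : Lau n) * T (-1) = 1 := by rw [← T_add, add_neg_cancel, T_zero]
  match i with
  | 0 =>
    refine ⟨![tyi n * ((1 + ty n) * (1 + tz n))],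
      ![-(tx n * (1 + ty n)), -(tyi n * (1 + ty n))], ![-(tyi n * (tx n * tz n * (1 + tz n))), -(tyi n * (1 + tz n))],
      ![mono n ![1, -1, 1] - mono n ![1, 0, 0]], ?_, ?_, ?_, ?_, ?_⟩
    · intro j
      rw [Subsingleton.elim j 0]
      simp [checkerboard, tau_eq, mono_xy_zi]
      grind
    · intro j
      rw [Subsingleton.elim j 0]
      simp [checkerboard, tau_eq, mono_xz_yi]
      grind
    · intro k
      fin_cases k <;> simp [checkerboard, tau_eq, mono_xy_zi, mono_xz_yi] <;> grind
    · intro l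
      refine (charge_eq l _).trans ?_
      fin_cases l
      · simp; grind
      · simp
      · simp
    · intro f j
      rw [Subsingleton.elim j 0]
      exact coeffSum_antipode_zero mem_closure_x (k := ![1, -1, 1]) (l := ![1, 0, 0])
        (by decide) (by decide) f rfl rfl
  | 1 =>
    refine ⟨![tzi n * ((1 + tz n) * (1 + tx n))],
      ![-(ty n * (1 + tz n)), -(tzi n * (1 + tz n))], ![-(tzi n * (ty n * tx n * (1 + tx n))), -(tzi n * (1 + tx n))],
      ![mono n ![1, 1, -1] - mono n ![0, 1, 0]], ?_, ?_, ?_, ?_, ?_⟩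
    · intro j
      rw [Subsingleton.elim j 0]
      simp [checkerboard, tau_eq, mono_yz_xi]
      grind
    · intro j
      rw [Subsingleton.elim j 0]
      simp [checkerboard, tau_eq, mono_xy_zi]
      grind
    · intro k
      fin_cases k <;> simp [checkerboard, tau_eq, mono_yz_xi, mono_xy_zi] <;> grind
    · intro l
      refine (charge_eq l _).trans ?_
      fin_cases l
      · simp
      · simp; grind
      · simp
    · intro f j
      rw [Subsingleton.elim j 0]
      exact coeffSum_antipode_zero mem_closure_y (k := ![1, 1, -1]) (l := ![0, 1, 0])
        (by decide) (by decide) f rfl rfl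
  | 2 =>
    refine ⟨![txi n * ((1 + tx n) * (1 + ty n))],
      ![-(tz n * (1 + tx n)), -(txi n * (1 + tx n))], ![-(txi n * (tz n * ty n * (1 + ty n))), -(txi n * (1 + ty n))],
      ![mono n ![-1, 1, 1] - mono n ![0, 0, 1]], ?_, ?_, ?_, ?_, ?_⟩
    · intro j
      rw [Subsingleton.elim j 0]
      simp [checkerboard, tau_eq, mono_xz_yi]
      grind
    · intro j
      rw [Subsingleton.elim j 0]
      simp [checkerboard, tau_eq, mono_yz_xi]
      grind
    · intro k
      fin_cases k <;> simp [checkerboard, tau_eq, mono_xz_yi, mono_yz_xi] <;> grind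
    · intro l
      refine (charge_eq l _).trans ?_
      fin_cases l
      · simp
      · simp
      · simp; grind
    · intro f j
      rw [Subsingleton.elim j 0]
      exact coeffSum_antipode_zero mem_closure_z (k := ![-1, 1, 1]) (l := ![0, 0, 1])
        (by decide) (by decide) f rfl rfl

end Loops

end Checkerboard

open LaurentPolynomial

namespace Checkerboard

variable {n : ℕ}

/-- The constraints on plane charges of one type. -/
def HalfConstraints (q : Fin 3 → Lau n) : Prop :=
  osum n (q 0) = esum n (q 1) - esum n (q 2) ∧ osum n (q 1) = esum n (q 2) - esum n (q 0) ∧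
    osum n (q 2) = esum n (q 0) - esum n (q 1)

/-- The constraints on plane charges. -/
def Constraints (n : ℕ) : Set (Fin 3 ⊕ Fin 3 → Lau n) :=
  {q | HalfConstraints (fun i => q (Sum.inl i)) ∧ HalfConstraints fun i => q (Sum.inr i)}

theorem halfConstraints_iff (q : Fin 3 → Lau n) : HalfConstraints q ↔ ∀ l, ∑ i,
    wsum ((![![alt n 0 1, alt n (-1) 0, alt n 1 0], ![alt n 1 0, alt n 0 1, alt n (-1) 0],
      ![alt n (-1) 0, alt n 1 0, alt n 0 1]] : Fin 3 → Fin 3 → ℤ → ZMod n) l i) (q i) = 0 := by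
  rw [Fin.forall_fin_succ, Fin.forall_fin_succ, Fin.forall_fin_one]
  simp [Fin.sum_univ_three, wsum_alt]
  refine and_congr ?_ (and_congr ?_ ?_) <;> rw [← sub_eq_zero] <;>
    exact iff_of_eq (congrArg (· = 0) (by ring))

theorem omega_eq_zero_iff (q : Fin 3 ⊕ Fin 3 → Lau n) :
    (checkerboardSeq n).omega q = 0 ↔ q ∈ Constraints n := by
  change _ ↔ HalfConstraints _ ∧ HalfConstraints _
  rw [halfConstraints_iff, halfConstraints_iff]
  refine ⟨fun h => ⟨fun l => congrFun h (Sum.inl l), fun l => congrFun h (Sum.inr l)⟩, fun h => ?_⟩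
  funext l
  rcases l with l | l
  · exact h.1 l
  · exact h.2 l

theorem surj (i : Fin 3) : Function.Surjective ((checkerboardSeq n).θ i) := by
  match i with
  | 0 => exact fun k => ⟨![0, k, 0], (add_zero k : k + 0 = k)⟩
  | 1 => exact fun k => ⟨![k, 0, 0], (zero_add k : 0 + k = k)⟩
  | 2 => exact fun k => ⟨![k, 0, 0], (add_zero k : k + 0 = k)⟩

theorem indep {i j : Fin 3} (hij : i ≠ j) :
    ∃ g, (checkerboardSeq n).θ i g = 0 ∧ (checkerboardSeq n).θ j g ≠ 0 := by
  fin_cases i <;> fin_cases j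
  · exact (hij rfl).elim
  · exact ⟨![1, 0, 0], rfl, one_ne_zero (α := ℤ)⟩
  · exact ⟨![1, 0, 0], rfl, one_ne_zero (α := ℤ)⟩
  · exact ⟨![0, 1, 0], rfl, one_ne_zero (α := ℤ)⟩
  · exact (hij rfl).elim
  · exact ⟨![0, 1, 0], rfl, one_ne_zero (α := ℤ)⟩
  · exact ⟨![0, 0, 1], rfl, one_ne_zero (α := ℤ)⟩
  · exact ⟨![0, 0, 1], rfl, one_ne_zero (α := ℤ)⟩
  · exact (hij rfl).elim

section

variable {q : Fin 3 → Lau n}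

theorem HalfConstraints.esum_eq_zero (hq : HalfConstraints q) {i : Fin 3} (h : ∀ j, j ≠ i → q j = 0) :
    esum n (q i) = 0 ∧ osum n (q i) = 0 := by
  obtain ⟨h0, h1, h2⟩ := hq
  match i with
  | 0 =>
    simp [h 1 (by decide), h 2 (by decide)] at h0 h2
    exact ⟨h2.symm, h0⟩
  | 1 =>
    simp [h 0 (by decide), h 2 (by decide)] at h0 h1
    exact ⟨h0.symm, h1⟩
  | 2 =>
    simp [h 0 (by decide), h 1 (by decide)] at h1 h2
    exact ⟨h1.symm, h2⟩

theorem HalfConstraints.osum_eq_zero (hq : HalfConstraints q) (h : ∀ j, esum n (q j) = 0) (i : Fin 3) :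
    osum n (q i) = 0 := by
  obtain ⟨h0, h1, h2⟩ := hq
  rw [h, h, sub_zero] at h0 h1 h2
  fin_cases i
  · exact h0
  · exact h1
  · exact h2

theorem HalfConstraints.esum_add (hq : HalfConstraints q) {i : Fin 3} (hi : q i = 0) :
    ∃ c, esum n (q 0) + esum n (q 1) + esum n (q 2) = 2 * c := by
  obtain ⟨h0, h1, h2⟩ := hq
  match i with
  | 0 => exact ⟨esum n (q 2), by simp [hi] at h0 ⊢; linear_combination -h0⟩
  | 1 => exact ⟨esum n (q 0), by simp [hi] at h1 ⊢; linear_combination -h1⟩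
  | 2 => exact ⟨esum n (q 1), by simp [hi] at h2 ⊢; linear_combination -h2⟩

end

theorem dvd_of_omega_eq_zero (i : Fin 3) (q : Fin 3 ⊕ Fin 3 → Lau n)
    (hq : (checkerboardSeq n).omega q = 0)
    (h : ∀ j, j ≠ i → q (Sum.inl j) = 0 ∧ q (Sum.inr j) = 0) :
    1 - T 2 ∣ q (Sum.inl i) ∧ invert (1 - T 2) ∣ q (Sum.inr i) := by
  obtain ⟨hZ, hX⟩ := (omega_eq_zero_iff _).1 hq
  have h1 := hZ.esum_eq_zero fun j hj => (h j hj).1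
  have h2 := hX.esum_eq_zero fun j hj => (h j hj).2
  exact ⟨one_sub_T_two_dvd h1.1 h1.2, invert_one_sub_T_two_dvd (one_sub_T_two_dvd h2.1 h2.2)⟩

theorem exists_pi_eq_one (i : Fin 3) :
    (∃ v, (checkerboardSeq n).pi v (Sum.inl i) = 1 ∧ (checkerboardSeq n).pi v (Sum.inr i) = 0) ∧
      ∃ v, (checkerboardSeq n).pi v (Sum.inl i) = 0 ∧ (checkerboardSeq n).pi v (Sum.inr i) = 1 :=
  (checkerboardSeq n).exists_pi_eq_one (surj i)
    ⟨(0 : Fin 1), by fin_cases i <;> exact isUnit_one⟩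
    ⟨(0 : Fin 1), by fin_cases i <;> exact isUnit_one⟩

/-- The canonical loops of the checkerboard model. -/
def braidData (hn : 1 < n) : BraidData (checkerboardSeq n) where
  one_lt := hn
  exact := isExact
  surj := surj
  indep _ _ := indep
  Δ _ := 1 - T 2
  κ _ := -1
  Δ_reg _ _ := of_one_sub_T_two_mul
  surjZ i := (exists_pi_eq_one i).1
  surjX i := (exists_pi_eq_one i).2
  dvd i v h := dvd_of_omega_eq_zero i _ ((isExact.2.2.2.1 _).2 ⟨v, rfl⟩) h
  g := ![![1, 1, -1], ![-1, 1, 1], ![1, -1, 1]]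
  h := ![![1, -1, 1], ![1, 1, -1], ![-1, 1, 1]]
  θ_g i := match i with
    | (0 : Fin 3) => rfl
    | (1 : Fin 3) => rfl
    | (2 : Fin 3) => rfl
  θ_h i := match i with
    | (0 : Fin 3) => rfl
    | (1 : Fin 3) => rfl
    | (2 : Fin 3) => rfl
  ind i := match i with
    | (0 : Fin 3) => planeMap_injective_of_coord (s := 0) (t := 1) (by decide)
    | (1 : Fin 3) => planeMap_injective_of_coord (s := 0) (t := 1) (by decide)
    | (2 : Fin 3) => planeMap_injective_of_coord (s := 0) (t := 2) (by decide)
  loopZ i := by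
    obtain ⟨e, sg, sh, w, L⟩ := loopsZ n i
    exact L.loopZ (X := checkerboard n) (M := checkerboardSeq n)
  loopX i := by
    obtain ⟨e, sg, sh, w, L⟩ := loopsX n i
    have := L.loopX (X := checkerboard n) (M := checkerboardSeq n)
    have h1 : (T (-(-1)) : Lau n) * invert (1 - T 2) = T 1 - T (-1) := by
      rw [map_sub, map_one, invert_T, mul_sub, ← T_add, mul_one]
      norm_num
    rwa [h1]

section Weights

/-- The even part of a plane charge. -/
def esumAt (s : Fin 3 ⊕ Fin 3) : (Fin 3 ⊕ Fin 3 → Lau n) →ₗ[ZMod n] ZMod n :=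
  esum n ∘ₗ LinearMap.proj s

@[simp] theorem esumAt_apply (s : Fin 3 ⊕ Fin 3) (q : Fin 3 ⊕ Fin 3 → Lau n) :
    esumAt s q = esum n (q s) := rfl

variable {q : Fin 3 ⊕ Fin 3 → Lau n}

theorem halfConstraints_single {f : Lau n} (i : Fin 3) (he : esum n f = 0) (ho : osum n f = 0) :
    HalfConstraints (Pi.single (M := fun _ => Lau n) i f) := by
  fin_cases i <;> simp [HalfConstraints, he, ho]

theorem mem_closure_of_esum {i : ℕ} (hi : 1 ≤ i) (hq : q ∈ Constraints n)
    (hZ : ∀ j, esum n (q (Sum.inl j)) = 0) (hX : ∀ j, esum n (q (Sum.inr j)) = 0) :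
    q ∈ AddSubgroup.closure {r | r ∈ Constraints n ∧ wt r ≤ i} :=
  mem_closure_of_part hi fun l =>
    ⟨halfConstraints_single l (hZ l) (hq.1.osum_eq_zero hZ l),
      halfConstraints_single l (hX l) (hq.2.osum_eq_zero hX l)⟩

theorem esum_of_wt (hq : q ∈ Constraints n) (h : wt q ≤ 1) (s : Fin 3 ⊕ Fin 3) : esum n (q s) = 0 := by
  have h0 (i : Fin 3) : (q (Sum.inl i) = 0 ∧ q (Sum.inr i) = 0) ∨
      ∀ j, j ≠ i → q (Sum.inl j) = 0 ∧ q (Sum.inr j) = 0 := by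
    by_contra! hc
    obtain ⟨hi, j, hj, hj'⟩ := hc
    obtain ⟨l, hl, h1, h2⟩ := exists_of_wt_lt (q := q) {j, i} (by rw [Finset.card_pair hj]; omega)
    rcases Finset.mem_insert.1 hl with rfl | hl
    · exact hj' h1 h2
    · rw [Finset.mem_singleton.1 hl] at h1 h2
      exact hi h1 h2
  rcases s with i | i <;> rcases h0 i with h1 | h1
  · rw [h1.1, map_zero]
  · exact (hq.1.esum_eq_zero fun j hj => (h1 j hj).1).1
  · rw [h1.2, map_zero]
  · exact (hq.2.esum_eq_zero fun j hj => (h1 j hj).2).1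

/-- Charges of one type with given even parts. -/
def ofEven (a : Fin 3 → ZMod n) : Fin 3 → Lau n :=
  ![C (a 0) + C (a 1 - a 2) * T 1, C (a 1) + C (a 2 - a 0) * T 1, C (a 2) + C (a 0 - a 1) * T 1]

theorem esum_ofEven (a : Fin 3 → ZMod n) (i : Fin 3) : esum n (ofEven a i) = a i := by
  have h (c d : ZMod n) : esum n (C c + C d * T 1) = c := by
    rw [map_add, esum_C, esum_C_mul_T_one, add_zero]
  fin_cases i <;> exact h _ _

theorem halfConstraints_ofEven (a : Fin 3 → ZMod n) : HalfConstraints (ofEven a) := by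
  have h (c d : ZMod n) : osum n (C c + C d * T 1) = d := by
    rw [map_add, osum_C, osum_C_mul_T_one, zero_add]
  refine ⟨?_, ?_, ?_⟩ <;> rw [esum_ofEven, esum_ofEven] <;> exact h _ _

theorem mem_constraints_ofEven (a b : Fin 3 → ZMod n) :
    (Sum.elim (ofEven a) (ofEven b) : Fin 3 ⊕ Fin 3 → Lau n) ∈ Constraints n :=
  ⟨halfConstraints_ofEven a, halfConstraints_ofEven b⟩

theorem HalfConstraints.sub {p q : Fin 3 → Lau n} (hp : HalfConstraints p) (hq : HalfConstraints q) :
    HalfConstraints (fun i => p i - q i) := by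
  obtain ⟨h0, h1, h2⟩ := hp
  obtain ⟨h0', h1', h2'⟩ := hq
  simp only [HalfConstraints, map_sub, h0, h1, h2, h0', h1', h2']
  exact ⟨by ring, by ring, by ring⟩

theorem sub_mem_constraints {p : Fin 3 ⊕ Fin 3 → Lau n} (hp : p ∈ Constraints n)
    (hq : q ∈ Constraints n) : p - q ∈ Constraints n := ⟨hp.1.sub hq.1, hp.2.sub hq.2⟩

/-- Even parts `s` at two of the three orientations. -/
def evenPair (i : Fin 3) (s : ZMod n) : Fin 3 → ZMod n := Function.update (fun _ => s) i 0

theorem sum_evenPair {a : Fin 3 → ZMod n} {c : ZMod n} (h : a 0 + a 1 + a 2 = 2 * c) :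
    evenPair 0 (c - a 0) + evenPair 1 (c - a 1) + evenPair 2 (c - a 2) = a := by
  funext i
  fin_cases i <;> simp [evenPair, Function.update] <;> linear_combination -h

theorem wt_evenPair_le (i : Fin 3) (s t : ZMod n) :
    wt (Sum.elim (ofEven (evenPair i s)) (ofEven (evenPair i t)) : Fin 3 ⊕ Fin 3 → Lau n) ≤ 2 := by
  refine (wt_le ({i}ᶜ : Finset (Fin 3)) fun j hj => ?_).trans_eq (by rw [Finset.card_compl]; rfl)
  obtain rfl : j = i := by simpa using hj
  fin_cases j <;> simp [ofEven, evenPair, Function.update]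

theorem mem_closure_of_esum_add (hq : q ∈ Constraints n)
    (hZ : ∃ c, esum n (q (Sum.inl 0)) + esum n (q (Sum.inl 1)) + esum n (q (Sum.inl 2)) = 2 * c)
    (hX : ∃ c, esum n (q (Sum.inr 0)) + esum n (q (Sum.inr 1)) + esum n (q (Sum.inr 2)) = 2 * c) :
    q ∈ AddSubgroup.closure {r | r ∈ Constraints n ∧ wt r ≤ 2} := by
  obtain ⟨c, hc⟩ := hZ
  obtain ⟨d, hd⟩ := hX
  let p (i : Fin 3) : Fin 3 ⊕ Fin 3 → Lau n :=
    Sum.elim (ofEven (evenPair i (c - esum n (q (Sum.inl i)))))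
      (ofEven (evenPair i (d - esum n (q (Sum.inr i)))))
  have hp (i : Fin 3) : p i ∈ Constraints n := mem_constraints_ofEven _ _
  have hp' (i : Fin 3) : p i ∈ AddSubgroup.closure {r | r ∈ Constraints n ∧ wt r ≤ 2} :=
    AddSubgroup.subset_closure ⟨hp i, wt_evenPair_le i _ _⟩
  have h1 : q - p 0 - p 1 - p 2 ∈ AddSubgroup.closure {r | r ∈ Constraints n ∧ wt r ≤ 2} := by
    refine mem_closure_of_esum one_le_two (sub_mem_constraints (sub_mem_constraints
      (sub_mem_constraints hq (hp 0)) (hp 1)) (hp 2)) (fun j => ?_) fun j => ?_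
    · have h2 := congrFun (sum_evenPair (a := fun i => esum n (q (Sum.inl i))) hc) j
      simp only [Pi.add_apply] at h2
      simp only [Pi.sub_apply, map_sub, p, Sum.elim_inl, esum_ofEven]
      linear_combination -h2
    · have h2 := congrFun (sum_evenPair (a := fun i => esum n (q (Sum.inr i))) hd) j
      simp only [Pi.add_apply] at h2
      simp only [Pi.sub_apply, map_sub, p, Sum.elim_inr, esum_ofEven]
      linear_combination -h2
  have h2 := add_mem (add_mem (add_mem h1 (hp' 2)) (hp' 1)) (hp' 0)
  rwa [sub_add_cancel, sub_add_cancel, sub_add_cancel] at h2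

/-- Reduction modulo the greatest common divisor with `2`. -/
def modTwo (n : ℕ) : ZMod n →+* ZMod (n.gcd 2) := ZMod.castHom (n.gcd_dvd_left 2) _

theorem modTwo_eq_zero_iff [NeZero n] (x : ZMod n) : modTwo n x = 0 ↔ ∃ c, x = 2 * c := by
  constructor
  · intro h
    rw [← ZMod.natCast_zmod_val x, map_natCast, ZMod.natCast_eq_zero_iff] at h
    obtain ⟨k, hk⟩ := h
    have hb := congrArg (Int.cast : ℤ → ZMod n) (Nat.gcd_eq_gcd_ab n 2)
    push_cast at hb
    rw [ZMod.natCast_self, zero_mul, zero_add] at hb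
    have hx := congrArg (Nat.cast : ℕ → ZMod n) hk
    rw [ZMod.natCast_zmod_val] at hx
    push_cast at hx
    exact ⟨(n.gcdB 2 : ZMod n) * k, by rw [hx, hb]; ring⟩
  · rintro ⟨c, rfl⟩
    have h2 : (2 : ZMod (n.gcd 2)) = 0 := by
      exact_mod_cast (ZMod.natCast_eq_zero_iff 2 _).2 (n.gcd_dvd_right 2)
    rw [map_mul, map_ofNat, h2, zero_mul]

theorem hasWeights_two (hn : 1 < n) : HasWeights (Constraints n) 2 (AbGrp [n.gcd 2, n.gcd 2]) := by
  have : NeZero n := ⟨by omega⟩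
  obtain ⟨e⟩ : Nonempty ((Fin 2 → ZMod (n.gcd 2)) ≃+ AbGrp [n.gcd 2, n.gcd 2]) :=
    abGrp_replicate (n.gcd 2) 2 (by simp)
  let ℓ : Fin 2 → (Fin 3 ⊕ Fin 3 → Lau n) →ₗ[ZMod n] ZMod n :=
    ![esumAt (Sum.inl 0) + esumAt (Sum.inl 1) + esumAt (Sum.inl 2),
      esumAt (Sum.inr 0) + esumAt (Sum.inr 1) + esumAt (Sum.inr 2)]
  let φ : (Fin 3 ⊕ Fin 3 → Lau n) →+ (Fin 2 → ZMod (n.gcd 2)) :=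
    AddMonoidHom.pi fun j => (modTwo n).toAddMonoidHom.comp (ℓ j).toAddMonoidHom
  have hφ (q) : φ q = 0 ↔ (∃ c, ℓ 0 q = 2 * c) ∧ ∃ c, ℓ 1 q = 2 * c := by
    rw [← modTwo_eq_zero_iff, ← modTwo_eq_zero_iff]
    exact ⟨fun h => ⟨congrFun h 0, congrFun h 1⟩, fun h => funext fun j => by
      fin_cases j
      · exact h.1
      · exact h.2⟩
  refine ⟨(e : (Fin 2 → ZMod (n.gcd 2)) →+ _).comp φ, fun a => ?_, fun q hq h => ?_, fun q hq h => ?_⟩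
  · have hs := ZMod.castHom_surjective (n.gcd_dvd_left 2)
    obtain ⟨x, hx⟩ := hs (e.symm a 0)
    obtain ⟨y, hy⟩ := hs (e.symm a 1)
    refine ⟨_, mem_constraints_ofEven ![x, 0, 0] ![y, 0, 0],
      (congrArg e (funext fun j => ?_)).trans (e.apply_symm_apply a)⟩
    fin_cases j
    · refine Eq.trans (congrArg (modTwo n) ?_) hx
      simp [ℓ, esum_ofEven]
    · refine Eq.trans (congrArg (modTwo n) ?_) hy
      simp [ℓ, esum_ofEven]
  · obtain ⟨l, -, h1, h2⟩ := exists_of_wt_lt (q := q) Finset.univ (by rw [Finset.card_fin]; omega)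
    exact (congrArg e ((hφ q).2 ⟨hq.1.esum_add h1, hq.2.esum_add h2⟩)).trans e.map_zero
  · obtain ⟨hZ, hX⟩ := (hφ q).1 (e.map_eq_zero_iff.1 h)
    exact mem_closure_of_esum_add hq hZ hX

theorem hasWeights (hn : 1 < n) (i : Fin 3) : HasWeights (Constraints n) (i + 1)
    (AbGrp (([[n, n, n, n, n, n], [n.gcd 2, n.gcd 2], []] : List (List ℕ)).get i)) := by
  match i with
  | 0 =>
    refine hasWeights_of_functionals (i := 1) (m := 6)
      ![esumAt (Sum.inl 0), esumAt (Sum.inl 1), esumAt (Sum.inl 2), esumAt (Sum.inr 0),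
        esumAt (Sum.inr 1), esumAt (Sum.inr 2)] (fun a => ?_) (fun q hq hw j => ?_) fun q hq h => ?_
    · refine ⟨_, mem_constraints_ofEven ![a 0, a 1, a 2] ![a 3, a 4, a 5], fun j => ?_⟩
      fin_cases j <;> simp [esum_ofEven]
    · fin_cases j <;> exact esum_of_wt hq hw _
    · refine mem_closure_of_esum le_rfl hq (fun j => ?_) fun j => ?_
      · fin_cases j
        exacts [h 0, h 1, h 2]
      · fin_cases j
        exacts [h 3, h 4, h 5]
  | 1 => exact hasWeights_two hn
  | 2 => exact hasWeights_nil (by simp [Constraints, HalfConstraints]) le_rfl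

end Weights

theorem isPModularWith (hn : 1 < n) : (checkerboard n).IsPModularWith (checkerboardSeq n)
    [n, n, n, n, n, n] [[n, n, n, n, n, n], [n.gcd 2, n.gcd 2], []] :=
  (braidData hn).isPModularWith (0 : Fin 3) rfl rfl fun _ _ _ hT i =>
    (braidData hn).nonempty_W_equiv_of_hasWeights hT omega_eq_zero_iff (hasWeights hn i)

end Checkerboard

open LaurentPolynomial

section Coarsen

theorem kerPlane_comp_subtype {T : Type} [AddCommGroup T] (η : T →+ E3) {H : AddSubgroup T} {N : ℕ}
    (hN : N ≠ 0) (hH : ∀ g, N • g ∈ H) {θ : T →+ ℤ} {θ' : H →+ ℤ} {m : ℤ} (hm : m ≠ 0)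
    (hθ : ∀ g : H, θ g = m * θ' g) : kerPlane (η.comp H.subtype) θ' = kerPlane η θ := by
  refine Eq.trans ?_ (span_image_eq_of_smul η (H := θ'.ker.map H.subtype) (K := θ.ker) ?_ N hN ?_)
  · refine congrArg (Submodule.span ℝ) (Set.ext fun v => ⟨?_, ?_⟩)
    · rintro ⟨g, hg, rfl⟩
      exact ⟨H.subtype g, ⟨g, hg, rfl⟩, rfl⟩
    · rintro ⟨_, ⟨g, hg, rfl⟩, rfl⟩
      exact ⟨g, hg, rfl⟩
  · rintro _ ⟨g, hg, rfl⟩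
    have h0 : θ' g = 0 := hg
    exact (hθ g).trans (by rw [h0, mul_zero])
  · intro g hg
    refine ⟨⟨N • g, hH g⟩, ?_, rfl⟩
    have h1 := hθ ⟨N • g, hH g⟩
    have h0 : θ g = 0 := hg
    rw [map_nsmul, h0, smul_zero] at h1
    exact (mul_eq_zero.1 h1.symm).resolve_left hm

variable {n : ℕ}

theorem sec_T_two_mul (j : ℤ) (f : Lau n) (k : Fin 2) : sec 1 (T (2 * j) * f) k = T j * sec 1 f k :=
  sec_T_mul 1 j f k

theorem sec_one_sub_T_two_mul (f : Lau n) (k : Fin 2) :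
    sec 1 ((1 - T 2) * f) k = (1 - T 1) * sec 1 f k := by
  have h := sec_T_two_mul 1 f k
  rw [mul_one] at h
  rw [sub_mul, one_mul, map_sub, Pi.sub_apply, h, sub_mul, one_mul]

theorem sec_invert_one_sub_T_two_mul (f : Lau n) (k : Fin 2) :
    sec 1 (invert (1 - T 2) * f) k = invert (1 - T 1) * sec 1 f k := by
  have h := sec_T_two_mul (-1) f k
  rw [mul_neg_one] at h
  rw [map_sub, map_one, invert_T, sub_mul, one_mul, map_sub, Pi.sub_apply, h, map_sub, map_one,
    invert_T, sub_mul, one_mul]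

variable {P : PData n} {ι : Type} (M : ChargeModel P 1 ι) {H : AddSubgroup P.T}

/-- The plane charges split into even and odd degrees. -/
def ChargeModel.splitCharge (i : ι) : P.S →ₗ[ZMod n] (Fin 2 → Lau n × Lau n) :=
  LinearMap.pi fun k => LinearMap.prod
    (LinearMap.proj k ∘ₗ (sec 1).toLinearMap ∘ₗ LinearMap.fst _ _ _ ∘ₗ LinearMap.proj 0 ∘ₗ M.c i)
    (LinearMap.proj k ∘ₗ (sec 1).toLinearMap ∘ₗ LinearMap.snd _ _ _ ∘ₗ LinearMap.proj 0 ∘ₗ M.c i)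

theorem ChargeModel.splitCharge_apply (i : ι) (x : P.S) (k : Fin 2) : M.splitCharge i x k =
    (sec 1 (M.c i x 0).1 k, sec 1 (M.c i x 0).2 k) := rfl

theorem ChargeModel.splitCharge_eq_zero_iff (i : ι) (x : P.S) :
    M.splitCharge i x = 0 ↔ M.c i x = 0 := by
  constructor
  · intro h
    funext k
    rw [Subsingleton.elim k 0]
    exact Prod.ext ((sec 1).map_eq_zero_iff.1 (funext fun k => congrArg Prod.fst (congrFun h k)))
      ((sec 1).map_eq_zero_iff.1 (funext fun k => congrArg Prod.snd (congrFun h k)))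
  · intro h
    funext k
    rw [M.splitCharge_apply, h]
    simp

theorem ChargeModel.splitCharge_planon (hΔ : ∀ i k, M.Δ i k = 1 - T 2) (i : ι) (p : P.S)
    (u v : Fin 1 → Lau n) : (∀ k, M.c i p k = (M.Δ i k * u k, invert (M.Δ i k) * v k)) ↔
      ∀ k, M.splitCharge i p k = ((1 - T 1) * sec 1 (u 0) k, invert (1 - T 1) * sec 1 (v 0) k) := by
  simp only [← sec_one_sub_T_two_mul, ← sec_invert_one_sub_T_two_mul, M.splitCharge_apply, hΔ]
  constructor
  · intro h k
    rw [h 0]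
  · intro h k
    rw [Subsingleton.elim k 0]
    exact Prod.ext ((sec 1).injective (funext fun k => congrArg Prod.fst (h k)))
      ((sec 1).injective (funext fun k => congrArg Prod.snd (h k)))

/-- The charge model of a theory whose translations are coarsened to even degrees. -/
def ChargeModel.coarsenEven (θ' : ι → H →+ ℤ) (hH : Nonempty (H ≃+ (Fin 3 → ℤ)))
    (hθ : ∀ i (g : H), M.θ i g = 2 * θ' i g) (hsurj : ∀ i, Function.Surjective (θ' i))
    (hsgn : ∀ i (g : H), M.sgn i g = 1) (hΔ : ∀ i k, M.Δ i k = 1 - T 2) :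
    ChargeModel (P.coarsen H) 2 ι where
  θ := θ'
  sgn _ _ := 1
  c := M.splitCharge
  Δ _ _ := 1 - T 1
  one_lt := M.one_lt
  pos := two_pos
  lattice := hH
  embedding := M.embedding.of_smul M.lattice H.subtype H.subtype_injective fun _ => rfl
  surj := hsurj
  indep i j hij := by
    obtain ⟨N, hN, hm⟩ := coarsen_exists_smul P H M.lattice hH
    obtain ⟨g, hg, hg'⟩ := M.indep i j hij
    have h1 := hθ i ⟨N • g, hm g⟩
    have h2 := hθ j ⟨N • g, hm g⟩
    rw [map_nsmul, hg, smul_zero] at h1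
    rw [map_nsmul] at h2
    exact ⟨⟨N • g, hm g⟩, (mul_eq_zero.1 h1.symm).resolve_left two_ne_zero, fun h0 =>
      smul_ne_zero hN hg' (h2.trans ((congrArg (2 * ·) h0).trans (mul_zero 2)))⟩
  sgn_sq _ _ := one_mul 1
  c_act := fun i (g : H) (x : P.S) k => by
    change M.splitCharge i (P.act (g : P.T) x) k = (C 1 * T (θ' i g) : Lau n) • M.splitCharge i x k
    rw [M.splitCharge_apply, M.c_act, hsgn, hθ, map_one, one_mul, one_mul]
    exact Prod.ext (sec_T_two_mul _ _ _) (sec_T_two_mul _ _ _)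
  inj x hx := M.inj x fun i => (M.splitCharge_eq_zero_iff i x).1 (hx i)
  surj_c i q := by
    obtain ⟨x, hx⟩ := M.surj_c i fun _ =>
      ((sec 1).symm fun k => (q k).1, (sec 1).symm fun k => (q k).2)
    refine ⟨x, (funext fun k => ?_ : M.splitCharge i x = q)⟩
    rw [M.splitCharge_apply, hx, LinearEquiv.apply_symm_apply, LinearEquiv.apply_symm_apply]
  Δ_reg _ _ _ := T_one_mul_eq_self
  planon i p hp := by
    obtain ⟨u, v, h⟩ := M.planon i p fun j hj => (M.splitCharge_eq_zero_iff j p).1 (hp j hj)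
    exact ⟨_, _, (M.splitCharge_planon hΔ i p u v).1 h⟩
  exists_planon i u v := by
    obtain ⟨p, hp, h⟩ := M.exists_planon i (fun _ => (sec 1).symm u) fun _ => (sec 1).symm v
    have h1 := (M.splitCharge_planon hΔ i p _ _).1 h
    simp only [LinearEquiv.apply_symm_apply] at h1
    exact ⟨p, fun j hj => (M.splitCharge_eq_zero_iff j p).2 (hp j hj), h1⟩
  form_eq i p x u v hp h := by
    obtain ⟨N, hN, hm⟩ := coarsen_exists_smul P H M.lattice hH
    have h1 := M.form_eq i p x (fun _ => (sec 1).symm u) (fun _ => (sec 1).symm v)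
      (fun j hj => (M.splitCharge_eq_zero_iff j p).1 (hp j hj)) ((M.splitCharge_planon hΔ i p _ _).2
        (by simp only [LinearEquiv.apply_symm_apply]; exact h))
    have h2 := kerPlane_comp_subtype P.η hN hm two_ne_zero (hθ i)
    change P.form (kerPlane (P.η.comp H.subtype) (θ' i)) p x = _
    rw [h2, h1, Fin.sum_univ_one, AddMonoidAlgebra.coeff_add, Finsupp.add_apply, coeff_zero_sec 1,
      coeff_zero_sec 1, LinearEquiv.apply_symm_apply, LinearEquiv.apply_symm_apply,
      AddMonoidAlgebra.coeff_sum, Finsupp.finsetSum_apply, ← Finset.sum_add_distrib]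
    rfl

end Coarsen

namespace Checkerboard

/-- The basis of the even translations. -/
def evenHom : Z3 →+ Z3 where
  toFun v := ![-v 0 + v 1 + v 2, v 0 - v 1 + v 2, v 0 + v 1 - v 2]
  map_zero' := by decide
  map_add' v w := by
    funext i
    fin_cases i <;> simp <;> ring

theorem evenHom_injective : Function.Injective evenHom := by
  intro v w h
  have h0 : -v 0 + v 1 + v 2 = -w 0 + w 1 + w 2 := congrFun h 0
  have h1 : v 0 - v 1 + v 2 = w 0 - w 1 + w 2 := congrFun h 1
  have h2 : v 0 + v 1 - v 2 = w 0 + w 1 - w 2 := congrFun h 2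
  funext i
  fin_cases i
  · change v 0 = w 0
    omega
  · change v 1 = w 1
    omega
  · change v 2 = w 2
    omega

theorem range_evenHom : evenHom.range = evenLattice := by
  refine le_antisymm ?_ ((AddSubgroup.closure_le _).2 ?_)
  · rintro _ ⟨v, rfl⟩
    have h : evenHom v = v 0 • ![-1, 1, 1] + v 1 • ![1, -1, 1] + v 2 • ![1, 1, -1] := by
      funext i
      fin_cases i <;> simp [evenHom] <;> ring
    rw [h, evenLattice]
    exact add_mem (add_mem (zsmul_mem (AddSubgroup.subset_closure (by simp)) _)
      (zsmul_mem (AddSubgroup.subset_closure (by simp)) _))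
      (zsmul_mem (AddSubgroup.subset_closure (by simp)) _)
  · rintro _ (rfl | rfl | rfl)
    exacts [⟨![1, 0, 0], by decide⟩, ⟨![0, 1, 0], by decide⟩, ⟨![0, 0, 1], by decide⟩]

/-- Coordinates of the even translations. -/
def evenEquiv : evenLattice ≃+ Z3 :=
  ((AddMonoidHom.ofInjective evenHom_injective).trans
    (AddEquiv.addSubgroupCongr range_evenHom)).symm

theorem evenHom_evenEquiv (g : evenLattice) : evenHom (evenEquiv g) = g :=
  congrArg Subtype.val (evenEquiv.symm_apply_apply g)

/-- The degrees of even translations. -/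
def evenDeg (i : Fin 3) : evenLattice →+ ℤ := (deg i).comp evenEquiv.toAddMonoidHom

variable {n : ℕ}

theorem theta_even (i : Fin 3) (g : evenLattice) :
    (checkerboardSeq n).θ i (g : Z3) = 2 * evenDeg i g := by
  change _ = 2 * evenEquiv g i
  rw [← evenHom_evenEquiv g]
  generalize evenEquiv g = v
  match i with
  | 0 => exact (by ring : (v 0 - v 1 + v 2) + (v 0 + v 1 - v 2) = 2 * v 0)
  | 1 => exact (by ring : (v 0 + v 1 - v 2) + (-v 0 + v 1 + v 2) = 2 * v 1)
  | 2 => exact (by ring : (-v 0 + v 1 + v 2) + (v 0 - v 1 + v 2) = 2 * v 2)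

theorem chi_even (i : Fin 3) (g : evenLattice) : Even ((checkerboardSeq n).χ i (g : Z3)) := by
  rw [← evenHom_evenEquiv g]
  generalize evenEquiv g = v
  match i with
  | 0 => exact ⟨v 2, (by ring : (-v 0 + v 1 + v 2) + (v 0 - v 1 + v 2) = v 2 + v 2)⟩
  | 1 => exact ⟨v 0, (by ring : (v 0 - v 1 + v 2) + (v 0 + v 1 - v 2) = v 0 + v 0)⟩
  | 2 => exact ⟨v 1, (by ring : (v 0 + v 1 - v 2) + (-v 0 + v 1 + v 2) = v 1 + v 1)⟩

theorem isFoliated (hn : 1 < n) {η : Z3 →+ E3} {normal : Plane → E3}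
    {form : Plane → (checkerboard n).Sec → ((checkerboard n).Sec →ₗ[ZMod n] ZMod n)}
    (hT : (checkerboard n).IsTheory η normal form) :
    (((checkerboard n).theory η normal form).coarsen evenLattice).IsFoliated 2 := by
  let M := (braidData hn).theoryModel hT
  let M' := M.coarsenEven (H := evenLattice) evenDeg
    ⟨evenEquiv⟩ (fun i g => theta_even (n := n) i g) (fun i => (deg_surjective i).comp evenEquiv.surjective)
    (fun i g => (neg_one_zpow_eq_ite _).trans (if_pos (chi_even (n := n) i g))) fun _ _ => rfl
  have : Finite (Fin (checkerboardSeq n).k) := inferInstance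
  refine M'.isFoliated_of_planar ?_ (fun _ _ => rfl) fun _ _ => rfl
  intro a ha
  have h := coarsen_A (P := (checkerboard n).theory η normal form) (H := evenLattice) M.lattice
    ⟨evenEquiv⟩
  exact hT.unitNormal a (h ▸ ha)

end Checkerboard

end Fracton

end

theorem mainTheorem9 (n : ℕ) (hn : 2 ≤ n) :
    -- the X-cube model
    ((xCube n).IsPModularWith (xCubeSeq n) [n, n, n] [[n, n, n], [n], []] ∧
      ∀ η normal form, (xCube n).IsTheory η normal form →
        ((xCube n).theory η normal form).IsFoliated 1) ∧
    -- toric code layers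
    ((toricCodeLayers n).IsPModularWith (toricCodeLayersSeq n) [] [[]] ∧
      ∀ η normal form, (toricCodeLayers n).IsTheory η normal form →
        ((toricCodeLayers n).theory η normal form).IsFoliated 1) ∧
    -- the anisotropic model
    ((anisotropic n).IsPModularWith (anisotropicSeq n) [n, n] [[n, n], []] ∧
      ∀ η normal form, (anisotropic n).IsTheory η normal form →
        ((anisotropic n).theory η normal form).IsFoliated 1) ∧
    -- the checkerboard model, with foliation after coarsening to even translations
    ((checkerboard n).IsPModularWith (checkerboardSeq n) [n, n, n, n, n, n]
        [[n, n, n, n, n, n], [n.gcd 2, n.gcd 2], []] ∧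
      ∀ η normal form, (checkerboard n).IsTheory η normal form →
        (((checkerboard n).theory η normal form).coarsen evenLattice).IsFoliated 2) ∧
    -- the 4-planar X-cube model
    ((fourPlanar n).IsPModularWith (fourPlanarSeq n) [n, n, n, n] [[n, n, n, n], [n], [n], []] ∧
      ∀ η normal form, (fourPlanar n).IsTheory η normal form →
        ((fourPlanar n).theory η normal form).IsFoliated 1) ∧
    -- for `n > 2` the checkerboard model is not equivalent to a stack of two X-cube models
    (2 < n → ∀ η normal form η₁ normal₁ form₁ η₂ normal₂ form₂,
      (checkerboard n).IsTheory η normal form → (xCube n).IsTheory η₁ normal₁ form₁ →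
      (xCube n).IsTheory η₂ normal₂ form₂ →
      ∀ P₁ P₂ P : PData n, P₁.IsPTheory → P₂.IsPTheory →
        PData.PhaseEquiv ((xCube n).theory η₁ normal₁ form₁) P₁ →
        PData.PhaseEquiv ((xCube n).theory η₂ normal₂ form₂) P₂ →
        P.IsStackOf ![P₁, P₂] →
        ¬ PData.PhaseEquiv ((checkerboard n).theory η normal form) P) := by
  have hn1 : 1 < n := hn
  refine ⟨⟨XCube.isPModularWith hn1, fun _ _ _ => XCube.isFoliated hn1⟩,
    ⟨ToricCodeLayers.isPModularWith hn1, fun _ _ _ => ToricCodeLayers.isFoliated hn1⟩,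
    ⟨Anisotropic.isPModularWith hn1, fun _ _ _ => Anisotropic.isFoliated hn1⟩,
    ⟨Checkerboard.isPModularWith hn1, fun _ _ _ => Checkerboard.isFoliated hn1⟩,
    ⟨FourPlanar.isPModularWith hn1, fun _ _ _ => FourPlanar.isFoliated hn1⟩, ?_⟩
  intro hn2 η normal form η₁ normal₁ form₁ η₂ normal₂ form₂ hT hT₁ hT₂ P₁ P₂ P hP₁ hP₂ e₁ e₂ hstack e
  have : NeZero n := ⟨by omega⟩
  obtain ⟨f₁⟩ := ((XCube.isPModularWith hn1).2.2 _ _ _ hT₁).2.2.2.2.2.2 1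
  obtain ⟨f₂⟩ := ((XCube.isPModularWith hn1).2.2 _ _ _ hT₂).2.2.2.2.2.2 1
  obtain ⟨f⟩ := ((Checkerboard.isPModularWith hn1).2.2 _ _ _ hT).2.2.2.2.2.2 1
  obtain ⟨g₁⟩ := e₁.W_equiv (i := 2) one_le_two
  obtain ⟨g₂⟩ := e₂.W_equiv (i := 2) one_le_two
  obtain ⟨g⟩ := e.W_equiv (i := 2) one_le_two
  obtain ⟨s⟩ := PData.W_stack_equiv hP₁ hP₂ hstack 2
  have hcard := Nat.card_congr (((f.symm.trans g).trans s).trans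
    ((g₁.symm.trans f₁).prodCongr (g₂.symm.trans f₂))).toEquiv
  have h1 : Nat.card (AbGrp [n]) = n := by
    rw [Nat.card_pi]
    exact (Fin.prod_univ_one _).trans (Nat.card_zmod n)
  have h2 : Nat.card (AbGrp [n.gcd 2, n.gcd 2]) = n.gcd 2 * n.gcd 2 := by
    rw [Nat.card_pi]
    exact (Fin.prod_univ_two _).trans (congrArg₂ _ (Nat.card_zmod _) (Nat.card_zmod _))
  have h3 : n.gcd 2 * n.gcd 2 = n * n :=
    h2.symm.trans (hcard.trans ((Nat.card_prod _ _).trans (congrArg₂ _ h1 h1)))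
  have h4 : n.gcd 2 ≤ 2 := Nat.gcd_le_right n two_pos
  nlinarith
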